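/- **Setting.** Let $\ell>0$ be the AdS radius ($\Lambda=-3/\ell^2$). The unknowns are $m(r),S(r),\alpha(r,\xi),\omega(r,\xi)$, $\xi\in[-1,1]$, with $\omega=\sqrt{1-\xi^2}\,f$, $\mu=1-\frac{2m}{r}+\frac{r^2}{\ell^2}$ and $$\eta=\tfrac12\!\int_{-1}^1\!\alpha_r^2\,d\xi,\quad \zeta=\tfrac12\!\int_{-1}^1\!\omega^2\alpha_\xi^2\,d\xi,\quad G=\tfrac12\!\int_{-1}^1\!\omega_r^2\,d\xi,\quad P=\tfrac18\!\int_{-1}^1\!\big(\partial_\xi(\omega^2+\xi^2)\big)^2d\xi .$$ The Einstein equations are $$m'=\tfrac32\Big(\tfrac{r^2\eta}{4S^2}+\tfrac{\zeta}{4\mu S^2}+\mu G+\tfrac{P}{r^2}\Big),\qquad \tfrac{S'}{S}=\tfrac2r\Big(G+\tfrac{\zeta}{4\mu^2S^2}\Big),$$ and the Yang–Mills equations are $$0=r^2\mu\,\alpha_{rr}+r^2\mu\big(\tfrac2r-\tfrac{S'}{S}\big)\alpha_r+\partial_\xi(\omega^2\alpha_\xi),$$ $$0=r^2\mu\,\omega_{rr}+\big(2m-\tfrac{3P}{r}+\tfrac{2r^3}{\ell^2}-\tfrac{3r^3\eta}{4S^2}\big)\omega_r+\tfrac{r^2\omega}{4\mu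 S^2}\alpha_\xi^2+\tfrac{\omega}{2}\partial_\xi^2(\omega^2+\xi^2).$$ A solution on $r\ge r_0$ has $m,S$ smooth for $r\ge r_0$, $\alpha,f$ smooth on $[r_0,\infty)\times[-1,1]$, $S>0$, $\mu>0$ for $r>r_0$, $\int_{-1}^1\alpha\,d\xi=0$, and is asymptotically AdS: $m=M+\frac{m_1}{r}+O(r^{-2})$, $S=1+O(r^{-4})$, $\alpha=\alpha_\infty+\frac{\mathcal A}{r}+O(r^{-2})$, $\omega=\omega_\infty+\frac{\mathcal W}{r}+O(r^{-2})$ for each $\xi$, with $\mathcal A=-\lim r^2\alpha_r$, $\mathcal W=-\lim r^2\omega_r$ and $\omega_\infty$ differentiable on $(-1,1)$; $M$ is the ADM mass. It is *globally regular* (a soliton or dyon) if $r_0=0$ and at $r=0$ one has $m=O(r^3)$, $S=S(0)+O(r^2)$, $\alpha=O(r)$, $\omega=\sqrt{1-\xi^2}+O(r^2)$. It is a *black hole* with horizon $r_h>0$ if $r_0=r_h$, $\mu(r_h)=0$ and $\alpha(r_h,\cdot)=0$. The charge functions are $$q_M(\xi)=\tfrac{\sqrt3}{2}\tfrac{d}{d\xi}\big(\omega_\infty^2+\xi^2\big),\qquad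 q_E(\xi)=\tfrac{\sqrt3}{2}\mathcal A(\xi).$$ Put $x=r/\ell$. A globally regular solution lies *in the class $\mathcal N(C,\ell)$* if $S\ge 1/C$ and, for $r>0$ and $|\xi|<1$, $|\alpha|,|\alpha_\xi|\le C\ell\frac{x}{1+x}$, $|\ell\alpha_r|\le\frac{C\ell}{(1+x)^2}$, $|f-1|,|f_\xi|,|f_{\xi\xi}|\le C\ell^2\frac{x^2}{(1+x)^2}$, $|\ell f_r|\le C\ell^2\frac{x}{(1+x)^3}$, $|\ell^2f_{rr}|\le \frac{C\ell^2}{(1+x)^3}$. A black hole is *$C$-bounded* if $S\ge 1/C$ and $|\alpha|,|r^2\alpha_r|,|f|,|f_\xi|,|r^2f_r|\le C$. Let $P^0_k$ be the Legendre polynomials and $P^1_k=\sqrt{1-\xi^2}\,\frac{d}{d\xi}P^0_k$. The constants $\rho_k$ ($k\ge1$), $\sigma_k$ ($k\ge2$) of a globally regular solution are the components along $P^0_k$, $P^1_{k-1}$ of the coefficient of $r^k$ in the Taylor expansion at $r=0$ of $\alpha$, $\omega$. For given real sequences, the *explicit gauge fields* are $$\alpha=\sum_{k\ge1}\rho_k\mathcal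 P_k(x)P^0_k(\xi)(x\ell)^k,\qquad \omega=\sqrt{1-\xi^2}+\sum_{k\ge2}\sigma_k\mathcal S_k(x)P^1_{k-1}(\xi)(x\ell)^k,$$ $\mathcal P_k={}_2F_1(\frac k2,\frac{k+1}2;\frac{2k+3}2;-x^2)$, $\mathcal S_k={}_2F_1(\frac k2,\frac{k+1}2;\frac{2k+1}2;-x^2)$. An *expansion solution* with these constants (and parameter $C$) consists of these gauge fields and of $m,S$ solving the Einstein equations with them, with $m,S$ continuous on $[0,\infty)$ and differentiable for $r>0$, $\mu>0$ for $r>0$, $S\ge1/C$, $m=O(r^3)$ at $0$, $S\to1$, $m\to M$ at infinity. **Theorem.** 1. For every $C>0$ there is $\ell_0>0$ such that for $0<\ell<\ell_0$ two globally regular solutions in $\mathcal N(C,\ell)$ with the same charge functions $q_M,q_E$ on $(-1,1)$ coincide ($m,S,\alpha,\omega$); in particular they have the same constants $\rho_k,\sigma_k$. 2. Let $\ell>0$ and let $|\rho_k|,|\sigma_k|\le B\theta^k$ with some $B$ and some $0\le\theta<\frac1{2\ell}$ (for each sequence). Then the series of the explicit gauge fields converge for all $r\ge0$, $\xi\in[-1,1]$,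 $\alpha$ is differentiable in $r>0$, the limits $\mathcal A=-\lim r^2\alpha_r$, $\omega_\infty=\lim\omega$ exist, and with convergent series $$\mathcal A=\sum_{k\ge1}\rho_ka_kP^0_k\ell^{k+1},\qquad \omega_\infty=\sqrt{1-\xi^2}+\sum_{k\ge2}\sigma_kw_kP^1_{k-1}\ell^k,$$ $$a_k=2\sqrt\pi\,k\left(\frac{\Gamma(\frac{2k+3}2)}{\Gamma(\frac k2)\Gamma(\frac{k+2}2)}-\frac{(k+1)\Gamma(\frac{2k+5}2)}{(2k+3)\Gamma(\frac{k+2}2)^2}\right),\qquad w_k=\frac{\sqrt\pi\,\Gamma(\frac{2k+1}2)}{\Gamma(\frac{k+1}2)^2};$$ the constants are recovered by $$\rho_k=\frac{2k+1}{2a_k\ell^{k+1}}\int_{-1}^1\mathcal A\,P^0_k\,d\xi\ (k\ge1),\qquad \sigma_k=\frac{2k-1}{2k(k-1)w_k\ell^k}\int_{-1}^1\omega_\infty P^1_{k-1}\,d\xi-\frac{\delta_{k,2}}{3\ell^2}\ (k\ge2).$$ 3. For all $B,\theta,C>0$ there is $\ell_0>0$ such that for $0<\ell<\ell_0$: if two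 choices of constants, all bounded by $B\theta^k$, give the same charge functions $q_M,q_E$ on $(-1,1)$, then the constants $\rho_k$ ($k\ge1$), $\sigma_k$ ($k\ge2$) coincide, and any two expansion solutions with these constants and parameter $C$ coincide ($m,S,\alpha,\omega$). 4. For every $C>0$ there are $K,\ell_0>0$ such that for $0<\ell<\ell_0$ every globally regular solution in $\mathcal N(C,\ell)$ has $0\le M\le K\ell^3$. For all $B,\theta,C>0$ there are $K,\ell_0>0$ such that for $0<\ell<\ell_0$ the same holds for every expansion solution with constants bounded by $B\theta^k$ and parameter $C$. 5. For all $r_h,C>0$ there are $K,\ell_0>0$ such that for $0<\ell<\ell_0$ every $C$-bounded black hole with horizon $r_h$ has $\frac{r_h^3}{2}\ell^{-2}\le M\le K\ell^{-2}$. 6. For all $r_h,C>0$ there is $\ell_0>0$ such that for $0<\ell<\ell_0$ every globally regular solution in $\mathcal N(C,\ell)$ has strictly smaller ADM mass than every $C$-bounded black hole with horizon $r_h$ (in particular than those with similar gauge fields at infinity). -/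

import Mathlib

open Set Filter Topology Asymptotics

noncomputable section

namespace SuInfEYM

/-! ## Legendre functions -/

/-- The Legendre polynomial of degree `l`, by Rodrigues' formula. -/
def legendrePoly (l : ℕ) : Polynomial ℝ :=
  Polynomial.C (1 / (2 ^ l * (l.factorial : ℝ))) *
    (Polynomial.derivative^[l] ((Polynomial.X ^ 2 - 1) ^ l))

/-- The Legendre function of order zero. -/
def legendre0 (l : ℕ) (ξ : ℝ) : ℝ := (legendrePoly l).eval ξ

/-- The Legendre function of order one, `√(1-ξ²) · d/dξ` of the Legendre polynomial
(no Condon-Shortley sign). -/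
def legendre1 (l : ℕ) (ξ : ℝ) : ℝ :=
  Real.sqrt (1 - ξ ^ 2) * (Polynomial.derivative (legendrePoly l)).eval ξ

/-! ## Fields and field equations -/

/-- Partial derivative in the radial variable. -/
def dr (g : ℝ → ℝ → ℝ) (r ξ : ℝ) : ℝ := deriv (fun r' => g r' ξ) r

/-- Partial derivative in the internal variable `ξ = cos ϑ`. -/
def dxi (g : ℝ → ℝ → ℝ) (r ξ : ℝ) : ℝ := deriv (fun ξ' => g r ξ') ξ

/-- The unknowns: mass function `m`, lapse `S`, electric gauge function `α` and the reduced
magnetic gauge function `f`; the magnetic gauge function itself is `ω = √(1-ξ²) f`. -/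
structure Fields where
  m : ℝ → ℝ
  S : ℝ → ℝ
  α : ℝ → ℝ → ℝ
  f : ℝ → ℝ → ℝ

namespace Fields

/-- The magnetic gauge function. -/
def ω (F : Fields) (r ξ : ℝ) : ℝ := Real.sqrt (1 - ξ ^ 2) * F.f r ξ

/-- The metric function `μ = 1 - 2m/r + r²/ℓ²`. -/
def μ (F : Fields) (ℓ r : ℝ) : ℝ := 1 - 2 * F.m r / r + r ^ 2 / ℓ ^ 2

def η (F : Fields) (r : ℝ) : ℝ := (1 / 2) * ∫ ξ in (-1 : ℝ)..1, (dr F.α r ξ) ^ 2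

def ζ (F : Fields) (r : ℝ) : ℝ :=
  (1 / 2) * ∫ ξ in (-1 : ℝ)..1, (F.ω r ξ) ^ 2 * (dxi F.α r ξ) ^ 2

def G (F : Fields) (r : ℝ) : ℝ := (1 / 2) * ∫ ξ in (-1 : ℝ)..1, (dr F.ω r ξ) ^ 2

def P (F : Fields) (r : ℝ) : ℝ :=
  (1 / 8) * ∫ ξ in (-1 : ℝ)..1, (dxi (fun r' ξ' => (F.ω r' ξ') ^ 2 + ξ' ^ 2) r ξ) ^ 2

/-- The two Einstein equations at radius `r`. -/
def EinsteinAt (F : Fields) (ℓ r : ℝ) : Prop :=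
  deriv F.m r = (3 / 2) * (r ^ 2 * F.η r / (4 * F.S r ^ 2)
      + F.ζ r / (4 * F.μ ℓ r * F.S r ^ 2) + F.μ ℓ r * F.G r + F.P r / r ^ 2) ∧
  deriv F.S r / F.S r =
    (2 / r) * (F.G r + F.ζ r / (4 * F.μ ℓ r ^ 2 * F.S r ^ 2))

/-- The two Yang-Mills equations at the point `(r, ξ)`. -/
def YangMillsAt (F : Fields) (ℓ r ξ : ℝ) : Prop :=
  0 = r ^ 2 * F.μ ℓ r * dr (dr F.α) r ξ
      + r ^ 2 * F.μ ℓ r * (2 / r - deriv F.S r / F.S r) * dr F.α r ξ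
      + dxi (fun r' ξ' => (F.ω r' ξ') ^ 2 * dxi F.α r' ξ') r ξ ∧
  0 = r ^ 2 * F.μ ℓ r * dr (dr F.ω) r ξ
      + (2 * F.m r - 3 * F.P r / r + 2 * r ^ 3 / ℓ ^ 2
          - 3 * r ^ 3 * F.η r / (4 * F.S r ^ 2)) * dr F.ω r ξ
      + r ^ 2 * F.ω r ξ / (4 * F.μ ℓ r * F.S r ^ 2) * (dxi F.α r ξ) ^ 2
      + F.ω r ξ / 2 * dxi (dxi (fun r' ξ' => (F.ω r' ξ') ^ 2 + ξ' ^ 2)) r ξ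

end Fields

/-- `F` is a smooth solution of the full dyonic system, with AdS radius `ℓ`, on the exterior
`r ≥ r₀`, static there (`μ > 0` for `r > r₀`). -/
structure IsSolutionOn (ℓ r₀ : ℝ) (F : Fields) : Prop where
  smooth_m : ContDiffOn ℝ ((⊤ : ℕ∞) : WithTop ℕ∞) F.m (Ici r₀)
  smooth_S : ContDiffOn ℝ ((⊤ : ℕ∞) : WithTop ℕ∞) F.S (Ici r₀)
  smooth_α : ContDiffOn ℝ ((⊤ : ℕ∞) : WithTop ℕ∞) (fun p : ℝ × ℝ => F.α p.1 p.2) (Ici r₀ ×ˢ Icc (-1) 1)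
  smooth_f : ContDiffOn ℝ ((⊤ : ℕ∞) : WithTop ℕ∞) (fun p : ℝ × ℝ => F.f p.1 p.2) (Ici r₀ ×ˢ Icc (-1) 1)
  S_pos : ∀ r, r₀ ≤ r → 0 < F.S r
  μ_pos : ∀ r, r₀ < r → 0 < F.μ ℓ r
  α_mean : ∀ r, r₀ ≤ r → ∫ ξ in (-1 : ℝ)..1, F.α r ξ = 0
  einstein : ∀ r, r₀ < r → F.EinsteinAt ℓ r
  yangMills : ∀ r, r₀ < r → ∀ ξ ∈ Ioo (-1 : ℝ) 1, F.YangMillsAt ℓ r ξ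

/-! ## Boundary data at infinity and charges -/

/-- Asymptotic data: the ADM mass `M`, the next mass coefficient `m₁`, and the boundary
functions of the gauge fields. -/
structure AsymptoticData where
  M : ℝ
  m₁ : ℝ
  αInf : ℝ → ℝ
  A : ℝ → ℝ
  ωInf : ℝ → ℝ
  W : ℝ → ℝ

/-- `F` is asymptotically AdS with asymptotic data `D`: the expansions in `1/r`. -/
structure HasAsymptotics (F : Fields) (D : AsymptoticData) : Prop where
  m_exp : (fun r => F.m r - D.M - D.m₁ / r) =O[atTop] fun r => 1 / r ^ 2
  S_exp : (fun r => F.S r - 1) =O[atTop] fun r => 1 / r ^ 4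
  α_exp : ∀ ξ ∈ Icc (-1 : ℝ) 1,
    (fun r => F.α r ξ - D.αInf ξ - D.A ξ / r) =O[atTop] fun r => 1 / r ^ 2
  ω_exp : ∀ ξ ∈ Icc (-1 : ℝ) 1,
    (fun r => F.ω r ξ - D.ωInf ξ - D.W ξ / r) =O[atTop] fun r => 1 / r ^ 2
  A_lim : ∀ ξ ∈ Icc (-1 : ℝ) 1,
    Tendsto (fun r => -(r ^ 2 * dr F.α r ξ)) atTop (𝓝 (D.A ξ))
  W_lim : ∀ ξ ∈ Icc (-1 : ℝ) 1,
    Tendsto (fun r => -(r ^ 2 * dr F.ω r ξ)) atTop (𝓝 (D.W ξ))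
  ωInf_diff : DifferentiableOn ℝ D.ωInf (Ioo (-1) 1)

/-- The magnetic charge function of a boundary function `ω_∞`. -/
def qM (ωInf : ℝ → ℝ) (ξ : ℝ) : ℝ :=
  Real.sqrt 3 / 2 * deriv (fun ξ' => (ωInf ξ') ^ 2 + ξ' ^ 2) ξ

/-- The electric charge function of a boundary function `𝒜`. -/
def qE (A : ℝ → ℝ) (ξ : ℝ) : ℝ := Real.sqrt 3 / 2 * A ξ

/-! ## Globally regular solutions and black holes -/

/-- A globally regular (soliton or dyon) solution with asymptotic data `D`. -/
structure IsGloballyRegular (ℓ : ℝ) (F : Fields) (D : AsymptoticData) : Prop where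
  sol : IsSolutionOn ℓ 0 F
  m_zero : F.m =O[𝓝[>] 0] fun r => r ^ 3
  S_zero : (fun r => F.S r - F.S 0) =O[𝓝[>] 0] fun r => r ^ 2
  α_zero : ∀ ξ ∈ Icc (-1 : ℝ) 1, (fun r => F.α r ξ) =O[𝓝[>] 0] fun r => r
  ω_zero : ∀ ξ ∈ Icc (-1 : ℝ) 1,
    (fun r => F.ω r ξ - Real.sqrt (1 - ξ ^ 2)) =O[𝓝[>] 0] fun r => r ^ 2
  asym : HasAsymptotics F D

/-- A black hole solution with regular event horizon at `r = r_h` and asymptotic data `D`. -/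
structure IsBlackHole (ℓ r_h : ℝ) (F : Fields) (D : AsymptoticData) : Prop where
  sol : IsSolutionOn ℓ r_h F
  horizon : F.μ ℓ r_h = 0
  α_horizon : ∀ ξ ∈ Icc (-1 : ℝ) 1, F.α r_h ξ = 0
  asym : HasAsymptotics F D

/-- The regime of globally regular solutions for small `ℓ`: with `x = r/ℓ`, uniformly
`α = O(ℓ)` and `ω/√(1-ξ²) - 1 = O(ℓ²)` with derivatives, with the decay and growth at `x = 0` and
`x = ∞` of the boundary expansions, and `S` bounded below. The mass function is not constrained. -/
structure NearAdS (C ℓ : ℝ) (F : Fields) : Prop where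
  S_low : ∀ r, 0 ≤ r → C⁻¹ ≤ F.S r
  α_bd : ∀ r, 0 < r → ∀ ξ ∈ Ioo (-1 : ℝ) 1,
    |F.α r ξ| ≤ C * ℓ * ((r / ℓ) / (1 + r / ℓ)) ∧
    |dxi F.α r ξ| ≤ C * ℓ * ((r / ℓ) / (1 + r / ℓ)) ∧
    ℓ * |dr F.α r ξ| ≤ C * ℓ * (1 / (1 + r / ℓ) ^ 2)
  f_bd : ∀ r, 0 < r → ∀ ξ ∈ Ioo (-1 : ℝ) 1,
    |F.f r ξ - 1| ≤ C * ℓ ^ 2 * ((r / ℓ) / (1 + r / ℓ)) ^ 2 ∧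
    |dxi F.f r ξ| ≤ C * ℓ ^ 2 * ((r / ℓ) / (1 + r / ℓ)) ^ 2 ∧
    |dxi (dxi F.f) r ξ| ≤ C * ℓ ^ 2 * ((r / ℓ) / (1 + r / ℓ)) ^ 2 ∧
    ℓ * |dr F.f r ξ| ≤ C * ℓ ^ 2 * ((r / ℓ) / (1 + r / ℓ) ^ 3) ∧
    ℓ ^ 2 * |dr (dr F.f) r ξ| ≤ C * ℓ ^ 2 * (1 / (1 + r / ℓ) ^ 3)

/-- Black hole gauge fields of size at most `C`, with `S` bounded below by `1/C`. -/
structure BoundedHair (C r_h : ℝ) (F : Fields) : Prop where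
  S_low : ∀ r, r_h ≤ r → C⁻¹ ≤ F.S r
  α_bd : ∀ r, r_h < r → ∀ ξ ∈ Ioo (-1 : ℝ) 1,
    |F.α r ξ| ≤ C ∧ r ^ 2 * |dr F.α r ξ| ≤ C
  f_bd : ∀ r, r_h < r → ∀ ξ ∈ Ioo (-1 : ℝ) 1,
    |F.f r ξ| ≤ C ∧ |dxi F.f r ξ| ≤ C ∧ r ^ 2 * |dr F.f r ξ| ≤ C

/-- The free constant `ρ_k`: the component along the Legendre polynomial of degree `k` of the
coefficient of `r^k` in the expansion of `α` at `r = 0`. -/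
def rhoConst (F : Fields) (k : ℕ) : ℝ :=
  (2 * (k : ℝ) + 1) / 2 * ∫ ξ in (-1 : ℝ)..1, legendre0 k ξ *
    (iteratedDerivWithin k (fun r => F.α r ξ) (Ici 0) 0 / (k.factorial : ℝ))

/-- The free constant `σ_k`: the component along the order-one Legendre function of degree `k-1`
of the coefficient of `r^k` in the expansion of `ω` at `r = 0` (used for `k ≥ 2`). -/
def sigmaConst (F : Fields) (k : ℕ) : ℝ :=
  (2 * (k : ℝ) - 1) / (2 * (k : ℝ) * ((k : ℝ) - 1)) * ∫ ξ in (-1 : ℝ)..1, legendre1 (k - 1) ξ *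
    (iteratedDerivWithin k (fun r => F.ω r ξ) (Ici 0) 0 / (k.factorial : ℝ))

/-! ## The explicit gauge fields of the large `|Λ|` expansion -/

/-- `₂F₁(a, b; c; -x²)` for `c > b > 0` and all real `x`, by Euler's integral. -/
def hyp (a b c x : ℝ) : ℝ :=
  Real.Gamma c / (Real.Gamma b * Real.Gamma (c - b)) *
    ∫ t in (0 : ℝ)..1, t ^ (b - 1) * (1 - t) ^ (c - b - 1) * (1 + x ^ 2 * t) ^ (-a)

/-- Electric radial mode `₂F₁(k/2, (k+1)/2; (2k+3)/2; -x²)`. -/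
def modeP (k : ℕ) (x : ℝ) : ℝ :=
  hyp ((k : ℝ) / 2) (((k : ℝ) + 1) / 2) ((2 * (k : ℝ) + 3) / 2) x

/-- Magnetic radial mode `₂F₁(k/2, (k+1)/2; (2k+1)/2; -x²)`. -/
def modeS (k : ℕ) (x : ℝ) : ℝ :=
  hyp ((k : ℝ) / 2) (((k : ℝ) + 1) / 2) ((2 * (k : ℝ) + 1) / 2) x

/-- General term (`k ≥ 1`) of the electric series, `ρ_k 𝒫_k(x) P⁰_k(ξ) (xℓ)^k` with `x = r/ℓ`. -/
def alphaTerm (ℓ : ℝ) (ρ : ℕ → ℝ) (k : ℕ) (r ξ : ℝ) : ℝ :=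
  ρ k * modeP k (r / ℓ) * legendre0 k ξ * r ^ k

/-- General term (`k ≥ 2`) of the magnetic series, `σ_k 𝒮_k(x) P¹_{k-1}(ξ) (xℓ)^k`, `x = r/ℓ`. -/
def omegaTerm (ℓ : ℝ) (σ : ℕ → ℝ) (k : ℕ) (r ξ : ℝ) : ℝ :=
  σ k * modeS k (r / ℓ) * legendre1 (k - 1) ξ * r ^ k

/-- `α = ∑_{k ≥ 1} ρ_k 𝒫_k(r/ℓ) P⁰_k(ξ) r^k`. -/
def alphaSeries (ℓ : ℝ) (ρ : ℕ → ℝ) (r ξ : ℝ) : ℝ := ∑' k : ℕ, alphaTerm ℓ ρ (k + 1) r ξ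

/-- `ω = √(1-ξ²) + ∑_{k ≥ 2} σ_k 𝒮_k(r/ℓ) P¹_{k-1}(ξ) r^k`. -/
def omegaSeries (ℓ : ℝ) (σ : ℕ → ℝ) (r ξ : ℝ) : ℝ :=
  Real.sqrt (1 - ξ ^ 2) + ∑' k : ℕ, omegaTerm ℓ σ (k + 2) r ξ

/-- Coefficient of `ρ_k P⁰_k ℓ^(k+1)` in the boundary function `𝒜`. -/
def coeffA (k : ℕ) : ℝ :=
  2 * Real.sqrt Real.pi * (k : ℝ) *
    (Real.Gamma ((2 * (k : ℝ) + 3) / 2) /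
        (Real.Gamma ((k : ℝ) / 2) * Real.Gamma (((k : ℝ) + 2) / 2))
      - ((k : ℝ) + 1) * Real.Gamma ((2 * (k : ℝ) + 5) / 2) /
        ((2 * (k : ℝ) + 3) * Real.Gamma (((k : ℝ) + 2) / 2) ^ 2))

/-- Coefficient of `σ_k P¹_{k-1} ℓ^k` in the boundary function `ω_∞`. -/
def coeffW (k : ℕ) : ℝ :=
  Real.sqrt Real.pi * Real.Gamma ((2 * (k : ℝ) + 1) / 2) / Real.Gamma (((k : ℝ) + 1) / 2) ^ 2

/-- General term (`k ≥ 1`) of the Legendre series of `𝒜`. -/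
def aTerm (ℓ : ℝ) (ρ : ℕ → ℝ) (k : ℕ) (ξ : ℝ) : ℝ :=
  ρ k * coeffA k * legendre0 k ξ * ℓ ^ (k + 1)

/-- General term (`k ≥ 2`) of the Legendre series of `ω_∞`. -/
def wTerm (ℓ : ℝ) (σ : ℕ → ℝ) (k : ℕ) (ξ : ℝ) : ℝ :=
  σ k * coeffW k * legendre1 (k - 1) ξ * ℓ ^ k

/-- The Legendre series of the boundary function `𝒜`. -/
def aSeries (ℓ : ℝ) (ρ : ℕ → ℝ) (ξ : ℝ) : ℝ := ∑' k : ℕ, aTerm ℓ ρ (k + 1) ξ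

/-- The Legendre series of the boundary function `ω_∞`. -/
def wSeries (ℓ : ℝ) (σ : ℕ → ℝ) (ξ : ℝ) : ℝ :=
  Real.sqrt (1 - ξ ^ 2) + ∑' k : ℕ, wTerm ℓ σ (k + 2) ξ

/-- The convergence condition: `|a_k| ≤ B θ^k` for some `B` and some `0 ≤ θ < 1/(2ℓ)`; it holds
whenever the `a_k` are eventually nonzero and `lim |a_{k+1}/a_k| < 1/(2ℓ)`. -/
def Admissible (ℓ : ℝ) (a : ℕ → ℝ) : Prop :=
  ∃ B θ : ℝ, 0 ≤ θ ∧ θ < 1 / (2 * ℓ) ∧ ∀ k, |a k| ≤ B * θ ^ k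

/-- The solution assembled from constants `ρ`, `σ`: the gauge fields are the explicit series, and
the metric functions solve the Einstein equations with these gauge fields, regular at the origin,
with `S → 1` and ADM mass `M` at infinity, and `S` bounded below by `1/C`. -/
structure IsExpansionSolution (C ℓ : ℝ) (ρ σ : ℕ → ℝ) (F : Fields) (M : ℝ) : Prop where
  α_eq : ∀ r, 0 ≤ r → ∀ ξ ∈ Icc (-1 : ℝ) 1, F.α r ξ = alphaSeries ℓ ρ r ξ
  ω_eq : ∀ r, 0 ≤ r → ∀ ξ ∈ Icc (-1 : ℝ) 1, F.ω r ξ = omegaSeries ℓ σ r ξ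
  m_cont : ContinuousOn F.m (Ici 0)
  S_cont : ContinuousOn F.S (Ici 0)
  m_diff : ∀ r, 0 < r → DifferentiableAt ℝ F.m r
  S_diff : ∀ r, 0 < r → DifferentiableAt ℝ F.S r
  S_low : ∀ r, 0 ≤ r → C⁻¹ ≤ F.S r
  μ_pos : ∀ r, 0 < r → 0 < F.μ ℓ r
  einstein : ∀ r, 0 < r → F.EinsteinAt ℓ r
  m_zero : F.m =O[𝓝[>] 0] fun r => r ^ 3
  m_lim : Tendsto F.m atTop (𝓝 M)
  S_lim : Tendsto F.S atTop (𝓝 1)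

end SuInfEYM

end

open SuInfEYM

/-!
Charges characterize solutions of the Einstein-Yang-Mills equations near anti-de Sitter space.

*Explicit gauge fields.* Euler's integral represents the radial modes `x^k 𝒫_k`, `x^k 𝒮_k` as
integrals of elementary kernels (`radialMode`). This bounds a mode and its derivative by `2^k` times
a polynomial in `k` and the expected decay in `x` (`radialMode_le`, `radialModeDeriv_le`). The
Legendre functions grow polynomially in `k` on `[-1, 1]`, by Sonin's argument
(`abs_eval_le_of_gegenbauer`), so all series converge geometrically when `θ < 1/(2ℓ)`. The limits at
infinity are Beta integrals, which give the constants `a_k`, `w_k`, and orthogonality of the Legendre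
functions inverts the boundary series (`explicit_gauge_fields`).

*Charges determine boundary values.* Equal electric charges mean equal `𝒜`. Equal magnetic charges
mean equal derivatives of `ω_∞²`; this function vanishes at `ξ = 1`, and `ω_∞ ≥ 0` for small `ℓ`, so
`ω_∞` is determined (`eqOn_of_qM_eq`). With the inversion formulas this already gives the equality of
the constants of explicit gauge fields.

*Uniqueness of solitons.* In divergence form, the Yang-Mills equations give the radial derivative of
the flux of each gauge field. Multiply the difference of the fluxes of two solutions by the difference
of the fields and integrate over `ξ`. This `energy` vanishes at the centre and, by equality of the
charges, at infinity. Its derivative dominates the squared difference of the fields, up to an error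
quadratic in the size `T` of the difference of the metrics (`GaugeProfile.integral_energyRate_ge`):
the potential term has no sign pointwise but is handled after integration by parts with a Hardy-type
inequality, and the couplings between the fields are small for small `ℓ`. Hence the energy, corrected
by `O(T²)`, is increasing and bounded by `O(T² ℓ³)`, which bounds the difference of the sources of the
Einstein equations in the mean (`SourceDifference`). Integrating the Einstein equations, `m` from the
centre and `log S` from infinity, improves the bound `T` to `O(ℓ²) T` (`metric_difference`). For small
`ℓ` the iteration forces equal metrics (`metric_unique`). Then there is no error term, the energy is
monotone between zero limits, and the fields coincide (`globallyRegular_unique`). For expansion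
solutions with equal constants the sources agree, and the contraction alone gives `expansion_unique`.

*Masses.* The Einstein equations give `m' ≥ 0`. For solitons a continuity argument keeps `2m/r` below
`1/2` (`MetricRegular.half_pAds_le_μ`), and the decay of the sources integrates to `0 ≤ M ≤ K ℓ³`
(`MetricRegular.mass_bounds`). For a black hole `μ(r_h) = 0` reads
`m(r_h) = r_h/2 + r_h³/(2ℓ²)`, whence the lower bound. In the upper bound the electric sources, which
have no pointwise bound at the horizon, form the derivative of a bounded flux
(`IsBlackHole.hasDerivAt_electricFlux`, `IsBlackHole.mass_le`). The two mass scales `ℓ³` and `ℓ⁻²`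
separate for small `ℓ` (`mass_lt_mass`).
-/

namespace SuInfEYM

/-! ### Legendre polynomials -/

open Polynomial in
/-- Legendre's equation. With `U = (X² - 1)^n`, differentiate `(X² - 1) U' = 2 n X U` once by hand and
`n` more times by the Leibniz rule. -/
theorem legendrePoly_ode (n : ℕ) :
    (1 - X ^ 2) * derivative (derivative (legendrePoly n)) - 2 * X * derivative (legendrePoly n)
      + (n * (n + 1) : ℝ[X]) * legendrePoly n = 0 := by
  set U : ℝ[X] := (X ^ 2 - 1) ^ n with hU
  have hC2 : (C 2 : ℝ[X]) = 2 := rfl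
  have h1 : derivative^[2] U * X ^ 2 - derivative^[2] U + (2 - 2 * (n : ℝ[X])) * (derivative U * X)
      - 2 * (n : ℝ[X]) * U = 0 := by
    have h0 : (X ^ 2 - 1) * derivative U = 2 * (n : ℝ[X]) * X * U := by
      rcases n with _ | n
      · simp [hU]
      · simp only [hU, derivative_pow, derivative_sub, derivative_X, derivative_one]
        simp [hC2]
        ring
    have h := congrArg derivative h0
    simp only [derivative_mul, derivative_sub, derivative_pow, derivative_X, derivative_one,
      derivative_natCast, derivative_ofNat] at h
    simp only [Function.iterate_succ, Function.iterate_zero, Function.comp, id]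
    simp [hC2] at h
    linear_combination h
  have h2 := congrArg (fun p => derivative^[n] p) h1
  have hc : ∀ p : ℝ[X], derivative^[n] ((2 - 2 * (n : ℝ[X])) * p)
      = (2 - 2 * (n : ℝ[X])) * derivative^[n] p := by
    intro p
    have : (2 - 2 * (n : ℝ[X])) = C (2 - 2 * (n : ℝ)) := by simp [hC2]
    rw [this, iterate_derivative_C_mul]
  have hc' : ∀ p : ℝ[X], derivative^[n] (2 * (n : ℝ[X]) * p)
      = 2 * (n : ℝ[X]) * derivative^[n] p := by
    intro p
    have : (2 * (n : ℝ[X])) = C (2 * (n : ℝ)) := by simp [hC2]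
    rw [this, iterate_derivative_C_mul]
  simp only [iterate_derivative_sub, iterate_map_add,
    iterate_derivative_derivative_mul_X_sq, hc, hc', iterate_derivative_derivative_mul_X,
    iterate_derivative_zero] at h2
  have e2 : derivative^[n] (derivative^[2] U) = derivative^[n+2] U := by
    rw [← Function.iterate_add_apply]
  rw [e2] at h2
  have hn : ((n * (n - 1) : ℕ) : ℝ[X]) = (n : ℝ[X]) * (n - 1) := by
    rcases n with _ | n <;> simp
  simp only [nsmul_eq_mul, hn] at h2
  unfold legendrePoly
  rw [← hU]
  simp only [derivative_C_mul, ← Function.iterate_succ_apply' derivative]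
  push_cast at h2
  linear_combination (-C (1 / (2 ^ n * (n.factorial : ℝ)))) * h2

open Polynomial in
/-- The value `P_n(s)` for `s = ±1`, read off Rodrigues' formula, where only the term that
differentiates `(X - s)^n` completely survives. -/
theorem legendrePoly_eval_of_sq_eq_one (n : ℕ) (s : ℝ) (hs : s ^ 2 = 1) :
    (legendrePoly n).eval s = s ^ n := by
  have h : ((X : ℝ[X]) ^ 2 - 1) ^ n = (X - C s) ^ n * (X + C s) ^ n := by
    rw [← mul_pow]
    congr 1
    have : (C s : ℝ[X]) ^ 2 = 1 := by rw [← C_pow, hs, C_1]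
    linear_combination this
  have := aeval_iterate_derivative_self (A := ℝ) (((X : ℝ[X]) ^ 2 - 1) ^ n) n s (p' := (X + C s) ^ n)
    (by simpa using h)
  simp only [coe_aeval_eq_eval] at this
  unfold legendrePoly
  rw [eval_mul, eval_C, this]
  simp only [eval_pow, eval_add, eval_X, eval_C, nsmul_eq_mul]
  have : (n.factorial : ℝ) ≠ 0 := by positivity
  rw [← two_mul, mul_pow]
  field_simp

open Polynomial in
theorem iterate_derivative_sq_sub_one_pow_eval (n j : ℕ) (hj : j < n) (s : ℝ) (hs : s ^ 2 = 1) :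
    (derivative^[j] (((X : ℝ[X]) ^ 2 - 1) ^ n)).eval s = 0 := by
  have h : ((X : ℝ[X]) ^ 2 - 1) ^ n = (X - C s) ^ n * (X + C s) ^ n := by
    rw [← mul_pow]
    congr 1
    have : (C s : ℝ[X]) ^ 2 = 1 := by rw [← C_pow, hs, C_1]
    linear_combination this
  have := aeval_iterate_derivative_of_lt (A := ℝ) (((X : ℝ[X]) ^ 2 - 1) ^ n) n s (p' := (X + C s) ^ n)
    (by simpa using h) hj
  simpa only [coe_aeval_eq_eval] using this

open Polynomial in
/-- Sonin's argument: for a solution of `(1 - x²) Q'' - 2a x Q' + lam Q = 0` with `a ≥ 1/2` and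
`lam > 0`, the function `Q² + (1 - x²) Q'² / lam` increases with `|x|`, so that on `[-1, 1]`
the values at `±1` bound `Q`. -/
theorem abs_eval_le_of_gegenbauer (Q : ℝ[X]) (a lam B : ℝ) (ha : 1 / 2 ≤ a) (hl : 0 < lam)
    (hQ : ∀ x, (1 - x ^ 2) * (derivative (derivative Q)).eval x - 2 * a * x * (derivative Q).eval x
      + lam * Q.eval x = 0)
    (h1 : |Q.eval 1| ≤ B) (h2 : |Q.eval (-1)| ≤ B) (x : ℝ) (hx : x ∈ Icc (-1 : ℝ) 1) :
    |Q.eval x| ≤ B := by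
  set E : ℝ → ℝ := fun x => (Q.eval x) ^ 2 + (1 - x ^ 2) * ((derivative Q).eval x) ^ 2 / lam
  have hB : 0 ≤ B := le_trans (abs_nonneg _) h1
  have hE : ∀ x, HasDerivAt E ((4 * a - 2) * x * ((derivative Q).eval x) ^ 2 / lam) x := by
    intro x
    have d1 := Q.hasDerivAt x
    have d2 := (derivative Q).hasDerivAt x
    have d := (d1.pow 2).add ((((((hasDerivAt_id x).pow 2).const_sub 1).mul (d2.pow 2)).div_const lam))
    refine d.congr_deriv ?_
    have := hQ x
    simp only [id, Pi.pow_apply]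
    field_simp
    linear_combination (2 * (derivative Q).eval x) * this
  have hEc : Continuous E := by
    rw [continuous_iff_continuousAt]; exact fun x => (hE x).continuousAt
  have key : E x ≤ B ^ 2 := by
    rcases le_total 0 x with h0 | h0
    · have : MonotoneOn E (Icc 0 1) := by
        apply monotoneOn_of_deriv_nonneg (convex_Icc 0 1) hEc.continuousOn
        · exact fun y _ => (hE y).differentiableAt.differentiableWithinAt
        · intro y hy
          rw [interior_Icc] at hy
          rw [(hE y).deriv]
          have := hy.1
          have : 0 ≤ 4 * a - 2 := by linarith
          positivity
      have h := this ⟨h0, hx.2⟩ ⟨zero_le_one, le_refl _⟩ hx.2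
      refine h.trans ?_
      simp only [E]
      norm_num
      exact sq_le_sq' (abs_le.1 h1).1 (abs_le.1 h1).2
    · have : AntitoneOn E (Icc (-1) 0) := by
        apply antitoneOn_of_deriv_nonpos (convex_Icc (-1) 0) hEc.continuousOn
        · exact fun y _ => (hE y).differentiableAt.differentiableWithinAt
        · intro y hy
          rw [interior_Icc] at hy
          rw [(hE y).deriv]
          have h3 := hy.2
          have h4 : 0 ≤ 4 * a - 2 := by linarith
          have : 0 ≤ (4 * a - 2) * (-y) * ((derivative Q).eval y) ^ 2 / lam := by
            have : 0 ≤ -y := by linarith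
            positivity
          have e : (4 * a - 2) * y * ((derivative Q).eval y) ^ 2 / lam
              = -((4 * a - 2) * (-y) * ((derivative Q).eval y) ^ 2 / lam) := by ring
          linarith
      have h := this ⟨le_refl _, by norm_num⟩ ⟨hx.1, h0⟩ hx.1
      refine h.trans ?_
      simp only [E]
      norm_num
      exact sq_le_sq' (abs_le.1 h2).1 (abs_le.1 h2).2
  apply abs_le_of_sq_le_sq _ hB
  refine le_trans ?_ key
  simp only [E]
  have : 0 ≤ 1 - x ^ 2 := by nlinarith [hx.1, hx.2]
  have : 0 ≤ (1 - x ^ 2) * ((derivative Q).eval x) ^ 2 / lam := by positivity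
  linarith

open Polynomial in
theorem legendrePoly_ode_eval (n : ℕ) (x : ℝ) :
    (1 - x ^ 2) * (derivative (derivative (legendrePoly n))).eval x
      - 2 * x * (derivative (legendrePoly n)).eval x
      + (n * (n + 1) : ℝ) * (legendrePoly n).eval x = 0 := by
  have := congrArg (fun p => p.eval x) (legendrePoly_ode n)
  simpa using this

open Polynomial in
/-- Differentiating Legendre's equation gives a Gegenbauer equation with `a = 2` for `P_n'`. -/
theorem legendrePoly_ode_eval_one (n : ℕ) (x : ℝ) :
    (1 - x ^ 2) * (derivative (derivative (derivative (legendrePoly n)))).eval x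
      - 2 * 2 * x * (derivative (derivative (legendrePoly n))).eval x
      + (n * (n + 1) - 2 : ℝ) * (derivative (legendrePoly n)).eval x = 0 := by
  have h := congrArg derivative (legendrePoly_ode n)
  simp only [derivative_add, derivative_sub, derivative_mul, derivative_one, derivative_X_pow,
    derivative_X, derivative_natCast, derivative_ofNat, derivative_zero] at h
  have := congrArg (fun p => p.eval x) h
  simp at this
  linear_combination this

open Polynomial in
/-- Differentiating Legendre's equation twice gives a Gegenbauer equation with `a = 3` for `P_n''`. -/
theorem legendrePoly_ode_eval_two (n : ℕ) (x : ℝ) :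
    (1 - x ^ 2) * (derivative (derivative (derivative (derivative (legendrePoly n))))).eval x
      - 2 * 3 * x * (derivative (derivative (derivative (legendrePoly n)))).eval x
      + (n * (n + 1) - 6 : ℝ) * (derivative (derivative (legendrePoly n))).eval x = 0 := by
  have h := congrArg derivative (congrArg derivative (legendrePoly_ode n))
  simp only [derivative_add, derivative_sub, derivative_mul, derivative_one, derivative_X_pow,
    derivative_X, derivative_natCast, derivative_ofNat, derivative_zero] at h
  have := congrArg (fun p => p.eval x) h
  simp at this
  linear_combination this

theorem legendrePoly_zero : legendrePoly 0 = 1 := by simp [legendrePoly]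

open Polynomial in
theorem legendrePoly_one : legendrePoly 1 = X := by
  simp only [legendrePoly, Function.iterate_succ, Function.iterate_zero, Function.comp, id]
  simp
  rw [show ((1 : ℝ[X]) + 1) = C 2 by rw [one_add_one_eq_two]; rfl, ← mul_assoc, ← C_mul]
  norm_num

theorem abs_legendrePoly_eval_le (n : ℕ) (x : ℝ) (hx : x ∈ Icc (-1 : ℝ) 1) :
    |(legendrePoly n).eval x| ≤ 1 := by
  rcases Nat.eq_zero_or_pos n with rfl | hn
  · simp [legendrePoly_zero]
  · have : (1 : ℝ) ≤ n := by exact_mod_cast hn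
    refine abs_eval_le_of_gegenbauer _ 1 (n * (n + 1)) 1 (by norm_num) (by positivity) ?_ ?_ ?_ x hx
    · intro x; linear_combination legendrePoly_ode_eval n x
    · rw [legendrePoly_eval_of_sq_eq_one n 1 (by norm_num)]; simp
    · rw [legendrePoly_eval_of_sq_eq_one n (-1) (by norm_num)]; simp

open Polynomial in
theorem abs_derivative_legendrePoly_eval_of_sq_eq_one (n : ℕ) (s : ℝ) (hs : s ^ 2 = 1) :
    |(derivative (legendrePoly n)).eval s| ≤ (n + 1 : ℝ) ^ 2 := by
  have h := legendrePoly_ode_eval n s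
  have hs' : |s| = 1 :=
    (pow_eq_one_iff_of_nonneg (abs_nonneg s) two_ne_zero).1 (by rw [sq_abs, hs])
  rw [hs, legendrePoly_eval_of_sq_eq_one n s hs] at h
  have h1 : |s * (derivative (legendrePoly n)).eval s| = |(n * (n + 1) : ℝ) / 2 * s ^ n| := by
    congr 1; linarith
  rw [abs_mul, hs', one_mul, abs_mul, abs_pow, hs', one_pow, mul_one,
    abs_of_nonneg (show (0 : ℝ) ≤ n * (n + 1) / 2 by positivity)] at h1
  rw [h1]
  nlinarith [Nat.cast_nonneg (α := ℝ) n]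

open Polynomial in
theorem abs_derivative_legendrePoly_eval_le (n : ℕ) (x : ℝ) (hx : x ∈ Icc (-1 : ℝ) 1) :
    |(derivative (legendrePoly n)).eval x| ≤ (n + 1 : ℝ) ^ 2 := by
  rcases n with _ | _ | n
  · simp [legendrePoly_zero]
  · simp [legendrePoly_one]; norm_num
  · refine abs_eval_le_of_gegenbauer _ 2 (((n + 2 : ℕ) : ℝ) * ((n + 2 : ℕ) + 1) - 2) _
      (by norm_num) (by push_cast; nlinarith [Nat.cast_nonneg (α := ℝ) n]) ?_ ?_ ?_ x hx
    · intro x; exact legendrePoly_ode_eval_one (n + 2) x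
    · exact abs_derivative_legendrePoly_eval_of_sq_eq_one _ 1 (by norm_num)
    · exact abs_derivative_legendrePoly_eval_of_sq_eq_one _ (-1) (by norm_num)

open Polynomial in
theorem abs_derivative_derivative_legendrePoly_eval_of_sq_eq_one (n : ℕ) (s : ℝ) (hs : s ^ 2 = 1) :
    |(derivative (derivative (legendrePoly n))).eval s| ≤ (n + 1 : ℝ) ^ 4 := by
  have h := legendrePoly_ode_eval_one n s
  have hs' : |s| = 1 :=
    (pow_eq_one_iff_of_nonneg (abs_nonneg s) two_ne_zero).1 (by rw [sq_abs, hs])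
  rw [hs] at h
  have h1 : |s * (derivative (derivative (legendrePoly n))).eval s|
      = |(n * (n + 1) - 2 : ℝ) / 4 * (derivative (legendrePoly n)).eval s| := by
    congr 1; linarith
  rw [abs_mul, hs', one_mul, abs_mul] at h1
  rw [h1]
  have hn := Nat.cast_nonneg (α := ℝ) n
  have h2 : |(n * (n + 1) - 2 : ℝ) / 4| ≤ (n + 1 : ℝ) ^ 2 := by
    rw [abs_le]; constructor <;> nlinarith
  calc _ ≤ (n + 1 : ℝ) ^ 2 * (n + 1 : ℝ) ^ 2 :=
        mul_le_mul h2 (abs_derivative_legendrePoly_eval_of_sq_eq_one n s hs) (abs_nonneg _)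
          (by positivity)
    _ = _ := by ring

open Polynomial in
theorem abs_derivative_derivative_legendrePoly_eval_le (n : ℕ) (x : ℝ) (hx : x ∈ Icc (-1 : ℝ) 1) :
    |(derivative (derivative (legendrePoly n))).eval x| ≤ (n + 1 : ℝ) ^ 4 := by
  rcases n with _ | _ | _ | n
  · simp [legendrePoly_zero]
  · simp [legendrePoly_one]
  · -- the eigenvalue vanishes for `n = 2`, where the second derivative is constant
    have hc : derivative (derivative (derivative (legendrePoly 2))) = 0 := by
      simp only [legendrePoly, Function.iterate_succ, Function.iterate_zero, Function.comp, id]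
      have : ((X : ℝ[X]) ^ 2 - 1) ^ 2 = X ^ 4 - 2 * X ^ 2 + 1 := by ring
      rw [this]
      simp
    have := eq_C_of_derivative_eq_zero hc
    have h1 := abs_derivative_derivative_legendrePoly_eval_of_sq_eq_one 2 1 (by norm_num)
    simp only [zero_add, Nat.reduceAdd]
    rw [this] at h1 ⊢
    simpa using h1
  · refine abs_eval_le_of_gegenbauer _ 3 (((n + 3 : ℕ) : ℝ) * ((n + 3 : ℕ) + 1) - 6) _
      (by norm_num) (by push_cast; nlinarith [Nat.cast_nonneg (α := ℝ) n]) ?_ ?_ ?_ x hx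
    · intro x; exact legendrePoly_ode_eval_two (n + 3) x
    · exact abs_derivative_derivative_legendrePoly_eval_of_sq_eq_one _ 1 (by norm_num)
    · exact abs_derivative_derivative_legendrePoly_eval_of_sq_eq_one _ (-1) (by norm_num)

/-! ### Orthogonality of the Legendre functions -/

open Polynomial in
theorem integral_mul_derivative_eval (p q : ℝ[X]) :
    ∫ x in (-1 : ℝ)..1, p.eval x * (derivative q).eval x =
      p.eval 1 * q.eval 1 - p.eval (-1) * q.eval (-1)
        - ∫ x in (-1 : ℝ)..1, (derivative p).eval x * q.eval x :=
  intervalIntegral.integral_mul_deriv_eq_deriv_mul (fun x _ => p.hasDerivAt x)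
    (fun x _ => q.hasDerivAt x) ((derivative p).continuous.intervalIntegrable _ _)
    ((derivative q).continuous.intervalIntegrable _ _)

open Polynomial in
theorem integral_mul_iterate_derivative_eq_zero (n j : ℕ) (hj : j ≤ n) (q : ℝ[X])
    (hq : q.natDegree < j) :
    ∫ x in (-1 : ℝ)..1, q.eval x * (derivative^[j] (((X : ℝ[X]) ^ 2 - 1) ^ n)).eval x = 0 := by
  induction j generalizing q with
  | zero => omega
  | succ j ih =>
    rw [Function.iterate_succ_apply', integral_mul_derivative_eval,
      iterate_derivative_sq_sub_one_pow_eval n j (by omega) 1 (by norm_num),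
      iterate_derivative_sq_sub_one_pow_eval n j (by omega) (-1) (by norm_num)]
    rcases Nat.eq_zero_or_pos q.natDegree with h | h
    · rw [eq_C_of_natDegree_eq_zero h]; simp
    · rw [ih (by omega) _ (by have := natDegree_derivative_lt h.ne'; omega)]; simp

open Polynomial in
theorem integral_mul_legendrePoly_eq_zero (n : ℕ) (q : ℝ[X]) (hq : q.natDegree < n) :
    ∫ x in (-1 : ℝ)..1, q.eval x * (legendrePoly n).eval x = 0 := by
  have := integral_mul_iterate_derivative_eq_zero n n le_rfl q hq
  simp only [legendrePoly, eval_mul, eval_C]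
  simp_rw [mul_left_comm]
  rw [intervalIntegral.integral_const_mul, this, mul_zero]

open Polynomial in
theorem natDegree_legendrePoly_le (n : ℕ) : (legendrePoly n).natDegree ≤ n := by
  unfold legendrePoly
  refine (natDegree_C_mul_le _ _).trans ?_
  refine (natDegree_iterate_derivative _ _).trans ?_
  have : ((X : ℝ[X]) ^ 2 - 1).natDegree ≤ 2 := by
    compute_degree
  have := natDegree_pow_le_of_le n this
  omega

open Polynomial in
theorem integral_legendrePoly_mul_of_ne {j k : ℕ} (h : j ≠ k) :
    ∫ x in (-1 : ℝ)..1, (legendrePoly j).eval x * (legendrePoly k).eval x = 0 := by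
  rcases lt_or_gt_of_ne h with h | h
  · exact integral_mul_legendrePoly_eq_zero k _ ((natDegree_legendrePoly_le j).trans_lt h)
  · simp_rw [mul_comm (eval _ (legendrePoly j))]
    exact integral_mul_legendrePoly_eq_zero j _ ((natDegree_legendrePoly_le k).trans_lt h)

open Polynomial in
/-- The normalization: `x P_n' - n P_n` has degree less than `n`, hence is orthogonal to `P_n`, and
integrating `(x P_n²)'` gives `2 = (2n + 1) ∫ P_n²`. -/
theorem integral_legendrePoly_sq (n : ℕ) :
    ∫ x in (-1 : ℝ)..1, (legendrePoly n).eval x * (legendrePoly n).eval x = 2 / (2 * n + 1) := by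
  set p := legendrePoly n with hp
  rcases Nat.eq_zero_or_pos n with rfl | hn
  · simp [hp, legendrePoly_zero]; norm_num
  have hdeg : (X * derivative p - (n : ℝ[X]) * p).natDegree < n := by
    by_cases h0 : X * derivative p - (n : ℝ[X]) * p = 0
    · simpa [h0] using hn
    rw [natDegree_lt_iff_degree_lt h0, degree_lt_iff_coeff_zero]
    intro m hm
    obtain ⟨m, rfl⟩ : ∃ m', m = m' + 1 := ⟨m - 1, by omega⟩
    rw [coeff_sub, coeff_X_mul, coeff_derivative, coeff_natCast_mul]
    rcases eq_or_lt_of_le hm with h | h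
    · rw [h]; push_cast; ring
    · rw [coeff_eq_zero_of_natDegree_lt ((natDegree_legendrePoly_le n).trans_lt h)]; simp
  have h0 := integral_mul_legendrePoly_eq_zero n _ hdeg
  have h1 := integral_mul_derivative_eval (X * p) p
  have e1 : p.eval 1 = 1 := by
    rw [hp, legendrePoly_eval_of_sq_eq_one n 1 (by norm_num), one_pow]
  have e2 : p.eval (-1) * p.eval (-1) = 1 := by
    rw [hp, legendrePoly_eval_of_sq_eq_one n (-1) (by norm_num), ← mul_pow]; norm_num
  simp only [eval_mul, eval_X, derivative_mul, derivative_X, eval_add, eval_one, e1, eval_sub,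
    eval_natCast, ← hp] at h0 h1
  have i1 : ∫ x in (-1 : ℝ)..1, (1 * p.eval x + x * (derivative p).eval x) * p.eval x
      = (∫ x in (-1 : ℝ)..1, p.eval x * p.eval x)
        + ∫ x in (-1 : ℝ)..1, x * p.eval x * (derivative p).eval x := by
    rw [← intervalIntegral.integral_add]
    · congr 1; ext x; ring
    · exact (by fun_prop : Continuous fun x => p.eval x * p.eval x).intervalIntegrable _ _
    · exact (by fun_prop : Continuous fun x => x * p.eval x * (derivative p).eval x).intervalIntegrable _ _
  have i2 : ∫ x in (-1 : ℝ)..1, (x * (derivative p).eval x - n * p.eval x) * p.eval x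
      = (∫ x in (-1 : ℝ)..1, x * p.eval x * (derivative p).eval x)
        - n * ∫ x in (-1 : ℝ)..1, p.eval x * p.eval x := by
    rw [← intervalIntegral.integral_const_mul, ← intervalIntegral.integral_sub]
    · congr 1; ext x; ring
    · exact (by fun_prop : Continuous fun x => x * p.eval x * (derivative p).eval x).intervalIntegrable _ _
    · exact (by fun_prop : Continuous fun x => n * (p.eval x * p.eval x)).intervalIntegrable _ _
  rw [i1] at h1
  rw [i2] at h0
  rw [eq_div_iff (by positivity)]
  linarith

theorem legendre0_continuous (k : ℕ) : Continuous (legendre0 k) := by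
  unfold legendre0; fun_prop

theorem legendre1_continuous (k : ℕ) : Continuous (legendre1 k) := by
  unfold legendre1; fun_prop

theorem integral_legendre0_mul (j k : ℕ) :
    ∫ ξ in (-1 : ℝ)..1, legendre0 j ξ * legendre0 k ξ =
      if j = k then 2 / (2 * (k : ℝ) + 1) else 0 := by
  unfold legendre0
  split_ifs with h
  · rw [h, integral_legendrePoly_sq]
  · exact integral_legendrePoly_mul_of_ne h

open Polynomial in
/-- Orthogonality of the associated Legendre functions of order one: integrating by parts and using
Legendre's equation reduces it to order zero. -/
theorem integral_legendre1_mul (j k : ℕ) :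
    ∫ ξ in (-1 : ℝ)..1, legendre1 j ξ * legendre1 k ξ =
      if j = k then 2 * (k : ℝ) * (k + 1) / (2 * (k : ℝ) + 1) else 0 := by
  have h1 : ∫ ξ in (-1 : ℝ)..1, legendre1 j ξ * legendre1 k ξ
      = ∫ ξ in (-1 : ℝ)..1, (((1 : ℝ[X]) - X ^ 2) * derivative (legendrePoly k)).eval ξ
          * (derivative (legendrePoly j)).eval ξ := by
    apply intervalIntegral.integral_congr
    intro ξ hξ
    rw [uIcc_of_le (by norm_num)] at hξ
    have : Real.sqrt (1 - ξ ^ 2) * Real.sqrt (1 - ξ ^ 2) = 1 - ξ ^ 2 :=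
      Real.mul_self_sqrt (by nlinarith [hξ.1, hξ.2])
    simp only [legendre1, eval_mul, eval_sub, eval_one, eval_pow, eval_X]
    linear_combination ((derivative (legendrePoly k)).eval ξ * (derivative (legendrePoly j)).eval ξ) * this
  rw [h1, integral_mul_derivative_eval]
  have h2 : ∀ ξ : ℝ, (derivative (((1 : ℝ[X]) - X ^ 2) * derivative (legendrePoly k))).eval ξ
      * (legendrePoly j).eval ξ
      = -((k : ℝ) * (k + 1)) * (legendre0 j ξ * legendre0 k ξ) := by
    intro ξ
    have := legendrePoly_ode_eval k ξ
    simp only [legendre0, derivative_mul, derivative_sub, derivative_one, derivative_X_pow, eval_add,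
      eval_mul, eval_sub, eval_one, eval_pow, eval_X, eval_zero]
    simp
    linear_combination ((legendrePoly j).eval ξ) * this
  simp_rw [h2]
  rw [intervalIntegral.integral_const_mul, integral_legendre0_mul]
  simp
  split_ifs with h
  · ring
  · simp

/-! ### Radial modes -/

open MeasureTheory in
theorem beta_integrable {u v : ℝ} (hu : 0 < u) (hv : 0 < v) :
    IntervalIntegrable (fun t : ℝ => t ^ (u - 1) * (1 - t) ^ (v - 1)) volume 0 1 := by
  have h := (Complex.betaIntegral_convergent (u := u) (v := v) (by simpa) (by simpa)).norm
  refine h.congr_uIoo ?_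
  intro t ht
  rw [uIoo_of_le zero_le_one] at ht
  have h1 : (0 : ℝ) ≤ 1 - t := by linarith [ht.2]
  have e1 : (t : ℂ) ^ ((u : ℂ) - 1) = ((t ^ (u - 1) : ℝ) : ℂ) := by
    rw [Complex.ofReal_cpow ht.1.le]; simp
  have e2 : (1 - (t : ℂ)) ^ ((v : ℂ) - 1) = (((1 - t) ^ (v - 1) : ℝ) : ℂ) := by
    rw [Complex.ofReal_cpow h1]; simp
  simp only [e1, e2, norm_mul, Complex.norm_real, Real.norm_eq_abs]
  rw [abs_of_nonneg (Real.rpow_nonneg ht.1.le _), abs_of_nonneg (Real.rpow_nonneg h1 _)]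

open MeasureTheory in
theorem beta_integral {u v : ℝ} (hu : 0 < u) (hv : 0 < v) :
    ∫ t in (0 : ℝ)..1, t ^ (u - 1) * (1 - t) ^ (v - 1)
      = Real.Gamma u * Real.Gamma v / Real.Gamma (u + v) := by
  have h := Complex.betaIntegral_eq_Gamma_mul_div u v (by simpa) (by simpa)
  have e : Complex.betaIntegral u v
      = ((∫ t in (0 : ℝ)..1, t ^ (u - 1) * (1 - t) ^ (v - 1) : ℝ) : ℂ) := by
    unfold Complex.betaIntegral
    rw [← intervalIntegral.integral_ofReal]
    apply intervalIntegral.integral_congr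
    intro t ht
    rw [uIcc_of_le zero_le_one] at ht
    have h1 : (0 : ℝ) ≤ 1 - t := by linarith [ht.2]
    have e1 : (t : ℂ) ^ ((u : ℂ) - 1) = ((t ^ (u - 1) : ℝ) : ℂ) := by
      rw [Complex.ofReal_cpow ht.1]; simp
    have e2 : (1 - (t : ℂ)) ^ ((v : ℂ) - 1) = (((1 - t) ^ (v - 1) : ℝ) : ℂ) := by
      rw [Complex.ofReal_cpow h1]; simp
    simp only [e1, e2, Complex.ofReal_mul]
  rw [e, ← Complex.ofReal_add, Complex.Gamma_ofReal, Complex.Gamma_ofReal, Complex.Gamma_ofReal] at h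
  exact_mod_cast h

/-- The normalization of Euler's integral for the radial mode `x^(n+1) ₂F₁`. -/
noncomputable def modeConst (n : ℕ) (e : ℝ) : ℝ :=
  Real.Gamma ((n : ℝ) / 2 + 1 + e) / (Real.Gamma ((n : ℝ) / 2 + 1) * Real.Gamma e)

/-- The weight of Euler's integral for the radial modes. -/
noncomputable def modeWeight (n : ℕ) (e t : ℝ) : ℝ := t ^ ((n : ℝ) / 2) * (1 - t) ^ (e - 1)

/-- The radial mode `x^(n+1) ₂F₁((n+1)/2, n/2+1; n/2+1+e; -x²)`, by Euler's integral. The electric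
modes have `e = (n+1)/2 + 1`, the magnetic ones `e = (n+1)/2`. -/
noncomputable def radialMode (n : ℕ) (e x : ℝ) : ℝ :=
  modeConst n e * ∫ t in (0 : ℝ)..1,
    modeWeight n e t * (x ^ (n + 1) * (1 + x ^ 2 * t) ^ (-(((n : ℝ) + 1) / 2)))

/-- The derivative of `radialMode n e`. -/
noncomputable def radialModeDeriv (n : ℕ) (e x : ℝ) : ℝ :=
  modeConst n e * (n + 1) * ∫ t in (0 : ℝ)..1,
    modeWeight n e t * (x ^ n * (1 + x ^ 2 * t) ^ (-(((n : ℝ) + 3) / 2)))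

theorem pow_mul_modeP (n : ℕ) (x : ℝ) :
    modeP (n + 1) x * x ^ (n + 1) = radialMode n (((n : ℝ) + 1) / 2 + 1) x := by
  unfold modeP hyp radialMode modeConst modeWeight
  push_cast
  rw [mul_assoc, ← intervalIntegral.integral_mul_const]
  have e1 : (2 * ((n : ℝ) + 1) + 3) / 2 - ((n : ℝ) + 1 + 1) / 2 = ((n : ℝ) + 1) / 2 + 1 := by ring
  have e2 : (2 * ((n : ℝ) + 1) + 3) / 2 = (n : ℝ) / 2 + 1 + (((n : ℝ) + 1) / 2 + 1) := by ring
  have e3 : ((n : ℝ) + 1 + 1) / 2 = (n : ℝ) / 2 + 1 := by ring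
  congr 1
  · rw [e1, e2, e3]
  · congr 1; ext t
    rw [show ((n : ℝ) + 1 + 1) / 2 - 1 = n / 2 by ring,
      show (2 * ((n : ℝ) + 1) + 3) / 2 - ((n : ℝ) + 1 + 1) / 2 - 1 = ((n : ℝ) + 1) / 2 + 1 - 1 by ring]
    ring

theorem pow_mul_modeS (n : ℕ) (x : ℝ) :
    modeS (n + 1) x * x ^ (n + 1) = radialMode n (((n : ℝ) + 1) / 2) x := by
  unfold modeS hyp radialMode modeConst modeWeight
  push_cast
  rw [mul_assoc, ← intervalIntegral.integral_mul_const]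
  have e1 : (2 * ((n : ℝ) + 1) + 1) / 2 - ((n : ℝ) + 1 + 1) / 2 = ((n : ℝ) + 1) / 2 := by ring
  have e2 : (2 * ((n : ℝ) + 1) + 1) / 2 = (n : ℝ) / 2 + 1 + (((n : ℝ) + 1) / 2) := by ring
  have e3 : ((n : ℝ) + 1 + 1) / 2 = (n : ℝ) / 2 + 1 := by ring
  congr 1
  · rw [e1, e2, e3]
  · congr 1; ext t
    rw [show ((n : ℝ) + 1 + 1) / 2 - 1 = n / 2 by ring,
      show (2 * ((n : ℝ) + 1) + 1) / 2 - ((n : ℝ) + 1 + 1) / 2 - 1 = ((n : ℝ) + 1) / 2 - 1 by ring]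
    ring

theorem modeWeight_nonneg (n : ℕ) (e t : ℝ) (ht : t ∈ Icc (0 : ℝ) 1) : 0 ≤ modeWeight n e t :=
  mul_nonneg (Real.rpow_nonneg ht.1 _) (Real.rpow_nonneg (by linarith [ht.2]) _)

theorem modeWeight_le (n : ℕ) (e t : ℝ) (he : 1 ≤ e) (ht : t ∈ Icc (0 : ℝ) 1) :
    modeWeight n e t ≤ t ^ ((n : ℝ) / 2) := by
  have := Real.rpow_le_one (x := 1 - t) (z := e - 1) (by linarith [ht.2]) (by linarith [ht.1])
    (by linarith)
  have h2 := Real.rpow_nonneg ht.1 ((n : ℝ) / 2)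
  unfold modeWeight
  nlinarith

theorem modeWeight_le_one (n : ℕ) (e t : ℝ) (he : 1 ≤ e) (ht : t ∈ Icc (0 : ℝ) 1) :
    modeWeight n e t ≤ 1 :=
  (modeWeight_le n e t he ht).trans (Real.rpow_le_one ht.1 ht.2 (by positivity))

theorem modeWeight_continuous (n : ℕ) (e : ℝ) (he : 1 ≤ e) : Continuous (modeWeight n e) := by
  unfold modeWeight
  refine Continuous.mul ?_ ?_
  · exact Real.continuous_rpow_const (by positivity)
  · exact (Real.continuous_rpow_const (by linarith)).comp (by fun_prop)

theorem modeConst_pos (n : ℕ) (e : ℝ) (he : 0 < e) : 0 < modeConst n e := by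
  unfold modeConst
  have h1 := Real.Gamma_pos_of_pos (show (0 : ℝ) < (n : ℝ) / 2 + 1 by positivity)
  have h2 := Real.Gamma_pos_of_pos he
  have h3 := Real.Gamma_pos_of_pos (show (0 : ℝ) < (n : ℝ) / 2 + 1 + e by positivity)
  positivity

theorem one_add_sq_mul_pos {x t : ℝ} (ht : 0 ≤ t) : 0 < 1 + x ^ 2 * t := by positivity

theorem continuousOn_modeKernel (n : ℕ) (e x : ℝ) (he : 1 ≤ e) (m : ℕ) (s : ℝ) :
    ContinuousOn (fun t => modeWeight n e t * (x ^ m * (1 + x ^ 2 * t) ^ s)) (Icc 0 1) := by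
  refine (modeWeight_continuous n e he).continuousOn.mul (continuousOn_const.mul ?_)
  refine ContinuousOn.rpow_const (by fun_prop) ?_
  intro t ht
  exact Or.inl (one_add_sq_mul_pos ht.1).ne'

open MeasureTheory in
theorem intervalIntegrable_modeKernel (n : ℕ) (e x : ℝ) (he : 1 ≤ e) (m : ℕ) (s : ℝ) :
    IntervalIntegrable (fun t => modeWeight n e t * (x ^ m * (1 + x ^ 2 * t) ^ s)) volume 0 1 := by
  apply ContinuousOn.intervalIntegrable
  rw [uIcc_of_le zero_le_one]
  exact continuousOn_modeKernel n e x he m s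

theorem hasDerivAt_modeKernel (n : ℕ) (x t : ℝ) (ht : 0 ≤ t) :
    HasDerivAt (fun x => x ^ (n + 1) * (1 + x ^ 2 * t) ^ (-(((n : ℝ) + 1) / 2)))
      ((n + 1) * (x ^ n * (1 + x ^ 2 * t) ^ (-(((n : ℝ) + 3) / 2)))) x := by
  have hp := one_add_sq_mul_pos (x := x) ht
  have h1 := hasDerivAt_pow (n + 1) x
  have h2 : HasDerivAt (fun x : ℝ => 1 + x ^ 2 * t) (2 * x * t) x := by
    have := ((hasDerivAt_pow 2 x).mul_const t).const_add 1
    simpa using this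
  have h3 := h2.rpow_const (p := -(((n : ℝ) + 1) / 2)) (Or.inl hp.ne')
  refine (h1.mul h3).congr_deriv ?_
  have e1 : (1 + x ^ 2 * t) ^ (-(((n : ℝ) + 1) / 2) - 1) = (1 + x ^ 2 * t) ^ (-(((n : ℝ) + 3) / 2)) := by
    congr 1; ring
  have e2 : (1 + x ^ 2 * t) ^ (-(((n : ℝ) + 1) / 2))
      = (1 + x ^ 2 * t) ^ (-(((n : ℝ) + 3) / 2)) * (1 + x ^ 2 * t) := by
    rw [← Real.rpow_add_one hp.ne']; congr 1; ring
  rw [e1, e2]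
  push_cast
  ring

/-- `t^(n/2) xⁿ (1+x²t)^(-s)` is at most `(1+x²t)^(n/2-s)`. -/
theorem rpow_mul_pow_mul_le (n : ℕ) (x t s : ℝ) (hx : 0 ≤ x) (ht : 0 ≤ t) :
    t ^ ((n : ℝ) / 2) * (x ^ n * (1 + x ^ 2 * t) ^ (-s)) ≤ (1 + x ^ 2 * t) ^ ((n : ℝ) / 2 - s) := by
  have hp := one_add_sq_mul_pos (x := x) ht
  have e : x ^ n = (x ^ 2) ^ ((n : ℝ) / 2) := by
    rw [← Real.rpow_natCast, ← Real.rpow_natCast, ← Real.rpow_mul hx]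
    congr 1; push_cast; ring
  rw [e, ← mul_assoc, ← Real.mul_rpow ht (by positivity), sub_eq_add_neg, Real.rpow_add hp]
  gcongr
  linarith

open MeasureTheory in
theorem hasDerivAt_radialMode (n : ℕ) (e x : ℝ) (he : 1 ≤ e) :
    HasDerivAt (radialMode n e) (radialModeDeriv n e x) x := by
  unfold radialMode radialModeDeriv
  have key := intervalIntegral.hasDerivAt_integral_of_dominated_loc_of_deriv_le
    (μ := MeasureTheory.volume) (a := 0) (b := 1) (x₀ := x) (s := Metric.ball x 1)
    (bound := fun _ => (n + 1) * (|x| + 1) ^ n)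
    (F := fun x t => modeWeight n e t * (x ^ (n + 1) * (1 + x ^ 2 * t) ^ (-(((n : ℝ) + 1) / 2))))
    (F' := fun x t => modeWeight n e t * ((n + 1) * (x ^ n * (1 + x ^ 2 * t) ^ (-(((n : ℝ) + 3) / 2)))))
    (Metric.ball_mem_nhds x one_pos) ?_ ?_ ?_ ?_ ?_ ?_
  · rw [mul_assoc, ← intervalIntegral.integral_const_mul]
    refine (key.2.const_mul _).congr_deriv ?_
    congr 1
    congr 1; ext t; ring
  · refine Eventually.of_forall fun y => ?_
    exact (intervalIntegrable_modeKernel n e y he _ _).aestronglyMeasurable_restrict_uIoc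
  · exact intervalIntegrable_modeKernel n e x he _ _
  · have := (intervalIntegrable_modeKernel n e x he n (-(((n : ℝ) + 3) / 2))).const_mul ((n : ℝ) + 1)
    refine this.aestronglyMeasurable_restrict_uIoc.congr (ae_of_all _ fun t => ?_)
    ring
  · refine ae_of_all _ fun t ht y hy => ?_
    rw [uIoc_of_le zero_le_one] at ht
    have hp := one_add_sq_mul_pos (x := y) ht.1.le
    have h1 : 1 ≤ 1 + y ^ 2 * t := by have := ht.1; have : 0 ≤ y ^ 2 * t := by positivity
                                      linarith
    have hy' : |y| ≤ |x| + 1 := by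
      rw [Metric.mem_ball, Real.dist_eq] at hy
      have := abs_add_le (y - x) x
      rw [sub_add_cancel] at this; linarith
    rw [Real.norm_eq_abs, abs_mul, abs_mul, abs_mul, abs_pow,
      abs_of_nonneg (modeWeight_nonneg n e t ⟨ht.1.le, ht.2⟩),
      abs_of_nonneg (show (0 : ℝ) ≤ n + 1 by positivity), abs_of_nonneg (Real.rpow_nonneg hp.le _)]
    have h2 : (1 + y ^ 2 * t) ^ (-(((n : ℝ) + 3) / 2)) ≤ 1 :=
      Real.rpow_le_one_of_one_le_of_nonpos h1 (by have : (0 : ℝ) ≤ n := by positivity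
                                                  linarith)
    calc _ ≤ 1 * ((n + 1) * ((|x| + 1) ^ n * 1)) := by
          gcongr
          exact modeWeight_le_one n e t he ⟨ht.1.le, ht.2⟩
      _ = _ := by ring
  · exact intervalIntegrable_const
  · refine ae_of_all _ fun t ht y _ => ?_
    rw [uIoc_of_le zero_le_one] at ht
    exact (hasDerivAt_modeKernel n y t ht.1.le).const_mul _

theorem radialModeDeriv_nonneg (n : ℕ) (e x : ℝ) (he : 1 ≤ e) (hx : 0 ≤ x) :
    0 ≤ radialModeDeriv n e x := by
  have := modeConst_pos n e (by linarith)
  refine mul_nonneg (by positivity) (intervalIntegral.integral_nonneg zero_le_one fun t ht => ?_)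
  have := modeWeight_nonneg n e t ht
  have hp := one_add_sq_mul_pos (x := x) ht.1
  positivity

theorem integral_rpow_neg_three_half_le (x : ℝ) (hx : 0 < x) :
    ∫ t in (0 : ℝ)..1, (1 + x ^ 2 * t) ^ (-(3 / 2) : ℝ) ≤ 2 / x ^ 2 := by
  have h : ∀ t ∈ uIcc (0 : ℝ) 1, HasDerivAt (fun t => -(2 / x ^ 2) * (1 + x ^ 2 * t) ^ (-(1 / 2) : ℝ))
      ((1 + x ^ 2 * t) ^ (-(3 / 2) : ℝ)) t := by
    intro t ht
    rw [uIcc_of_le zero_le_one] at ht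
    have hp := one_add_sq_mul_pos (x := x) ht.1
    have h2 : HasDerivAt (fun t : ℝ => 1 + x ^ 2 * t) (x ^ 2) t := by
      simpa using ((hasDerivAt_id t).const_mul (x ^ 2)).const_add 1
    refine ((h2.rpow_const (p := -(1 / 2)) (Or.inl hp.ne')).const_mul _).congr_deriv ?_
    norm_num
    field_simp
  rw [intervalIntegral.integral_eq_sub_of_hasDerivAt h]
  · have : 0 ≤ (1 + x ^ 2 * 1) ^ (-(1 / 2) : ℝ) := by positivity
    simp only [mul_zero, add_zero, Real.one_rpow]
    have h2 : 0 ≤ 2 / x ^ 2 * (1 + x ^ 2 * 1) ^ (-(1 / 2) : ℝ) := by positivity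
    linarith
  · apply ContinuousOn.intervalIntegrable
    rw [uIcc_of_le zero_le_one]
    refine ContinuousOn.rpow_const (by fun_prop) fun t ht => Or.inl (one_add_sq_mul_pos ht.1).ne'

theorem radialModeDeriv_le_const (n : ℕ) (e x : ℝ) (he : 1 ≤ e) (hx : 0 ≤ x) :
    radialModeDeriv n e x ≤ modeConst n e * (n + 1) := by
  have := modeConst_pos n e (by linarith)
  refine mul_le_of_le_one_right (by positivity) ?_
  refine le_of_le_of_eq (b := ∫ t in (0 : ℝ)..1, (1 : ℝ)) ?_ (by simp)
  refine intervalIntegral.integral_mono_on zero_le_one (intervalIntegrable_modeKernel n e x he _ _)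
    intervalIntegrable_const fun t ht => ?_
  have hp := one_add_sq_mul_pos (x := x) ht.1
  calc _ ≤ t ^ ((n : ℝ) / 2) * (x ^ n * (1 + x ^ 2 * t) ^ (-(((n : ℝ) + 3) / 2))) :=
        mul_le_mul_of_nonneg_right (modeWeight_le n e t he ht) (by positivity)
    _ ≤ _ := rpow_mul_pow_mul_le n x t _ hx ht.1
    _ ≤ 1 := Real.rpow_le_one_of_one_le_of_nonpos
        (by have := ht.1; have : 0 ≤ x ^ 2 * t := by positivity
            linarith) (by linarith)

theorem radialModeDeriv_le_inv_sq (n : ℕ) (e x : ℝ) (he : 1 ≤ e) (hx : 0 < x) :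
    radialModeDeriv n e x ≤ modeConst n e * (n + 1) * (2 / x ^ 2) := by
  have := modeConst_pos n e (by linarith)
  refine mul_le_mul_of_nonneg_left ?_ (by positivity)
  refine le_trans ?_ (integral_rpow_neg_three_half_le x hx)
  refine intervalIntegral.integral_mono_on zero_le_one (intervalIntegrable_modeKernel n e x he _ _)
    ?_ fun t ht => ?_
  · apply ContinuousOn.intervalIntegrable
    rw [uIcc_of_le zero_le_one]
    refine ContinuousOn.rpow_const (by fun_prop) fun t ht => Or.inl (one_add_sq_mul_pos ht.1).ne'
  have hp := one_add_sq_mul_pos (x := x) ht.1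
  calc _ ≤ t ^ ((n : ℝ) / 2) * (x ^ n * (1 + x ^ 2 * t) ^ (-(((n : ℝ) + 3) / 2))) :=
        mul_le_mul_of_nonneg_right (modeWeight_le n e t he ht) (by positivity)
    _ ≤ _ := rpow_mul_pow_mul_le n x t _ hx.le ht.1
    _ = _ := by congr 1; ring

theorem radialModeDeriv_le_self (n : ℕ) (e x : ℝ) (he : 1 ≤ e) (hx : 0 ≤ x) :
    radialModeDeriv (n + 1) e x ≤ modeConst (n + 1) e * ((n + 1 : ℕ) + 1) * x := by
  have := modeConst_pos (n + 1) e (by linarith)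
  refine mul_le_mul_of_nonneg_left ?_ (by positivity)
  refine le_of_le_of_eq (b := ∫ t in (0 : ℝ)..1, x) ?_ (by simp)
  refine intervalIntegral.integral_mono_on zero_le_one
    (intervalIntegrable_modeKernel (n + 1) e x he _ _) intervalIntegrable_const fun t ht => ?_
  have hp := one_add_sq_mul_pos (x := x) ht.1
  calc _ ≤ t ^ (((n + 1 : ℕ) : ℝ) / 2)
          * (x ^ (n + 1) * (1 + x ^ 2 * t) ^ (-((((n + 1 : ℕ) : ℝ) + 3) / 2))) :=
        mul_le_mul_of_nonneg_right (modeWeight_le (n + 1) e t he ht) (by positivity)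
    _ = (t ^ ((1 : ℝ) / 2) * x) * (t ^ ((n : ℝ) / 2)
          * (x ^ n * (1 + x ^ 2 * t) ^ (-((((n + 1 : ℕ) : ℝ) + 3) / 2)))) := by
        rw [show (((n + 1 : ℕ) : ℝ) / 2) = 1 / 2 + (n : ℝ) / 2 by push_cast; ring,
          Real.rpow_add_of_nonneg ht.1 (by norm_num) (by positivity)]
        ring
    _ ≤ (1 * x) * 1 := by
        refine mul_le_mul (mul_le_mul_of_nonneg_right (Real.rpow_le_one ht.1 ht.2 (by norm_num)) hx)
          ?_ (by have := ht.1; positivity) (by positivity)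
        · refine (rpow_mul_pow_mul_le n x t _ hx ht.1).trans ?_
          exact Real.rpow_le_one_of_one_le_of_nonpos
            (by have := ht.1; have : 0 ≤ x ^ 2 * t := by positivity
                linarith) (by push_cast; linarith)
    _ = x := by ring

theorem radialModeDeriv_le (n : ℕ) (e x : ℝ) (he : 1 ≤ e) (hx : 0 ≤ x) :
    radialModeDeriv n e x ≤ modeConst n e * (n + 1) * 8 * (1 / (1 + x) ^ 2) := by
  have h0 := modeConst_pos n e (by linarith)
  rcases le_total x 1 with h | h
  · refine (radialModeDeriv_le_const n e x he hx).trans ?_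
    rw [mul_assoc _ (8 : ℝ)]
    refine le_mul_of_one_le_right (by positivity) ?_
    rw [mul_one_div, one_le_div (by positivity)]
    nlinarith
  · refine (radialModeDeriv_le_inv_sq n e x he (by linarith)).trans ?_
    rw [mul_assoc _ (8 : ℝ)]
    refine mul_le_mul_of_nonneg_left ?_ (by positivity)
    rw [mul_one_div, div_le_div_iff₀ (by positivity) (by positivity)]
    nlinarith

theorem radialModeDeriv_succ_le (n : ℕ) (e x : ℝ) (he : 1 ≤ e) (hx : 0 ≤ x) :
    radialModeDeriv (n + 1) e x
      ≤ modeConst (n + 1) e * ((n + 1 : ℕ) + 1) * 16 * (x / (1 + x) ^ 3) := by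
  have h0 := modeConst_pos (n + 1) e (by linarith)
  rcases le_total x 1 with h | h
  · refine (radialModeDeriv_le_self n e x he hx).trans ?_
    rw [mul_assoc _ (16 : ℝ)]
    refine mul_le_mul_of_nonneg_left ?_ (by positivity)
    rw [mul_div_assoc', le_div_iff₀ (by positivity)]
    have : (1 + x) ^ 3 ≤ 8 := by nlinarith [mul_nonneg hx hx]
    nlinarith
  · refine (radialModeDeriv_le_inv_sq (n + 1) e x he (by linarith)).trans ?_
    rw [mul_assoc _ (16 : ℝ)]
    refine mul_le_mul_of_nonneg_left ?_ (by positivity)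
    rw [mul_div_assoc', div_le_div_iff₀ (by positivity) (by positivity)]
    have : (1 + x) ^ 3 ≤ (2 * x) ^ 3 := by gcongr; linarith
    nlinarith

theorem radialMode_zero (n : ℕ) (e : ℝ) : radialMode n e 0 = 0 := by
  simp [radialMode]

/-- A bound on the derivative integrates to a bound on the function. -/
theorem le_of_hasDerivAt_le {f f' g g' : ℝ → ℝ} (hf : ∀ x, 0 ≤ x → HasDerivAt f (f' x) x)
    (hg : ∀ x, 0 ≤ x → HasDerivAt g (g' x) x) (h : ∀ x, 0 ≤ x → f' x ≤ g' x) (h0 : f 0 = g 0)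
    (x : ℝ) (hx : 0 ≤ x) : f x ≤ g x := by
  have : MonotoneOn (fun x => g x - f x) (Ici 0) := by
    apply monotoneOn_of_deriv_nonneg (convex_Ici 0)
    · exact fun y hy => ((hg y hy).sub (hf y hy)).continuousAt.continuousWithinAt
    · intro y hy
      rw [interior_Ici] at hy
      exact ((hg y hy.le).sub (hf y hy.le)).differentiableAt.differentiableWithinAt
    · intro y hy
      rw [interior_Ici] at hy
      have := ((hg y hy.le).sub (hf y hy.le)).deriv
      rw [show (fun x => g x - f x) = g - f from rfl, this]
      linarith [h y hy.le]
  have := this (mem_Ici.2 le_rfl) (mem_Ici.2 hx) hx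
  simp only [h0] at this
  linarith

theorem radialMode_nonneg (n : ℕ) (e x : ℝ) (he : 1 ≤ e) (hx : 0 ≤ x) : 0 ≤ radialMode n e x :=
  le_of_hasDerivAt_le (f := fun _ => 0) (f' := fun _ => 0) (fun x _ => hasDerivAt_const x 0)
    (fun x _ => hasDerivAt_radialMode n e x he) (fun x hx => radialModeDeriv_nonneg n e x he hx)
    (radialMode_zero n e).symm x hx

theorem radialMode_le (n : ℕ) (e x : ℝ) (he : 1 ≤ e) (hx : 0 ≤ x) :
    radialMode n e x ≤ modeConst n e * (n + 1) * 8 * (x / (1 + x)) := by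
  refine le_of_hasDerivAt_le (g := fun x => modeConst n e * (n + 1) * 8 * (x / (1 + x)))
    (g' := fun x => modeConst n e * (n + 1) * 8 * (1 / (1 + x) ^ 2))
    (fun x _ => hasDerivAt_radialMode n e x he) ?_
    (fun x hx => radialModeDeriv_le n e x he hx) (by simp [radialMode_zero]) x hx
  intro x hx
  refine HasDerivAt.const_mul _ (((hasDerivAt_id x).div ((hasDerivAt_id x).const_add 1)
    (by simp; positivity)).congr_deriv ?_)
  simp

theorem radialMode_succ_le (n : ℕ) (e x : ℝ) (he : 1 ≤ e) (hx : 0 ≤ x) :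
    radialMode (n + 1) e x
      ≤ modeConst (n + 1) e * ((n + 1 : ℕ) + 1) * 16 * (x / (1 + x)) ^ 2 := by
  refine (le_of_hasDerivAt_le
    (g := fun x => modeConst (n + 1) e * ((n + 1 : ℕ) + 1) * 16 * (x / (1 + x)) ^ 2)
    (g' := fun x => modeConst (n + 1) e * ((n + 1 : ℕ) + 1) * 16 * (2 * (x / (1 + x) ^ 3)))
    (fun x _ => hasDerivAt_radialMode (n + 1) e x he) ?_
    (fun x hx => (radialModeDeriv_succ_le n e x he hx).trans ?_) (by simp [radialMode_zero]) x hx)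
  · intro x hx
    have h1 : (0 : ℝ) < 1 + x := by linarith
    have := (((hasDerivAt_id x).div ((hasDerivAt_id x).const_add 1) (by simp; positivity)).pow 2)
    refine HasDerivAt.const_mul _ (this.congr_deriv ?_)
    simp
    field_simp
  · have h0 := modeConst_pos (n + 1) e (by linarith)
    refine mul_le_mul_of_nonneg_left ?_ (by positivity)
    have : 0 ≤ x / (1 + x) ^ 3 := by positivity
    linarith

/-! ### Size of the coefficients -/

theorem Gamma_mul_Gamma_half (n : ℕ) :
    Real.Gamma ((n : ℝ) / 2 + 1) * Real.Gamma ((n : ℝ) / 2 + 1 + 1 / 2) * 2 ^ (n + 1)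
      = Real.Gamma (n + 2) * Real.sqrt Real.pi := by
  rw [Real.Gamma_mul_Gamma_add_half, show 2 * ((n : ℝ) / 2 + 1) = n + 2 by ring,
    show 1 - ((n : ℝ) + 2) = -((n + 1 : ℕ) : ℝ) by push_cast; ring, Real.rpow_neg (by norm_num),
    Real.rpow_natCast]
  have : (2 : ℝ) ^ (n + 1) ≠ 0 := by positivity
  field_simp

theorem one_le_sqrt_pi : 1 ≤ Real.sqrt Real.pi :=
  Real.one_le_sqrt.2 (by linarith [Real.pi_gt_three])

theorem modeConst_electric_le (n : ℕ) :
    modeConst n (((n : ℝ) + 1) / 2 + 1) ≤ (n + 2) * 2 ^ (n + 1) := by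
  unfold modeConst
  rw [show ((n : ℝ) + 1) / 2 + 1 = (n : ℝ) / 2 + 1 + 1 / 2 by ring]
  have h1 := Real.Gamma_pos_of_pos (show (0 : ℝ) < (n : ℝ) / 2 + 1 by positivity)
  have h2 := Real.Gamma_pos_of_pos (show (0 : ℝ) < (n : ℝ) / 2 + 1 + 1 / 2 by positivity)
  rw [div_le_iff₀ (by positivity)]
  have h3 := Gamma_mul_Gamma_half n
  have h4 : Real.Gamma ((n : ℝ) / 2 + 1 + ((n : ℝ) / 2 + 1 + 1 / 2)) ≤ Real.Gamma (n + 2 + 1) :=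
    Real.Gamma_strictMonoOn_Ici.monotoneOn (by simp; linarith [Nat.cast_nonneg (α := ℝ) n])
      (by simp; linarith [Nat.cast_nonneg (α := ℝ) n]) (by linarith)
  rw [Real.Gamma_add_one (by positivity)] at h4
  have h5 := Real.Gamma_pos_of_pos (show (0 : ℝ) < (n : ℝ) + 2 by positivity)
  calc _ ≤ _ := h4
    _ ≤ ((n : ℝ) + 2) * (Real.Gamma (n + 2) * Real.sqrt Real.pi) := by
        gcongr
        exact le_mul_of_one_le_right h5.le one_le_sqrt_pi
    _ = _ := by rw [← h3]; ring

theorem modeConst_magnetic_le (n : ℕ) :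
    modeConst (n + 1) (((n + 1 : ℕ) + 1 : ℝ) / 2) ≤ ((n + 1 : ℕ) + 2) * 2 ^ (n + 1 + 1) := by
  have h3 := Gamma_mul_Gamma_half (n + 1)
  unfold modeConst
  set s : ℝ := ((n + 1 : ℕ) : ℝ) with hs
  have hs1 : 1 ≤ s := by rw [hs]; push_cast; linarith [Nat.cast_nonneg (α := ℝ) n]
  have h1 := Real.Gamma_pos_of_pos (show (0 : ℝ) < s / 2 + 1 by positivity)
  have h2 := Real.Gamma_pos_of_pos (show (0 : ℝ) < (s + 1) / 2 by positivity)
  rw [div_le_iff₀ (by positivity)]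
  have h4 : Real.Gamma (s / 2 + 1 + (s + 1) / 2) ≤ Real.Gamma (s + 2) :=
    Real.Gamma_strictMonoOn_Ici.monotoneOn (by simp; linarith) (by simp; linarith) (by linarith)
  have h6 : Real.Gamma (s / 2 + 1 + 1 / 2) = (s + 1) / 2 * Real.Gamma ((s + 1) / 2) := by
    rw [← Real.Gamma_add_one (by positivity)]; congr 1; ring
  rw [h6] at h3
  have h5 := Real.Gamma_pos_of_pos (show (0 : ℝ) < s + 2 by positivity)
  calc _ ≤ _ := h4
    _ ≤ Real.Gamma (s + 2) * Real.sqrt Real.pi := le_mul_of_one_le_right h5.le one_le_sqrt_pi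
    _ = (s + 1) / 2 * 2 ^ (n + 1 + 1) * (Real.Gamma (s / 2 + 1) * Real.Gamma ((s + 1) / 2)) := by
        rw [← h3]; ring
    _ ≤ _ := by gcongr; linarith

/-! ### The modes at infinity -/

open MeasureTheory in
/-- For `t > 0` the kernel `x^(n+1) (1 + x² t)^(-(n+1)/2)` tends to `t^(-(n+1)/2)`; by dominated
convergence the mode tends to a Beta integral with parameters `1/2` and `e`. -/
theorem tendsto_radialMode (n : ℕ) (e : ℝ) (he : 1 ≤ e) :
    Tendsto (radialMode n e) atTop
      (𝓝 (Real.sqrt Real.pi * Real.Gamma ((n : ℝ) / 2 + 1 + e)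
        / (Real.Gamma ((n : ℝ) / 2 + 1) * Real.Gamma (e + 1 / 2)))) := by
  have hb := beta_integral (u := 1 / 2) (v := e) (by norm_num) (by linarith)
  have hlim : Tendsto (fun x => ∫ t in (0 : ℝ)..1,
      modeWeight n e t * (x ^ (n + 1) * (1 + x ^ 2 * t) ^ (-(((n : ℝ) + 1) / 2)))) atTop
      (𝓝 (∫ t in (0 : ℝ)..1, t ^ ((1 / 2 : ℝ) - 1) * (1 - t) ^ (e - 1))) := by
    have hrw : ∀ x t : ℝ, 0 < x → 0 < t → x ^ (n + 1) * (1 + x ^ 2 * t) ^ (-(((n : ℝ) + 1) / 2))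
        = ((x ^ 2)⁻¹ + t) ^ (-(((n : ℝ) + 1) / 2)) := by
      intro x t hx ht
      have e1 : x ^ (n + 1) = ((x ^ 2)⁻¹) ^ (-(((n : ℝ) + 1) / 2)) := by
        rw [← Real.rpow_natCast x 2, ← Real.rpow_neg hx.le, ← Real.rpow_mul hx.le,
          ← Real.rpow_natCast]
        congr 1; push_cast; ring
      rw [e1, ← Real.mul_rpow (by positivity) (by positivity)]
      congr 1; field_simp
    refine intervalIntegral.tendsto_integral_filter_of_dominated_convergence
      (fun t => t ^ ((1 / 2 : ℝ) - 1) * (1 - t) ^ ((1 : ℝ) - 1)) ?_ ?_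
      (beta_integrable (by norm_num) (by norm_num)) ?_
    · exact Eventually.of_forall fun x =>
        (intervalIntegrable_modeKernel n e x he _ _).aestronglyMeasurable_restrict_uIoc
    · filter_upwards [eventually_gt_atTop 0] with x hx
      refine ae_of_all _ fun t ht => ?_
      rw [uIoc_of_le zero_le_one] at ht
      have hw := modeWeight_nonneg n e t ⟨ht.1.le, ht.2⟩
      rw [hrw x t hx ht.1, Real.norm_eq_abs, abs_of_nonneg (by have := ht.1; positivity), sub_self,
        Real.rpow_zero, mul_one]
      calc _ ≤ t ^ ((n : ℝ) / 2) * t ^ (-(((n : ℝ) + 1) / 2)) := by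
            have ht1 := ht.1
            refine mul_le_mul (modeWeight_le n e t he ⟨ht.1.le, ht.2⟩) ?_ (by positivity)
              (by positivity)
            refine Real.rpow_le_rpow_of_nonpos ht.1 ?_ ?_
            · have : 0 ≤ (x ^ 2)⁻¹ := by positivity
              linarith
            · have : (0 : ℝ) ≤ n := by positivity
              linarith
        _ = _ := by rw [← Real.rpow_add ht.1]; congr 1; ring
    · refine ae_of_all _ fun t ht => ?_
      rw [uIoc_of_le zero_le_one] at ht
      have h1 : Tendsto (fun x : ℝ => ((x ^ 2)⁻¹ + t) ^ (-(((n : ℝ) + 1) / 2))) atTop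
          (𝓝 ((0 + t) ^ (-(((n : ℝ) + 1) / 2)))) := by
        have : Tendsto (fun x : ℝ => (x ^ 2)⁻¹ + t) atTop (𝓝 (0 + t)) :=
          (tendsto_inv_atTop_zero.comp (tendsto_pow_atTop two_ne_zero)).add_const t
        exact this.rpow_const (Or.inl (by simpa using ht.1.ne'))
      have h2 := h1.const_mul (modeWeight n e t)
      have e2 : modeWeight n e t * (0 + t) ^ (-(((n : ℝ) + 1) / 2))
          = t ^ ((1 / 2 : ℝ) - 1) * (1 - t) ^ (e - 1) := by
        unfold modeWeight
        rw [zero_add, mul_right_comm, ← Real.rpow_add ht.1]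
        congr 2; ring
      rw [← e2]
      refine h2.congr' ?_
      filter_upwards [eventually_gt_atTop 0] with x hx
      rw [hrw x t hx ht.1]
  rw [hb, Real.Gamma_one_half_eq] at hlim
  have := hlim.const_mul (modeConst n e)
  unfold radialMode
  convert this using 2
  unfold modeConst
  have h1 := (Real.Gamma_pos_of_pos (show (0 : ℝ) < (n : ℝ) / 2 + 1 by positivity)).ne'
  have h2 := (Real.Gamma_pos_of_pos (show (0 : ℝ) < e by linarith)).ne'
  have h3 := (Real.Gamma_pos_of_pos (show (0 : ℝ) < e + 1 / 2 by linarith)).ne'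
  rw [add_comm (1 / 2) e]
  field_simp

open MeasureTheory in
/-- Euler's integral for `x² y'` after the substitution `t = p / (x² (1 - p))`, which spreads the
mass that concentrates at `t ≈ x⁻²` as `x → ∞`. -/
theorem sq_mul_integral_modeKernel (n : ℕ) (e x : ℝ) (hx : 0 < x) :
    x ^ 2 * ∫ t in (0 : ℝ)..1, modeWeight n e t * (x ^ n * (1 + x ^ 2 * t) ^ (-(((n : ℝ) + 3) / 2)))
      = ∫ p in (0 : ℝ)..1, (Iio (x ^ 2 / (1 + x ^ 2))).indicator
          (fun p => p ^ ((n : ℝ) / 2) * (1 - p) ^ (-(1 / 2) : ℝ)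
            * (1 - p / (x ^ 2 * (1 - p))) ^ (e - 1)) p := by
  set c := x ^ 2 / (1 + x ^ 2) with hc
  have hx2 : 0 < x ^ 2 := by positivity
  have hc1 : c < 1 := by rw [hc, div_lt_one (by positivity)]; linarith
  have himg : (fun p => p / (x ^ 2 * (1 - p))) '' Ioo 0 c = Ioo 0 1 := by
    ext t
    constructor
    · rintro ⟨p, hp, rfl⟩
      have h1 : 0 < 1 - p := by linarith [hp.2]
      have h2 := hp.2
      rw [hc, lt_div_iff₀ (by positivity)] at h2
      refine ⟨div_pos hp.1 (by positivity), ?_⟩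
      simp only
      rw [div_lt_one (by positivity)]
      linarith
    · intro ht
      have h0 : 0 < 1 + x ^ 2 * t := one_add_sq_mul_pos ht.1.le
      have ht0 := ht.1
      refine ⟨x ^ 2 * t / (1 + x ^ 2 * t), ⟨by positivity, ?_⟩, ?_⟩
      · rw [hc, div_lt_div_iff₀ h0 (by positivity)]
        nlinarith [mul_lt_mul_of_pos_left ht.2 hx2]
      · simp only
        have : 1 - x ^ 2 * t / (1 + x ^ 2 * t) = 1 / (1 + x ^ 2 * t) := by field_simp; ring
        rw [this]; field_simp
  have hder : ∀ p ∈ Ioo 0 c, HasDerivWithinAt (fun p => p / (x ^ 2 * (1 - p)))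
      (1 / (x ^ 2 * (1 - p) ^ 2)) (Ioo 0 c) p := by
    intro p hp
    have h1 : 0 < 1 - p := by linarith [hp.2]
    have h2 : HasDerivAt (fun p : ℝ => x ^ 2 * (1 - p)) (-x ^ 2) p := by
      simpa using ((hasDerivAt_id p).const_sub 1).const_mul (x ^ 2)
    refine (((hasDerivAt_id p).div h2 (by positivity)).congr_deriv ?_).hasDerivWithinAt
    simp; field_simp; ring
  have hinj : InjOn (fun p => p / (x ^ 2 * (1 - p))) (Ioo 0 c) := by
    intro p hp p' hp' h
    have h1 : 0 < 1 - p := by linarith [hp.2]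
    have h1' : 0 < 1 - p' := by linarith [hp'.2]
    simp only at h
    rw [div_eq_div_iff (by positivity) (by positivity)] at h
    have : x ^ 2 * (p - p') = 0 := by linear_combination h
    have := (mul_eq_zero.1 this).resolve_left hx2.ne'
    linarith
  have key := integral_image_eq_integral_abs_deriv_smul measurableSet_Ioo hder hinj
    (fun t => modeWeight n e t * (x ^ n * (1 + x ^ 2 * t) ^ (-(((n : ℝ) + 3) / 2))))
  rw [himg] at key
  rw [intervalIntegral.integral_of_le zero_le_one, integral_Ioc_eq_integral_Ioo, key,
    intervalIntegral.integral_of_le zero_le_one, integral_Ioc_eq_integral_Ioo,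
    setIntegral_indicator measurableSet_Iio, Ioo_inter_Iio, min_eq_right hc1.le,
    ← integral_const_mul]
  refine setIntegral_congr_fun measurableSet_Ioo fun p hp => ?_
  have h1 : 0 < 1 - p := by linarith [hp.2]
  have hp0 := hp.1
  have e1 : 1 + x ^ 2 * (p / (x ^ 2 * (1 - p))) = (1 - p)⁻¹ := by field_simp; ring
  simp only [smul_eq_mul, modeWeight, e1]
  rw [abs_of_pos (by positivity), Real.div_rpow hp0.le (by positivity),
    Real.mul_rpow hx2.le h1.le]
  have e2 : (x ^ 2) ^ ((n : ℝ) / 2) = x ^ n := by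
    rw [← Real.rpow_natCast, ← Real.rpow_natCast, ← Real.rpow_mul hx.le]
    congr 1; push_cast; ring
  have e3 : ((1 - p)⁻¹) ^ (-(((n : ℝ) + 3) / 2))
      = (1 - p) ^ ((n : ℝ) / 2) * (1 - p) ^ (-(1 / 2) : ℝ) * (1 - p) ^ 2 := by
    rw [Real.inv_rpow h1.le, Real.rpow_neg h1.le, inv_inv, ← Real.rpow_natCast (1 - p) 2,
      ← Real.rpow_add h1, ← Real.rpow_add h1]
    congr 1; push_cast; ring
  rw [e2, e3]
  have : 0 < (1 - p) ^ ((n : ℝ) / 2) := by positivity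
  field_simp

open MeasureTheory in
/-- The substitution `p = x² t / (1 + x² t)` turns the integral in `x² radialModeDeriv` into one over
`0 < p < x² / (1 + x²)`, which tends to a Beta integral with parameters `n/2 + 1` and `1/2`. -/
theorem tendsto_sq_mul_radialModeDeriv (n : ℕ) (e : ℝ) (he : 1 ≤ e) :
    Tendsto (fun x => x ^ 2 * radialModeDeriv n e x) atTop
      (𝓝 (modeConst n e * (n + 1) * (Real.Gamma ((n : ℝ) / 2 + 1) * Real.sqrt Real.pi
        / Real.Gamma ((n : ℝ) / 2 + 1 + 1 / 2)))) := by
  have hb := beta_integral (u := (n : ℝ) / 2 + 1) (v := 1 / 2) (by positivity) (by norm_num)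
  rw [Real.Gamma_one_half_eq] at hb
  rw [← hb]
  have hlim : Tendsto (fun x : ℝ => ∫ p in (0 : ℝ)..1, (Iio (x ^ 2 / (1 + x ^ 2))).indicator
          (fun p => p ^ ((n : ℝ) / 2) * (1 - p) ^ (-(1 / 2) : ℝ)
            * (1 - p / (x ^ 2 * (1 - p))) ^ (e - 1)) p) atTop
      (𝓝 (∫ t in (0 : ℝ)..1, t ^ ((n : ℝ) / 2 + 1 - 1) * (1 - t) ^ ((1 / 2 : ℝ) - 1))) := by
    have h12 : ((1 / 2 : ℝ) - 1) = -(1 / 2) := by norm_num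
    refine intervalIntegral.tendsto_integral_filter_of_dominated_convergence
      (fun t => t ^ ((n : ℝ) / 2 + 1 - 1) * (1 - t) ^ ((1 / 2 : ℝ) - 1)) ?_ ?_
      (beta_integrable (by positivity) (by norm_num)) ?_
    · refine Eventually.of_forall fun x => Measurable.aestronglyMeasurable ?_
      refine Measurable.indicator ?_ measurableSet_Iio
      fun_prop
    · filter_upwards [eventually_gt_atTop 0] with x hx
      refine ae_of_all _ fun p hp => ?_
      rw [uIoc_of_le zero_le_one] at hp
      have hp0 := hp.1.le
      have hp1 : 0 ≤ 1 - p := by linarith [hp.2]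
      rw [add_sub_cancel_right, h12]
      by_cases h : p ∈ Iio (x ^ 2 / (1 + x ^ 2))
      · rw [indicator_of_mem h]
        rw [mem_Iio, lt_div_iff₀ (by positivity)] at h
        have h1 : 0 < 1 - p := by nlinarith
        have h2 : p / (x ^ 2 * (1 - p)) ≤ 1 := by
          rw [div_le_one (by positivity)]; linarith
        have h3 : 0 ≤ p / (x ^ 2 * (1 - p)) := by positivity
        have h4 : (1 - p / (x ^ 2 * (1 - p))) ^ (e - 1) ≤ 1 :=
          Real.rpow_le_one (by linarith) (by linarith) (by linarith)
        have h5 : 0 ≤ (1 - p / (x ^ 2 * (1 - p))) ^ (e - 1) := Real.rpow_nonneg (by linarith) _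
        rw [Real.norm_eq_abs, abs_of_nonneg (by positivity)]
        exact mul_le_of_le_one_right (by positivity) h4
      · rw [indicator_of_notMem h, norm_zero]; positivity
    · have hne : ∀ᵐ p : ℝ, p ≠ 1 := by simp [ae_iff, measure_singleton]
      filter_upwards [hne] with p hp1 hp
      rw [uIoc_of_le zero_le_one] at hp
      have h1 : 0 < 1 - p := by
        have := lt_of_le_of_ne hp.2 hp1; linarith
      have hinv : Tendsto (fun x : ℝ => (x ^ 2)⁻¹) atTop (𝓝 0) :=
        tendsto_inv_atTop_zero.comp (tendsto_pow_atTop two_ne_zero)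
      have h2 : Tendsto (fun x : ℝ => (1 - p / (x ^ 2 * (1 - p))) ^ (e - 1)) atTop (𝓝 1) := by
        have : Tendsto (fun x : ℝ => 1 - p / (x ^ 2 * (1 - p))) atTop (𝓝 (1 - p / (1 - p) * 0)) := by
          refine ((hinv.const_mul (p / (1 - p))).const_sub 1).congr fun x => ?_
          rw [div_mul_eq_div_div_swap]; ring
        rw [mul_zero, sub_zero] at this
        simpa using this.rpow_const (p := e - 1) (Or.inl one_ne_zero)
      have h3 := h2.const_mul (p ^ ((n : ℝ) / 2) * (1 - p) ^ (-(1 / 2) : ℝ))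
      rw [mul_one] at h3
      rw [add_sub_cancel_right, h12]
      refine h3.congr' ?_
      have h4 : Tendsto (fun x : ℝ => x ^ 2 / (1 + x ^ 2)) atTop (𝓝 1) := by
        have : Tendsto (fun x : ℝ => ((x ^ 2)⁻¹ + 1)⁻¹) atTop (𝓝 ((0 + 1)⁻¹)) :=
          (hinv.add_const 1).inv₀ (by norm_num)
        rw [zero_add, inv_one] at this
        refine this.congr' ?_
        filter_upwards [eventually_gt_atTop 0] with x hx
        field_simp
      filter_upwards [h4.eventually (lt_mem_nhds (show p < 1 by linarith))] with x hx
      rw [indicator_of_mem (show p ∈ Iio (x ^ 2 / (1 + x ^ 2)) from hx)]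
  have := hlim.const_mul (modeConst n e * (n + 1))
  refine this.congr' ?_
  filter_upwards [eventually_gt_atTop 0] with x hx
  rw [← sq_mul_integral_modeKernel n e x hx]
  unfold radialModeDeriv
  ring

theorem coeffW_eq (n : ℕ) : coeffW (n + 1)
    = Real.sqrt Real.pi * Real.Gamma ((n : ℝ) / 2 + 1 + ((n : ℝ) + 1) / 2)
        / (Real.Gamma ((n : ℝ) / 2 + 1) * Real.Gamma (((n : ℝ) + 1) / 2 + 1 / 2)) := by
  unfold coeffW
  push_cast
  rw [sq]
  congr 2
  · congr 1; ring
  · congr 1; ring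
  · congr 1; ring

theorem coeffA_eq (n : ℕ) : coeffA (n + 1)
    = -(modeConst n (((n : ℝ) + 1) / 2 + 1) * (n + 1) * (Real.Gamma ((n : ℝ) / 2 + 1)
        * Real.sqrt Real.pi / Real.Gamma ((n : ℝ) / 2 + 1 + 1 / 2))) := by
  unfold coeffA modeConst
  push_cast
  have e1 : (2 * ((n : ℝ) + 1) + 5) / 2 = (2 * ((n : ℝ) + 1) + 3) / 2 + 1 := by ring
  have e2 : ((n : ℝ) + 1 + 2) / 2 = ((n : ℝ) + 1) / 2 + 1 := by ring
  have e3 : (n : ℝ) / 2 + 1 + (((n : ℝ) + 1) / 2 + 1) = (2 * ((n : ℝ) + 1) + 3) / 2 := by ring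
  have e4 : (n : ℝ) / 2 + 1 + 1 / 2 = ((n : ℝ) + 1) / 2 + 1 := by ring
  rw [e3, e1, e2, e4, Real.Gamma_add_one (by positivity), Real.Gamma_add_one (by positivity)]
  have h1 := (Real.Gamma_pos_of_pos (show (0 : ℝ) < (n : ℝ) / 2 + 1 by positivity)).ne'
  have h2 := (Real.Gamma_pos_of_pos (show (0 : ℝ) < ((n : ℝ) + 1) / 2 by positivity)).ne'
  have h3 : (n : ℝ) + 1 ≠ 0 := by positivity
  have h4 : 2 * ((n : ℝ) + 1) + 3 ≠ 0 := by positivity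
  field_simp
  ring

theorem coeffA_ne_zero (n : ℕ) : coeffA (n + 1) ≠ 0 := by
  rw [coeffA_eq]
  have h0 := modeConst_pos n (((n : ℝ) + 1) / 2 + 1) (by positivity)
  have h1 := Real.Gamma_pos_of_pos (show (0 : ℝ) < (n : ℝ) / 2 + 1 by positivity)
  have h2 := Real.Gamma_pos_of_pos (show (0 : ℝ) < (n : ℝ) / 2 + 1 + 1 / 2 by positivity)
  have h3 := Real.sqrt_pos.2 Real.pi_pos
  have : 0 < modeConst n (((n : ℝ) + 1) / 2 + 1) * (n + 1) * (Real.Gamma ((n : ℝ) / 2 + 1)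
        * Real.sqrt Real.pi / Real.Gamma ((n : ℝ) / 2 + 1 + 1 / 2)) := by positivity
  linarith

theorem coeffW_pos (n : ℕ) : 0 < coeffW (n + 1) := by
  rw [coeffW_eq]
  have h0 := Real.Gamma_pos_of_pos (show (0 : ℝ) < (n : ℝ) / 2 + 1 + ((n : ℝ) + 1) / 2 by positivity)
  have h1 := Real.Gamma_pos_of_pos (show (0 : ℝ) < (n : ℝ) / 2 + 1 by positivity)
  have h2 := Real.Gamma_pos_of_pos (show (0 : ℝ) < ((n : ℝ) + 1) / 2 + 1 / 2 by positivity)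
  have h3 := Real.sqrt_pos.2 Real.pi_pos
  positivity

theorem coeffW_two : coeffW 2 = 3 := by
  unfold coeffW
  have e1 : (2 * ((2 : ℕ) : ℝ) + 1) / 2 = 1 / 2 + 1 + 1 := by norm_num
  have e2 : (((2 : ℕ) : ℝ) + 1) / 2 = 1 / 2 + 1 := by norm_num
  rw [e1, e2, Real.Gamma_add_one (by norm_num), Real.Gamma_add_one (by norm_num),
    Real.Gamma_one_half_eq]
  have h3 := Real.sqrt_pos.2 Real.pi_pos
  field_simp
  norm_num

/-! ### Series of modes -/

/-- The electric radial mode `x^(n+1) 𝒫_(n+1)(x)`. -/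
noncomputable def elMode (n : ℕ) (x : ℝ) : ℝ := radialMode n (((n : ℝ) + 1) / 2 + 1) x

/-- The derivative of `elMode n`. -/
noncomputable def elModeDeriv (n : ℕ) (x : ℝ) : ℝ := radialModeDeriv n (((n : ℝ) + 1) / 2 + 1) x

/-- The magnetic radial mode `x^(n+2) 𝒮_(n+2)(x)`. -/
noncomputable def magMode (n : ℕ) (x : ℝ) : ℝ := radialMode (n + 1) ((((n + 1 : ℕ) : ℝ) + 1) / 2) x

/-- The derivative of `magMode n`. -/
noncomputable def magModeDeriv (n : ℕ) (x : ℝ) : ℝ :=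
  radialModeDeriv (n + 1) ((((n + 1 : ℕ) : ℝ) + 1) / 2) x

/-- A common bound for the normalizations of the modes; its growth rate `2ⁿ` is sharp. -/
noncomputable def modeBound (n : ℕ) : ℝ := 16 * ((n : ℝ) + 4) ^ 2 * 2 ^ (n + 2)

theorem modeBound_pos (n : ℕ) : 0 < modeBound n := by unfold modeBound; positivity

theorem el_exponent (n : ℕ) : (1 : ℝ) ≤ ((n : ℝ) + 1) / 2 + 1 := by
  have : (0 : ℝ) ≤ n := by positivity
  linarith

theorem mag_exponent (n : ℕ) : (1 : ℝ) ≤ (((n + 1 : ℕ) : ℝ) + 1) / 2 := by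
  have : (0 : ℝ) ≤ n := by positivity
  push_cast; linarith

theorem modeConst_el_le (n : ℕ) :
    modeConst n (((n : ℝ) + 1) / 2 + 1) * (n + 1) * 8 ≤ modeBound n := by
  have h := modeConst_electric_le n
  unfold modeBound
  have hn : (0 : ℝ) ≤ n := by positivity
  calc _ ≤ (((n : ℝ) + 2) * 2 ^ (n + 1)) * (n + 1) * 8 := by gcongr
    _ = (8 * (((n : ℝ) + 2) * (n + 1))) * 2 ^ (n + 1) := by ring
    _ ≤ (16 * ((n : ℝ) + 4) ^ 2) * 2 ^ (n + 2) := by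
        refine mul_le_mul (by nlinarith) ?_ (by positivity) (by positivity)
        exact pow_le_pow_right₀ (by norm_num) (by omega)

theorem modeConst_mag_le (n : ℕ) :
    modeConst (n + 1) ((((n + 1 : ℕ) : ℝ) + 1) / 2) * ((n + 1 : ℕ) + 1) * 16 ≤ modeBound n := by
  have h := modeConst_magnetic_le n
  unfold modeBound
  have hn : (0 : ℝ) ≤ n := by positivity
  calc _ ≤ ((((n + 1 : ℕ) : ℝ) + 2) * 2 ^ (n + 1 + 1)) * ((n + 1 : ℕ) + 1) * 16 := by gcongr
    _ = (16 * (((n : ℝ) + 3) * (n + 2))) * 2 ^ (n + 2) := by push_cast; ring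
    _ ≤ (16 * ((n : ℝ) + 4) ^ 2) * 2 ^ (n + 2) := by
        refine mul_le_mul (by nlinarith) le_rfl (by positivity) (by positivity)

theorem hasDerivAt_elMode (n : ℕ) (x : ℝ) : HasDerivAt (elMode n) (elModeDeriv n x) x :=
  hasDerivAt_radialMode n _ x (el_exponent n)

theorem hasDerivAt_magMode (n : ℕ) (x : ℝ) : HasDerivAt (magMode n) (magModeDeriv n x) x :=
  hasDerivAt_radialMode (n + 1) _ x (mag_exponent n)

theorem abs_elMode_le (n : ℕ) (x : ℝ) (hx : 0 ≤ x) : |elMode n x| ≤ modeBound n * (x / (1 + x)) := by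
  unfold elMode
  rw [abs_of_nonneg (radialMode_nonneg n _ x (el_exponent n) hx)]
  exact (radialMode_le n _ x (el_exponent n) hx).trans
    (mul_le_mul_of_nonneg_right (modeConst_el_le n) (by positivity))

theorem abs_elModeDeriv_le (n : ℕ) (x : ℝ) (hx : 0 ≤ x) :
    |elModeDeriv n x| ≤ modeBound n * (1 / (1 + x) ^ 2) := by
  unfold elModeDeriv
  rw [abs_of_nonneg (radialModeDeriv_nonneg n _ x (el_exponent n) hx)]
  exact (radialModeDeriv_le n _ x (el_exponent n) hx).trans
    (mul_le_mul_of_nonneg_right (modeConst_el_le n) (by positivity))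

theorem abs_magMode_le (n : ℕ) (x : ℝ) (hx : 0 ≤ x) :
    |magMode n x| ≤ modeBound n * (x / (1 + x)) ^ 2 := by
  unfold magMode
  rw [abs_of_nonneg (radialMode_nonneg _ _ x (mag_exponent n) hx)]
  exact (radialMode_succ_le n _ x (mag_exponent n) hx).trans
    (mul_le_mul_of_nonneg_right (modeConst_mag_le n) (by positivity))

theorem abs_magModeDeriv_le (n : ℕ) (x : ℝ) (hx : 0 ≤ x) :
    |magModeDeriv n x| ≤ modeBound n * (x / (1 + x) ^ 3) := by
  unfold magModeDeriv
  rw [abs_of_nonneg (radialModeDeriv_nonneg _ _ x (mag_exponent n) hx)]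
  exact (radialModeDeriv_succ_le n _ x (mag_exponent n) hx).trans
    (mul_le_mul_of_nonneg_right (modeConst_mag_le n) (by positivity))

theorem div_one_add_le_one {x : ℝ} (hx : 0 ≤ x) : x / (1 + x) ≤ 1 := by
  rw [div_le_one (by positivity)]; linarith

theorem one_div_one_add_sq_le_one {x : ℝ} (hx : 0 ≤ x) : 1 / (1 + x) ^ 2 ≤ 1 := by
  rw [div_le_one (by positivity)]; nlinarith

theorem div_one_add_cube_le_one {x : ℝ} (hx : 0 ≤ x) : x / (1 + x) ^ 3 ≤ 1 := by
  rw [div_le_one (by positivity)]; nlinarith [mul_nonneg hx hx, mul_nonneg hx (mul_nonneg hx hx)]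

theorem tendsto_magMode (n : ℕ) : Tendsto (magMode n) atTop (𝓝 (coeffW (n + 2))) := by
  rw [show n + 2 = (n + 1) + 1 from rfl, coeffW_eq]
  exact tendsto_radialMode (n + 1) _ (mag_exponent n)

theorem tendsto_sq_mul_elModeDeriv (n : ℕ) :
    Tendsto (fun x => x ^ 2 * elModeDeriv n x) atTop (𝓝 (-coeffA (n + 1))) := by
  rw [coeffA_eq, neg_neg]
  exact tendsto_sq_mul_radialModeDeriv n _ (el_exponent n)

theorem abs_sq_mul_elModeDeriv_le (n : ℕ) (x : ℝ) (hx : 0 ≤ x) :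
    |x ^ 2 * elModeDeriv n x| ≤ modeBound n := by
  rw [abs_mul, abs_of_nonneg (sq_nonneg x)]
  calc _ ≤ x ^ 2 * (modeBound n * (1 / (1 + x) ^ 2)) := by
        gcongr; exact abs_elModeDeriv_le n x hx
    _ = modeBound n * (x / (1 + x)) ^ 2 := by field_simp
    _ ≤ _ := mul_le_of_le_one_right (modeBound_pos n).le
        (pow_le_one₀ (by positivity) (div_one_add_le_one hx))

theorem abs_coeffA_le (n : ℕ) : |coeffA (n + 1)| ≤ modeBound n := by
  have h := (tendsto_sq_mul_elModeDeriv n).abs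
  rw [abs_neg] at h
  refine le_of_tendsto h ?_
  filter_upwards [eventually_ge_atTop 0] with x hx using abs_sq_mul_elModeDeriv_le n x hx

theorem abs_coeffW_le (n : ℕ) : |coeffW (n + 2)| ≤ modeBound n := by
  refine le_of_tendsto (tendsto_magMode n).abs ?_
  filter_upwards [eventually_ge_atTop 0] with x hx
  exact (abs_magMode_le n x hx).trans (mul_le_of_le_one_right (modeBound_pos n).le
    (pow_le_one₀ (by positivity) (div_one_add_le_one hx)))

theorem alphaTerm_eq {ℓ : ℝ} (hℓ : 0 < ℓ) (ρ : ℕ → ℝ) (n : ℕ) (r ξ : ℝ) :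
    alphaTerm ℓ ρ (n + 1) r ξ
      = ρ (n + 1) * ℓ ^ (n + 1) * elMode n (r / ℓ) * (legendrePoly (n + 1)).eval ξ := by
  unfold alphaTerm elMode legendre0
  rw [← pow_mul_modeP]
  have : r ^ (n + 1) = ℓ ^ (n + 1) * (r / ℓ) ^ (n + 1) := by rw [← mul_pow]; field_simp
  rw [this]; ring

open Polynomial in
theorem omegaTerm_eq {ℓ : ℝ} (hℓ : 0 < ℓ) (σ : ℕ → ℝ) (n : ℕ) (r ξ : ℝ) :
    omegaTerm ℓ σ (n + 2) r ξ = Real.sqrt (1 - ξ ^ 2) *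
      (σ (n + 2) * ℓ ^ (n + 2) * magMode n (r / ℓ)
        * (derivative (legendrePoly (n + 1))).eval ξ) := by
  unfold omegaTerm magMode legendre1
  rw [← pow_mul_modeS]
  have : r ^ (n + 2) = ℓ ^ (n + 2) * (r / ℓ) ^ (n + 1 + 1) := by
    rw [show n + 1 + 1 = n + 2 from rfl, ← mul_pow]; field_simp
  rw [this]
  simp only [show n + 2 - 1 = n + 1 from rfl, show n + 1 + 1 = n + 2 from rfl]
  ring

/-- The summability weight of the mode series: `modeBound` times a bound for the first two
derivatives of the Legendre polynomials. -/
noncomputable def seriesWeight (n : ℕ) : ℝ := modeBound n * ((n : ℝ) + 4) ^ 4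

theorem seriesWeight_pos (n : ℕ) : 0 < seriesWeight n :=
  mul_pos (modeBound_pos n) (by positivity)

theorem summable_geometric_mul_seriesWeight {q : ℝ} (h0 : 0 ≤ q) (h1 : q < 1 / 2) :
    Summable (fun n => q ^ n * seriesWeight n) := by
  have hq : ‖2 * q‖ < 1 := by rw [Real.norm_eq_abs, abs_of_nonneg (by positivity)]; linarith
  have hs := (summable_pow_mul_geometric_of_norm_lt_one 6 hq).add
    (summable_pow_mul_geometric_of_norm_lt_one 0 hq)
  refine Summable.of_nonneg_of_le (fun n => by have := seriesWeight_pos n; positivity) (fun n => ?_)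
    (hs.mul_left (64 * 5 ^ 6))
  have h : ((n : ℝ) + 4) ^ 6 ≤ 5 ^ 6 * ((n : ℝ) ^ 6 + 1) := by
    rcases Nat.eq_zero_or_pos n with rfl | hn
    · norm_num
    · have : (1 : ℝ) ≤ n := by exact_mod_cast hn
      calc ((n : ℝ) + 4) ^ 6 ≤ (5 * n) ^ 6 := by gcongr; linarith
        _ = 5 ^ 6 * (n : ℝ) ^ 6 := by ring
        _ ≤ _ := by linarith
  unfold seriesWeight modeBound
  calc _ = 64 * (2 * q) ^ n * ((n : ℝ) + 4) ^ 6 := by rw [mul_pow]; ring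
    _ ≤ 64 * (2 * q) ^ n * (5 ^ 6 * ((n : ℝ) ^ 6 + 1)) := by gcongr
    _ = _ := by ring

/-- Geometric bounds on the constants make the mode series converge, with a sum of the order of the
first term. -/
theorem abs_coeff_mul_seriesWeight_le {ℓ B θ : ℝ} (hℓ : 0 < ℓ) {a : ℕ → ℝ}
    (ha : ∀ k, |a k| ≤ B * θ ^ k) (j n : ℕ) :
    |a (n + j) * ℓ ^ (n + j)| * seriesWeight n
      ≤ B * (θ * ℓ) ^ j * ((θ * ℓ) ^ n * seriesWeight n) := by
  have hw := seriesWeight_pos n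
  rw [abs_mul, abs_of_nonneg (show 0 ≤ ℓ ^ (n + j) by positivity)]
  calc _ ≤ B * θ ^ (n + j) * ℓ ^ (n + j) * seriesWeight n := by gcongr; exact ha _
    _ = _ := by rw [pow_add, pow_add, mul_pow, mul_pow]; ring

theorem summable_coeff_mul_seriesWeight {ℓ B θ : ℝ} (hℓ : 0 < ℓ) (hθ : 0 ≤ θ)
    (hlt : θ * ℓ < 1 / 2) {a : ℕ → ℝ} (ha : ∀ k, |a k| ≤ B * θ ^ k) (j : ℕ) :
    Summable (fun n => |a (n + j) * ℓ ^ (n + j)| * seriesWeight n) :=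
  Summable.of_nonneg_of_le (fun n => by have := seriesWeight_pos n; positivity)
    (fun n => abs_coeff_mul_seriesWeight_le hℓ ha j n)
    ((summable_geometric_mul_seriesWeight (by positivity) hlt).mul_left _)

theorem summable_modeSeries {A : ℕ → ℝ} (hA : Summable (fun n => |A n| * seriesWeight n))
    {R Θ : ℕ → ℝ} {h : ℝ} (hR : ∀ n, |R n| ≤ modeBound n * h)
    (hΘ : ∀ n, |Θ n| ≤ ((n : ℝ) + 4) ^ 4) : Summable (fun n => A n * R n * Θ n) := by
  refine Summable.of_norm_bounded (hA.mul_right h) fun n => ?_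
  rw [Real.norm_eq_abs, abs_mul, abs_mul]
  have h0 : 0 ≤ modeBound n * h := (abs_nonneg _).trans (hR n)
  calc _ ≤ |A n| * (modeBound n * h) * ((n : ℝ) + 4) ^ 4 := by
        gcongr
        · exact hR n
        · exact hΘ n
    _ = _ := by unfold seriesWeight; ring

theorem abs_modeSeries_le {A : ℕ → ℝ} (hA : Summable (fun n => |A n| * seriesWeight n))
    {R Θ : ℕ → ℝ} {h : ℝ} (hR : ∀ n, |R n| ≤ modeBound n * h)
    (hΘ : ∀ n, |Θ n| ≤ ((n : ℝ) + 4) ^ 4) :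
    |∑' n, A n * R n * Θ n| ≤ (∑' n, |A n| * seriesWeight n) * h := by
  rw [← tsum_mul_right, ← Real.norm_eq_abs]
  refine tsum_of_norm_bounded (hA.mul_right h).hasSum fun n => ?_
  rw [Real.norm_eq_abs, abs_mul, abs_mul]
  have h0 : 0 ≤ modeBound n * h := (abs_nonneg _).trans (hR n)
  calc _ ≤ |A n| * (modeBound n * h) * ((n : ℝ) + 4) ^ 4 := by
        gcongr
        · exact hR n
        · exact hΘ n
    _ = _ := by unfold seriesWeight; ring

theorem hasDerivAt_modeSeries_radial {A : ℕ → ℝ} (hA : Summable (fun n => |A n| * seriesWeight n))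
    {R R' : ℕ → ℝ → ℝ} {Θ : ℕ → ℝ}
    (hd : ∀ n x, HasDerivAt (R n) (R' n x) x) (hR : ∀ n x, 0 ≤ x → |R n x| ≤ modeBound n)
    (hR' : ∀ n x, 0 ≤ x → |R' n x| ≤ modeBound n) (hΘ : ∀ n, |Θ n| ≤ ((n : ℝ) + 4) ^ 4)
    {ℓ r : ℝ} (hℓ : 0 < ℓ) (hr : 0 < r) :
    HasDerivAt (fun r => ∑' n, A n * R n (r / ℓ) * Θ n)
      (1 / ℓ * ∑' n, A n * R' n (r / ℓ) * Θ n) r := by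
  have key : HasDerivAt (fun x => ∑' n, A n * R n x * Θ n)
      (∑' n, A n * R' n (r / ℓ) * Θ n) (r / ℓ) := by
    refine hasDerivAt_tsum_of_isPreconnected hA isOpen_Ioi (isPreconnected_Ioi (a := (0 : ℝ)))
      (g' := fun n x => A n * R' n x * Θ n)
      (fun n x _ => ((hd n x).const_mul (A n)).mul_const (Θ n)) ?_ (mem_Ioi.2 (div_pos hr hℓ)) ?_
      (mem_Ioi.2 (div_pos hr hℓ))
    · intro n x hx
      rw [Real.norm_eq_abs, abs_mul, abs_mul]
      calc _ ≤ |A n| * modeBound n * ((n : ℝ) + 4) ^ 4 := by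
            have := modeBound_pos n
            gcongr
            · exact hR' n x (le_of_lt hx)
            · exact hΘ n
        _ = _ := by unfold seriesWeight; ring
    · exact summable_modeSeries hA (h := 1) (fun n => by simpa using hR n _ (div_pos hr hℓ).le) hΘ
  have h2 : HasDerivAt (fun r : ℝ => r / ℓ) (1 / ℓ) r := (hasDerivAt_id r).div_const ℓ
  have := key.comp r h2
  rw [mul_comm] at this
  exact this

theorem hasDerivAt_modeSeries_angular {A : ℕ → ℝ} (hA : Summable (fun n => |A n| * seriesWeight n))
    {R : ℕ → ℝ} {Θ Θ' : ℕ → ℝ → ℝ} {h : ℝ}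
    (hd : ∀ n ξ, HasDerivAt (Θ n) (Θ' n ξ) ξ) (hR : ∀ n, |R n| ≤ modeBound n * h)
    (hΘ : ∀ n, ∀ ξ ∈ Icc (-1 : ℝ) 1, |Θ n ξ| ≤ ((n : ℝ) + 4) ^ 4)
    (hΘ' : ∀ n, ∀ ξ ∈ Icc (-1 : ℝ) 1, |Θ' n ξ| ≤ ((n : ℝ) + 4) ^ 4)
    {ξ : ℝ} (hξ : ξ ∈ Ioo (-1 : ℝ) 1) :
    HasDerivAt (fun ξ => ∑' n, A n * R n * Θ n ξ) (∑' n, A n * R n * Θ' n ξ) ξ := by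
  refine hasDerivAt_tsum_of_isPreconnected (hA.mul_right h) isOpen_Ioo isPreconnected_Ioo
    (g' := fun n ξ => A n * R n * Θ' n ξ) (fun n ξ _ => (hd n ξ).const_mul _) ?_ hξ
    (summable_modeSeries hA hR (fun n => hΘ n ξ (Ioo_subset_Icc_self hξ))) hξ
  intro n ξ hξ
  rw [Real.norm_eq_abs, abs_mul, abs_mul]
  have h0 : 0 ≤ modeBound n * h := (abs_nonneg _).trans (hR n)
  calc _ ≤ |A n| * (modeBound n * h) * ((n : ℝ) + 4) ^ 4 := by
        gcongr
        · exact hR n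
        · exact hΘ' n ξ (Ioo_subset_Icc_self hξ)
    _ = _ := by unfold seriesWeight; ring

theorem tendsto_modeSeries {A : ℕ → ℝ} (hA : Summable (fun n => |A n| * seriesWeight n))
    {R : ℕ → ℝ → ℝ} {c Θ : ℕ → ℝ}
    (hR : ∀ n x, 0 ≤ x → |R n x| ≤ modeBound n) (hΘ : ∀ n, |Θ n| ≤ ((n : ℝ) + 4) ^ 4)
    (hlim : ∀ n, Tendsto (R n) atTop (𝓝 (c n))) :
    Tendsto (fun x => ∑' n, A n * R n x * Θ n) atTop (𝓝 (∑' n, A n * c n * Θ n)) := by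
  refine tendsto_tsum_of_dominated_convergence hA
    (fun n => ((hlim n).const_mul (A n)).mul_const (Θ n)) ?_
  filter_upwards [eventually_ge_atTop 0] with x hx n
  rw [Real.norm_eq_abs, abs_mul, abs_mul]
  calc _ ≤ |A n| * modeBound n * ((n : ℝ) + 4) ^ 4 := by
        have := modeBound_pos n
        gcongr
        · exact hR n x hx
        · exact hΘ n
    _ = _ := by unfold seriesWeight; ring

theorem integral_modeSeries_mul {A : ℕ → ℝ} (hA : Summable (fun n => |A n| * seriesWeight n))
    {c : ℕ → ℝ} {Θ : ℕ → ℝ → ℝ} {g : ℝ → ℝ}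
    (hc : ∀ n, |c n| ≤ modeBound n)
    (hΘ : ∀ n, ∀ ξ ∈ Icc (-1 : ℝ) 1, |Θ n ξ| ≤ ((n : ℝ) + 4) ^ 4)
    (hΘc : ∀ n, Continuous (Θ n)) (hg : Continuous g) :
    ∫ ξ in (-1 : ℝ)..1, (∑' n, A n * c n * Θ n ξ) * g ξ
      = ∑' n, A n * c n * ∫ ξ in (-1 : ℝ)..1, Θ n ξ * g ξ := by
  obtain ⟨C, hC⟩ := isCompact_Icc.exists_bound_of_continuousOn (s := Icc (-1 : ℝ) 1)
    (hg.continuousOn)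
  have key := intervalIntegral.hasSum_integral_of_dominated_convergence (μ := MeasureTheory.volume)
    (a := -1) (b := 1) (F := fun n ξ => A n * c n * Θ n ξ * g ξ)
    (f := fun ξ => (∑' n, A n * c n * Θ n ξ) * g ξ)
    (fun n _ => |A n| * seriesWeight n * C) ?_ ?_ ?_ ?_ ?_
  · rw [← key.tsum_eq]
    congr 1; ext n
    rw [← intervalIntegral.integral_const_mul]
    congr 1; ext ξ; ring
  · intro n
    exact (((hΘc n).const_smul (A n * c n)).mul hg).aestronglyMeasurable
  · intro n
    refine MeasureTheory.ae_of_all _ fun ξ hξ => ?_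
    rw [uIoc_of_le (by norm_num)] at hξ
    have hξ' : ξ ∈ Icc (-1 : ℝ) 1 := ⟨hξ.1.le, hξ.2⟩
    rw [norm_mul, Real.norm_eq_abs, abs_mul, abs_mul]
    calc _ ≤ |A n| * modeBound n * ((n : ℝ) + 4) ^ 4 * C := by
          have := modeBound_pos n
          gcongr
          · exact hc n
          · exact hΘ n ξ hξ'
          · exact hC ξ hξ'
      _ = _ := by unfold seriesWeight; ring
  · exact MeasureTheory.ae_of_all _ fun ξ _ => hA.mul_right C
  · exact intervalIntegrable_const
  · refine MeasureTheory.ae_of_all _ fun ξ hξ => ?_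
    rw [uIoc_of_le (by norm_num)] at hξ
    have hξ' : ξ ∈ Icc (-1 : ℝ) 1 := ⟨hξ.1.le, hξ.2⟩
    exact (summable_modeSeries hA (h := 1) (by simpa using hc)
      (fun n => hΘ n ξ hξ')).hasSum.mul_right (g ξ)

theorem continuousOn_modeSeries {A : ℕ → ℝ} (hA : Summable (fun n => |A n| * seriesWeight n))
    {R : ℕ → ℝ} {Θ : ℕ → ℝ → ℝ} {h : ℝ} (hR : ∀ n, |R n| ≤ modeBound n * h)
    (hΘ : ∀ n, ∀ ξ ∈ Icc (-1 : ℝ) 1, |Θ n ξ| ≤ ((n : ℝ) + 4) ^ 4)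
    (hΘc : ∀ n, Continuous (Θ n)) :
    ContinuousOn (fun ξ => ∑' n, A n * R n * Θ n ξ) (Icc (-1) 1) := by
  refine continuousOn_tsum (fun n => (continuous_const.mul (hΘc n)).continuousOn)
    (hA.mul_right h) fun n ξ hξ => ?_
  rw [Real.norm_eq_abs, abs_mul, abs_mul]
  have h0 : 0 ≤ modeBound n * h := (abs_nonneg _).trans (hR n)
  calc _ ≤ |A n| * (modeBound n * h) * ((n : ℝ) + 4) ^ 4 := by
        gcongr
        · exact hR n
        · exact hΘ n ξ hξ
    _ = _ := by unfold seriesWeight; ring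

theorem le_pow_four (n : ℕ) : (1 : ℝ) ≤ ((n : ℝ) + 4) ^ 4 :=
  one_le_pow₀ (by have : (0 : ℝ) ≤ n := by positivity
                  linarith)

theorem abs_legendre_le (n : ℕ) (ξ : ℝ) (hξ : ξ ∈ Icc (-1 : ℝ) 1) :
    |(legendrePoly (n + 1)).eval ξ| ≤ ((n : ℝ) + 4) ^ 4 :=
  (abs_legendrePoly_eval_le _ ξ hξ).trans (le_pow_four n)

open Polynomial in
theorem abs_legendre_deriv_le (n : ℕ) (ξ : ℝ) (hξ : ξ ∈ Icc (-1 : ℝ) 1) :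
    |(derivative (legendrePoly (n + 1))).eval ξ| ≤ ((n : ℝ) + 4) ^ 4 := by
  refine (abs_derivative_legendrePoly_eval_le _ ξ hξ).trans ?_
  have hn : (0 : ℝ) ≤ n := by positivity
  push_cast
  calc ((n : ℝ) + 1 + 1) ^ 2 ≤ ((n : ℝ) + 4) ^ 2 :=
        pow_le_pow_left₀ (by positivity) (by linarith) _
    _ ≤ _ := pow_le_pow_right₀ (by linarith) (by norm_num)

open Polynomial in
theorem abs_legendre_deriv_deriv_le (n : ℕ) (ξ : ℝ) (hξ : ξ ∈ Icc (-1 : ℝ) 1) :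
    |(derivative (derivative (legendrePoly (n + 1)))).eval ξ| ≤ ((n : ℝ) + 4) ^ 4 := by
  refine (abs_derivative_derivative_legendrePoly_eval_le _ ξ hξ).trans ?_
  have hn : (0 : ℝ) ≤ n := by positivity
  push_cast
  exact pow_le_pow_left₀ (by positivity) (by linarith) _

/-! ### The explicit gauge fields -/

/-- The electric coefficients in units of the AdS radius. -/
noncomputable def elCoeff (ℓ : ℝ) (ρ : ℕ → ℝ) (n : ℕ) : ℝ := ρ (n + 1) * ℓ ^ (n + 1)

/-- The magnetic coefficients in units of the AdS radius. -/
noncomputable def magCoeff (ℓ : ℝ) (σ : ℕ → ℝ) (n : ℕ) : ℝ := σ (n + 2) * ℓ ^ (n + 2)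

/-- The reduced magnetic series, `f` in `ω = √(1-ξ²) f`. -/
noncomputable def fSeries (ℓ : ℝ) (σ : ℕ → ℝ) (r ξ : ℝ) : ℝ :=
  1 + ∑' n, magCoeff ℓ σ n * magMode n (r / ℓ)
    * (Polynomial.derivative (legendrePoly (n + 1))).eval ξ

/-- The boundary value of `fSeries` at infinity. -/
noncomputable def fInfSeries (ℓ : ℝ) (σ : ℕ → ℝ) (ξ : ℝ) : ℝ :=
  1 + ∑' n, magCoeff ℓ σ n * coeffW (n + 2)
    * (Polynomial.derivative (legendrePoly (n + 1))).eval ξ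

theorem alphaSeries_eq {ℓ : ℝ} (hℓ : 0 < ℓ) (ρ : ℕ → ℝ) (r ξ : ℝ) :
    alphaSeries ℓ ρ r ξ
      = ∑' n, elCoeff ℓ ρ n * elMode n (r / ℓ) * (legendrePoly (n + 1)).eval ξ := by
  unfold alphaSeries elCoeff
  simp_rw [alphaTerm_eq hℓ]

theorem omegaSeries_eq {ℓ : ℝ} (hℓ : 0 < ℓ) (σ : ℕ → ℝ) (r ξ : ℝ) :
    omegaSeries ℓ σ r ξ = Real.sqrt (1 - ξ ^ 2) * fSeries ℓ σ r ξ := by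
  unfold omegaSeries fSeries magCoeff
  simp_rw [omegaTerm_eq hℓ, tsum_mul_left]
  ring

theorem aTerm_eq (ℓ : ℝ) (ρ : ℕ → ℝ) (n : ℕ) (ξ : ℝ) : aTerm ℓ ρ (n + 1) ξ
    = ℓ * (elCoeff ℓ ρ n * coeffA (n + 1) * (legendrePoly (n + 1)).eval ξ) := by
  unfold aTerm elCoeff legendre0; ring

theorem aSeries_eq (ℓ : ℝ) (ρ : ℕ → ℝ) (ξ : ℝ) : aSeries ℓ ρ ξ
    = ℓ * ∑' n, elCoeff ℓ ρ n * coeffA (n + 1) * (legendrePoly (n + 1)).eval ξ := by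
  unfold aSeries
  simp_rw [aTerm_eq, tsum_mul_left]

theorem wTerm_eq (ℓ : ℝ) (σ : ℕ → ℝ) (n : ℕ) (ξ : ℝ) : wTerm ℓ σ (n + 2) ξ
    = Real.sqrt (1 - ξ ^ 2) * (magCoeff ℓ σ n * coeffW (n + 2)
      * (Polynomial.derivative (legendrePoly (n + 1))).eval ξ) := by
  unfold wTerm magCoeff legendre1
  simp only [show n + 2 - 1 = n + 1 from rfl]
  ring

theorem wSeries_eq (ℓ : ℝ) (σ : ℕ → ℝ) (ξ : ℝ) :
    wSeries ℓ σ ξ = Real.sqrt (1 - ξ ^ 2) * fInfSeries ℓ σ ξ := by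
  unfold wSeries fInfSeries
  simp_rw [wTerm_eq, tsum_mul_left]
  ring

section Radial

variable {ℓ : ℝ} {ρ σ : ℕ → ℝ}

theorem hasDerivAt_alphaSeries_radial (hℓ : 0 < ℓ)
    (hA : Summable (fun n => |elCoeff ℓ ρ n| * seriesWeight n)) {r ξ : ℝ} (hr : 0 < r)
    (hξ : ξ ∈ Icc (-1 : ℝ) 1) :
    HasDerivAt (fun r => alphaSeries ℓ ρ r ξ)
      (1 / ℓ * ∑' n, elCoeff ℓ ρ n * elModeDeriv n (r / ℓ) * (legendrePoly (n + 1)).eval ξ) r := by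
  simp_rw [alphaSeries_eq hℓ]
  refine hasDerivAt_modeSeries_radial hA hasDerivAt_elMode (fun n x hx => ?_) (fun n x hx => ?_)
    (fun n => abs_legendre_le n ξ hξ) hℓ hr
  · exact (abs_elMode_le n x hx).trans
      (mul_le_of_le_one_right (modeBound_pos n).le (div_one_add_le_one hx))
  · exact (abs_elModeDeriv_le n x hx).trans
      (mul_le_of_le_one_right (modeBound_pos n).le (one_div_one_add_sq_le_one hx))

theorem tendsto_alphaSeries_deriv (hℓ : 0 < ℓ)
    (hA : Summable (fun n => |elCoeff ℓ ρ n| * seriesWeight n)) {ξ : ℝ}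
    (hξ : ξ ∈ Icc (-1 : ℝ) 1) :
    Tendsto (fun r => -(r ^ 2 * dr (alphaSeries ℓ ρ) r ξ)) atTop (𝓝 (aSeries ℓ ρ ξ)) := by
  have h := tendsto_modeSeries hA (R := fun n x => x ^ 2 * elModeDeriv n x)
    (Θ := fun n => (legendrePoly (n + 1)).eval ξ) abs_sq_mul_elModeDeriv_le
    (fun n => abs_legendre_le n ξ hξ) tendsto_sq_mul_elModeDeriv
  have h2 : Tendsto (fun r : ℝ => r / ℓ) atTop atTop := tendsto_id.atTop_div_const hℓ
  have h3 := ((h.comp h2).const_mul ℓ).neg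
  have e : -(ℓ * ∑' n, elCoeff ℓ ρ n * -coeffA (n + 1) * (legendrePoly (n + 1)).eval ξ)
      = aSeries ℓ ρ ξ := by
    rw [aSeries_eq, ← mul_neg, ← tsum_neg]
    congr 2; ext n; ring
  rw [e] at h3
  refine h3.congr' ?_
  filter_upwards [eventually_gt_atTop 0] with r hr
  have hd : dr (alphaSeries ℓ ρ) r ξ = _ := (hasDerivAt_alphaSeries_radial hℓ hA hr hξ).deriv
  rw [hd]
  simp only [Function.comp]
  rw [neg_inj, ← mul_assoc, ← tsum_mul_left, ← tsum_mul_left]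
  congr 1; ext n
  field_simp

theorem tendsto_omegaSeries (hℓ : 0 < ℓ)
    (hA : Summable (fun n => |magCoeff ℓ σ n| * seriesWeight n)) {ξ : ℝ}
    (hξ : ξ ∈ Icc (-1 : ℝ) 1) :
    Tendsto (fun r => omegaSeries ℓ σ r ξ) atTop (𝓝 (wSeries ℓ σ ξ)) := by
  have h := tendsto_modeSeries hA (R := magMode)
    (Θ := fun n => (Polynomial.derivative (legendrePoly (n + 1))).eval ξ)
    (fun n x hx => (abs_magMode_le n x hx).trans (mul_le_of_le_one_right (modeBound_pos n).le
      (pow_le_one₀ (by positivity) (div_one_add_le_one hx))))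
    (fun n => abs_legendre_deriv_le n ξ hξ) tendsto_magMode
  have h2 : Tendsto (fun r : ℝ => r / ℓ) atTop atTop := tendsto_id.atTop_div_const hℓ
  simp_rw [omegaSeries_eq hℓ, wSeries_eq]
  exact ((h.comp h2).const_add 1).const_mul _

theorem rho_eq_integral (hℓ : 0 < ℓ)
    (hA : Summable (fun n => |elCoeff ℓ ρ n| * seriesWeight n)) (k : ℕ) (hk : 1 ≤ k) :
    ρ k = (2 * (k : ℝ) + 1) / (2 * coeffA k * ℓ ^ (k + 1)) *
        ∫ ξ in (-1 : ℝ)..1, aSeries ℓ ρ ξ * legendre0 k ξ := by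
  obtain ⟨k, rfl⟩ : ∃ j, k = j + 1 := ⟨k - 1, by omega⟩
  have h := integral_modeSeries_mul hA (c := fun n => coeffA (n + 1))
    (Θ := fun n => legendre0 (n + 1)) (g := legendre0 (k + 1)) abs_coeffA_le
    (fun n ξ hξ => abs_legendre_le n ξ hξ) (fun n => legendre0_continuous _)
    (legendre0_continuous _)
  simp_rw [integral_legendre0_mul] at h
  rw [tsum_eq_single k (by intro n hn; simp [hn])] at h
  have e : ∀ ξ, aSeries ℓ ρ ξ * legendre0 (k + 1) ξ
      = ℓ * ((∑' n, elCoeff ℓ ρ n * coeffA (n + 1) * legendre0 (n + 1) ξ) * legendre0 (k + 1) ξ) := by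
    intro ξ; rw [aSeries_eq]; unfold legendre0; ring
  simp_rw [e]
  rw [intervalIntegral.integral_const_mul, h]
  have := coeffA_ne_zero k
  have h2 : (2 * ((k + 1 : ℕ) : ℝ) + 1) ≠ 0 := by positivity
  simp only [if_true]
  unfold elCoeff
  field_simp
  ring

theorem abs_fInfSeries_le (hA : Summable (fun n => |magCoeff ℓ σ n| * seriesWeight n)) {ξ : ℝ}
    (hξ : ξ ∈ Icc (-1 : ℝ) 1) :
    |fInfSeries ℓ σ ξ - 1| ≤ ∑' n, |magCoeff ℓ σ n| * seriesWeight n := by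
  have := abs_modeSeries_le hA (R := fun n => coeffW (n + 2)) (h := 1)
    (Θ := fun n => (Polynomial.derivative (legendrePoly (n + 1))).eval ξ)
    (by simpa using abs_coeffW_le) (fun n => abs_legendre_deriv_le n ξ hξ)
  unfold fInfSeries
  simpa using this

open Polynomial in
/-- Inversion of the magnetic series. The summand `√(1-ξ²)` of `ω_∞` is the Legendre function
`legendre1 1`, whence the correction at `k = 2`. -/
theorem sigma_eq_integral (hℓ : 0 < ℓ)
    (hA : Summable (fun n => |magCoeff ℓ σ n| * seriesWeight n)) (k : ℕ) (hk : 2 ≤ k) :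
    σ k = (2 * (k : ℝ) - 1) / (2 * (k : ℝ) * ((k : ℝ) - 1) * coeffW k * ℓ ^ k) *
          (∫ ξ in (-1 : ℝ)..1, wSeries ℓ σ ξ * legendre1 (k - 1) ξ)
        - (if k = 2 then 1 / (3 * ℓ ^ 2) else 0) := by
  obtain ⟨k, rfl⟩ : ∃ j, k = j + 2 := ⟨k - 2, by omega⟩
  simp only [show k + 2 - 1 = k + 1 from rfl]
  have hgc : Continuous (fun ξ => Real.sqrt (1 - ξ ^ 2) * legendre1 (k + 1) ξ) := by
    have := legendre1_continuous (k + 1)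
    fun_prop
  have hP : ∀ n : ℕ, Continuous (fun ξ => (derivative (legendrePoly (n + 1))).eval ξ) :=
    fun n => (derivative (legendrePoly (n + 1))).continuous
  have h := integral_modeSeries_mul hA (c := fun n => coeffW (n + 2))
    (Θ := fun n ξ => (derivative (legendrePoly (n + 1))).eval ξ) abs_coeffW_le
    abs_legendre_deriv_le hP hgc
  have e1 : ∀ n : ℕ, ∀ ξ : ℝ, (derivative (legendrePoly (n + 1))).eval ξ
      * (Real.sqrt (1 - ξ ^ 2) * legendre1 (k + 1) ξ) = legendre1 (n + 1) ξ * legendre1 (k + 1) ξ := by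
    intro n ξ; unfold legendre1; ring
  simp_rw [e1, integral_legendre1_mul] at h
  rw [tsum_eq_single k (by intro n hn; simp [hn])] at h
  have e2 : ∀ ξ, wSeries ℓ σ ξ * legendre1 (k + 1) ξ = legendre1 1 ξ * legendre1 (k + 1) ξ
      + (∑' n, magCoeff ℓ σ n * coeffW (n + 2) * (derivative (legendrePoly (n + 1))).eval ξ)
        * (Real.sqrt (1 - ξ ^ 2) * legendre1 (k + 1) ξ) := by
    intro ξ
    rw [wSeries_eq]; unfold fInfSeries legendre1
    simp [legendrePoly_one]
    ring
  simp_rw [e2]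
  rw [intervalIntegral.integral_add, h, integral_legendre1_mul]
  · have h1 := (coeffW_pos (k + 1)).ne'
    have h2 : (2 * ((k + 1 : ℕ) : ℝ) + 1) ≠ 0 := by positivity
    have h3 : (k : ℝ) + 1 ≠ 0 := by positivity
    have h4 : (k : ℝ) + 2 ≠ 0 := by positivity
    rw [show k + 1 + 1 = k + 2 from rfl] at h1
    rcases Nat.eq_zero_or_pos k with rfl | hk0
    · simp only [if_true, magCoeff, coeffW_two, zero_add]
      push_cast
      field_simp
      ring
    · have hne : ¬ (1 = k + 1) := by omega
      have hne' : ¬ (k + 2 = 2) := by omega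
      simp only [if_true, hne, hne', if_false, magCoeff, zero_add, sub_zero]
      push_cast at h2 ⊢
      have h5 : (2 * ((k : ℝ) + 2) - 1) = 2 * ((k : ℝ) + 1) + 1 := by ring
      have h6 : (k : ℝ) + 2 - 1 = k + 1 := by ring
      rw [h5, h6]
      field_simp
      ring
  · exact ((legendre1_continuous 1).mul (legendre1_continuous (k + 1))).intervalIntegrable _ _
  · apply ContinuousOn.intervalIntegrable
    rw [uIcc_of_le (by norm_num)]
    refine ContinuousOn.mul ?_ hgc.continuousOn
    exact continuousOn_modeSeries hA (h := 1) (by simpa using abs_coeffW_le)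
      abs_legendre_deriv_le hP

theorem summable_elCoeff_mul_seriesWeight {B θ : ℝ} (hℓ : 0 < ℓ) (hθ : 0 ≤ θ) (hlt : θ * ℓ < 1 / 2)
    (ha : ∀ k, |ρ k| ≤ B * θ ^ k) : Summable (fun n => |elCoeff ℓ ρ n| * seriesWeight n) :=
  summable_coeff_mul_seriesWeight hℓ hθ hlt ha 1

theorem summable_magCoeff_mul_seriesWeight {B θ : ℝ} (hℓ : 0 < ℓ) (hθ : 0 ≤ θ) (hlt : θ * ℓ < 1 / 2)
    (ha : ∀ k, |σ k| ≤ B * θ ^ k) : Summable (fun n => |magCoeff ℓ σ n| * seriesWeight n) :=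
  summable_coeff_mul_seriesWeight hℓ hθ hlt ha 2

end Radial

/-- Convergence of the explicit gauge fields, their boundary functions, and the inversion of the
Legendre series of the latter. -/
theorem explicit_gauge_fields {ℓ : ℝ} (hℓ : 0 < ℓ) {ρ σ : ℕ → ℝ} (hρ : Admissible ℓ ρ)
    (hσ : Admissible ℓ σ) :
    (∀ ξ ∈ Icc (-1 : ℝ) 1,
        (∀ r, 0 ≤ r → Summable (fun k : ℕ => alphaTerm ℓ ρ (k + 1) r ξ) ∧
          Summable (fun k : ℕ => omegaTerm ℓ σ (k + 2) r ξ)) ∧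
        Summable (fun k : ℕ => aTerm ℓ ρ (k + 1) ξ) ∧
        Summable (fun k : ℕ => wTerm ℓ σ (k + 2) ξ) ∧
        (∀ r, 0 < r → DifferentiableAt ℝ (fun r' => alphaSeries ℓ ρ r' ξ) r) ∧
        Tendsto (fun r => -(r ^ 2 * dr (alphaSeries ℓ ρ) r ξ)) atTop (𝓝 (aSeries ℓ ρ ξ)) ∧
        Tendsto (fun r => omegaSeries ℓ σ r ξ) atTop (𝓝 (wSeries ℓ σ ξ))) ∧
      (∀ k : ℕ, 1 ≤ k → ρ k = (2 * (k : ℝ) + 1) / (2 * coeffA k * ℓ ^ (k + 1)) *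
        ∫ ξ in (-1 : ℝ)..1, aSeries ℓ ρ ξ * legendre0 k ξ) ∧
      (∀ k : ℕ, 2 ≤ k → σ k = (2 * (k : ℝ) - 1) /
          (2 * (k : ℝ) * ((k : ℝ) - 1) * coeffW k * ℓ ^ k) *
          (∫ ξ in (-1 : ℝ)..1, wSeries ℓ σ ξ * legendre1 (k - 1) ξ)
        - (if k = 2 then 1 / (3 * ℓ ^ 2) else 0)) := by
  obtain ⟨B₁, θ₁, h₁, hlt₁, hρ⟩ := hρ
  obtain ⟨B₂, θ₂, h₂, hlt₂, hσ⟩ := hσ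
  rw [lt_div_iff₀ (by positivity)] at hlt₁ hlt₂
  have hA := summable_elCoeff_mul_seriesWeight hℓ h₁ (by linarith) hρ
  have hW := summable_magCoeff_mul_seriesWeight hℓ h₂ (by linarith) hσ
  refine ⟨fun ξ hξ => ⟨fun r hr => ⟨?_, ?_⟩, ?_, ?_, fun r hr =>
      (hasDerivAt_alphaSeries_radial hℓ hA hr hξ).differentiableAt,
      tendsto_alphaSeries_deriv hℓ hA hξ, tendsto_omegaSeries hℓ hW hξ⟩,
    rho_eq_integral hℓ hA, sigma_eq_integral hℓ hW⟩
  · simp_rw [alphaTerm_eq hℓ]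
    exact summable_modeSeries hA (fun n => abs_elMode_le n _ (by positivity))
      (fun n => abs_legendre_le n ξ hξ)
  · simp_rw [omegaTerm_eq hℓ]
    exact (summable_modeSeries hW (fun n => abs_magMode_le n _ (by positivity))
      (fun n => abs_legendre_deriv_le n ξ hξ)).mul_left _
  · simp_rw [aTerm_eq]
    exact (summable_modeSeries hA (h := 1) (by simpa using abs_coeffA_le)
      (fun n => abs_legendre_le n ξ hξ)).mul_left _
  · simp_rw [wTerm_eq]
    exact (summable_modeSeries hW (h := 1) (by simpa using abs_coeffW_le)
      (fun n => abs_legendre_deriv_le n ξ hξ)).mul_left _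

/-! ### The Einstein equations as differential equations for the metric functions -/

/-- The weight `r / (1 + r/ℓ)²` that bounds the gauge field derivatives in units adapted to the
energy. -/
noncomputable def kap (ℓ r : ℝ) : ℝ := r / (1 + r / ℓ) ^ 2

/-- The metric function of pure AdS space, `1 + r²/ℓ²`. -/
noncomputable def pAds (ℓ r : ℝ) : ℝ := 1 + (r / ℓ) ^ 2

/-- The primitive of `kap ℓ ^ 2` that vanishes at the origin. -/
noncomputable def kapPrim (ℓ r : ℝ) : ℝ := (r / (1 + r / ℓ)) ^ 3 / 3

theorem hasDerivAt_div_one_add {ℓ r : ℝ} (hℓ : 0 < ℓ) (hr : 0 < r) :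
    HasDerivAt (fun r => r / (1 + r / ℓ)) (1 / (1 + r / ℓ) ^ 2) r := by
  have h1 : (0 : ℝ) < 1 + r / ℓ := by positivity
  refine ((hasDerivAt_id r).div (((hasDerivAt_id r).div_const ℓ).const_add 1)
    (by simpa using h1.ne')).congr_deriv ?_
  simp
  field_simp
  ring

theorem hasDerivAt_kapPrim {ℓ r : ℝ} (hℓ : 0 < ℓ) (hr : 0 < r) :
    HasDerivAt (kapPrim ℓ) (kap ℓ r ^ 2) r := by
  have h1 : (0 : ℝ) < 1 + r / ℓ := by positivity
  refine (((hasDerivAt_div_one_add hℓ hr).pow 3).div_const 3).congr_deriv ?_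
  unfold kap
  push_cast
  field_simp

theorem div_one_add_le_self {ℓ r : ℝ} (hℓ : 0 < ℓ) (hr : 0 < r) : r / (1 + r / ℓ) ≤ r :=
  div_le_self hr.le (by have : 0 < r / ℓ := by positivity
                        linarith)

theorem div_one_add_le_radius {ℓ r : ℝ} (hℓ : 0 < ℓ) (hr : 0 < r) : r / (1 + r / ℓ) ≤ ℓ := by
  rw [div_le_iff₀ (by positivity), mul_add, mul_div_cancel₀ _ hℓ.ne']; linarith

theorem kapPrim_nonneg {ℓ r : ℝ} (hℓ : 0 < ℓ) (hr : 0 < r) : 0 ≤ kapPrim ℓ r := by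
  unfold kapPrim; positivity

theorem kapPrim_le_cube {ℓ r : ℝ} (hℓ : 0 < ℓ) (hr : 0 < r) : kapPrim ℓ r ≤ ℓ ^ 3 := by
  have h1 := div_one_add_le_radius hℓ hr
  have h0 : 0 ≤ r / (1 + r / ℓ) := by positivity
  have := pow_le_pow_left₀ h0 h1 3
  unfold kapPrim
  have : 0 < ℓ ^ 3 := by positivity
  linarith

theorem kapPrim_le_sq_mul {ℓ r : ℝ} (hℓ : 0 < ℓ) (hr : 0 < r) : kapPrim ℓ r ≤ ℓ ^ 2 * r / 3 := by
  have h1 := div_one_add_le_radius hℓ hr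
  have h2 := div_one_add_le_self hℓ hr
  have h0 : 0 ≤ r / (1 + r / ℓ) := by positivity
  unfold kapPrim
  have : (r / (1 + r / ℓ)) ^ 3 ≤ ℓ ^ 2 * r := by
    calc _ = (r / (1 + r / ℓ)) ^ 2 * (r / (1 + r / ℓ)) := by ring
      _ ≤ _ := by gcongr
  linarith

theorem kapPrim_le_mul_sq {ℓ r : ℝ} (hℓ : 0 < ℓ) (hr : 0 < r) : kapPrim ℓ r ≤ ℓ * r ^ 2 := by
  have h1 := div_one_add_le_radius hℓ hr
  have h2 := div_one_add_le_self hℓ hr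
  have h0 : 0 ≤ r / (1 + r / ℓ) := by positivity
  unfold kapPrim
  have : (r / (1 + r / ℓ)) ^ 3 ≤ ℓ * r ^ 2 := by
    calc _ = (r / (1 + r / ℓ)) * (r / (1 + r / ℓ)) ^ 2 := by ring
      _ ≤ _ := by gcongr
  have : 0 ≤ ℓ * r ^ 2 := by positivity
  linarith

theorem one_le_pAds (ℓ r : ℝ) : 1 ≤ pAds ℓ r := by
  unfold pAds; nlinarith [sq_nonneg (r / ℓ)]

theorem pAds_pos (ℓ r : ℝ) : 0 < pAds ℓ r := lt_of_lt_of_le one_pos (one_le_pAds ℓ r)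

/-- The metric functions of `F` solve the Einstein equations on `r > 0`, with regular centre and
`S → 1` at infinity. -/
structure MetricRegular (C ℓ : ℝ) (F : Fields) : Prop where
  m_diff : ∀ r, 0 < r → DifferentiableAt ℝ F.m r
  S_diff : ∀ r, 0 < r → DifferentiableAt ℝ F.S r
  S_low : ∀ r, 0 < r → C⁻¹ ≤ F.S r
  μ_pos : ∀ r, 0 < r → 0 < F.μ ℓ r
  einstein : ∀ r, 0 < r → F.EinsteinAt ℓ r
  m_zero : F.m =O[𝓝[>] 0] fun r => r ^ 3
  S_lim : Tendsto F.S atTop (𝓝 1)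

/-- The four sources of the Einstein equations, in normalized form, are at most `K kap²`. -/
structure GaugeBounds (K ℓ : ℝ) (F : Fields) : Prop where
  η_le : ∀ r, 0 < r → r ^ 2 * F.η r ≤ K * kap ℓ r ^ 2
  ζ_le : ∀ r, 0 < r → F.ζ r / pAds ℓ r ≤ K * kap ℓ r ^ 2
  G_le : ∀ r, 0 < r → pAds ℓ r * F.G r ≤ K * kap ℓ r ^ 2
  P_le : ∀ r, 0 < r → F.P r / r ^ 2 ≤ K * kap ℓ r ^ 2

namespace Fields

variable (F : Fields) (r : ℝ)

theorem η_nonneg : 0 ≤ F.η r :=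
  mul_nonneg (by norm_num)
    (intervalIntegral.integral_nonneg (by norm_num) fun _ _ => sq_nonneg _)

theorem ζ_nonneg : 0 ≤ F.ζ r :=
  mul_nonneg (by norm_num)
    (intervalIntegral.integral_nonneg (by norm_num) fun _ _ =>
      mul_nonneg (sq_nonneg _) (sq_nonneg _))

theorem G_nonneg : 0 ≤ F.G r :=
  mul_nonneg (by norm_num)
    (intervalIntegral.integral_nonneg (by norm_num) fun _ _ => sq_nonneg _)

theorem P_nonneg : 0 ≤ F.P r :=
  mul_nonneg (by norm_num)
    (intervalIntegral.integral_nonneg (by norm_num) fun _ _ => sq_nonneg _)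

end Fields

theorem deriv_m_nonneg {F : Fields} {ℓ r : ℝ} (hμ : 0 < F.μ ℓ r) (hE : F.EinsteinAt ℓ r) :
    0 ≤ deriv F.m r := by
  rw [hE.1]
  have h1 := F.η_nonneg r
  have h2 := F.ζ_nonneg r
  have h3 := F.G_nonneg r
  have h4 := F.P_nonneg r
  positivity

theorem tendsto_zero_of_isBigO_pow {f : ℝ → ℝ} {n : ℕ} (hn : n ≠ 0)
    (h : f =O[𝓝[>] 0] fun r => r ^ n) : Tendsto f (𝓝[>] 0) (𝓝 0) := by
  refine h.trans_tendsto ?_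
  have : Tendsto (fun r : ℝ => r ^ n) (𝓝 0) (𝓝 (0 ^ n)) := (continuous_pow n).tendsto 0
  rw [zero_pow hn] at this
  exact this.mono_left nhdsWithin_le_nhds

/-- Continuity argument: a bound that holds near `0` and that improves itself holds everywhere. -/
theorem bootstrap {h : ℝ → ℝ} {c : ℝ} (hc : ContinuousOn h (Ioi 0)) (h0 : ∀ᶠ r in 𝓝[>] 0, h r < c)
    (step : ∀ R, 0 < R → (∀ r, 0 < r → r ≤ R → h r ≤ c) → h R < c) (r : ℝ) (hr : 0 < r) :
    h r < c := by
  by_contra! hcon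
  obtain ⟨δ, hδ, hδ'⟩ := mem_nhdsGT_iff_exists_Ioo_subset.1 h0
  set A : Set ℝ := {s | s ∈ Icc (min δ r) r ∧ c ≤ h s} with hA
  have hδ0 : 0 < min δ r := lt_min hδ hr
  have hcl : IsClosed A := by
    have : ContinuousOn h (Icc (min δ r) r) := hc.mono fun s hs => hδ0.trans_le hs.1
    exact this.preimage_isClosed_of_isClosed isClosed_Icc isClosed_Ici
  have hne : A.Nonempty := ⟨r, ⟨min_le_right _ _, le_rfl⟩, hcon⟩
  have hbd : BddBelow A := ⟨min δ r, fun s hs => hs.1.1⟩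
  have hs := hcl.csInf_mem hne hbd
  set s := sInf A
  have hs0 : 0 < s := hδ0.trans_le hs.1.1
  have hlt : ∀ t, 0 < t → t < s → h t < c := by
    intro t ht hts
    by_contra! hct
    rcases lt_or_ge t (min δ r) with h1 | h1
    · exact absurd (hδ' ⟨ht, h1.trans_le (min_le_left _ _)⟩) (not_lt.2 hct)
    · exact absurd (csInf_le hbd ⟨⟨h1, hts.le.trans hs.1.2⟩, hct⟩) (not_le.2 hts)
  have hle : h s ≤ c := by
    have hcont : Tendsto h (𝓝[<] s) (𝓝 (h s)) :=
      (hc.continuousAt (Ioi_mem_nhds hs0)).mono_left nhdsWithin_le_nhds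
    refine le_of_tendsto hcont ?_
    filter_upwards [Ioo_mem_nhdsLT hs0] with t ht using (hlt t ht.1 ht.2).le
  refine absurd (step s hs0 fun t ht hts => ?_) (not_lt.2 hs.2)
  rcases eq_or_lt_of_le hts with rfl | h1
  · exact hle
  · exact (hlt t ht h1).le

theorem abs_sub_le_of_abs_deriv_le {f g f' g' : ℝ → ℝ} {a b : ℝ} (ha : 0 < a) (hab : a ≤ b)
    (hf : ∀ r, 0 < r → HasDerivAt f (f' r) r) (hg : ∀ r, 0 < r → HasDerivAt g (g' r) r)
    (h : ∀ r, 0 < r → r ≤ b → |f' r| ≤ g' r) : |f b - f a| ≤ g b - g a := by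
  have mono : ∀ s : ℝ, |s| ≤ 1 → g a - s * f a ≤ g b - s * f b := by
    intro s hs
    have hd : ∀ r ∈ Icc a b, HasDerivAt (fun r => g r - s * f r) (g' r - s * f' r) r :=
      fun r hr => (hg r (ha.trans_le hr.1)).sub ((hf r (ha.trans_le hr.1)).const_mul s)
    refine (monotoneOn_of_deriv_nonneg (convex_Icc a b)
      (fun r hr => (hd r hr).continuousAt.continuousWithinAt)
      (fun r hr => (hd r (interior_subset hr)).differentiableAt.differentiableWithinAt) ?_)
      (left_mem_Icc.2 hab) (right_mem_Icc.2 hab) hab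
    intro r hr
    have hr' := interior_subset hr
    rw [(hd r hr').deriv]
    have h1 := h r (ha.trans_le hr'.1) hr'.2
    have h2 : s * f' r ≤ |f' r| := by
      calc s * f' r ≤ |s * f' r| := le_abs_self _
        _ = |s| * |f' r| := abs_mul _ _
        _ ≤ _ := mul_le_of_le_one_left (abs_nonneg _) hs
    linarith
  have h1 := mono 1 (by simp)
  have h2 := mono (-1) (by simp)
  rw [abs_le]; constructor <;> linarith

namespace MetricRegular

variable {C ℓ : ℝ} {F : Fields}

theorem one_le (h : MetricRegular C ℓ F) (hC : 0 < C) : 1 ≤ C := by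
  have : C⁻¹ ≤ 1 := ge_of_tendsto h.S_lim (by
    filter_upwards [eventually_gt_atTop 0] with r hr using h.S_low r hr)
  exact (inv_le_one₀ hC).1 this

theorem S_pos (h : MetricRegular C ℓ F) (hC : 0 < C) {r : ℝ} (hr : 0 < r) : 0 < F.S r :=
  (inv_pos.2 hC).trans_le (h.S_low r hr)

theorem S_le_one (h : MetricRegular C ℓ F) (hC : 0 < C) {r : ℝ} (hr : 0 < r) : F.S r ≤ 1 := by
  have hmono : MonotoneOn F.S (Ioi 0) := by
    refine monotoneOn_of_deriv_nonneg (convex_Ioi 0)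
      (fun r hr => (h.S_diff r hr).continuousAt.continuousWithinAt)
      (fun r hr => (h.S_diff r (interior_subset hr)).differentiableWithinAt) fun r hr => ?_
    have hr' : 0 < r := interior_subset hr
    have hS := h.S_pos hC hr'
    have h2 := (h.einstein r hr').2
    rw [div_eq_iff hS.ne'] at h2
    rw [h2]
    have h1 := F.G_nonneg r
    have h3 := F.ζ_nonneg r
    positivity
  refine ge_of_tendsto h.S_lim ?_
  filter_upwards [eventually_ge_atTop r] with s hs
  exact hmono hr (lt_of_lt_of_le hr hs) hs

theorem monotoneOn_m (h : MetricRegular C ℓ F) : MonotoneOn F.m (Ioi 0) :=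
  monotoneOn_of_deriv_nonneg (convex_Ioi 0)
    (fun r hr => (h.m_diff r hr).continuousAt.continuousWithinAt)
    (fun r hr => (h.m_diff r (interior_subset hr)).differentiableWithinAt) fun r hr =>
    deriv_m_nonneg (h.μ_pos r (interior_subset hr)) (h.einstein r (interior_subset hr))

theorem m_nonneg (h : MetricRegular C ℓ F) {r : ℝ} (hr : 0 < r) : 0 ≤ F.m r := by
  refine le_of_tendsto (tendsto_zero_of_isBigO_pow (by norm_num) h.m_zero) ?_
  filter_upwards [Ioo_mem_nhdsGT hr] with s hs
  exact h.monotoneOn_m hs.1 hr hs.2.le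

theorem μ_le (h : MetricRegular C ℓ F) {r : ℝ} (hr : 0 < r) : F.μ ℓ r ≤ pAds ℓ r := by
  have := h.m_nonneg hr
  unfold Fields.μ pAds
  rw [div_pow]
  have : 0 ≤ 2 * F.m r / r := by positivity
  linarith

/-- As long as `μ` is comparable to its value `pAds` in pure AdS space, `m'` is bounded by the
sources. -/
theorem deriv_m_le (h : MetricRegular C ℓ F) {K : ℝ} (hb : GaugeBounds K ℓ F) (hC : 0 < C)
    (hK : 0 ≤ K) {r : ℝ} (hr : 0 < r) (hμ : pAds ℓ r / 2 ≤ F.μ ℓ r) :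
    deriv F.m r ≤ 5 * K * C ^ 2 * kap ℓ r ^ 2 := by
  have hC1 := h.one_le hC
  have hS := h.S_pos hC hr
  have hs : 1 / F.S r ^ 2 ≤ C ^ 2 := by
    rw [one_div, ← inv_pow]
    exact pow_le_pow_left₀ (by positivity) (inv_le_of_inv_le₀ hC (h.S_low r hr)) 2
  have hp := pAds_pos ℓ r
  have hμ0 := h.μ_pos r hr
  have h1 := F.η_nonneg r
  have h2 := F.ζ_nonneg r
  have h3 := F.G_nonneg r
  have b1 := hb.η_le r hr
  have b2 := hb.ζ_le r hr
  have b3 := hb.G_le r hr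
  have b4 := hb.P_le r hr
  set X := K * kap ℓ r ^ 2 with hX
  have hX0 : 0 ≤ X := by positivity
  have t1 : r ^ 2 * F.η r / (4 * F.S r ^ 2) ≤ X * C ^ 2 / 4 := by
    calc _ = (r ^ 2 * F.η r) * (1 / F.S r ^ 2) / 4 := by field_simp
      _ ≤ _ := by gcongr
  have t2 : F.ζ r / (4 * F.μ ℓ r * F.S r ^ 2) ≤ X * C ^ 2 / 2 := by
    calc _ = F.ζ r / F.μ ℓ r * (1 / F.S r ^ 2) / 4 := by field_simp
      _ ≤ (F.ζ r / (pAds ℓ r / 2)) * C ^ 2 / 4 := by gcongr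
      _ = (F.ζ r / pAds ℓ r) * C ^ 2 / 2 := by field_simp; ring
      _ ≤ _ := by gcongr
  have t3 : F.μ ℓ r * F.G r ≤ X := (mul_le_mul_of_nonneg_right (h.μ_le hr) h3).trans b3
  rw [(h.einstein r hr).1]
  have : X ≤ X * C ^ 2 := le_mul_of_one_le_right hX0 (one_le_pow₀ hC1)
  calc _ ≤ 3 / 2 * (X * C ^ 2 / 4 + X * C ^ 2 / 2 + X + X) := by gcongr
    _ ≤ 5 * (X * C ^ 2) := by nlinarith
    _ = _ := by rw [hX]; ring

theorem m_le_of_bound (h : MetricRegular C ℓ F) {A R : ℝ} (hℓ : 0 < ℓ) (hA : 0 ≤ A) (hR : 0 < R)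
    (hd : ∀ r, 0 < r → r ≤ R → deriv F.m r ≤ A * kap ℓ r ^ 2) : F.m R ≤ A * kapPrim ℓ R := by
  have key : ∀ a ∈ Ioo 0 R, F.m R - F.m a ≤ A * kapPrim ℓ R := by
    intro a ha
    have h1 := abs_sub_le_of_abs_deriv_le (f := F.m) (g := fun r => A * kapPrim ℓ r) ha.1 ha.2.le
      (fun r hr => (h.m_diff r hr).hasDerivAt)
      (fun r hr => (hasDerivAt_kapPrim hℓ hr).const_mul A)
      (fun r hr hrR => by
        rw [abs_of_nonneg (deriv_m_nonneg (h.μ_pos r hr) (h.einstein r hr))]; exact hd r hr hrR)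
    have h2 := kapPrim_nonneg hℓ ha.1
    have h3 := (le_abs_self _).trans h1
    have : 0 ≤ A * kapPrim ℓ a := by positivity
    linarith
  have hlim := (tendsto_zero_of_isBigO_pow (by norm_num) h.m_zero).const_sub (F.m R)
  rw [sub_zero] at hlim
  refine le_of_tendsto hlim ?_
  filter_upwards [Ioo_mem_nhdsGT hR] with a ha using key a ha

/-- For small `ℓ` the geometry stays close to pure AdS space: `2m/r` cannot reach `1/2`, because as
long as it does not, the Einstein equation makes it `O(ℓ²)`. -/
theorem half_pAds_le_μ (h : MetricRegular C ℓ F) {K : ℝ} (hb : GaugeBounds K ℓ F) (hC : 0 < C)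
    (hK : 0 ≤ K) (hℓ : 0 < ℓ) (hsmall : 5 * K * C ^ 2 * ℓ ^ 2 ≤ 1 / 2) {r : ℝ} (hr : 0 < r) :
    pAds ℓ r / 2 ≤ F.μ ℓ r := by
  have hμ : ∀ r, 2 * F.m r / r ≤ 1 / 2 → pAds ℓ r / 2 ≤ F.μ ℓ r := by
    intro r hr
    unfold Fields.μ pAds
    rw [div_pow]
    have : 0 ≤ r ^ 2 / ℓ ^ 2 := by positivity
    linarith
  refine hμ r (le_of_lt (bootstrap (h := fun r => 2 * F.m r / r) ?_ ?_ ?_ r hr))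
  · intro r hr
    have h1 := (h.m_diff r hr).continuousAt
    exact ((h1.const_mul 2).div continuousAt_id (ne_of_gt hr)).continuousWithinAt
  · have h1 : (fun r => 2 * F.m r / r) =O[𝓝[>] 0] fun r => r ^ 2 := by
      have := (h.m_zero.const_mul_left 2).mul (isBigO_refl (fun r : ℝ => r⁻¹) (𝓝[>] 0))
      refine this.trans_eventuallyEq ?_
      filter_upwards [self_mem_nhdsWithin] with r hr
      have : r ≠ 0 := ne_of_gt hr
      field_simp
    exact (tendsto_zero_of_isBigO_pow (by norm_num) h1).eventually (gt_mem_nhds (by norm_num))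
  · intro R hR hle
    have h1 := h.m_le_of_bound (A := 5 * K * C ^ 2) hℓ (by positivity) hR
      fun r hr hrR => h.deriv_m_le hb hC hK hr (hμ r (hle r hr hrR))
    have h2 := kapPrim_le_sq_mul hℓ hR
    have h3 : F.m R ≤ 1 / 6 * R := by
      calc F.m R ≤ _ := h1
        _ ≤ 5 * K * C ^ 2 * (ℓ ^ 2 * R / 3) := by gcongr
        _ = (5 * K * C ^ 2 * ℓ ^ 2) * R / 3 := by ring
        _ ≤ 1 / 2 * R / 3 := by gcongr
        _ = _ := by ring
    rw [div_lt_iff₀ hR]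
    linarith

theorem m_le (h : MetricRegular C ℓ F) {K : ℝ} (hb : GaugeBounds K ℓ F) (hC : 0 < C)
    (hK : 0 ≤ K) (hℓ : 0 < ℓ) (hsmall : 5 * K * C ^ 2 * ℓ ^ 2 ≤ 1 / 2) {r : ℝ} (hr : 0 < r) :
    F.m r ≤ 5 * K * C ^ 2 * kapPrim ℓ r :=
  h.m_le_of_bound hℓ (by positivity) hr
    fun _ hr _ => h.deriv_m_le hb hC hK hr (h.half_pAds_le_μ hb hC hK hℓ hsmall hr)

theorem mass_bounds (h : MetricRegular C ℓ F) {K M : ℝ} (hb : GaugeBounds K ℓ F) (hC : 0 < C)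
    (hK : 0 ≤ K) (hℓ : 0 < ℓ) (hsmall : 5 * K * C ^ 2 * ℓ ^ 2 ≤ 1 / 2)
    (hM : Tendsto F.m atTop (𝓝 M)) : 0 ≤ M ∧ M ≤ 5 * K * C ^ 2 * ℓ ^ 3 := by
  constructor
  · refine ge_of_tendsto hM ?_
    filter_upwards [eventually_gt_atTop 0] with r hr using h.m_nonneg hr
  · refine le_of_tendsto hM ?_
    filter_upwards [eventually_gt_atTop 0] with r hr
    exact (h.m_le hb hC hK hℓ hsmall hr).trans
      (mul_le_mul_of_nonneg_left (kapPrim_le_cube hℓ hr) (by positivity))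

end MetricRegular

/-! ### The metric is determined by the sources -/

theorem abs_mul_sub_mul_le {a b a' b' α β α' β' : ℝ} (h1 : |a - a'| ≤ α) (h2 : |b| ≤ β)
    (h3 : |a'| ≤ α') (h4 : |b - b'| ≤ β') : |a * b - a' * b'| ≤ α * β + α' * β' := by
  have e : a * b - a' * b' = (a - a') * b + a' * (b - b') := by ring
  rw [e]
  refine (abs_add_le _ _).trans (add_le_add ?_ ?_)
  · rw [abs_mul]
    exact mul_le_mul h1 h2 (abs_nonneg _) ((abs_nonneg _).trans h1)
  · rw [abs_mul]
    exact mul_le_mul h3 h4 (abs_nonneg _) ((abs_nonneg _).trans h3)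

theorem abs_sq_le {a α : ℝ} (h : |a| ≤ α) : |a ^ 2| ≤ α ^ 2 := by
  rw [abs_pow]; exact pow_le_pow_left₀ (abs_nonneg _) h 2

/-- Lipschitz dependence of the right-hand sides of the Einstein equations on the normalized sources
`e, z, g, q` and on the metric through `s = 1/S`, `n = p/μ`, `u = μ/p`. -/
theorem source_difference {L X T k e₁ e₂ z₁ z₂ g₁ g₂ q₁ q₂ s₁ s₂ n₁ n₂ u₁ u₂ : ℝ} (hL : 1 ≤ L)
    (hX : 0 ≤ X) (hT : 0 ≤ T) (hk : 0 ≤ k) (he : |e₁ - e₂| ≤ X) (hz : |z₁ - z₂| ≤ X)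
    (hg : |g₁ - g₂| ≤ X) (hq : |q₁ - q₂| ≤ X) (he₂ : |e₂| ≤ L * k) (hz₂ : |z₂| ≤ L * k)
    (hg₂ : |g₂| ≤ L * k) (hs₁ : |s₁| ≤ L) (hs₂ : |s₂| ≤ L) (hs : |s₁ - s₂| ≤ L ^ 2 * T)
    (hn₁ : |n₁| ≤ 2) (hn₂ : |n₂| ≤ 2) (hn : |n₁ - n₂| ≤ 8 * T) (hu₁ : |u₁| ≤ 1)
    (hu : |u₁ - u₂| ≤ 2 * T) :
    |3 / 2 * (e₁ * s₁ ^ 2 / 4 + z₁ * (n₁ * s₁ ^ 2) / 4 + u₁ * g₁ + q₁)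
      - 3 / 2 * (e₂ * s₂ ^ 2 / 4 + z₂ * (n₂ * s₂ ^ 2) / 4 + u₂ * g₂ + q₂)|
        ≤ 12 * L ^ 4 * (X + T * k) ∧
    |(g₁ + z₁ * (n₁ ^ 2 * s₁ ^ 2) / 4) - (g₂ + z₂ * (n₂ ^ 2 * s₂ ^ 2) / 4)|
        ≤ 12 * L ^ 4 * (X + T * k) := by
  have hs2 : |s₁ ^ 2 - s₂ ^ 2| ≤ 2 * L ^ 3 * T := by
    rw [sq, sq]
    refine (abs_mul_sub_mul_le hs hs₁ hs₂ hs).trans (le_of_eq (by ring))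
  have hn2 : |n₁ ^ 2 - n₂ ^ 2| ≤ 32 * T := by
    rw [sq, sq]
    refine (abs_mul_sub_mul_le hn hn₁ hn₂ hn).trans (le_of_eq (by ring))
  have hs1 := abs_sq_le hs₁
  have hn1 := abs_sq_le hn₁
  have hn2' := abs_sq_le hn₂
  have a1 := abs_mul_sub_mul_le he hs1 he₂ hs2
  have a2 := abs_mul_sub_mul_le hn hs1 hn₂ hs2
  have a3 := abs_mul_sub_mul_le hn2 hs1 hn2' hs2
  have b1 : |n₁ * s₁ ^ 2| ≤ 2 * L ^ 2 := by
    rw [abs_mul]; exact mul_le_mul hn₁ hs1 (abs_nonneg _) (by norm_num)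
  have b2 : |n₁ ^ 2 * s₁ ^ 2| ≤ 2 ^ 2 * L ^ 2 := by
    rw [abs_mul]; exact mul_le_mul hn1 hs1 (abs_nonneg _) (by norm_num)
  have c1 := abs_mul_sub_mul_le hz b1 hz₂ a2
  have c2 := abs_mul_sub_mul_le hz b2 hz₂ a3
  have c3 := abs_mul_sub_mul_le (a := g₁) (b := u₁) (a' := g₂) (b' := u₂) hg hu₁ hg₂ hu
  have hTk : 0 ≤ T * k := by positivity
  have L1 : L ≤ L ^ 4 := le_self_pow₀ hL (by norm_num)
  have L2 : L ^ 2 ≤ L ^ 4 := pow_le_pow_right₀ hL (by norm_num)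
  have L3 : L ^ 3 ≤ L ^ 4 := pow_le_pow_right₀ hL (by norm_num)
  have L0 : 1 ≤ L ^ 4 := one_le_pow₀ hL
  have x0 : X ≤ L ^ 4 * X := le_mul_of_one_le_left hX L0
  have x2 : L ^ 2 * X ≤ L ^ 4 * X := mul_le_mul_of_nonneg_right L2 hX
  have t1 : L * (T * k) ≤ L ^ 4 * (T * k) := mul_le_mul_of_nonneg_right L1 hTk
  have t3 : L ^ 3 * (T * k) ≤ L ^ 4 * (T * k) := mul_le_mul_of_nonneg_right L3 hTk
  rw [abs_le] at a1 c1 c2 c3 hq hg ⊢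
  rw [abs_le]
  refine ⟨⟨?_, ?_⟩, ⟨?_, ?_⟩⟩ <;> linarith

theorem abs_sub_le_abs_log_sub {a b : ℝ} (ha : 0 < a) (hb : 0 < b) (ha1 : a ≤ 1) (hb1 : b ≤ 1) :
    |a - b| ≤ |Real.log a - Real.log b| := by
  wlog h : b ≤ a generalizing a b
  · rw [abs_sub_comm, abs_sub_comm (Real.log a)]
    exact this hb ha hb1 ha1 (le_of_not_ge h)
  have h1 : Real.log b ≤ Real.log a := Real.log_le_log hb h
  rw [abs_of_nonneg (by linarith), abs_of_nonneg (by linarith)]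
  have h2 := Real.log_le_sub_one_of_pos (div_pos hb ha)
  rw [Real.log_div hb.ne' ha.ne'] at h2
  have h3 : a - b ≤ 1 - b / a := by
    rw [← sub_nonneg]
    have : 1 - b / a - (a - b) = (a - b) * (1 - a) / a := by field_simp
    rw [this]
    have : 0 ≤ (a - b) * (1 - a) := mul_nonneg (by linarith) (by linarith)
    positivity
  linarith

/-- `F₁` and `F₂` have sources whose differences are controlled by the growth of a bounded increasing
function `J`: `|difference| ≤ √(kap² J')`, stated with a free parameter `lam` in the
arithmetic-geometric mean inequality. -/
structure SourceDifference (A ℓ T : ℝ) (J J' : ℝ → ℝ) (F₁ F₂ : Fields) : Prop where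
  deriv : ∀ r, 0 < r → HasDerivAt J (J' r) r
  deriv_nonneg : ∀ r, 0 < r → 0 ≤ J' r
  nonneg : ∀ r, 0 < r → 0 ≤ J r
  le : ∀ r, 0 < r → J r ≤ A * T ^ 2 * ℓ ^ 3
  η_le : ∀ r, 0 < r → ∀ lam, 0 < lam →
    |r ^ 2 * F₁.η r - r ^ 2 * F₂.η r| ≤ A * (lam * kap ℓ r ^ 2 + J' r / lam)
  ζ_le : ∀ r, 0 < r → ∀ lam, 0 < lam →
    |F₁.ζ r / pAds ℓ r - F₂.ζ r / pAds ℓ r| ≤ A * (lam * kap ℓ r ^ 2 + J' r / lam)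
  G_le : ∀ r, 0 < r → ∀ lam, 0 < lam →
    |pAds ℓ r * F₁.G r - pAds ℓ r * F₂.G r| ≤ A * (lam * kap ℓ r ^ 2 + J' r / lam)
  P_le : ∀ r, 0 < r → ∀ lam, 0 < lam →
    |F₁.P r / r ^ 2 - F₂.P r / r ^ 2| ≤ A * (lam * kap ℓ r ^ 2 + J' r / lam)

/-- The standing assumptions on one solution: the metric solves the Einstein equations, the sources
are bounded, and `ℓ` is small. -/
structure NearVacuum (L ℓ : ℝ) (F : Fields) : Prop where
  metric : MetricRegular L ℓ F
  gauge : GaugeBounds L ℓ F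
  small : 5 * L * L ^ 2 * ℓ ^ 2 ≤ 1 / 2

/-- The coefficients `1/S`, `p/μ`, `μ/p` of the Einstein equations are Lipschitz in the metric. -/
theorem difference_metric_coeffs {L ℓ T r : ℝ} (hL : 0 < L) (hℓ : 0 < ℓ) {F₁ F₂ : Fields}
    (h₁ : NearVacuum L ℓ F₁) (h₂ : NearVacuum L ℓ F₂) (hr : 0 < r)
    (hm : |F₁.m r - F₂.m r| ≤ T * r) (hS : |F₁.S r - F₂.S r| ≤ T) :
    |1 / F₁.S r - 1 / F₂.S r| ≤ L ^ 2 * T ∧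
    |pAds ℓ r / F₁.μ ℓ r - pAds ℓ r / F₂.μ ℓ r| ≤ 8 * T ∧
    |F₁.μ ℓ r / pAds ℓ r - F₂.μ ℓ r / pAds ℓ r| ≤ 2 * T := by
  have hT : 0 ≤ T := (abs_nonneg _).trans hS
  have s1 := h₁.metric.S_pos hL hr
  have s2 := h₂.metric.S_pos hL hr
  have i1 : 1 / F₁.S r ≤ L := by
    rw [one_div]; exact inv_le_of_inv_le₀ hL (h₁.metric.S_low r hr)
  have i2 : 1 / F₂.S r ≤ L := by
    rw [one_div]; exact inv_le_of_inv_le₀ hL (h₂.metric.S_low r hr)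
  have u1 := h₁.metric.half_pAds_le_μ h₁.gauge hL hL.le hℓ h₁.small hr
  have u2 := h₂.metric.half_pAds_le_μ h₂.gauge hL hL.le hℓ h₂.small hr
  have p1 := one_le_pAds ℓ r
  have p0 := pAds_pos ℓ r
  have m1 := h₁.metric.μ_pos r hr
  have m2 := h₂.metric.μ_pos r hr
  have hμ : |F₁.μ ℓ r - F₂.μ ℓ r| ≤ 2 * T := by
    have : F₁.μ ℓ r - F₂.μ ℓ r = -(2 * (F₁.m r - F₂.m r) / r) := by unfold Fields.μ; ring
    rw [this, abs_neg, abs_div, abs_mul, abs_of_pos hr, div_le_iff₀ hr, abs_of_pos two_pos]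
    linarith
  have n1 : pAds ℓ r / F₁.μ ℓ r ≤ 2 := by rw [div_le_iff₀ m1]; linarith
  have n2 : pAds ℓ r / F₂.μ ℓ r ≤ 2 := by rw [div_le_iff₀ m2]; linarith
  refine ⟨?_, ?_, ?_⟩
  · have : 1 / F₁.S r - 1 / F₂.S r = (1 / F₁.S r) * (1 / F₂.S r) * (F₂.S r - F₁.S r) := by
      field_simp
    rw [this, abs_mul, abs_sub_comm (F₂.S r), abs_of_pos (by positivity)]
    calc _ ≤ L * L * T := by gcongr
      _ = _ := by ring
  · have : pAds ℓ r / F₁.μ ℓ r - pAds ℓ r / F₂.μ ℓ r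
        = (pAds ℓ r / F₁.μ ℓ r) * (pAds ℓ r / F₂.μ ℓ r) * ((F₂.μ ℓ r - F₁.μ ℓ r) / pAds ℓ r) := by
      field_simp
    rw [this, abs_mul, abs_div, abs_sub_comm (F₂.μ ℓ r), abs_of_pos (by positivity), abs_of_pos p0]
    calc _ ≤ 2 * 2 * ((2 * T) / 1) := by gcongr
      _ = _ := by ring
  · rw [← sub_div, abs_div, abs_of_pos p0, div_le_iff₀ p0]
    nlinarith

/-- The Einstein right-hand sides differ by little when the metrics and the sources do. -/
theorem difference_einstein {L A ℓ T : ℝ} (hL : 1 ≤ L) (hA : 0 ≤ A) (hℓ : 0 < ℓ) {F₁ F₂ : Fields}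
    {J J' : ℝ → ℝ} (h₁ : NearVacuum L ℓ F₁) (h₂ : NearVacuum L ℓ F₂)
    (hJ : SourceDifference A ℓ T J J' F₁ F₂) {r lam : ℝ} (hr : 0 < r) (hlam : 0 < lam)
    (hm : |F₁.m r - F₂.m r| ≤ T * r) (hS : |F₁.S r - F₂.S r| ≤ T) :
    |deriv F₁.m r - deriv F₂.m r|
      ≤ 12 * L ^ 4 * (A * (lam * kap ℓ r ^ 2 + J' r / lam) + T * kap ℓ r ^ 2) ∧
    |deriv F₁.S r / F₁.S r - deriv F₂.S r / F₂.S r|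
      ≤ 2 / (r * pAds ℓ r)
        * (12 * L ^ 4 * (A * (lam * kap ℓ r ^ 2 + J' r / lam) + T * kap ℓ r ^ 2)) := by
  have hL0 : 0 < L := by linarith
  have hT : 0 ≤ T := (abs_nonneg _).trans hS
  obtain ⟨hs, hn, hu⟩ := difference_metric_coeffs hL0 hℓ h₁ h₂ hr hm hS
  have hJ0 := hJ.deriv_nonneg r hr
  have s1 := h₁.metric.S_pos hL0 hr
  have s2 := h₂.metric.S_pos hL0 hr
  have i1 : |1 / F₁.S r| ≤ L := by
    rw [abs_of_pos (by positivity), one_div]; exact inv_le_of_inv_le₀ hL0 (h₁.metric.S_low r hr)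
  have i2 : |1 / F₂.S r| ≤ L := by
    rw [abs_of_pos (by positivity), one_div]; exact inv_le_of_inv_le₀ hL0 (h₂.metric.S_low r hr)
  have v1 := h₁.metric.half_pAds_le_μ h₁.gauge hL0 hL0.le hℓ h₁.small hr
  have v2 := h₂.metric.half_pAds_le_μ h₂.gauge hL0 hL0.le hℓ h₂.small hr
  have p0 := pAds_pos ℓ r
  have m1 := h₁.metric.μ_pos r hr
  have m2 := h₂.metric.μ_pos r hr
  have n1 : |pAds ℓ r / F₁.μ ℓ r| ≤ 2 := by
    rw [abs_of_pos (by positivity), div_le_iff₀ m1]; linarith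
  have n2 : |pAds ℓ r / F₂.μ ℓ r| ≤ 2 := by
    rw [abs_of_pos (by positivity), div_le_iff₀ m2]; linarith
  have w1 : |F₁.μ ℓ r / pAds ℓ r| ≤ 1 := by
    rw [abs_of_pos (by positivity), div_le_one p0]; exact h₁.metric.μ_le hr
  have e2 : |r ^ 2 * F₂.η r| ≤ L * kap ℓ r ^ 2 := by
    rw [abs_of_nonneg (mul_nonneg (sq_nonneg r) (F₂.η_nonneg r))]; exact h₂.gauge.η_le r hr
  have z2 : |F₂.ζ r / pAds ℓ r| ≤ L * kap ℓ r ^ 2 := by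
    rw [abs_of_nonneg (div_nonneg (F₂.ζ_nonneg r) p0.le)]; exact h₂.gauge.ζ_le r hr
  have g2 : |pAds ℓ r * F₂.G r| ≤ L * kap ℓ r ^ 2 := by
    rw [abs_of_nonneg (mul_nonneg p0.le (F₂.G_nonneg r))]; exact h₂.gauge.G_le r hr
  have key := source_difference hL (X := A * (lam * kap ℓ r ^ 2 + J' r / lam)) (by positivity) hT
    (sq_nonneg (kap ℓ r)) (hJ.η_le r hr lam hlam) (hJ.ζ_le r hr lam hlam) (hJ.G_le r hr lam hlam)
    (hJ.P_le r hr lam hlam) e2 z2 g2 i1 i2 hs n1 n2 hn w1 hu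
  constructor
  · refine le_trans (le_of_eq ?_) key.1
    rw [(h₁.metric.einstein r hr).1, (h₂.metric.einstein r hr).1]
    congr 1
    field_simp
  · have e : deriv F₁.S r / F₁.S r - deriv F₂.S r / F₂.S r = 2 / (r * pAds ℓ r) *
        ((pAds ℓ r * F₁.G r + F₁.ζ r / pAds ℓ r * ((pAds ℓ r / F₁.μ ℓ r) ^ 2 * (1 / F₁.S r) ^ 2) / 4)
        - (pAds ℓ r * F₂.G r + F₂.ζ r / pAds ℓ r * ((pAds ℓ r / F₂.μ ℓ r) ^ 2 * (1 / F₂.S r) ^ 2) / 4)) := by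
      rw [(h₁.metric.einstein r hr).2, (h₂.metric.einstein r hr).2]
      field_simp
    rw [e, abs_mul, abs_of_pos (by positivity)]
    exact mul_le_mul_of_nonneg_left key.2 (by positivity)

/-- If the metrics differ by at most `T`, and the sources accordingly, then the metrics differ by at
most `O(ℓ²) T`. -/
theorem metric_difference {L A ℓ T : ℝ} (hL : 1 ≤ L) (hA : 0 ≤ A) (hℓ : 0 < ℓ) {F₁ F₂ : Fields}
    {J J' : ℝ → ℝ} (h₁ : NearVacuum L ℓ F₁) (h₂ : NearVacuum L ℓ F₂) (hT : 0 < T)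
    (hJ : SourceDifference A ℓ T J J' F₁ F₂)
    (hm : ∀ r, 0 < r → |F₁.m r - F₂.m r| ≤ T * r) (hS : ∀ r, 0 < r → |F₁.S r - F₂.S r| ≤ T)
    {r : ℝ} (hr : 0 < r) :
    |F₁.m r - F₂.m r| ≤ 24 * L ^ 4 * (A ^ 2 + A + 1) * ℓ ^ 2 * T * r ∧
    |F₁.S r - F₂.S r| ≤ 24 * L ^ 4 * (A ^ 2 + A + 1) * ℓ ^ 2 * T := by
  have hL0 : 0 < L := by linarith
  constructor
  -- integrate from the centre, where `m` vanishes; this `lam` balances `lam * kapPrim` and `J / lam`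
  · set lam := T * ℓ / r with hlam
    have hlam0 : 0 < lam := by positivity
    have key : ∀ a ∈ Ioo 0 r, |(F₁.m r - F₂.m r) - (F₁.m a - F₂.m a)|
        ≤ 24 * L ^ 4 * (A ^ 2 + A + 1) * ℓ ^ 2 * T * r := by
      intro a ha
      have := abs_sub_le_of_abs_deriv_le (f := fun r => F₁.m r - F₂.m r)
        (g := fun r => 12 * L ^ 4 * (A * (lam * kapPrim ℓ r + J r / lam) + T * kapPrim ℓ r))
        ha.1 ha.2.le
        (fun r hr => (h₁.metric.m_diff r hr).hasDerivAt.sub (h₂.metric.m_diff r hr).hasDerivAt)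
        (fun r hr => (((((hasDerivAt_kapPrim hℓ hr).const_mul lam).add
          ((hJ.deriv r hr).div_const lam)).const_mul A).add
          ((hasDerivAt_kapPrim hℓ hr).const_mul T)).const_mul _)
        (fun r hr _ => (difference_einstein hL hA hℓ h₁ h₂ hJ hr hlam0 (hm r hr) (hS r hr)).1)
      refine this.trans ?_
      have q0 := kapPrim_nonneg hℓ ha.1
      have j0 := hJ.nonneg a ha.1
      have jr := hJ.le r hr
      have k1 := kapPrim_le_sq_mul hℓ hr
      have k2 := kapPrim_le_mul_sq hℓ hr
      have b0 : 0 ≤ 12 * L ^ 4 * (A * (lam * kapPrim ℓ a + J a / lam) + T * kapPrim ℓ a) := by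
        positivity
      have c1 : lam * kapPrim ℓ r ≤ ℓ ^ 2 * T * r := by
        calc _ ≤ lam * (ℓ * r ^ 2) := by gcongr
          _ = _ := by rw [hlam]; field_simp
      have c2 : J r / lam ≤ A * (ℓ ^ 2 * T * r) := by
        calc _ ≤ A * T ^ 2 * ℓ ^ 3 / lam := by gcongr
          _ = _ := by rw [hlam]; field_simp
      have c3 : T * kapPrim ℓ r ≤ ℓ ^ 2 * T * r := by
        have : T * kapPrim ℓ r ≤ T * (ℓ ^ 2 * r / 3) := by gcongr
        have h5 : 0 ≤ T * ℓ ^ 2 * r := by positivity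
        nlinarith
      have c4 : 12 * L ^ 4 * (A * (lam * kapPrim ℓ r + J r / lam) + T * kapPrim ℓ r)
          ≤ 12 * L ^ 4 * (A * (ℓ ^ 2 * T * r + A * (ℓ ^ 2 * T * r)) + ℓ ^ 2 * T * r) := by
        gcongr
      have c5 : 0 ≤ L ^ 4 * (A ^ 2 + A + 1) * (ℓ ^ 2 * T * r) := by positivity
      nlinarith
    have hlim : Tendsto (fun a => |(F₁.m r - F₂.m r) - (F₁.m a - F₂.m a)|) (𝓝[>] 0)
        (𝓝 |(F₁.m r - F₂.m r) - (0 - 0)|) :=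
      (((tendsto_zero_of_isBigO_pow (by norm_num) h₁.metric.m_zero).sub
        (tendsto_zero_of_isBigO_pow (by norm_num) h₂.metric.m_zero)).const_sub _).abs
    rw [sub_zero, sub_zero] at hlim
    refine le_of_tendsto hlim ?_
    filter_upwards [Ioo_mem_nhdsGT hr] with a ha using key a ha
  -- integrate `(log S)'` to infinity, where `S` tends to `1`; the weight at radius `r` is `lam / r`
  · have s1 := fun r (hr : 0 < r) => h₁.metric.S_pos hL0 hr
    have s2 := fun r (hr : 0 < r) => h₂.metric.S_pos hL0 hr
    refine (abs_sub_le_abs_log_sub (s1 r hr) (s2 r hr) (h₁.metric.S_le_one hL0 hr)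
      (h₂.metric.S_le_one hL0 hr)).trans ?_
    set lam := T * ℓ with hlam
    have hlam0 : 0 < lam := by positivity
    have key : ∀ b, r ≤ b → |(Real.log (F₁.S b) - Real.log (F₂.S b))
        - (Real.log (F₁.S r) - Real.log (F₂.S r))|
        ≤ 24 * L ^ 4 * (A ^ 2 + A + 1) * ℓ ^ 2 * T := by
      intro b hb
      have hb0 : 0 < b := hr.trans_le hb
      have := abs_sub_le_of_abs_deriv_le
        (f := fun r => Real.log (F₁.S r) - Real.log (F₂.S r))
        (g := fun r => 24 * L ^ 4 * ((A * lam + T * ℓ) * (r / (1 + r / ℓ)) + A * (J r / lam)))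
        (g' := fun r => 24 * L ^ 4 * ((A * lam + T * ℓ) * (1 / (1 + r / ℓ) ^ 2) + A * (J' r / lam)))
        hr hb
        (fun r hr => ((h₁.metric.S_diff r hr).hasDerivAt.log (s1 r hr).ne').sub
          ((h₂.metric.S_diff r hr).hasDerivAt.log (s2 r hr).ne'))
        (fun r hr => ((((hasDerivAt_div_one_add hℓ hr).const_mul _)).add
          (((hJ.deriv r hr).div_const lam).const_mul A)).const_mul _) ?_
      · refine this.trans ?_
        have j0 := hJ.nonneg r hr
        have jb := hJ.le b hb0
        have k1 := div_one_add_le_radius hℓ hb0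
        have b0 : 0 ≤ 24 * L ^ 4 * ((A * lam + T * ℓ) * (r / (1 + r / ℓ)) + A * (J r / lam)) := by
          positivity
        have c2 : J b / lam ≤ A * (ℓ ^ 2 * T) := by
          calc _ ≤ A * T ^ 2 * ℓ ^ 3 / lam := by gcongr
            _ = _ := by rw [hlam]; field_simp
        have c4 : 24 * L ^ 4 * ((A * lam + T * ℓ) * (b / (1 + b / ℓ)) + A * (J b / lam))
            ≤ 24 * L ^ 4 * ((A * lam + T * ℓ) * ℓ + A * (A * (ℓ ^ 2 * T))) := by
          gcongr
        refine (sub_le_self _ b0).trans (c4.trans (le_of_eq ?_))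
        rw [hlam]; ring
      · intro r hr _
        have hlr : 0 < lam / r := by positivity
        refine (difference_einstein hL hA hℓ h₁ h₂ hJ hr hlr (hm r hr) (hS r hr)).2.trans ?_
        have hJ0 := hJ.deriv_nonneg r hr
        have p1 := one_le_pAds ℓ r
        have hx : 0 < 1 + r / ℓ := by positivity
        have hx1 : 1 ≤ 1 + r / ℓ := by have : 0 < r / ℓ := by positivity
                                       linarith
        have d1 : kap ℓ r ^ 2 ≤ r ^ 2 * (1 / (1 + r / ℓ) ^ 2) := by
          unfold kap
          rw [div_pow, mul_one_div]
          gcongr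
          exact le_self_pow₀ hx1 (by norm_num)
        have d2 : kap ℓ r ^ 2 ≤ ℓ * r * (1 / (1 + r / ℓ) ^ 2) := by
          have := div_one_add_le_radius hℓ hr
          have e : kap ℓ r ^ 2 = (r / (1 + r / ℓ)) * (r / (1 + r / ℓ)) * (1 / (1 + r / ℓ) ^ 2) := by
            unfold kap; field_simp
          rw [e]
          have := div_one_add_le_self hℓ hr
          gcongr
        have e0 : 2 / (r * pAds ℓ r) ≤ 2 / r := by
          gcongr; exact le_mul_of_one_le_right hr.le p1
        calc _ ≤ 2 / r * (12 * L ^ 4 * (A * (lam / r * kap ℓ r ^ 2 + J' r / (lam / r))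
                + T * kap ℓ r ^ 2)) := by
              gcongr
          _ ≤ 2 / r * (12 * L ^ 4 * (A * (lam / r * (r ^ 2 * (1 / (1 + r / ℓ) ^ 2))
                + J' r / (lam / r)) + T * (ℓ * r * (1 / (1 + r / ℓ) ^ 2)))) := by
              gcongr
          _ = _ := by field_simp; ring
    have hlim : Tendsto (fun b => |(Real.log (F₁.S b) - Real.log (F₂.S b))
        - (Real.log (F₁.S r) - Real.log (F₂.S r))|) atTop
        (𝓝 |(Real.log 1 - Real.log 1) - (Real.log (F₁.S r) - Real.log (F₂.S r))|) :=
      (((h₁.metric.S_lim.log one_ne_zero).sub (h₂.metric.S_lim.log one_ne_zero)).sub_const _).abs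
    rw [sub_self, zero_sub, abs_neg] at hlim
    refine le_of_tendsto hlim ?_
    filter_upwards [eventually_ge_atTop r] with b hb using key b hb

/-- Two near-vacuum metrics coincide once a bound `T` on their difference always comes with a
control of the sources by `T`. -/
theorem metric_unique {L A ℓ : ℝ} (hL : 1 ≤ L) (hA : 0 ≤ A) (hℓ : 0 < ℓ) {F₁ F₂ : Fields}
    (h₁ : NearVacuum L ℓ F₁) (h₂ : NearVacuum L ℓ F₂)
    (hsmall : 24 * L ^ 4 * (A ^ 2 + A + 1) * ℓ ^ 2 ≤ 1 / 2)
    (hJ : ∀ T, 0 < T → (∀ r, 0 < r → |F₁.m r - F₂.m r| ≤ T * r) →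
      (∀ r, 0 < r → |F₁.S r - F₂.S r| ≤ T) → ∃ J J', SourceDifference A ℓ T J J' F₁ F₂)
    {r : ℝ} (hr : 0 < r) : F₁.m r = F₂.m r ∧ F₁.S r = F₂.S r := by
  have hL0 : 0 < L := by linarith
  -- each application of `metric_difference` halves `T`, starting from `0 ≤ m ≤ r`, `0 ≤ S ≤ 1`
  have key : ∀ n : ℕ, ∀ r, 0 < r → |F₁.m r - F₂.m r| ≤ (1 / 2) ^ n * r
      ∧ |F₁.S r - F₂.S r| ≤ (1 / 2) ^ n := by
    intro n
    induction n with
    | zero =>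
      intro r hr
      rw [pow_zero, one_mul]
      have b : ∀ F : Fields, NearVacuum L ℓ F → 0 ≤ F.m r ∧ F.m r ≤ r ∧ 0 ≤ F.S r ∧ F.S r ≤ 1 := by
        intro F h
        refine ⟨h.metric.m_nonneg hr, ?_, (h.metric.S_pos hL0 hr).le, h.metric.S_le_one hL0 hr⟩
        calc F.m r ≤ _ := h.metric.m_le h.gauge hL0 hL0.le hℓ h.small hr
          _ ≤ 5 * L * L ^ 2 * (ℓ ^ 2 * r / 3) := by gcongr; exact kapPrim_le_sq_mul hℓ hr
          _ = (5 * L * L ^ 2 * ℓ ^ 2) * r / 3 := by ring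
          _ ≤ 1 / 2 * r / 3 := by gcongr; exact h.small
          _ ≤ r := by linarith
      have b1 := b F₁ h₁
      have b2 := b F₂ h₂
      constructor <;> rw [abs_le] <;> constructor <;> linarith [b1.1, b1.2.1, b1.2.2.1, b1.2.2.2,
        b2.1, b2.2.1, b2.2.2.1, b2.2.2.2]
    | succ n ih =>
      intro r hr
      have hT : (0 : ℝ) < (1 / 2) ^ n := by positivity
      obtain ⟨J, J', hJ⟩ := hJ _ hT (fun r hr => (ih r hr).1) (fun r hr => (ih r hr).2)
      have h := metric_difference hL hA hℓ h₁ h₂ hT hJ (fun r hr => (ih r hr).1)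
        (fun r hr => (ih r hr).2) hr
      rw [pow_succ]
      constructor
      · refine h.1.trans ?_
        calc _ ≤ (1 / 2 : ℝ) * (1 / 2) ^ n * r := by gcongr
          _ = _ := by ring
      · refine h.2.trans ?_
        calc _ ≤ (1 / 2 : ℝ) * (1 / 2) ^ n := by gcongr
          _ = _ := by ring
  have hlim : Tendsto (fun n : ℕ => ((1 : ℝ) / 2) ^ n) atTop (𝓝 0) :=
    tendsto_pow_atTop_nhds_zero_of_lt_one (by norm_num) (by norm_num)
  constructor
  · have h := ge_of_tendsto' (hlim.mul_const r) (fun n => (key n r hr).1)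
    rw [zero_mul] at h
    exact sub_eq_zero.1 (abs_eq_zero.1 (le_antisymm h (abs_nonneg _)))
  · have h := ge_of_tendsto' hlim (fun n => (key n r hr).2)
    exact sub_eq_zero.1 (abs_eq_zero.1 (le_antisymm h (abs_nonneg _)))

/-! ### Smooth functions on a half strip -/

/-- The half strip `r ≥ r₀`, `|ξ| ≤ 1` on which the gauge fields are smooth. -/
def strip (r₀ : ℝ) : Set (ℝ × ℝ) := Ici r₀ ×ˢ Icc (-1) 1

/-- Smoothness up to the boundary of the strip. -/
def SmoothOnStrip (r₀ : ℝ) (g : ℝ → ℝ → ℝ) : Prop :=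
  ContDiffOn ℝ ((⊤ : ℕ∞) : WithTop ℕ∞) (fun p : ℝ × ℝ => g p.1 p.2) (strip r₀)

/-- Radial derivative on the strip, one-sided on its boundary. -/
noncomputable def stripDr (r₀ : ℝ) (g : ℝ → ℝ → ℝ) (r ξ : ℝ) : ℝ :=
  fderivWithin ℝ (fun p : ℝ × ℝ => g p.1 p.2) (strip r₀) (r, ξ) (1, 0)

/-- Angular derivative on the strip, one-sided on its boundary. -/
noncomputable def stripDxi (r₀ : ℝ) (g : ℝ → ℝ → ℝ) (r ξ : ℝ) : ℝ :=
  fderivWithin ℝ (fun p : ℝ × ℝ => g p.1 p.2) (strip r₀) (r, ξ) (0, 1)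

theorem uniqueDiffOn_strip (r₀ : ℝ) : UniqueDiffOn ℝ (strip r₀) :=
  (uniqueDiffOn_Ici r₀).prod (uniqueDiffOn_Icc (by norm_num))

namespace SmoothOnStrip

variable {r₀ : ℝ} {g : ℝ → ℝ → ℝ}

theorem fderivWithin_apply (h : SmoothOnStrip r₀ g) (v : ℝ × ℝ) :
    ContDiffOn ℝ ((⊤ : ℕ∞) : WithTop ℕ∞)
      (fun p => fderivWithin ℝ (fun p : ℝ × ℝ => g p.1 p.2) (strip r₀) p v) (strip r₀) :=
  (h.fderivWithin (uniqueDiffOn_strip r₀) (by simp)).clm_apply contDiffOn_const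

theorem stripDr (h : SmoothOnStrip r₀ g) : SmoothOnStrip r₀ (stripDr r₀ g) :=
  h.fderivWithin_apply (1, 0)

theorem stripDxi (h : SmoothOnStrip r₀ g) : SmoothOnStrip r₀ (stripDxi r₀ g) :=
  h.fderivWithin_apply (0, 1)

theorem continuousOn (h : SmoothOnStrip r₀ g) :
    ContinuousOn (fun p : ℝ × ℝ => g p.1 p.2) (Ici r₀ ×ˢ Icc (-1) 1) :=
  ContDiffOn.continuousOn h

theorem continuousOn_slice (h : SmoothOnStrip r₀ g) {r : ℝ} (hr : r₀ ≤ r) :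
    ContinuousOn (g r) (Icc (-1) 1) :=
  h.continuousOn.comp (f := fun ξ : ℝ => (r, ξ)) (by fun_prop) fun _ hξ => ⟨hr, hξ⟩

theorem hasDerivAt_radial (h : SmoothOnStrip r₀ g) {r ξ : ℝ} (hr : r₀ < r)
    (hξ : ξ ∈ Icc (-1 : ℝ) 1) : HasDerivAt (fun r => g r ξ) (SuInfEYM.stripDr r₀ g r ξ) r := by
  have h1 := (ContDiffOn.differentiableOn h (by simp) (r, ξ) ⟨hr.le, hξ⟩).hasFDerivWithinAt
  refine h1.comp_hasDerivAt (f := fun r : ℝ => (r, ξ)) r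
    ((hasDerivAt_id r).prodMk (hasDerivAt_const r ξ)) ?_
  filter_upwards [Ioi_mem_nhds hr] with s hs using ⟨(show r₀ < s from hs).le, hξ⟩

theorem hasDerivAt_angular (h : SmoothOnStrip r₀ g) {r ξ : ℝ} (hr : r₀ ≤ r)
    (hξ : ξ ∈ Ioo (-1 : ℝ) 1) : HasDerivAt (g r) (SuInfEYM.stripDxi r₀ g r ξ) ξ := by
  have h1 := (ContDiffOn.differentiableOn h (by simp) (r, ξ)
    ⟨hr, Ioo_subset_Icc_self hξ⟩).hasFDerivWithinAt
  refine h1.comp_hasDerivAt (f := fun ξ : ℝ => (r, ξ)) ξ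
    ((hasDerivAt_const ξ r).prodMk (hasDerivAt_id ξ)) ?_
  filter_upwards [Ioo_mem_nhds hξ.1 hξ.2] with s hs using ⟨hr, Ioo_subset_Icc_self hs⟩

theorem dr_eq (h : SmoothOnStrip r₀ g) {r ξ : ℝ} (hr : r₀ < r) (hξ : ξ ∈ Icc (-1 : ℝ) 1) :
    dr g r ξ = SuInfEYM.stripDr r₀ g r ξ :=
  (h.hasDerivAt_radial hr hξ).deriv

theorem dxi_eq (h : SmoothOnStrip r₀ g) {r ξ : ℝ} (hr : r₀ ≤ r) (hξ : ξ ∈ Ioo (-1 : ℝ) 1) :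
    dxi g r ξ = SuInfEYM.stripDxi r₀ g r ξ :=
  (h.hasDerivAt_angular hr hξ).deriv

theorem dr_dr_eq (h : SmoothOnStrip r₀ g) {r ξ : ℝ} (hr : r₀ < r) (hξ : ξ ∈ Icc (-1 : ℝ) 1) :
    dr (dr g) r ξ = SuInfEYM.stripDr r₀ (SuInfEYM.stripDr r₀ g) r ξ := by
  rw [← h.stripDr.dr_eq hr hξ]
  refine Filter.EventuallyEq.deriv_eq ?_
  filter_upwards [Ioi_mem_nhds hr] with s hs using h.dr_eq hs hξ

theorem dxi_dxi_eq (h : SmoothOnStrip r₀ g) {r ξ : ℝ} (hr : r₀ ≤ r) (hξ : ξ ∈ Ioo (-1 : ℝ) 1) :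
    dxi (dxi g) r ξ = SuInfEYM.stripDxi r₀ (SuInfEYM.stripDxi r₀ g) r ξ := by
  rw [← h.stripDxi.dxi_eq hr hξ]
  refine Filter.EventuallyEq.deriv_eq ?_
  filter_upwards [Ioo_mem_nhds hξ.1 hξ.2] with s hs using h.dxi_eq hr hs

end SmoothOnStrip

/-- Differentiation under the integral over `[-1, 1]`; the endpoints do not matter. -/
theorem hasDerivAt_integral_strip {r₀ : ℝ} {H H' : ℝ → ℝ → ℝ}
    (hH : ContinuousOn (fun p : ℝ × ℝ => H p.1 p.2) (Ioi r₀ ×ˢ Icc (-1) 1))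
    (hH' : ContinuousOn (fun p : ℝ × ℝ => H' p.1 p.2) (Ioi r₀ ×ˢ Icc (-1) 1))
    (hd : ∀ r, r₀ < r → ∀ ξ ∈ Ioo (-1 : ℝ) 1, HasDerivAt (fun r => H r ξ) (H' r ξ) r)
    {r : ℝ} (hr : r₀ < r) :
    HasDerivAt (fun r => ∫ ξ in (-1 : ℝ)..1, H r ξ) (∫ ξ in (-1 : ℝ)..1, H' r ξ) r := by
  obtain ⟨a, ha, har⟩ := exists_between hr
  have hslice : ∀ {K : ℝ → ℝ → ℝ},
      ContinuousOn (fun p : ℝ × ℝ => K p.1 p.2) (Ioi r₀ ×ˢ Icc (-1) 1) → ∀ s, r₀ < s →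
      IntervalIntegrable (K s) MeasureTheory.volume (-1) 1 := by
    intro K hK s hs
    refine ContinuousOn.intervalIntegrable ?_
    rw [uIcc_of_le (by norm_num)]
    exact hK.comp (f := fun ξ : ℝ => (s, ξ)) (by fun_prop) fun _ hξ => ⟨hs, hξ⟩
  have hcpt : IsCompact (Icc a (r + 1) ×ˢ Icc (-1 : ℝ) 1) := isCompact_Icc.prod isCompact_Icc
  have hsub : Icc a (r + 1) ×ˢ Icc (-1 : ℝ) 1 ⊆ Ioi r₀ ×ˢ Icc (-1) 1 :=
    Set.prod_mono (fun s hs => ha.trans_le hs.1) Subset.rfl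
  obtain ⟨M, hM⟩ := hcpt.exists_bound_of_continuousOn (hH'.mono hsub)
  have hne : ∀ᵐ ξ : ℝ ∂MeasureTheory.volume, ξ ≠ 1 := by
    simp [MeasureTheory.ae_iff, MeasureTheory.measure_singleton]
  refine (intervalIntegral.hasDerivAt_integral_of_dominated_loc_of_deriv_le
    (bound := fun _ => M) (s := Ioo a (r + 1)) (Ioo_mem_nhds har (by linarith)) ?_
    (hslice hH r hr) (hslice hH' r hr).aestronglyMeasurable_restrict_uIoc ?_ ?_ ?_).2
  · filter_upwards [Ioi_mem_nhds hr] with s hs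
      using (hslice hH s hs).aestronglyMeasurable_restrict_uIoc
  · refine Eventually.of_forall fun ξ hξ s hs => ?_
    rw [uIoc_of_le (by norm_num)] at hξ
    exact hM (s, ξ) ⟨Ioo_subset_Icc_self hs, Ioc_subset_Icc_self hξ⟩
  · simp
  · filter_upwards [hne] with ξ hξ1 hξ s hs
    rw [uIoc_of_le (by norm_num)] at hξ
    exact hd s (ha.trans hs.1) ξ ⟨hξ.1, lt_of_le_of_ne hξ.2 hξ1⟩

/-- A function continuous on `[-1, 1]` is interval integrable there. -/
theorem intervalIntegrable_of_continuousOn {g : ℝ → ℝ} (hg : ContinuousOn g (Icc (-1) 1)) :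
    IntervalIntegrable g MeasureTheory.volume (-1) 1 :=
  ContinuousOn.intervalIntegrable (by rwa [uIcc_of_le (by norm_num)])

/-- Integration by parts on `[-1, 1]` without boundary terms. -/
theorem integral_deriv_mul_eq_neg {u v u' v' : ℝ → ℝ} (hu : ContinuousOn u (Icc (-1) 1))
    (hv : ContinuousOn v (Icc (-1) 1)) (hu' : ContinuousOn u' (Icc (-1) 1))
    (hv' : ContinuousOn v' (Icc (-1) 1)) (hdu : ∀ ξ ∈ Ioo (-1 : ℝ) 1, HasDerivAt u (u' ξ) ξ)
    (hdv : ∀ ξ ∈ Ioo (-1 : ℝ) 1, HasDerivAt v (v' ξ) ξ) (h1 : u 1 = 0) (h2 : u (-1) = 0) :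
    ∫ ξ in (-1 : ℝ)..1, u' ξ * v ξ = -∫ ξ in (-1 : ℝ)..1, u ξ * v' ξ := by
  have hmin : min (-1 : ℝ) 1 = -1 := by norm_num
  have hmax : max (-1 : ℝ) 1 = 1 := by norm_num
  have e := intervalIntegral.integral_mul_deriv_eq_deriv_mul_of_hasDerivAt (a := -1) (b := 1)
    (u := u) (v := v) (u' := u') (v' := v') (by rwa [uIcc_of_le (by norm_num)])
    (by rwa [uIcc_of_le (by norm_num)]) (by rwa [hmin, hmax]) (by rwa [hmin, hmax])
    (intervalIntegrable_of_continuousOn hu') (intervalIntegrable_of_continuousOn hv')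
  rw [h1, h2] at e
  linarith

/-- A Hardy inequality: for `u = (1-ξ²) G` one has `u'² = (1-ξ²)² G'² + 2 (1-ξ²) G² + (-2ξ(1-ξ²)G²)'`. -/
theorem two_mul_integral_le_integral_sq {G G' : ℝ → ℝ} (hG : ContinuousOn G (Icc (-1) 1))
    (hG' : ContinuousOn G' (Icc (-1) 1)) (hd : ∀ ξ ∈ Ioo (-1 : ℝ) 1, HasDerivAt G (G' ξ) ξ) :
    2 * ∫ ξ in (-1 : ℝ)..1, (1 - ξ ^ 2) * G ξ ^ 2
      ≤ ∫ ξ in (-1 : ℝ)..1, (-2 * ξ * G ξ + (1 - ξ ^ 2) * G' ξ) ^ 2 := by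
  have c1 : ContinuousOn (fun ξ : ℝ => -2 * (1 - ξ ^ 2) * G ξ ^ 2 + 4 * ξ ^ 2 * G ξ ^ 2
      - 4 * ξ * (1 - ξ ^ 2) * G ξ * G' ξ) (Icc (-1) 1) := by fun_prop
  have e : ∫ ξ in (-1 : ℝ)..1, (-2 * (1 - ξ ^ 2) * G ξ ^ 2 + 4 * ξ ^ 2 * G ξ ^ 2
      - 4 * ξ * (1 - ξ ^ 2) * G ξ * G' ξ) = 0 := by
    rw [intervalIntegral.integral_eq_sub_of_hasDerivAt_of_le (by norm_num)
      (f := fun ξ => -2 * ξ * (1 - ξ ^ 2) * G ξ ^ 2) (by fun_prop) ?_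
      (intervalIntegrable_of_continuousOn c1)]
    · norm_num
    · intro ξ hξ
      have h1 : HasDerivAt (fun ξ : ℝ => -2 * ξ * (1 - ξ ^ 2)) (-2 * (1 - ξ ^ 2) + 4 * ξ ^ 2) ξ := by
        refine ((((hasDerivAt_id ξ).const_mul (-2))).mul
          (((hasDerivAt_id ξ).pow 2).const_sub 1)).congr_deriv ?_
        simp; ring
      refine (h1.mul ((hd ξ hξ).pow 2)).congr_deriv ?_
      simp; ring
  have c2 : ContinuousOn (fun ξ : ℝ => (1 - ξ ^ 2) * G ξ ^ 2) (Icc (-1) 1) := by fun_prop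
  rw [← intervalIntegral.integral_const_mul]
  have i1 := intervalIntegrable_of_continuousOn c1
  have i2 := (intervalIntegrable_of_continuousOn c2).const_mul 2
  rw [← add_zero (∫ ξ in (-1 : ℝ)..1, 2 * ((1 - ξ ^ 2) * G ξ ^ 2)), ← e,
    ← intervalIntegral.integral_add i2 i1]
  refine intervalIntegral.integral_mono_on (by norm_num) (i2.add i1)
    (intervalIntegrable_of_continuousOn (by fun_prop)) fun ξ _ => ?_
  nlinarith [sq_nonneg ((1 - ξ ^ 2) * G' ξ)]

/-! ### The energy inequality at a fixed radius -/

theorem abs_mul_le_mul {x y α β : ℝ} (hx : |x| ≤ α) (hy : |y| ≤ β) : |x * y| ≤ α * β := by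
  rw [abs_mul]; exact mul_le_mul hx hy (abs_nonneg _) ((abs_nonneg _).trans hx)

/-- Absorption of a linear error term. -/
theorem mul_abs_le_sq_add {Q κ v : ℝ} (hκ : 0 < κ) : Q * |v| ≤ κ / 16 * v ^ 2 + 4 * Q ^ 2 / κ := by
  have h : κ / 16 * v ^ 2 + 4 * Q ^ 2 / κ - Q * |v| = (κ / 4 * |v| - 2 * Q) ^ 2 / κ := by
    rw [← sq_abs v]; field_simp; ring
  have : 0 ≤ (κ / 4 * |v| - 2 * Q) ^ 2 / κ := by positivity
  linarith

theorem abs_mul_le_half_sq_add_sq (d b : ℝ) : |d * b| ≤ (b ^ 2 + d ^ 2) / 2 := by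
  rw [abs_le]; constructor <;> nlinarith [sq_nonneg (b + d), sq_nonneg (b - d)]

set_option maxHeartbeats 400000 in
/-- The energy integrand is coercive up to errors that are small (`ε`) or quadratic in the difference
`T` of the metrics. The letters `a = x₁ - x₂`, `b = t (y₁ - y₂)`, `c = z₁ - z₂`, `d` stand for the
normalized differences of the gauge field derivatives and of the magnetic field. -/
theorem energy_integrand_lower {H κ ε T k r A₁ A₂ B₁ B₂ C₁ C₂ D₁ D₂ E₁ E₂ x₁ x₂ y₁ y₂ z₁ z₂ f₁ f₂
    t d e U V : ℝ} (hH : 1 ≤ H) (hκ : 0 < κ) (hε : 0 ≤ ε) (hε1 : ε ≤ 1) (hT : 0 ≤ T)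
    (hk : 0 ≤ k) (hA : 1 ≤ A₁) (hB : 1 ≤ B₁) (hC : κ ≤ C₁) (hE : κ ≤ E₁)
    (hB' : |B₁| ≤ H) (hD' : |D₁| ≤ H) (hE' : |E₁| ≤ H)
    (dA : |A₁ - A₂| ≤ H * T) (dB : |B₁ - B₂| ≤ H * T) (dC : |C₁ - C₂| ≤ H * T)
    (dD : |D₁ - D₂| ≤ H * T) (dE : |E₁ - E₂| ≤ H * T)
    (hx : |x₂| ≤ H * k) (hy : |y₂| ≤ H * k) (hz : |z₂| ≤ H * k) (hV : |V| ≤ H * k)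
    (ry₁ : |r * y₁| ≤ H * ε) (ry₂ : |r * y₂| ≤ H * ε) (hU : |U| ≤ 2 * (H * ε))
    (hf₁ : 1 / 2 ≤ f₁) (hf₁' : f₁ ≤ 2) (hf₂ : 1 / 2 ≤ f₂) (hf₂' : f₂ ≤ 2)
    (ht : 0 ≤ t) (ht1 : t ≤ 1) (hd : r * d = t * (f₁ - f₂)) :
    (x₁ - x₂) ^ 2 + (t * (y₁ - y₂)) ^ 2 / 4 + κ * (z₁ - z₂) ^ 2 + κ * e ^ 2 / 4
      - 6 * H ^ 3 * ε * ((t * (y₁ - y₂)) ^ 2 + d ^ 2)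
      - κ / 16 * ((x₁ - x₂) ^ 2 + (t * (y₁ - y₂)) ^ 2 + (z₁ - z₂) ^ 2 + d ^ 2)
      - 576 * (H ^ 6 / κ * (T ^ 2 * k ^ 2))
    ≤ (A₁ * x₁ - A₂ * x₂) * (x₁ - x₂)
      + (B₁ * f₁ ^ 2 * (t * y₁) - B₂ * f₂ ^ 2 * (t * y₂)) * (t * (y₁ - y₂))
      + (C₁ * z₁ - C₂ * z₂) * (z₁ - z₂)
      - d * r * (D₁ * f₁ * (t * y₁ ^ 2) - D₂ * f₂ * (t * y₂ ^ 2))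
      + E₁ * e ^ 2 / 4 - E₁ / 4 * d ^ 2 * U - (E₁ - E₂) / 2 * (d * (t * (f₂ * V))) := by
  set a := x₁ - x₂ with ha
  set b := t * (y₁ - y₂) with hb
  set c := z₁ - z₂ with hc
  have hH0 : 0 ≤ H := by linarith
  have at1 : |t| ≤ 1 := by rw [abs_of_nonneg ht]; exact ht1
  have af₁ : |f₁| ≤ 2 := by rw [abs_of_nonneg (by linarith)]; exact hf₁'
  have af₂ : |f₂| ≤ 2 := by rw [abs_of_nonneg (by linarith)]; exact hf₂'
  have afs : |f₁ + f₂| ≤ 4 := by rw [abs_of_nonneg (by linarith)]; linarith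
  have key : (A₁ * x₁ - A₂ * x₂) * a
      + (B₁ * f₁ ^ 2 * (t * y₁) - B₂ * f₂ ^ 2 * (t * y₂)) * b
      + (C₁ * z₁ - C₂ * z₂) * c
      - d * r * (D₁ * f₁ * (t * y₁ ^ 2) - D₂ * f₂ * (t * y₂ ^ 2))
      + E₁ * e ^ 2 / 4 - E₁ / 4 * d ^ 2 * U - (E₁ - E₂) / 2 * (d * (t * (f₂ * V)))
      = A₁ * a ^ 2 + B₁ * f₁ ^ 2 * b ^ 2 + C₁ * c ^ 2 + E₁ * e ^ 2 / 4
        + ((A₁ - A₂) * x₂) * a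
        + (B₁ * ((f₁ + f₂) * (r * y₂))) * (d * b)
        + ((B₁ - B₂) * (f₂ * (f₂ * (t * y₂)))) * b
        + ((C₁ - C₂) * z₂) * c
        - (D₁ * (f₁ * (r * y₁ + r * y₂))) * (d * b)
        - (D₁ * ((r * y₂) * (r * y₂))) * d ^ 2
        - ((D₁ - D₂) * (f₂ * (t * (y₂ * (r * y₂))))) * d
        - (E₁ / 4 * U) * d ^ 2
        - ((E₁ - E₂) / 2 * (t * (f₂ * V))) * d := by
    rw [ha, hb, hc]
    linear_combination (-(B₁ * (f₁ + f₂) * y₂ * (t * (y₁ - y₂))) + d * D₁ * r * y₂ ^ 2) * hd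
  rw [key]
  have n2 : |f₂ * (f₂ * (t * y₂))| ≤ 2 * (2 * (1 * (H * k))) :=
    abs_mul_le_mul af₂ (abs_mul_le_mul af₂ (abs_mul_le_mul at1 hy))
  have nry : |r * y₁ + r * y₂| ≤ 2 * (H * ε) := (abs_add_le _ _).trans (by linarith)
  have e1 := abs_mul_le_mul dA hx
  have e2 := abs_mul_le_mul hB' (abs_mul_le_mul afs ry₂)
  have e3 := abs_mul_le_mul dB n2
  have e4 := abs_mul_le_mul dC hz
  have e5 := abs_mul_le_mul hD' (abs_mul_le_mul af₁ nry)
  have e6 := abs_mul_le_mul hD' (abs_mul_le_mul ry₂ ry₂)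
  have e7 := abs_mul_le_mul dD (abs_mul_le_mul af₂ (abs_mul_le_mul at1 (abs_mul_le_mul hy ry₂)))
  have e8 : |E₁ / 4 * U| ≤ H / 4 * (2 * (H * ε)) :=
    abs_mul_le_mul (by rw [abs_div, abs_of_pos (by norm_num : (0 : ℝ) < 4)]; gcongr) hU
  have e9 : |(E₁ - E₂) / 2 * (t * (f₂ * V))| ≤ H * T / 2 * (1 * (2 * (H * k))) :=
    abs_mul_le_mul (by rw [abs_div, abs_of_pos (by norm_num : (0 : ℝ) < 2)]; gcongr)
      (abs_mul_le_mul at1 (abs_mul_le_mul af₂ hV))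
  have H23 : H ^ 2 ≤ H ^ 3 := pow_le_pow_right₀ hH (by norm_num)
  have hTk : 0 ≤ T * k := mul_nonneg hT hk
  set Q := 6 * H ^ 3 * (T * k) with hQ
  have hH2 : 0 ≤ H ^ 2 := by positivity
  have hH3 : 0 ≤ H ^ 3 := by positivity
  have tk23 : H ^ 2 * (T * k) ≤ H ^ 3 * (T * k) := mul_le_mul_of_nonneg_right H23 hTk
  have tk2 : 0 ≤ H ^ 2 * (T * k) := by positivity
  have tke : H ^ 3 * (T * k) * ε ≤ H ^ 3 * (T * k) := mul_le_of_le_one_right (by positivity) hε1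
  have e23 : H ^ 2 * ε ≤ H ^ 3 * ε := mul_le_mul_of_nonneg_right H23 hε
  have e33 : H ^ 3 * ε * ε ≤ H ^ 3 * ε := mul_le_of_le_one_right (by positivity) hε1
  -- errors linear in the differences, of size `T k`
  have g1 : |((A₁ - A₂) * x₂) * a| ≤ Q * |a| :=
    abs_mul_le_mul (e1.trans (by linarith)) le_rfl
  have g3 : |((B₁ - B₂) * (f₂ * (f₂ * (t * y₂)))) * b| ≤ Q * |b| :=
    abs_mul_le_mul (e3.trans (by linarith)) le_rfl
  have g4 : |((C₁ - C₂) * z₂) * c| ≤ Q * |c| :=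
    abs_mul_le_mul (e4.trans (by linarith)) le_rfl
  have g7 : |((D₁ - D₂) * (f₂ * (t * (y₂ * (r * y₂))))) * d| ≤ 2 * H ^ 3 * (T * k) * |d| :=
    abs_mul_le_mul (e7.trans (by linarith)) le_rfl
  have g9 : |((E₁ - E₂) / 2 * (t * (f₂ * V))) * d| ≤ H ^ 3 * (T * k) * |d| :=
    abs_mul_le_mul (e9.trans (by linarith)) le_rfl
  have g79 : 2 * H ^ 3 * (T * k) * |d| + H ^ 3 * (T * k) * |d| ≤ Q * |d| := by
    rw [← add_mul]; gcongr; linarith [show 0 ≤ H ^ 3 * (T * k) by positivity]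
  -- errors quadratic in the differences, of size `ε`
  have hdb := abs_mul_le_half_sq_add_sq d b
  have g2 : |(B₁ * ((f₁ + f₂) * (r * y₂))) * (d * b)| ≤ 4 * H ^ 2 * ε * ((b ^ 2 + d ^ 2) / 2) :=
    abs_mul_le_mul (e2.trans (by linarith)) hdb
  have g5 : |(D₁ * (f₁ * (r * y₁ + r * y₂))) * (d * b)| ≤ 4 * H ^ 2 * ε * ((b ^ 2 + d ^ 2) / 2) :=
    abs_mul_le_mul (e5.trans (by linarith)) hdb
  have g6 : |(D₁ * ((r * y₂) * (r * y₂))) * d ^ 2| ≤ H ^ 3 * ε * d ^ 2 :=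
    abs_mul_le_mul (e6.trans (by linarith)) (abs_of_nonneg (sq_nonneg d)).le
  have g8 : |(E₁ / 4 * U) * d ^ 2| ≤ H ^ 2 * ε / 2 * d ^ 2 :=
    abs_mul_le_mul (e8.trans (by linarith)) (abs_of_nonneg (sq_nonneg d)).le
  have m1 : a ^ 2 ≤ A₁ * a ^ 2 := le_mul_of_one_le_left (sq_nonneg _) hA
  have m2 : b ^ 2 / 4 ≤ B₁ * f₁ ^ 2 * b ^ 2 := by
    have h1 : 1 / 4 ≤ f₁ ^ 2 :=
      le_trans (by norm_num) (pow_le_pow_left₀ (by norm_num) hf₁ 2)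
    have h2 : 1 / 4 ≤ B₁ * f₁ ^ 2 := h1.trans (le_mul_of_one_le_left (sq_nonneg _) hB)
    have := mul_le_mul_of_nonneg_right h2 (sq_nonneg b)
    linarith
  have m3 : κ * c ^ 2 ≤ C₁ * c ^ 2 := mul_le_mul_of_nonneg_right hC (sq_nonneg _)
  have m4 : κ * e ^ 2 ≤ E₁ * e ^ 2 := mul_le_mul_of_nonneg_right hE (sq_nonneg _)
  have q1 := mul_abs_le_sq_add (Q := Q) (v := a) hκ
  have q2 := mul_abs_le_sq_add (Q := Q) (v := b) hκ
  have q3 := mul_abs_le_sq_add (Q := Q) (v := c) hκ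
  have q4 := mul_abs_le_sq_add (Q := Q) (v := d) hκ
  have hQ2 : 4 * Q ^ 2 / κ = 144 * (H ^ 6 / κ * (T ^ 2 * k ^ 2)) := by rw [hQ]; ring
  rw [hQ2] at q1 q2 q3 q4
  have w1 : H ^ 2 * ε * b ^ 2 ≤ H ^ 3 * ε * b ^ 2 := mul_le_mul_of_nonneg_right e23 (sq_nonneg _)
  have w2 : H ^ 2 * ε * d ^ 2 ≤ H ^ 3 * ε * d ^ 2 := mul_le_mul_of_nonneg_right e23 (sq_nonneg _)
  have w3 : 0 ≤ H ^ 2 * ε * b ^ 2 := by positivity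
  have w4 : 0 ≤ H ^ 2 * ε * d ^ 2 := by positivity
  rw [abs_le] at g1 g2 g3 g4 g5 g6 g7 g8 g9
  linarith [g1.1, g2.1, g3.1, g4.1, g5.2, g6.2, g7.2, g8.2, g9.2]

/-- Bounds for the coefficients of the normalized energy integrand. -/
theorem energy_coefficients {L T p S₁ S₂ μ₁ μ₂ : ℝ} (hL : 1 ≤ L) (hp : 0 < p) (hS₁ : L⁻¹ ≤ S₁)
    (hS₂ : L⁻¹ ≤ S₂) (hS₁' : S₁ ≤ 1) (hS₂' : S₂ ≤ 1) (hμ₁ : p / 2 ≤ μ₁) (hμ₂ : p / 2 ≤ μ₂)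
    (hμ₁' : μ₁ ≤ p) (hμ₂' : μ₂ ≤ p) (dS : |S₁ - S₂| ≤ T)
    (dSi : |1 / S₁ - 1 / S₂| ≤ L ^ 2 * T) (dn : |p / μ₁ - p / μ₂| ≤ 8 * T)
    (du : |μ₁ / p - μ₂ / p| ≤ 2 * T) :
    (1 ≤ 1 / S₁ ∧ 1 ≤ p / μ₁ * (1 / S₁) ∧ 1 / (2 * L ^ 2) ≤ μ₁ / p * (S₁ * √S₁) ∧
      1 / (2 * L ^ 2) ≤ S₁ * √S₁) ∧
    (|p / μ₁ * (1 / S₁)| ≤ 10 * L ^ 3 ∧ |p / μ₁ * (1 / √S₁) / 4| ≤ 10 * L ^ 3 ∧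
      |S₁ * √S₁| ≤ 10 * L ^ 3) ∧
    |1 / S₁ - 1 / S₂| ≤ 10 * L ^ 3 * T ∧
    |p / μ₁ * (1 / S₁) - p / μ₂ * (1 / S₂)| ≤ 10 * L ^ 3 * T ∧
    |μ₁ / p * (S₁ * √S₁) - μ₂ / p * (S₂ * √S₂)| ≤ 10 * L ^ 3 * T ∧
    |p / μ₁ * (1 / √S₁) / 4 - p / μ₂ * (1 / √S₂) / 4| ≤ 10 * L ^ 3 * T ∧
    |S₁ * √S₁ - S₂ * √S₂| ≤ 10 * L ^ 3 * T := by
  have hL0 : 0 < L := by linarith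
  have hT : 0 ≤ T := (abs_nonneg _).trans dS
  have root : ∀ S, L⁻¹ ≤ S → S ≤ 1 → 0 < S ∧ 0 < √S ∧ L⁻¹ ≤ √S ∧ √S ≤ 1 ∧ √S * √S = S
      ∧ 1 / √S ≤ L ∧ 1 / S ≤ L := by
    intro S h1 h2
    have h0 : 0 < S := (inv_pos.2 hL0).trans_le h1
    have hs : L⁻¹ ≤ √S := by
      refine h1.trans (Real.le_sqrt_of_sq_le ?_)
      nlinarith
    refine ⟨h0, Real.sqrt_pos.2 h0, hs, Real.sqrt_le_one.2 h2,
      Real.mul_self_sqrt h0.le, ?_, ?_⟩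
    · rw [one_div]; exact inv_le_of_inv_le₀ hL0 hs
    · rw [one_div]; exact inv_le_of_inv_le₀ hL0 h1
  obtain ⟨a0, a1, a2, a3, a4, a5, a6⟩ := root S₁ hS₁ hS₁'
  obtain ⟨b0, b1, b2, b3, b4, b5, b6⟩ := root S₂ hS₂ hS₂'
  set s₁ := √S₁
  set s₂ := √S₂
  have m1 : 0 < μ₁ := by linarith
  have m2 : 0 < μ₂ := by linarith
  have hLi : 0 < L⁻¹ := inv_pos.2 hL0
  have L1 : L ≤ L ^ 3 := le_self_pow₀ hL (by norm_num)
  have L2 : L ^ 2 ≤ L ^ 3 := pow_le_pow_right₀ hL (by norm_num)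
  have L3 : 1 ≤ L ^ 3 := one_le_pow₀ hL
  have T1 : L * T ≤ L ^ 3 * T := mul_le_mul_of_nonneg_right L1 hT
  have T2 : L ^ 2 * T ≤ L ^ 3 * T := mul_le_mul_of_nonneg_right L2 hT
  have T3 : T ≤ L ^ 3 * T := le_mul_of_one_le_left hT L3
  have n1 : |p / μ₁| ≤ 2 := by
    rw [abs_of_pos (by positivity), div_le_iff₀ m1]; linarith
  have n2 : |p / μ₂| ≤ 2 := by
    rw [abs_of_pos (by positivity), div_le_iff₀ m2]; linarith
  have u2 : |μ₂ / p| ≤ 1 := by rw [abs_of_pos (by positivity), div_le_one hp]; exact hμ₂'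
  have i1 : |1 / S₁| ≤ L := by rw [abs_of_pos (by positivity)]; exact a6
  have j1 : |1 / s₁| ≤ L := by rw [abs_of_pos (by positivity)]; exact a5
  have j2 : |1 / s₂| ≤ L := by rw [abs_of_pos (by positivity)]; exact b5
  have as1 : |s₁| ≤ 1 := by rw [abs_of_pos a1]; exact a3
  have aS1 : |S₁| ≤ 1 := by rw [abs_of_pos a0]; exact hS₁'
  have aS2 : |S₂| ≤ 1 := by rw [abs_of_pos b0]; exact hS₂'
  have one_inv : ∀ x : ℝ, 0 < x → x ≤ 1 → 1 ≤ 1 / x := fun x h0 h1 => by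
    rw [le_div_iff₀ h0]; linarith
  have ds : |s₁ - s₂| ≤ L * T := by
    have e : S₁ - S₂ = (s₁ - s₂) * (s₁ + s₂) := by rw [← a4, ← b4]; ring
    rw [e, abs_mul, abs_of_pos (by positivity : 0 < s₁ + s₂)] at dS
    have h2 : |s₁ - s₂| * L⁻¹ ≤ T :=
      (mul_le_mul_of_nonneg_left (by linarith) (abs_nonneg _)).trans dS
    rw [← div_eq_mul_inv, div_le_iff₀ hL0] at h2
    linarith
  have dsi : |1 / s₁ - 1 / s₂| ≤ L ^ 3 * T := by
    have e : 1 / s₁ - 1 / s₂ = (1 / s₁) * ((1 / s₂) * (s₂ - s₁)) := by field_simp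
    rw [e]
    refine (abs_mul_le_mul j1 (abs_mul_le_mul j2 ((abs_sub_comm s₂ s₁).le.trans ds))).trans
      (le_of_eq (by ring))
  have hE : |S₁ * s₁ - S₂ * s₂| ≤ 2 * L * T := by
    have := abs_mul_sub_mul_le dS as1 aS2 ds
    have : T ≤ L * T := le_mul_of_one_le_left hT hL
    linarith
  have aE1 : |S₁ * s₁| ≤ 1 := (abs_mul_le_mul aS1 as1).trans (by norm_num)
  have hs3 : 1 / L ^ 2 ≤ S₁ * s₁ := by
    calc 1 / L ^ 2 = L⁻¹ * L⁻¹ := by field_simp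
      _ ≤ _ := by gcongr
  have hu1 : 1 / 2 ≤ μ₁ / p := by rw [le_div_iff₀ hp]; linarith
  have d2 := abs_mul_sub_mul_le dn i1 n2 dSi
  have d3 := abs_mul_sub_mul_le du aE1 u2 hE
  have d4 := abs_mul_sub_mul_le dn j1 n2 dsi
  have LT3 : 0 ≤ L ^ 3 * T := by positivity
  have hn1 : 1 ≤ p / μ₁ := by rw [le_div_iff₀ m1]; linarith
  have e2 : 1 / (2 * L ^ 2) = 1 / 2 * (1 / L ^ 2) := by field_simp
  have e3 : 0 < 1 / L ^ 2 := by positivity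
  refine ⟨⟨one_inv _ a0 hS₁', ?_, ?_, ?_⟩, ⟨?_, ?_, ?_⟩, ?_, ?_, ?_, ?_, ?_⟩
  · exact one_le_mul_of_one_le_of_one_le hn1 (one_inv _ a0 hS₁')
  · rw [e2]; gcongr
  · rw [e2]; linarith
  · exact (abs_mul_le_mul n1 i1).trans (by linarith)
  · rw [abs_div, abs_of_pos (by norm_num : (0 : ℝ) < 4)]
    have := abs_mul_le_mul n1 j1
    linarith
  · linarith
  · linarith
  · linarith
  · linarith
  · rw [← sub_div, abs_div, abs_of_pos (by norm_num : (0 : ℝ) < 4)]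
    linarith
  · linarith

/-! ### Gauge fields at a fixed radius -/

/-- The gauge fields `α`, `f` at a fixed radius, as functions of `ξ`, together with their radial
(`ar`, `fr`) and angular (`ax`, `axx`, `fx`, `fxx`) derivatives. -/
structure GaugeProfile where
  α : ℝ → ℝ
  f : ℝ → ℝ
  ar : ℝ → ℝ
  ax : ℝ → ℝ
  axx : ℝ → ℝ
  fr : ℝ → ℝ
  fx : ℝ → ℝ
  fxx : ℝ → ℝ

namespace GaugeProfile

/-- `∂_ξ (ω² + ξ²)`, with `ω² + ξ² - 1 = (1-ξ²)(f²-1)`. -/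
def du (φ : GaugeProfile) (ξ : ℝ) : ℝ :=
  -2 * ξ * (φ.f ξ ^ 2 - 1) + 2 * (1 - ξ ^ 2) * (φ.f ξ * φ.fx ξ)

/-- `∂_ξ² (ω² + ξ²)`. -/
def ddu (φ : GaugeProfile) (ξ : ℝ) : ℝ :=
  -2 * (φ.f ξ ^ 2 - 1) - 8 * ξ * (φ.f ξ * φ.fx ξ)
    + 2 * (1 - ξ ^ 2) * (φ.fx ξ ^ 2 + φ.f ξ * φ.fxx ξ)

/-- `ω² ∂_ξ α`. -/
def cur (φ : GaugeProfile) (ξ : ℝ) : ℝ := (1 - ξ ^ 2) * φ.f ξ ^ 2 * φ.ax ξ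

/-- `∂_ξ (ω² ∂_ξ α)`. -/
def dcur (φ : GaugeProfile) (ξ : ℝ) : ℝ :=
  -2 * ξ * φ.f ξ ^ 2 * φ.ax ξ
    + (1 - ξ ^ 2) * (2 * φ.f ξ * φ.fx ξ * φ.ax ξ + φ.f ξ ^ 2 * φ.axx ξ)

/-- Continuity up to `ξ = ±1`, and the angular derivatives are what their names say. -/
structure Regular (φ : GaugeProfile) : Prop where
  α_cont : ContinuousOn φ.α (Icc (-1) 1)
  f_cont : ContinuousOn φ.f (Icc (-1) 1)
  ar_cont : ContinuousOn φ.ar (Icc (-1) 1)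
  ax_cont : ContinuousOn φ.ax (Icc (-1) 1)
  axx_cont : ContinuousOn φ.axx (Icc (-1) 1)
  fr_cont : ContinuousOn φ.fr (Icc (-1) 1)
  fx_cont : ContinuousOn φ.fx (Icc (-1) 1)
  fxx_cont : ContinuousOn φ.fxx (Icc (-1) 1)
  α_deriv : ∀ ξ ∈ Ioo (-1 : ℝ) 1, HasDerivAt φ.α (φ.ax ξ) ξ
  ax_deriv : ∀ ξ ∈ Ioo (-1 : ℝ) 1, HasDerivAt φ.ax (φ.axx ξ) ξ
  f_deriv : ∀ ξ ∈ Ioo (-1 : ℝ) 1, HasDerivAt φ.f (φ.fx ξ) ξ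
  fx_deriv : ∀ ξ ∈ Ioo (-1 : ℝ) 1, HasDerivAt φ.fx (φ.fxx ξ) ξ

/-- The normalized field derivatives at radius `r`, where `p = 1 + r²/ℓ²`, are at most `H k`. -/
structure Bounded (φ : GaugeProfile) (H k r p : ℝ) : Prop where
  f_low : ∀ ξ ∈ Ioo (-1 : ℝ) 1, 1 / 2 ≤ φ.f ξ
  f_le : ∀ ξ ∈ Ioo (-1 : ℝ) 1, φ.f ξ ≤ 2
  ar_le : ∀ ξ ∈ Ioo (-1 : ℝ) 1, |r * φ.ar ξ| ≤ H * k
  ax_le : ∀ ξ ∈ Ioo (-1 : ℝ) 1, |φ.ax ξ / √p| ≤ H * k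
  fr_le : ∀ ξ ∈ Ioo (-1 : ℝ) 1, |√p * φ.fr ξ| ≤ H * k
  du_le : ∀ ξ ∈ Ioo (-1 : ℝ) 1, |φ.du ξ / r| ≤ H * k
  ddu_le : ∀ ξ ∈ Ioo (-1 : ℝ) 1, |φ.ddu ξ / r| ≤ H * k

theorem Regular.du_cont {φ : GaugeProfile} (h : φ.Regular) : ContinuousOn φ.du (Icc (-1) 1) := by
  have h1 := h.f_cont
  have h2 := h.fx_cont
  unfold du; fun_prop

theorem Regular.ddu_cont {φ : GaugeProfile} (h : φ.Regular) : ContinuousOn φ.ddu (Icc (-1) 1) := by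
  have h1 := h.f_cont
  have h2 := h.fx_cont
  have h3 := h.fxx_cont
  unfold ddu; fun_prop

theorem Regular.cur_cont {φ : GaugeProfile} (h : φ.Regular) : ContinuousOn φ.cur (Icc (-1) 1) := by
  have h1 := h.f_cont
  have h2 := h.ax_cont
  unfold cur; fun_prop

theorem Regular.dcur_cont {φ : GaugeProfile} (h : φ.Regular) :
    ContinuousOn φ.dcur (Icc (-1) 1) := by
  have h1 := h.f_cont
  have h2 := h.ax_cont
  have h3 := h.fx_cont
  have h4 := h.axx_cont
  unfold dcur; fun_prop

theorem hasDerivAt_one_sub_sq (ξ : ℝ) : HasDerivAt (fun ξ : ℝ => 1 - ξ ^ 2) (-2 * ξ) ξ :=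
  (((hasDerivAt_id ξ).pow 2).const_sub 1).congr_deriv (by simp)

theorem Regular.hasDerivAt_cur {φ : GaugeProfile} (h : φ.Regular) {ξ : ℝ}
    (hξ : ξ ∈ Ioo (-1 : ℝ) 1) : HasDerivAt φ.cur (φ.dcur ξ) ξ := by
  refine ((((hasDerivAt_one_sub_sq ξ).mul ((h.f_deriv ξ hξ).pow 2))).mul
    (h.ax_deriv ξ hξ)).congr_deriv ?_
  simp [dcur]; ring

theorem Regular.hasDerivAt_u {φ : GaugeProfile} (h : φ.Regular) {ξ : ℝ}
    (hξ : ξ ∈ Ioo (-1 : ℝ) 1) :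
    HasDerivAt (fun ξ => (1 - ξ ^ 2) * (φ.f ξ ^ 2 - 1)) (φ.du ξ) ξ := by
  refine ((hasDerivAt_one_sub_sq ξ).mul (((h.f_deriv ξ hξ).pow 2).sub_const 1)).congr_deriv ?_
  simp [du]; ring

theorem Regular.hasDerivAt_du {φ : GaugeProfile} (h : φ.Regular) {ξ : ℝ}
    (hξ : ξ ∈ Ioo (-1 : ℝ) 1) : HasDerivAt φ.du (φ.ddu ξ) ξ := by
  have h1 : HasDerivAt (fun ξ : ℝ => -2 * ξ) (-2) ξ := by
    simpa using (hasDerivAt_id ξ).const_mul (-2)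
  refine ((h1.mul (((h.f_deriv ξ hξ).pow 2).sub_const 1)).add
    (((hasDerivAt_one_sub_sq ξ).const_mul 2).mul
      ((h.f_deriv ξ hξ).mul (h.fx_deriv ξ hξ)))).congr_deriv ?_
  simp [ddu]; ring

variable (φ₁ φ₂ : GaugeProfile) (r p S₁ S₂ μ₁ μ₂ : ℝ)

/-- The radial derivative of the energy density
`(r²α₁'/S₁ - r²α₂'/S₂)(α₁-α₂) + (1-ξ²)(μ₁S₁^{3/2}f₁' - μ₂S₂^{3/2}f₂')(f₁-f₂)`,
with the Yang-Mills equations substituted. -/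
noncomputable def energyRate (ξ : ℝ) : ℝ :=
  (-(φ₁.dcur ξ / (μ₁ * S₁)) - -(φ₂.dcur ξ / (μ₂ * S₂))) * (φ₁.α ξ - φ₂.α ξ)
    + (r ^ 2 * φ₁.ar ξ / S₁ - r ^ 2 * φ₂.ar ξ / S₂) * (φ₁.ar ξ - φ₂.ar ξ)
    + (1 - ξ ^ 2) * ((-(φ₁.f ξ * φ₁.ax ξ ^ 2 / (4 * μ₁ * √S₁)
          + S₁ * √S₁ / (2 * r ^ 2) * (φ₁.f ξ * φ₁.ddu ξ))
        - -(φ₂.f ξ * φ₂.ax ξ ^ 2 / (4 * μ₂ * √S₂)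
          + S₂ * √S₂ / (2 * r ^ 2) * (φ₂.f ξ * φ₂.ddu ξ))) * (φ₁.f ξ - φ₂.f ξ)
      + (μ₁ * (S₁ * √S₁) * φ₁.fr ξ - μ₂ * (S₂ * √S₂) * φ₂.fr ξ) * (φ₁.fr ξ - φ₂.fr ξ))

/-- The integrand of the derivative of the energy after integration by parts in `ξ`. -/
noncomputable def energyForm (ξ : ℝ) : ℝ :=
  (r ^ 2 * φ₁.ar ξ / S₁ - r ^ 2 * φ₂.ar ξ / S₂) * (φ₁.ar ξ - φ₂.ar ξ)
    + (φ₁.cur ξ / (μ₁ * S₁) - φ₂.cur ξ / (μ₂ * S₂)) * (φ₁.ax ξ - φ₂.ax ξ)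
    + (1 - ξ ^ 2) * (μ₁ * (S₁ * √S₁) * φ₁.fr ξ - μ₂ * (S₂ * √S₂) * φ₂.fr ξ) * (φ₁.fr ξ - φ₂.fr ξ)
    - (1 - ξ ^ 2) * (φ₁.f ξ - φ₂.f ξ) / 4 * (φ₁.f ξ * φ₁.ax ξ ^ 2 / (μ₁ * √S₁)
        - φ₂.f ξ * φ₂.ax ξ ^ 2 / (μ₂ * √S₂))
    + S₁ * √S₁ / (4 * r ^ 2) * (φ₁.du ξ - φ₂.du ξ) ^ 2
    - S₁ * √S₁ / (4 * r ^ 2) * ((1 - ξ ^ 2) * (φ₁.f ξ - φ₂.f ξ) ^ 2 * (φ₁.ddu ξ + φ₂.ddu ξ))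
    - (S₁ * √S₁ - S₂ * √S₂) / (2 * r ^ 2)
        * ((1 - ξ ^ 2) * (φ₁.f ξ - φ₂.f ξ) * (φ₂.f ξ * φ₂.ddu ξ))

/-- The squares of the normalized differences of the field derivatives. -/
noncomputable def diffDensity (ξ : ℝ) : ℝ :=
  r ^ 2 * (φ₁.ar ξ - φ₂.ar ξ) ^ 2 + (1 - ξ ^ 2) / p * (φ₁.ax ξ - φ₂.ax ξ) ^ 2
    + (1 - ξ ^ 2) * p * (φ₁.fr ξ - φ₂.fr ξ) ^ 2 + (1 - ξ ^ 2) / r ^ 2 * (φ₁.f ξ - φ₂.f ξ) ^ 2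
    + (φ₁.du ξ - φ₂.du ξ) ^ 2 / r ^ 2

variable {φ₁ φ₂ : GaugeProfile}

theorem energyRate_cont (h₁ : φ₁.Regular) (h₂ : φ₂.Regular) :
    ContinuousOn (energyRate φ₁ φ₂ r S₁ S₂ μ₁ μ₂) (Icc (-1) 1) := by
  obtain ⟨a1, a2, a3, a4, -, a6, -, -, -, -, -, -⟩ := id h₁
  obtain ⟨b1, b2, b3, b4, -, b6, -, -, -, -, -, -⟩ := id h₂
  have := h₁.dcur_cont
  have := h₂.dcur_cont
  have := h₁.ddu_cont
  have := h₂.ddu_cont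
  unfold energyRate; fun_prop

theorem energyForm_cont (h₁ : φ₁.Regular) (h₂ : φ₂.Regular) :
    ContinuousOn (energyForm φ₁ φ₂ r S₁ S₂ μ₁ μ₂) (Icc (-1) 1) := by
  obtain ⟨a1, a2, a3, a4, -, a6, -, -, -, -, -, -⟩ := id h₁
  obtain ⟨b1, b2, b3, b4, -, b6, -, -, -, -, -, -⟩ := id h₂
  have := h₁.cur_cont
  have := h₂.cur_cont
  have := h₁.du_cont
  have := h₂.du_cont
  have := h₁.ddu_cont
  have := h₂.ddu_cont
  unfold energyForm; fun_prop

theorem diffDensity_cont (h₁ : φ₁.Regular) (h₂ : φ₂.Regular) :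
    ContinuousOn (diffDensity φ₁ φ₂ r p) (Icc (-1) 1) := by
  obtain ⟨a1, a2, a3, a4, -, a6, -, -, -, -, -, -⟩ := id h₁
  obtain ⟨b1, b2, b3, b4, -, b6, -, -, -, -, -, -⟩ := id h₂
  have := h₁.du_cont
  have := h₂.du_cont
  unfold diffDensity; fun_prop

theorem diffDensity_nonneg (hp : 0 < p) {ξ : ℝ} (hξ : ξ ∈ Icc (-1 : ℝ) 1) :
    0 ≤ diffDensity φ₁ φ₂ r p ξ := by
  have : 0 ≤ 1 - ξ ^ 2 := by nlinarith [hξ.1, hξ.2]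
  unfold diffDensity; positivity

/-- Integration by parts in `ξ`, which uses
`(1-ξ²)(f₁-f₂)(f₁u₁'' - f₂u₂'') = (u₁-u₂)(u₁-u₂)''/2 + (1-ξ²)(f₁-f₂)²(u₁''+u₂'')/2`
with `u = (1-ξ²)(f²-1)`. -/
theorem integral_energyRate_eq (h₁ : φ₁.Regular) (h₂ : φ₂.Regular) :
    ∫ ξ in (-1 : ℝ)..1, energyRate φ₁ φ₂ r S₁ S₂ μ₁ μ₂ ξ
      = ∫ ξ in (-1 : ℝ)..1, energyForm φ₁ φ₂ r S₁ S₂ μ₁ μ₂ ξ := by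
  have i1 := intervalIntegrable_of_continuousOn (energyRate_cont r S₁ S₂ μ₁ μ₂ h₁ h₂)
  have i2 := intervalIntegrable_of_continuousOn (energyForm_cont r S₁ S₂ μ₁ μ₂ h₁ h₂)
  rw [eq_comm, ← sub_eq_zero, ← intervalIntegral.integral_sub i2 i1]
  obtain ⟨a1, a2, a3, a4, -, a6, -, -, -, -, -, -⟩ := id h₁
  obtain ⟨b1, b2, b3, b4, -, b6, -, -, -, -, -, -⟩ := id h₂
  have c1 := h₁.cur_cont
  have c2 := h₂.cur_cont
  have c3 := h₁.du_cont
  have c4 := h₂.du_cont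
  rw [intervalIntegral.integral_eq_sub_of_hasDerivAt_of_le (by norm_num)
    (f := fun ξ => (φ₁.cur ξ / (μ₁ * S₁) - φ₂.cur ξ / (μ₂ * S₂)) * (φ₁.α ξ - φ₂.α ξ)
      + S₁ * √S₁ / (4 * r ^ 2) * (((1 - ξ ^ 2) * (φ₁.f ξ ^ 2 - 1) - (1 - ξ ^ 2) * (φ₂.f ξ ^ 2 - 1))
        * (φ₁.du ξ - φ₂.du ξ))) (by fun_prop) ?_ (i2.sub i1)]
  · simp [cur]
  · intro ξ hξ
    refine (((((h₁.hasDerivAt_cur hξ).div_const (μ₁ * S₁)).sub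
      ((h₂.hasDerivAt_cur hξ).div_const (μ₂ * S₂))).mul
      ((h₁.α_deriv ξ hξ).sub (h₂.α_deriv ξ hξ))).add
      ((((h₁.hasDerivAt_u hξ).sub (h₂.hasDerivAt_u hξ)).mul
      ((h₁.hasDerivAt_du hξ).sub (h₂.hasDerivAt_du hξ))).const_mul _)).congr_deriv ?_
    simp only [Pi.sub_apply, energyForm, energyRate]
    ring

/-- The integrand in the normalized variables. -/
theorem energyForm_eq (hr : r ≠ 0) {ξ t s : ℝ} (ht : t ^ 2 = 1 - ξ ^ 2) (hs : s ≠ 0)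
    (hp : s ^ 2 = p) (hμ₁ : μ₁ ≠ 0) (hμ₂ : μ₂ ≠ 0) (hS₁ : 0 < S₁) (hS₂ : 0 < S₂) :
    energyForm φ₁ φ₂ r S₁ S₂ μ₁ μ₂ ξ =
      (1 / S₁ * (r * φ₁.ar ξ) - 1 / S₂ * (r * φ₂.ar ξ)) * (r * φ₁.ar ξ - r * φ₂.ar ξ)
      + (p / μ₁ * (1 / S₁) * φ₁.f ξ ^ 2 * (t * (φ₁.ax ξ / s))
        - p / μ₂ * (1 / S₂) * φ₂.f ξ ^ 2 * (t * (φ₂.ax ξ / s))) * (t * (φ₁.ax ξ / s - φ₂.ax ξ / s))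
      + (μ₁ / p * (S₁ * √S₁) * (t * (s * φ₁.fr ξ)) - μ₂ / p * (S₂ * √S₂) * (t * (s * φ₂.fr ξ)))
        * (t * (s * φ₁.fr ξ) - t * (s * φ₂.fr ξ))
      - t * (φ₁.f ξ - φ₂.f ξ) / r * r * (p / μ₁ * (1 / √S₁) / 4 * φ₁.f ξ * (t * (φ₁.ax ξ / s) ^ 2)
        - p / μ₂ * (1 / √S₂) / 4 * φ₂.f ξ * (t * (φ₂.ax ξ / s) ^ 2))
      + S₁ * √S₁ * ((φ₁.du ξ - φ₂.du ξ) / r) ^ 2 / 4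
      - S₁ * √S₁ / 4 * (t * (φ₁.f ξ - φ₂.f ξ) / r) ^ 2 * (φ₁.ddu ξ + φ₂.ddu ξ)
      - (S₁ * √S₁ - S₂ * √S₂) / 2
        * (t * (φ₁.f ξ - φ₂.f ξ) / r * (t * (φ₂.f ξ * (φ₂.ddu ξ / r)))) := by
  have h1 := Real.sqrt_pos.2 hS₁
  have h2 := Real.sqrt_pos.2 hS₂
  subst hp
  unfold energyForm cur
  rw [← ht]
  field_simp

theorem diffDensity_eq {ξ t s : ℝ} (ht : t ^ 2 = 1 - ξ ^ 2) (hp : s ^ 2 = p) :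
    diffDensity φ₁ φ₂ r p ξ = (r * φ₁.ar ξ - r * φ₂.ar ξ) ^ 2
      + (t * (φ₁.ax ξ / s - φ₂.ax ξ / s)) ^ 2 + (t * (s * φ₁.fr ξ) - t * (s * φ₂.fr ξ)) ^ 2
      + (t * (φ₁.f ξ - φ₂.f ξ) / r) ^ 2 + ((φ₁.du ξ - φ₂.du ξ) / r) ^ 2 := by
  subst hp
  unfold diffDensity
  rw [← ht]
  ring

/-- The Hardy inequality for `u₁ - u₂ = (1-ξ²)(f₁² - f₂²)`. -/
theorem two_mul_integral_diff_le (h₁ : φ₁.Regular) (h₂ : φ₂.Regular)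
    (hf₁ : ∀ ξ ∈ Ioo (-1 : ℝ) 1, 1 / 2 ≤ φ₁.f ξ) (hf₂ : ∀ ξ ∈ Ioo (-1 : ℝ) 1, 1 / 2 ≤ φ₂.f ξ) :
    2 * ∫ ξ in (-1 : ℝ)..1, (1 - ξ ^ 2) * (φ₁.f ξ - φ₂.f ξ) ^ 2
      ≤ ∫ ξ in (-1 : ℝ)..1, (φ₁.du ξ - φ₂.du ξ) ^ 2 := by
  have a1 := h₁.f_cont
  have a2 := h₂.f_cont
  have b1 := h₁.fx_cont
  have b2 := h₂.fx_cont
  have hardy := two_mul_integral_le_integral_sq (G := fun ξ => φ₁.f ξ ^ 2 - φ₂.f ξ ^ 2)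
    (G' := fun ξ => 2 * φ₁.f ξ * φ₁.fx ξ - 2 * φ₂.f ξ * φ₂.fx ξ) (by fun_prop) (by fun_prop)
    (fun ξ hξ => (((h₁.f_deriv ξ hξ).pow 2).sub ((h₂.f_deriv ξ hξ).pow 2)).congr_deriv
      (by simp))
  have e : ∀ ξ, (-2 * ξ * (φ₁.f ξ ^ 2 - φ₂.f ξ ^ 2)
      + (1 - ξ ^ 2) * (2 * φ₁.f ξ * φ₁.fx ξ - 2 * φ₂.f ξ * φ₂.fx ξ)) ^ 2
      = (φ₁.du ξ - φ₂.du ξ) ^ 2 := fun ξ => by unfold du; ring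
  simp only [e] at hardy
  refine le_trans (mul_le_mul_of_nonneg_left ?_ (by norm_num)) hardy
  refine intervalIntegral.integral_mono_on_of_le_Ioo (by norm_num)
    (intervalIntegrable_of_continuousOn (by fun_prop))
    (intervalIntegrable_of_continuousOn (by fun_prop)) fun ξ hξ => ?_
  have hq : 0 ≤ 1 - ξ ^ 2 := by nlinarith [hξ.1, hξ.2]
  refine mul_le_mul_of_nonneg_left ?_ hq
  have h3 : 1 ≤ (φ₁.f ξ + φ₂.f ξ) ^ 2 := by nlinarith [hf₁ ξ hξ, hf₂ ξ hξ]
  have : (φ₁.f ξ ^ 2 - φ₂.f ξ ^ 2) ^ 2 = (φ₁.f ξ - φ₂.f ξ) ^ 2 * (φ₁.f ξ + φ₂.f ξ) ^ 2 := by ring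
  rw [this]
  exact le_mul_of_one_le_right (sq_nonneg _) h3

set_option maxHeartbeats 400000 in
/-- The energy inequality at a fixed radius: the derivative of the energy dominates the squared
differences of the fields, up to an error quadratic in the difference of the metrics. -/
theorem integral_energyRate_ge {r p S₁ S₂ μ₁ μ₂ L T k : ℝ} (h₁ : φ₁.Regular) (h₂ : φ₂.Regular)
    (b₁ : φ₁.Bounded (10 * L ^ 3) k r p) (b₂ : φ₂.Bounded (10 * L ^ 3) k r p) (hr : 0 < r)
    (hk : 0 ≤ k) (hrk : 192000 * L ^ 11 * (r * k) ≤ 1)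
    (hL : 1 ≤ L) (hp : 0 < p) (hS₁ : L⁻¹ ≤ S₁)
    (hS₂ : L⁻¹ ≤ S₂) (hS₁' : S₁ ≤ 1) (hS₂' : S₂ ≤ 1) (hμ₁ : p / 2 ≤ μ₁) (hμ₂ : p / 2 ≤ μ₂)
    (hμ₁' : μ₁ ≤ p) (hμ₂' : μ₂ ≤ p) (dS : |S₁ - S₂| ≤ T)
    (dSi : |1 / S₁ - 1 / S₂| ≤ L ^ 2 * T) (dn : |p / μ₁ - p / μ₂| ≤ 8 * T)
    (du : |μ₁ / p - μ₂ / p| ≤ 2 * T) :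
    1 / (16 * L ^ 2) * ∫ ξ in (-1 : ℝ)..1, diffDensity φ₁ φ₂ r p ξ
      ≤ (∫ ξ in (-1 : ℝ)..1, energyRate φ₁ φ₂ r S₁ S₂ μ₁ μ₂ ξ)
        + 2400000000 * L ^ 20 * (T ^ 2 * k ^ 2) := by
  have hL0 : 0 < L := by linarith
  have hT : 0 ≤ T := (abs_nonneg _).trans dS
  obtain ⟨⟨c1, c2, c3, c4⟩, ⟨c5, c6, c7⟩, d1, d2, d3, d4, d5⟩ :=
    energy_coefficients hL hp hS₁ hS₂ hS₁' hS₂' hμ₁ hμ₂ hμ₁' hμ₂' dS dSi dn du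
  have s1 : 0 < S₁ := (inv_pos.2 hL0).trans_le hS₁
  have s2 : 0 < S₂ := (inv_pos.2 hL0).trans_le hS₂
  have m1 : 0 < μ₁ := by linarith
  have m2 : 0 < μ₂ := by linarith
  set H := 10 * L ^ 3 with hH
  set κ := 1 / (2 * L ^ 2) with hκ
  have hκ0 : 0 < κ := by positivity
  have L3 : 1 ≤ L ^ 3 := one_le_pow₀ hL
  have hH1 : 1 ≤ H := by linarith
  have L11 : 1 ≤ L ^ 11 := one_le_pow₀ hL
  have hκ1 : κ ≤ 1 := by
    rw [hκ, div_le_one (by positivity)]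
    have : 1 ≤ L ^ 2 := one_le_pow₀ hL
    linarith
  set ε := r * k with hε
  have hε0 : 0 ≤ ε := by positivity
  have hε1 : ε ≤ 1 := by nlinarith
  -- the hypothesis on `r k` makes the error terms linear in `ε` absorbable by the coercive terms
  have hHε : 6 * H ^ 3 * ε ≤ κ / 16 := by
    rw [hκ, hH, div_div, le_div_iff₀ (by positivity)]
    calc _ = 192000 * L ^ 11 * ε := by ring
      _ ≤ 1 := hrk
  have hR : 576 * (H ^ 6 / κ * (T ^ 2 * k ^ 2)) = 1152000000 * L ^ 20 * (T ^ 2 * k ^ 2) := by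
    rw [hκ, hH]; field_simp; ring
  set R := 1152000000 * L ^ 20 * (T ^ 2 * k ^ 2) with hRdef
  have hR0 : 0 ≤ R := by positivity
  set s := √p with hs
  have hs0 : 0 < s := Real.sqrt_pos.2 hp
  have hsp : s ^ 2 = p := Real.sq_sqrt hp.le
  -- pointwise inequality, up to the combination controlled by the Hardy inequality
  have point : ∀ ξ ∈ Ioo (-1 : ℝ) 1,
      κ / 8 * (diffDensity φ₁ φ₂ r p ξ + (1 / r ^ 2 * (φ₁.du ξ - φ₂.du ξ) ^ 2
        - 2 / r ^ 2 * ((1 - ξ ^ 2) * (φ₁.f ξ - φ₂.f ξ) ^ 2))) - R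
        ≤ energyForm φ₁ φ₂ r S₁ S₂ μ₁ μ₂ ξ := by
    intro ξ hξ
    have hq : 0 ≤ 1 - ξ ^ 2 := by nlinarith [hξ.1, hξ.2]
    set t := √(1 - ξ ^ 2) with ht
    have ht0 : 0 ≤ t := Real.sqrt_nonneg _
    have ht2 : t ^ 2 = 1 - ξ ^ 2 := Real.sq_sqrt hq
    have ht1 : t ≤ 1 := by rw [ht, Real.sqrt_le_one]; linarith [sq_nonneg ξ]
    have at1 : |t| ≤ 1 := by rw [abs_of_nonneg ht0]; exact ht1
    have ry : ∀ φ : GaugeProfile, φ.Bounded H k r p → |r * (φ.ax ξ / s)| ≤ H * ε := by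
      intro φ hφ
      refine (abs_mul_le_mul (abs_of_pos hr).le (hφ.ax_le ξ hξ)).trans (le_of_eq ?_)
      rw [hε]; ring
    have hdd : ∀ φ : GaugeProfile, φ.Bounded H k r p → |φ.ddu ξ| ≤ H * ε := by
      intro φ hφ
      have h := abs_mul_le_mul (abs_of_pos hr).le (hφ.ddu_le ξ hξ)
      rw [mul_div_cancel₀ _ hr.ne'] at h
      exact h.trans (le_of_eq (by rw [hε]; ring))
    have hz : |t * (s * φ₂.fr ξ)| ≤ H * k :=
      (abs_mul_le_mul at1 (b₂.fr_le ξ hξ)).trans (le_of_eq (by ring))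
    have key := energy_integrand_lower (T := T) (e := (φ₁.du ξ - φ₂.du ξ) / r)
      (d := t * (φ₁.f ξ - φ₂.f ξ) / r) (x₁ := r * φ₁.ar ξ) (z₁ := t * (s * φ₁.fr ξ))
      hH1 hκ0 hε0 hε1 hT hk c1 c2 c3 c4 c5 c6 c7 d1 d2 d3 d4 d5
      (b₂.ar_le ξ hξ) (b₂.ax_le ξ hξ) hz (b₂.ddu_le ξ hξ) (ry φ₁ b₁) (ry φ₂ b₂)
      (U := φ₁.ddu ξ + φ₂.ddu ξ)
      ((abs_add_le _ _).trans (by linarith [hdd φ₁ b₁, hdd φ₂ b₂]))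
      (b₁.f_low ξ hξ) (b₁.f_le ξ hξ) (b₂.f_low ξ hξ) (b₂.f_le ξ hξ) ht0 ht1
      (mul_div_cancel₀ _ hr.ne')
    rw [← energyForm_eq r p S₁ S₂ μ₁ μ₂ hr.ne' ht2 hs0.ne' hsp m1.ne' m2.ne' s1 s2, hR] at key
    refine le_trans ?_ key
    rw [diffDensity_eq r p ht2 hsp]
    have e1 : 1 / r ^ 2 * (φ₁.du ξ - φ₂.du ξ) ^ 2 = ((φ₁.du ξ - φ₂.du ξ) / r) ^ 2 := by ring
    have e2 : 2 / r ^ 2 * ((1 - ξ ^ 2) * (φ₁.f ξ - φ₂.f ξ) ^ 2)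
        = 2 * (t * (φ₁.f ξ - φ₂.f ξ) / r) ^ 2 := by rw [← ht2]; ring
    rw [e1, e2]
    generalize (φ₁.du ξ - φ₂.du ξ) / r = e
    generalize t * (φ₁.f ξ - φ₂.f ξ) / r = d
    generalize r * φ₁.ar ξ - r * φ₂.ar ξ = a
    generalize t * (φ₁.ax ξ / s - φ₂.ax ξ / s) = b
    generalize t * (s * φ₁.fr ξ) - t * (s * φ₂.fr ξ) = c
    have w : 6 * H ^ 3 * ε * (b ^ 2 + d ^ 2) ≤ κ / 16 * (b ^ 2 + d ^ 2) :=
      mul_le_mul_of_nonneg_right hHε (by positivity)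
    have w1 : κ * a ^ 2 ≤ a ^ 2 := mul_le_of_le_one_left (sq_nonneg _) hκ1
    have w2 : κ * b ^ 2 ≤ b ^ 2 := mul_le_of_le_one_left (sq_nonneg _) hκ1
    have w3 : 0 ≤ κ * c ^ 2 := by positivity
    have w4 : 0 ≤ κ * a ^ 2 := by positivity
    linarith
  have a1 := h₁.f_cont
  have a2 := h₂.f_cont
  have a3 := h₁.du_cont
  have a4 := h₂.du_cont
  have iN := intervalIntegrable_of_continuousOn (diffDensity_cont r p h₁ h₂)
  have i1 : IntervalIntegrable (fun ξ => 1 / r ^ 2 * (φ₁.du ξ - φ₂.du ξ) ^ 2)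
      MeasureTheory.volume (-1) 1 := intervalIntegrable_of_continuousOn (by fun_prop)
  have i2 : IntervalIntegrable (fun ξ => 2 / r ^ 2 * ((1 - ξ ^ 2) * (φ₁.f ξ - φ₂.f ξ) ^ 2))
      MeasureTheory.volume (-1) 1 := intervalIntegrable_of_continuousOn (by fun_prop)
  have mono := intervalIntegral.integral_mono_on_of_le_Ioo (by norm_num)
    (((iN.add (i1.sub i2)).const_mul (κ / 8)).sub intervalIntegrable_const)
    (intervalIntegrable_of_continuousOn (energyForm_cont r S₁ S₂ μ₁ μ₂ h₁ h₂)) point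
  rw [intervalIntegral.integral_sub ((iN.add (i1.sub i2)).const_mul (κ / 8)) intervalIntegrable_const,
    intervalIntegral.integral_const_mul, intervalIntegral.integral_add iN (i1.sub i2),
    intervalIntegral.integral_sub i1 i2, intervalIntegral.integral_const_mul,
    intervalIntegral.integral_const_mul, intervalIntegral.integral_const,
    ← integral_energyRate_eq r S₁ S₂ μ₁ μ₂ h₁ h₂] at mono
  have hardy := mul_le_mul_of_nonneg_left (two_mul_integral_diff_le h₁ h₂ b₁.f_low b₂.f_low)
    (show 0 ≤ κ / 8 * (1 / r ^ 2) by positivity)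
  have e : 1 / (16 * L ^ 2) = κ / 8 := by rw [hκ]; field_simp; norm_num
  rw [e]
  have e2 : (2 : ℝ) / r ^ 2 = 1 / r ^ 2 * 2 := by ring
  rw [e2, smul_eq_mul] at mono
  generalize 1 / r ^ 2 = v at mono hardy
  have : 0 ≤ L ^ 20 * (T ^ 2 * k ^ 2) := by positivity
  linarith

end GaugeProfile

/-! ### The field equations in divergence form -/

/-- The gauge field profile of `F` at radius `r`, for fields smooth on `r ≥ r₀`. -/
noncomputable def profile (r₀ : ℝ) (F : Fields) (r : ℝ) : GaugeProfile where
  α := F.α r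
  f := F.f r
  ar := stripDr r₀ F.α r
  ax := stripDxi r₀ F.α r
  axx := stripDxi r₀ (stripDxi r₀ F.α) r
  fr := stripDr r₀ F.f r
  fx := stripDxi r₀ F.f r
  fxx := stripDxi r₀ (stripDxi r₀ F.f) r

theorem integral_congr_Ioo {g h : ℝ → ℝ} (e : ∀ ξ ∈ Ioo (-1 : ℝ) 1, g ξ = h ξ) :
    ∫ ξ in (-1 : ℝ)..1, g ξ = ∫ ξ in (-1 : ℝ)..1, h ξ := by
  refine intervalIntegral.integral_congr_uIoo fun ξ hξ => e ξ ?_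
  rwa [uIoo_of_le (by norm_num)] at hξ

theorem one_sub_sq_nonneg {ξ : ℝ} (hξ : ξ ∈ Icc (-1 : ℝ) 1) : 0 ≤ 1 - ξ ^ 2 := by
  nlinarith [hξ.1, hξ.2]

theorem one_sub_sq_pos {ξ : ℝ} (hξ : ξ ∈ Ioo (-1 : ℝ) 1) : 0 < 1 - ξ ^ 2 := by
  nlinarith [hξ.1, hξ.2]

theorem Fields.ω_sq (F : Fields) (r : ℝ) {ξ : ℝ} (hξ : ξ ∈ Icc (-1 : ℝ) 1) :
    F.ω r ξ ^ 2 = (1 - ξ ^ 2) * F.f r ξ ^ 2 := by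
  unfold Fields.ω; rw [mul_pow, Real.sq_sqrt (one_sub_sq_nonneg hξ)]

namespace IsSolutionOn

variable {ℓ r₀ : ℝ} {F : Fields}

theorem profile_regular (h : IsSolutionOn ℓ r₀ F) {r : ℝ} (hr : r₀ ≤ r) :
    (profile r₀ F r).Regular := by
  have ha : SmoothOnStrip r₀ F.α := h.smooth_α
  have hf : SmoothOnStrip r₀ F.f := h.smooth_f
  exact ⟨ha.continuousOn_slice hr, hf.continuousOn_slice hr, ha.stripDr.continuousOn_slice hr,
    ha.stripDxi.continuousOn_slice hr, ha.stripDxi.stripDxi.continuousOn_slice hr,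
    hf.stripDr.continuousOn_slice hr, hf.stripDxi.continuousOn_slice hr,
    hf.stripDxi.stripDxi.continuousOn_slice hr, fun ξ hξ => ha.hasDerivAt_angular hr hξ,
    fun ξ hξ => ha.stripDxi.hasDerivAt_angular hr hξ, fun ξ hξ => hf.hasDerivAt_angular hr hξ,
    fun ξ hξ => hf.stripDxi.hasDerivAt_angular hr hξ⟩

theorem m_differentiableAt (h : IsSolutionOn ℓ r₀ F) {r : ℝ} (hr : r₀ < r) :
    DifferentiableAt ℝ F.m r :=
  (h.smooth_m.differentiableOn (by simp) r hr.le).differentiableAt (Ici_mem_nhds hr)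

theorem S_differentiableAt (h : IsSolutionOn ℓ r₀ F) {r : ℝ} (hr : r₀ < r) :
    DifferentiableAt ℝ F.S r :=
  (h.smooth_S.differentiableOn (by simp) r hr.le).differentiableAt (Ici_mem_nhds hr)

theorem hasDerivAt_ω_radial (h : IsSolutionOn ℓ r₀ F) {r ξ : ℝ} (hr : r₀ < r)
    (hξ : ξ ∈ Icc (-1 : ℝ) 1) :
    HasDerivAt (fun r => F.ω r ξ) (√(1 - ξ ^ 2) * (profile r₀ F r).fr ξ) r :=
  (SmoothOnStrip.hasDerivAt_radial h.smooth_f hr hξ).const_mul _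

theorem dr_ω_eq (h : IsSolutionOn ℓ r₀ F) {r ξ : ℝ} (hr : r₀ < r) (hξ : ξ ∈ Icc (-1 : ℝ) 1) :
    dr F.ω r ξ = √(1 - ξ ^ 2) * (profile r₀ F r).fr ξ :=
  (h.hasDerivAt_ω_radial hr hξ).deriv

theorem dr_dr_ω_eq (h : IsSolutionOn ℓ r₀ F) {r ξ : ℝ} (hr : r₀ < r) (hξ : ξ ∈ Icc (-1 : ℝ) 1) :
    dr (dr F.ω) r ξ = √(1 - ξ ^ 2) * stripDr r₀ (stripDr r₀ F.f) r ξ := by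
  have hf : SmoothOnStrip r₀ F.f := h.smooth_f
  refine (((hf.stripDr.hasDerivAt_radial hr hξ).const_mul √(1 - ξ ^ 2)).congr_of_eventuallyEq
    ?_).deriv
  filter_upwards [Ioi_mem_nhds hr] with s hs using h.dr_ω_eq hs hξ

theorem dxi_ω_sq_eq (h : IsSolutionOn ℓ r₀ F) {r ξ : ℝ} (hr : r₀ ≤ r) (hξ : ξ ∈ Ioo (-1 : ℝ) 1) :
    dxi (fun r' ξ' => F.ω r' ξ' ^ 2 + ξ' ^ 2) r ξ = (profile r₀ F r).du ξ := by
  refine ((((h.profile_regular hr).hasDerivAt_u hξ).add_const 1).congr_of_eventuallyEq ?_).deriv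
  filter_upwards [Ioo_mem_nhds hξ.1 hξ.2] with s hs
  rw [F.ω_sq r (Ioo_subset_Icc_self hs)]
  simp only [profile]; ring

theorem dxi_dxi_ω_sq_eq (h : IsSolutionOn ℓ r₀ F) {r ξ : ℝ} (hr : r₀ ≤ r)
    (hξ : ξ ∈ Ioo (-1 : ℝ) 1) :
    dxi (dxi (fun r' ξ' => F.ω r' ξ' ^ 2 + ξ' ^ 2)) r ξ = (profile r₀ F r).ddu ξ := by
  refine (((h.profile_regular hr).hasDerivAt_du hξ).congr_of_eventuallyEq ?_).deriv
  filter_upwards [Ioo_mem_nhds hξ.1 hξ.2] with s hs using h.dxi_ω_sq_eq hr hs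

theorem dxi_current_eq (h : IsSolutionOn ℓ r₀ F) {r ξ : ℝ} (hr : r₀ ≤ r)
    (hξ : ξ ∈ Ioo (-1 : ℝ) 1) :
    dxi (fun r' ξ' => F.ω r' ξ' ^ 2 * dxi F.α r' ξ') r ξ = (profile r₀ F r).dcur ξ := by
  refine (((h.profile_regular hr).hasDerivAt_cur hξ).congr_of_eventuallyEq ?_).deriv
  filter_upwards [Ioo_mem_nhds hξ.1 hξ.2] with s hs
  rw [F.ω_sq r (Ioo_subset_Icc_self hs), SmoothOnStrip.dxi_eq h.smooth_α hr hs]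
  rfl

theorem η_eq (h : IsSolutionOn ℓ r₀ F) {r : ℝ} (hr : r₀ < r) :
    F.η r = 1 / 2 * ∫ ξ in (-1 : ℝ)..1, (profile r₀ F r).ar ξ ^ 2 := by
  unfold Fields.η
  congr 1
  exact integral_congr_Ioo fun ξ hξ => by
    rw [SmoothOnStrip.dr_eq h.smooth_α hr (Ioo_subset_Icc_self hξ)]; rfl

theorem ζ_eq (h : IsSolutionOn ℓ r₀ F) {r : ℝ} (hr : r₀ ≤ r) :
    F.ζ r = 1 / 2 * ∫ ξ in (-1 : ℝ)..1,
      (1 - ξ ^ 2) * (profile r₀ F r).f ξ ^ 2 * (profile r₀ F r).ax ξ ^ 2 := by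
  unfold Fields.ζ
  congr 1
  exact integral_congr_Ioo fun ξ hξ => by
    rw [SmoothOnStrip.dxi_eq h.smooth_α hr hξ, F.ω_sq r (Ioo_subset_Icc_self hξ)]; rfl

theorem G_eq (h : IsSolutionOn ℓ r₀ F) {r : ℝ} (hr : r₀ < r) :
    F.G r = 1 / 2 * ∫ ξ in (-1 : ℝ)..1, (1 - ξ ^ 2) * (profile r₀ F r).fr ξ ^ 2 := by
  unfold Fields.G
  congr 1
  exact integral_congr_Ioo fun ξ hξ => by
    rw [h.dr_ω_eq hr (Ioo_subset_Icc_self hξ), mul_pow,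
      Real.sq_sqrt (one_sub_sq_nonneg (Ioo_subset_Icc_self hξ))]

theorem P_eq (h : IsSolutionOn ℓ r₀ F) {r : ℝ} (hr : r₀ ≤ r) :
    F.P r = 1 / 8 * ∫ ξ in (-1 : ℝ)..1, (profile r₀ F r).du ξ ^ 2 := by
  unfold Fields.P
  congr 1
  exact integral_congr_Ioo fun ξ hξ => by rw [h.dxi_ω_sq_eq hr hξ]

/-- The electric Yang-Mills equation in divergence form. -/
theorem hasDerivAt_electric_flux (h : IsSolutionOn ℓ r₀ F) {r ξ : ℝ} (h0 : 0 < r) (hr : r₀ < r)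
    (hξ : ξ ∈ Ioo (-1 : ℝ) 1) :
    HasDerivAt (fun r => r ^ 2 * (profile r₀ F r).ar ξ / F.S r)
      (-((profile r₀ F r).dcur ξ / (F.μ ℓ r * F.S r))) r := by
  have hξ' := Ioo_subset_Icc_self hξ
  have ha : SmoothOnStrip r₀ F.α := h.smooth_α
  have hS := h.S_pos r hr.le
  have hμ := h.μ_pos r hr
  have e := (h.yangMills r hr ξ hξ).1
  rw [ha.dr_dr_eq hr hξ', ha.dr_eq hr hξ', h.dxi_current_eq hr.le hξ] at e
  have h1 := (((hasDerivAt_id r).pow 2).mul (ha.stripDr.hasDerivAt_radial hr hξ')).div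
    (h.S_differentiableAt hr).hasDerivAt hS.ne'
  refine h1.congr_deriv ?_
  simp only [Pi.mul_apply, Pi.pow_apply, id]
  push_cast
  have e2 : (profile r₀ F r).dcur ξ = -(r ^ 2 * F.μ ℓ r * stripDr r₀ (stripDr r₀ F.α) r ξ
      + r ^ 2 * F.μ ℓ r * (2 / r - deriv F.S r / F.S r) * stripDr r₀ F.α r ξ) := by linarith
  rw [e2]
  field_simp
  ring

theorem hasDerivAt_μ (h : IsSolutionOn ℓ r₀ F) {r : ℝ} (h0 : 0 < r) (hr : r₀ < r) :
    HasDerivAt (F.μ ℓ) (-(2 * deriv F.m r / r) + 2 * F.m r / r ^ 2 + 2 * r / ℓ ^ 2) r := by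
  have h1 := (((((h.m_differentiableAt hr).hasDerivAt.const_mul 2).div (hasDerivAt_id r)
    h0.ne').const_sub 1)).add (((hasDerivAt_id r).pow 2).div_const (ℓ ^ 2))
  refine h1.congr_deriv ?_
  simp only [id]
  field_simp
  push_cast
  ring

/-- The magnetic Yang-Mills equation in divergence form; the Einstein equations turn the coefficient
of `ω_r` into a logarithmic derivative of `μ S^{3/2}`. -/
theorem hasDerivAt_magnetic_flux (h : IsSolutionOn ℓ r₀ F) {r ξ : ℝ} (hℓ : 0 < ℓ) (h0 : 0 < r)
    (hr : r₀ < r) (hξ : ξ ∈ Ioo (-1 : ℝ) 1) :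
    HasDerivAt (fun r => F.μ ℓ r * (F.S r * √(F.S r)) * (profile r₀ F r).fr ξ)
      (-((profile r₀ F r).f ξ * (profile r₀ F r).ax ξ ^ 2 / (4 * F.μ ℓ r * √(F.S r))
          + F.S r * √(F.S r) / (2 * r ^ 2) * ((profile r₀ F r).f ξ * (profile r₀ F r).ddu ξ))) r := by
  have hξ' := Ioo_subset_Icc_self hξ
  have hf : SmoothOnStrip r₀ F.f := h.smooth_f
  have hS := h.S_pos r hr.le
  have hμ := h.μ_pos r hr
  have hs := Real.sqrt_pos.2 hS
  have hss := Real.sq_sqrt hS.le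
  have hq := Real.sqrt_pos.2 (one_sub_sq_pos hξ)
  obtain ⟨e1, e2⟩ := h.einstein r hr
  have e := (h.yangMills r hr ξ hξ).2
  rw [h.dr_dr_ω_eq hr hξ', h.dr_ω_eq hr hξ', h.dxi_dxi_ω_sq_eq hr.le hξ,
    SmoothOnStrip.dxi_eq h.smooth_α hr.le hξ] at e
  have hω : F.ω r ξ = √(1 - ξ ^ 2) * (profile r₀ F r).f ξ := rfl
  rw [hω] at e
  have hSd := (h.S_differentiableAt hr).hasDerivAt
  have h1 := ((h.hasDerivAt_μ h0 hr).mul (hSd.mul (hSd.sqrt hS.ne'))).mul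
    (hf.stripDr.hasDerivAt_radial hr hξ')
  refine h1.congr_deriv ?_
  rw [div_eq_iff hS.ne'] at e2
  have e3 : r ^ 2 * F.μ ℓ r * stripDr r₀ (stripDr r₀ F.f) r ξ
      = -((2 * F.m r - 3 * F.P r / r + 2 * r ^ 3 / ℓ ^ 2 - 3 * r ^ 3 * F.η r / (4 * F.S r ^ 2))
          * (profile r₀ F r).fr ξ
        + r ^ 2 * (profile r₀ F r).f ξ / (4 * F.μ ℓ r * F.S r ^ 2) * stripDxi r₀ F.α r ξ ^ 2
        + (profile r₀ F r).f ξ / 2 * (profile r₀ F r).ddu ξ) := by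
    refine mul_left_cancel₀ hq.ne' ?_
    linear_combination -e
  have e4 : stripDr r₀ (stripDr r₀ F.f) r ξ
      = -((2 * F.m r - 3 * F.P r / r + 2 * r ^ 3 / ℓ ^ 2 - 3 * r ^ 3 * F.η r / (4 * F.S r ^ 2))
          * (profile r₀ F r).fr ξ
        + r ^ 2 * (profile r₀ F r).f ξ / (4 * F.μ ℓ r * F.S r ^ 2) * stripDxi r₀ F.α r ξ ^ 2
        + (profile r₀ F r).f ξ / 2 * (profile r₀ F r).ddu ξ) / (r ^ 2 * F.μ ℓ r) := by
    rw [eq_div_iff (by positivity), ← e3]; ring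
  simp only [Pi.mul_apply]
  rw [e4, e1, e2]
  have e5 : (profile r₀ F r).ax ξ = stripDxi r₀ F.α r ξ := rfl
  have e6 : stripDr r₀ F.f r ξ = (profile r₀ F r).fr ξ := rfl
  rw [e5, e6]
  generalize (profile r₀ F r).ddu ξ = u
  generalize (profile r₀ F r).fr ξ = fr
  generalize (profile r₀ F r).f ξ = f
  generalize stripDxi r₀ F.α r ξ = ax
  generalize F.P r = P
  generalize F.η r = η
  generalize F.G r = G
  generalize F.ζ r = ζ
  generalize F.m r = m
  generalize F.μ ℓ r = μ at hμ ⊢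
  rw [← hss]
  rw [Real.sqrt_sq hs.le]
  generalize √(F.S r) = s at hs ⊢
  field_simp
  ring

end IsSolutionOn

/-! ### Pointwise bounds for the gauge fields -/

theorem abs_integral_le_of_abs_le {g : ℝ → ℝ} {c : ℝ} (h : ∀ ξ ∈ Ioo (-1 : ℝ) 1, |g ξ| ≤ c) :
    |∫ ξ in (-1 : ℝ)..1, g ξ| ≤ 2 * c := by
  have hne : ∀ᵐ ξ : ℝ ∂MeasureTheory.volume, ξ ≠ 1 := by
    simp [MeasureTheory.ae_iff, MeasureTheory.measure_singleton]
  have := intervalIntegral.norm_integral_le_of_norm_le_const_ae (a := -1) (b := 1) (f := g) (C := c) (by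
    filter_upwards [hne] with ξ hξ1 hξ
    rw [uIoc_of_le (by norm_num)] at hξ
    exact h ξ ⟨hξ.1, lt_of_le_of_ne hξ.2 hξ1⟩)
  rw [Real.norm_eq_abs] at this
  refine this.trans (le_of_eq ?_)
  norm_num
  ring

theorem pAds_le_sq {ℓ r : ℝ} (hℓ : 0 < ℓ) (hr : 0 < r) : pAds ℓ r ≤ (1 + r / ℓ) ^ 2 := by
  have : 0 < r / ℓ := by positivity
  unfold pAds; nlinarith

theorem sq_le_two_mul_pAds (ℓ r : ℝ) : (1 + r / ℓ) ^ 2 ≤ 2 * pAds ℓ r := by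
  unfold pAds; nlinarith [sq_nonneg (1 - r / ℓ)]

theorem sqrt_pAds_le {ℓ r : ℝ} (hℓ : 0 < ℓ) (hr : 0 < r) : √(pAds ℓ r) ≤ 1 + r / ℓ :=
  Real.sqrt_le_iff.2 ⟨by positivity, pAds_le_sq hℓ hr⟩

theorem le_two_mul_sqrt_pAds {ℓ r : ℝ} : 1 + r / ℓ ≤ 2 * √(pAds ℓ r) := by
  have h := sq_le_two_mul_pAds ℓ r
  have h1 := Real.sq_sqrt (pAds_pos ℓ r).le
  have h2 := Real.sqrt_nonneg (pAds ℓ r)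
  nlinarith [pAds_pos ℓ r]

theorem kap_nonneg {ℓ r : ℝ} (hr : 0 < r) : 0 ≤ kap ℓ r := by
  unfold kap; positivity

theorem mul_kap_le {ℓ r : ℝ} (hℓ : 0 < ℓ) (hr : 0 < r) : r * kap ℓ r ≤ ℓ ^ 2 := by
  have h1 := div_one_add_le_radius hℓ hr
  have h0 : 0 ≤ r / (1 + r / ℓ) := by positivity
  have e : r * kap ℓ r = (r / (1 + r / ℓ)) ^ 2 := by
    unfold kap; rw [div_pow]; ring
  rw [e]
  exact pow_le_pow_left₀ h0 h1 2

/-- Bounds on the gauge fields that make the sources of the Einstein equations `O(kap²)`. -/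
structure FieldBounds (K ℓ : ℝ) (F : Fields) : Prop where
  dr_α : ∀ r, 0 < r → ∀ ξ ∈ Ioo (-1 : ℝ) 1, |dr F.α r ξ| ≤ K / (1 + r / ℓ) ^ 2
  dxi_α : ∀ r, 0 < r → ∀ ξ ∈ Ioo (-1 : ℝ) 1, |dxi F.α r ξ| ≤ K * (r / (1 + r / ℓ))
  dr_ω : ∀ r, 0 < r → ∀ ξ ∈ Ioo (-1 : ℝ) 1, |dr F.ω r ξ| ≤ K * (r / (1 + r / ℓ) ^ 3)
  ω_le : ∀ r, 0 < r → ∀ ξ ∈ Ioo (-1 : ℝ) 1, |F.ω r ξ| ≤ K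
  dxi_ω : ∀ r, 0 < r → ∀ ξ ∈ Ioo (-1 : ℝ) 1,
    |dxi (fun r' ξ' => F.ω r' ξ' ^ 2 + ξ' ^ 2) r ξ| ≤ K * (r / (1 + r / ℓ)) ^ 2

theorem FieldBounds.gaugeBounds {K ℓ : ℝ} {F : Fields} (h : FieldBounds K ℓ F) (hK : 1 ≤ K)
    (hℓ : 0 < ℓ) : GaugeBounds (2 * K ^ 4) ℓ F := by
  have hK0 : 0 < K := by linarith
  have K24 : K ^ 2 ≤ 2 * K ^ 4 := by
    have : K ^ 2 ≤ K ^ 4 := pow_le_pow_right₀ hK (by norm_num)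
    have : 0 < K ^ 4 := by positivity
    linarith
  refine ⟨fun r hr => ?_, fun r hr => ?_, fun r hr => ?_, fun r hr => ?_⟩
  · have hx : 0 < 1 + r / ℓ := by positivity
    have b := (le_abs_self _).trans (abs_integral_le_of_abs_le fun ξ hξ => abs_sq_le (h.dr_α r hr ξ hξ))
    calc _ ≤ r ^ 2 * (1 / 2 * (2 * (K / (1 + r / ℓ) ^ 2) ^ 2)) := by unfold Fields.η; gcongr
      _ = K ^ 2 * kap ℓ r ^ 2 := by unfold kap; field_simp
      _ ≤ _ := by gcongr
  · have hx : 0 < 1 + r / ℓ := by positivity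
    have hp := pAds_pos ℓ r
    have b := (le_abs_self _).trans (abs_integral_le_of_abs_le fun ξ hξ =>
      abs_mul_le_mul (abs_sq_le (h.ω_le r hr ξ hξ)) (abs_sq_le (h.dxi_α r hr ξ hξ)))
    calc _ ≤ 1 / 2 * (2 * (K ^ 2 * (K * (r / (1 + r / ℓ))) ^ 2)) / ((1 + r / ℓ) ^ 2 / 2) := by
          unfold Fields.ζ
          gcongr
          linarith [sq_le_two_mul_pAds ℓ r]
      _ = _ := by unfold kap; field_simp
  · have hx : 0 < 1 + r / ℓ := by positivity
    have hp := pAds_pos ℓ r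
    have b := (le_abs_self _).trans (abs_integral_le_of_abs_le fun ξ hξ => abs_sq_le (h.dr_ω r hr ξ hξ))
    calc _ ≤ (1 + r / ℓ) ^ 2 * (1 / 2 * (2 * (K * (r / (1 + r / ℓ) ^ 3)) ^ 2)) := by
          unfold Fields.G
          have := pAds_le_sq hℓ hr
          gcongr
          exact mul_nonneg (by norm_num) (intervalIntegral.integral_nonneg (by norm_num)
            fun _ _ => sq_nonneg _)
      _ = K ^ 2 * kap ℓ r ^ 2 := by unfold kap; field_simp
      _ ≤ _ := by gcongr
  · have hx : 0 < 1 + r / ℓ := by positivity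
    have b := (le_abs_self _).trans (abs_integral_le_of_abs_le fun ξ hξ => abs_sq_le (h.dxi_ω r hr ξ hξ))
    calc _ ≤ 1 / 8 * (2 * (K * (r / (1 + r / ℓ)) ^ 2) ^ 2) / r ^ 2 := by
          unfold Fields.P; gcongr
      _ = K ^ 2 / 4 * kap ℓ r ^ 2 := by unfold kap; field_simp; ring
      _ ≤ _ := by gcongr; linarith [sq_nonneg K]

theorem GaugeBounds.mono {K L ℓ : ℝ} {F : Fields} (h : GaugeBounds K ℓ F) (hKL : K ≤ L) :
    GaugeBounds L ℓ F :=
  ⟨fun r hr => (h.η_le r hr).trans (by gcongr), fun r hr => (h.ζ_le r hr).trans (by gcongr),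
    fun r hr => (h.G_le r hr).trans (by gcongr), fun r hr => (h.P_le r hr).trans (by gcongr)⟩

theorem MetricRegular.mono {C L ℓ : ℝ} {F : Fields} (h : MetricRegular C ℓ F) (hC : 0 < C)
    (hCL : C ≤ L) : MetricRegular L ℓ F :=
  ⟨h.m_diff, h.S_diff, fun r hr => (inv_anti₀ hC hCL).trans (h.S_low r hr), h.μ_pos, h.einstein,
    h.m_zero, h.S_lim⟩

theorem HasAsymptotics.tendsto_S {F : Fields} {D : AsymptoticData} (h : HasAsymptotics F D) :
    Tendsto F.S atTop (𝓝 1) := by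
  have h0 : Tendsto (fun r : ℝ => 1 / r ^ 4) atTop (𝓝 0) :=
    tendsto_const_nhds.div_atTop (tendsto_pow_atTop (by norm_num))
  have := (h.S_exp.trans_tendsto h0).add_const 1
  simpa using this

theorem IsGloballyRegular.metricRegular {ℓ C : ℝ} {F : Fields} {D : AsymptoticData}
    (h : IsGloballyRegular ℓ F D) (hS : ∀ r, 0 ≤ r → C⁻¹ ≤ F.S r) : MetricRegular C ℓ F :=
  ⟨fun _ hr => h.sol.m_differentiableAt hr, fun _ hr => h.sol.S_differentiableAt hr,
    fun r hr => hS r hr.le, h.sol.μ_pos, h.sol.einstein, h.m_zero, h.asym.tendsto_S⟩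

theorem HasAsymptotics.tendsto_m {F : Fields} {D : AsymptoticData} (h : HasAsymptotics F D) :
    Tendsto F.m atTop (𝓝 D.M) := by
  have h0 : Tendsto (fun r : ℝ => 1 / r ^ 2) atTop (𝓝 0) :=
    tendsto_const_nhds.div_atTop (tendsto_pow_atTop (by norm_num))
  have h1 : Tendsto (fun r : ℝ => D.m₁ / r) atTop (𝓝 0) := tendsto_const_nhds.div_atTop tendsto_id
  have := ((h.m_exp.trans_tendsto h0).add h1).add_const D.M
  simpa using this

/-- The bounds of the near-AdS regime, in terms of the profile at radius `r`. -/
structure GaugeProfile.Near (φ : GaugeProfile) (C ℓ r : ℝ) : Prop where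
  α_le : ∀ ξ ∈ Ioo (-1 : ℝ) 1, |φ.α ξ| ≤ C * (r / (1 + r / ℓ))
  ax_le : ∀ ξ ∈ Ioo (-1 : ℝ) 1, |φ.ax ξ| ≤ C * (r / (1 + r / ℓ))
  ar_le : ∀ ξ ∈ Ioo (-1 : ℝ) 1, |φ.ar ξ| ≤ C / (1 + r / ℓ) ^ 2
  f_le : ∀ ξ ∈ Ioo (-1 : ℝ) 1, |φ.f ξ - 1| ≤ C * (r / (1 + r / ℓ)) ^ 2
  fx_le : ∀ ξ ∈ Ioo (-1 : ℝ) 1, |φ.fx ξ| ≤ C * (r / (1 + r / ℓ)) ^ 2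
  fxx_le : ∀ ξ ∈ Ioo (-1 : ℝ) 1, |φ.fxx ξ| ≤ C * (r / (1 + r / ℓ)) ^ 2
  fr_le : ∀ ξ ∈ Ioo (-1 : ℝ) 1, |φ.fr ξ| ≤ C * (r / (1 + r / ℓ) ^ 3)

theorem NearAdS.profile_near {C ℓ : ℝ} {F : Fields} (h : NearAdS C ℓ F) (hs : IsSolutionOn ℓ 0 F)
    (hℓ : 0 < ℓ) {r : ℝ} (hr : 0 < r) : (profile 0 F r).Near C ℓ r := by
  have hx : 0 < 1 + r / ℓ := by positivity
  have ha : SmoothOnStrip 0 F.α := hs.smooth_α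
  have hf : SmoothOnStrip 0 F.f := hs.smooth_f
  have e1 : C * ℓ * ((r / ℓ) / (1 + r / ℓ)) = C * (r / (1 + r / ℓ)) := by field_simp
  have e2 : C * ℓ ^ 2 * ((r / ℓ) / (1 + r / ℓ)) ^ 2 = C * (r / (1 + r / ℓ)) ^ 2 := by field_simp
  refine ⟨fun ξ hξ => ?_, fun ξ hξ => ?_, fun ξ hξ => ?_, fun ξ hξ => ?_, fun ξ hξ => ?_,
    fun ξ hξ => ?_, fun ξ hξ => ?_⟩
  · rw [← e1]; exact (h.α_bd r hr ξ hξ).1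
  · have := (h.α_bd r hr ξ hξ).2.1
    rwa [e1, ha.dxi_eq hr.le hξ] at this
  · have := (h.α_bd r hr ξ hξ).2.2
    rw [ha.dr_eq hr (Ioo_subset_Icc_self hξ)] at this
    refine le_of_mul_le_mul_left (this.trans (le_of_eq ?_)) hℓ
    field_simp
  · rw [← e2]; exact (h.f_bd r hr ξ hξ).1
  · have := (h.f_bd r hr ξ hξ).2.1
    rwa [e2, hf.dxi_eq hr.le hξ] at this
  · have := (h.f_bd r hr ξ hξ).2.2.1
    rwa [e2, hf.dxi_dxi_eq hr.le hξ] at this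
  · have := (h.f_bd r hr ξ hξ).2.2.2.1
    rw [hf.dr_eq hr (Ioo_subset_Icc_self hξ)] at this
    refine le_of_mul_le_mul_left (this.trans (le_of_eq ?_)) hℓ
    field_simp

namespace GaugeProfile.Near

variable {φ : GaugeProfile} {C ℓ r : ℝ}

theorem pointwise (h : φ.Near C ℓ r) (hC : 0 < C) (hℓ : 0 < ℓ) (hr : 0 < r)
    (hs : C * ℓ ^ 2 ≤ 1 / 2) {ξ : ℝ} (hξ : ξ ∈ Ioo (-1 : ℝ) 1) :
    1 / 2 ≤ φ.f ξ ∧ φ.f ξ ≤ 2 ∧ |φ.du ξ| ≤ 28 * C * (r / (1 + r / ℓ)) ^ 2 ∧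
      |φ.ddu ξ| ≤ 28 * C * (r / (1 + r / ℓ)) ^ 2 := by
  have h0 : 0 ≤ r / (1 + r / ℓ) := by positivity
  have hX : C * (r / (1 + r / ℓ)) ^ 2 ≤ 1 / 2 := by
    refine le_trans ?_ hs
    have := div_one_add_le_radius hℓ hr
    gcongr
  have f1 := h.f_le ξ hξ
  have f2 := h.fx_le ξ hξ
  have f3 := h.fxx_le ξ hξ
  set X := C * (r / (1 + r / ℓ)) ^ 2 with hXdef
  have hX0 : 0 ≤ X := by positivity
  have f1' := abs_le.1 f1
  have hfl : 1 / 2 ≤ φ.f ξ := by linarith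
  have hfu : φ.f ξ ≤ 2 := by linarith
  have af : |φ.f ξ| ≤ 2 := by rw [abs_of_nonneg (by linarith)]; exact hfu
  have a1 : |φ.f ξ ^ 2 - 1| ≤ 3 * X := by
    have : φ.f ξ ^ 2 - 1 = (φ.f ξ + 1) * (φ.f ξ - 1) := by ring
    rw [this]
    exact abs_mul_le_mul (by rw [abs_of_nonneg (by linarith)]; linarith) f1
  have aξ : |ξ| ≤ 1 := abs_le.2 ⟨hξ.1.le, hξ.2.le⟩
  have aq : |1 - ξ ^ 2| ≤ 1 := by
    have := one_sub_sq_pos hξ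
    rw [abs_of_pos this]; linarith [sq_nonneg ξ]
  have a2 : |φ.f ξ * φ.fx ξ| ≤ 2 * X := abs_mul_le_mul af f2
  have a3 : |φ.fx ξ ^ 2 + φ.f ξ * φ.fxx ξ| ≤ 1 / 2 * X + 2 * X := by
    refine (abs_add_le _ _).trans (add_le_add ?_ (abs_mul_le_mul af f3))
    rw [sq]
    exact abs_mul_le_mul (f2.trans hX) f2
  have e28 : 28 * C * (r / (1 + r / ℓ)) ^ 2 = 28 * X := by rw [hXdef]; ring
  rw [e28]
  have b1 := abs_le.1 (abs_mul_le_mul aξ a1)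
  have b2 := abs_le.1 (abs_mul_le_mul aq a2)
  have b3 := abs_le.1 (abs_mul_le_mul aξ a2)
  have b4 := abs_le.1 (abs_mul_le_mul aq a3)
  have a1' := abs_le.1 a1
  refine ⟨hfl, hfu, ?_, ?_⟩
  · unfold du; rw [abs_le]; constructor <;> linarith
  · unfold ddu; rw [abs_le]; constructor <;> linarith

theorem bounded (h : φ.Near C ℓ r) (hC : 0 < C) (hℓ : 0 < ℓ) (hr : 0 < r)
    (hs : C * ℓ ^ 2 ≤ 1 / 2) {H : ℝ} (hH : 28 * C ≤ H) :
    φ.Bounded H (kap ℓ r) r (pAds ℓ r) := by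
  have hx : 0 < 1 + r / ℓ := by positivity
  have hk := kap_nonneg (ℓ := ℓ) hr
  have hHk : 28 * C * kap ℓ r ≤ H * kap ℓ r := by gcongr
  have hCk : 0 ≤ C * kap ℓ r := by positivity
  have hp := Real.sqrt_pos.2 (pAds_pos ℓ r)
  refine ⟨fun ξ hξ => (h.pointwise hC hℓ hr hs hξ).1, fun ξ hξ => (h.pointwise hC hℓ hr hs hξ).2.1,
    fun ξ hξ => ?_, fun ξ hξ => ?_, fun ξ hξ => ?_, fun ξ hξ => ?_, fun ξ hξ => ?_⟩
  · rw [abs_mul, abs_of_pos hr]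
    calc _ ≤ r * (C / (1 + r / ℓ) ^ 2) := by gcongr; exact h.ar_le ξ hξ
      _ = C * kap ℓ r := by unfold kap; ring
      _ ≤ _ := by linarith
  · rw [abs_div, abs_of_pos hp]
    calc _ ≤ C * (r / (1 + r / ℓ)) / ((1 + r / ℓ) / 2) := by
          gcongr
          · exact h.ax_le ξ hξ
          · linarith [le_two_mul_sqrt_pAds (ℓ := ℓ) (r := r)]
      _ = 2 * (C * kap ℓ r) := by unfold kap; field_simp
      _ ≤ _ := by linarith
  · rw [abs_mul, abs_of_pos hp]
    calc _ ≤ (1 + r / ℓ) * (C * (r / (1 + r / ℓ) ^ 3)) := by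
          gcongr
          · exact sqrt_pAds_le hℓ hr
          · exact h.fr_le ξ hξ
      _ = C * kap ℓ r := by unfold kap; field_simp
      _ ≤ _ := by linarith
  · rw [abs_div, abs_of_pos hr]
    calc _ ≤ 28 * C * (r / (1 + r / ℓ)) ^ 2 / r := by
          gcongr; exact (h.pointwise hC hℓ hr hs hξ).2.2.1
      _ = 28 * C * kap ℓ r := by unfold kap; field_simp
      _ ≤ _ := hHk
  · rw [abs_div, abs_of_pos hr]
    calc _ ≤ 28 * C * (r / (1 + r / ℓ)) ^ 2 / r := by
          gcongr; exact (h.pointwise hC hℓ hr hs hξ).2.2.2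
      _ = 28 * C * kap ℓ r := by unfold kap; field_simp
      _ ≤ _ := hHk

end GaugeProfile.Near

theorem NearAdS.fieldBounds {C ℓ : ℝ} {F : Fields} (h : NearAdS C ℓ F) (hs : IsSolutionOn ℓ 0 F)
    (hC : 1 ≤ C) (hℓ : 0 < ℓ) (hsmall : C * ℓ ^ 2 ≤ 1 / 2) : FieldBounds (28 * C) ℓ F := by
  have hC0 : 0 < C := by linarith
  refine ⟨fun r hr ξ hξ => ?_, fun r hr ξ hξ => ?_, fun r hr ξ hξ => ?_, fun r hr ξ hξ => ?_,
    fun r hr ξ hξ => ?_⟩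
  all_goals
    have hn := h.profile_near hs hℓ hr
    have hξ' := Ioo_subset_Icc_self hξ
    have hx : 0 < 1 + r / ℓ := by positivity
    have hq : |√(1 - ξ ^ 2)| ≤ 1 := by
      rw [abs_of_nonneg (Real.sqrt_nonneg _), Real.sqrt_le_one]; linarith [sq_nonneg ξ]
  · rw [SmoothOnStrip.dr_eq hs.smooth_α hr hξ']
    exact (hn.ar_le ξ hξ).trans (by gcongr; linarith)
  · rw [SmoothOnStrip.dxi_eq hs.smooth_α hr.le hξ]
    exact (hn.ax_le ξ hξ).trans (by gcongr; linarith)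
  · rw [hs.dr_ω_eq hr hξ']
    refine (abs_mul_le_mul hq (hn.fr_le ξ hξ)).trans ?_
    rw [one_mul]; gcongr; linarith
  · obtain ⟨h1, h2, -, -⟩ := hn.pointwise hC0 hℓ hr hsmall hξ
    have hf : |F.f r ξ| ≤ 2 := abs_le.2 ⟨by have : 1 / 2 ≤ F.f r ξ := h1
                                            linarith, h2⟩
    exact (abs_mul_le_mul hq hf).trans (by linarith)
  · rw [hs.dxi_ω_sq_eq hr.le hξ]
    exact (hn.pointwise hC0 hℓ hr hsmall hξ).2.2.1

/-! ### The sources of the Einstein equations depend on the fields in mean square -/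

/-- A difference of squares is bounded by a sum times a difference; the arithmetic-geometric mean
inequality with weight `lam` turns this into a bound by the squared difference. -/
theorem abs_integral_sq_sub_le {v₁ v₂ N : ℝ → ℝ} {M k a lam : ℝ} (h₁ : ContinuousOn v₁ (Icc (-1) 1))
    (h₂ : ContinuousOn v₂ (Icc (-1) 1)) (hN : ContinuousOn N (Icc (-1) 1)) (hlam : 0 < lam)
    (hM : 0 ≤ M) (b₁ : ∀ ξ ∈ Ioo (-1 : ℝ) 1, |v₁ ξ| ≤ M * k)
    (b₂ : ∀ ξ ∈ Ioo (-1 : ℝ) 1, |v₂ ξ| ≤ M * k)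
    (hd : ∀ ξ ∈ Ioo (-1 : ℝ) 1, (v₁ ξ - v₂ ξ) ^ 2 ≤ a * N ξ) :
    |(∫ ξ in (-1 : ℝ)..1, v₁ ξ ^ 2) - ∫ ξ in (-1 : ℝ)..1, v₂ ξ ^ 2|
      ≤ 2 * M * (lam * k ^ 2) + M * a * ((∫ ξ in (-1 : ℝ)..1, N ξ) / lam) := by
  have i1 := intervalIntegrable_of_continuousOn (h₁.pow 2)
  have i2 := intervalIntegrable_of_continuousOn (h₂.pow 2)
  have iN := intervalIntegrable_of_continuousOn hN
  have iB : IntervalIntegrable (fun ξ => M * (lam * k ^ 2) + M * a / lam * N ξ)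
      MeasureTheory.volume (-1) 1 := intervalIntegrable_const.add (iN.const_mul _)
  have eB : ∫ ξ in (-1 : ℝ)..1, (M * (lam * k ^ 2) + M * a / lam * N ξ)
      = 2 * M * (lam * k ^ 2) + M * a * ((∫ ξ in (-1 : ℝ)..1, N ξ) / lam) := by
    rw [intervalIntegral.integral_add intervalIntegrable_const (iN.const_mul _),
      intervalIntegral.integral_const, intervalIntegral.integral_const_mul, smul_eq_mul]
    ring
  have point : ∀ ξ ∈ Ioo (-1 : ℝ) 1, |v₁ ξ ^ 2 - v₂ ξ ^ 2| ≤ M * (lam * k ^ 2) + M * a / lam * N ξ := by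
    intro ξ hξ
    have e : v₁ ξ ^ 2 - v₂ ξ ^ 2 = (v₁ ξ + v₂ ξ) * (v₁ ξ - v₂ ξ) := by ring
    have h3 : |v₁ ξ + v₂ ξ| ≤ 2 * (M * k) :=
      (abs_add_le _ _).trans (by linarith [b₁ ξ hξ, b₂ ξ hξ])
    rw [e]
    refine (abs_mul_le_mul h3 le_rfl).trans ?_
    have h4 : 2 * k * |v₁ ξ - v₂ ξ| ≤ lam * k ^ 2 + (v₁ ξ - v₂ ξ) ^ 2 / lam := by
      have : lam * k ^ 2 + (v₁ ξ - v₂ ξ) ^ 2 / lam - 2 * k * |v₁ ξ - v₂ ξ|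
          = (lam * k - |v₁ ξ - v₂ ξ|) ^ 2 / lam := by
        rw [← sq_abs (v₁ ξ - v₂ ξ)]; field_simp; ring
      have : 0 ≤ (lam * k - |v₁ ξ - v₂ ξ|) ^ 2 / lam := by positivity
      linarith
    calc _ = M * (2 * k * |v₁ ξ - v₂ ξ|) := by ring
      _ ≤ M * (lam * k ^ 2 + (v₁ ξ - v₂ ξ) ^ 2 / lam) := by gcongr
      _ ≤ M * (lam * k ^ 2 + a * N ξ / lam) := by gcongr; exact hd ξ hξ
      _ = _ := by ring
  have m1 := intervalIntegral.integral_mono_on_of_le_Ioo (by norm_num) (i1.sub i2) iB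
    fun ξ hξ => (le_abs_self _).trans (point ξ hξ)
  have m2 := intervalIntegral.integral_mono_on_of_le_Ioo (by norm_num) (i2.sub i1) iB
    fun ξ hξ => (neg_le_abs _).trans' (by simp) |>.trans (point ξ hξ)
  rw [intervalIntegral.integral_sub i1 i2, eB] at m1
  rw [intervalIntegral.integral_sub i2 i1, eB] at m2
  simp only [Pi.pow_apply] at m1 m2
  rw [abs_le]; constructor <;> linarith

namespace GaugeProfile

variable {φ₁ φ₂ : GaugeProfile} {H k r p lam : ℝ}

/-- The four normalized sources `r²η`, `ζ/p`, `pG`, `P/r²` differ by at most the mean square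
`diffDensity` of the difference of the fields; `lam` is the free weight in the
arithmetic-geometric mean inequality. -/
theorem source_differences (h₁ : φ₁.Regular) (h₂ : φ₂.Regular) (b₁ : φ₁.Bounded H k r p)
    (b₂ : φ₂.Bounded H k r p) (hr : 0 < r) (hp : 0 < p) (hH : 0 ≤ H)
    (hHrk : H * (r * k) ≤ 1) (hlam : 0 < lam) :
    |r ^ 2 * (1 / 2 * ∫ ξ in (-1 : ℝ)..1, φ₁.ar ξ ^ 2)
        - r ^ 2 * (1 / 2 * ∫ ξ in (-1 : ℝ)..1, φ₂.ar ξ ^ 2)|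
      ≤ 8 * H * (lam * k ^ 2 + (∫ ξ in (-1 : ℝ)..1, diffDensity φ₁ φ₂ r p ξ) / lam) ∧
    |(1 / 2 * ∫ ξ in (-1 : ℝ)..1, (1 - ξ ^ 2) * φ₁.f ξ ^ 2 * φ₁.ax ξ ^ 2) / p
        - (1 / 2 * ∫ ξ in (-1 : ℝ)..1, (1 - ξ ^ 2) * φ₂.f ξ ^ 2 * φ₂.ax ξ ^ 2) / p|
      ≤ 8 * H * (lam * k ^ 2 + (∫ ξ in (-1 : ℝ)..1, diffDensity φ₁ φ₂ r p ξ) / lam) ∧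
    |p * (1 / 2 * ∫ ξ in (-1 : ℝ)..1, (1 - ξ ^ 2) * φ₁.fr ξ ^ 2)
        - p * (1 / 2 * ∫ ξ in (-1 : ℝ)..1, (1 - ξ ^ 2) * φ₂.fr ξ ^ 2)|
      ≤ 8 * H * (lam * k ^ 2 + (∫ ξ in (-1 : ℝ)..1, diffDensity φ₁ φ₂ r p ξ) / lam) ∧
    |(1 / 8 * ∫ ξ in (-1 : ℝ)..1, φ₁.du ξ ^ 2) / r ^ 2
        - (1 / 8 * ∫ ξ in (-1 : ℝ)..1, φ₂.du ξ ^ 2) / r ^ 2|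
      ≤ 8 * H * (lam * k ^ 2 + (∫ ξ in (-1 : ℝ)..1, diffDensity φ₁ φ₂ r p ξ) / lam) := by
  obtain ⟨-, a2, a3, a4, -, a6, -, -, -, -, -, -⟩ := id h₁
  obtain ⟨-, c2, c3, c4, -, c6, -, -, -, -, -, -⟩ := id h₂
  have a7 := h₁.du_cont
  have c7 := h₂.du_cont
  have hN := diffDensity_cont r p h₁ h₂
  have hs0 : 0 < √p := Real.sqrt_pos.2 hp
  have hsp : √p ^ 2 = p := Real.sq_sqrt hp.le
  have cq : Continuous fun ξ : ℝ => √(1 - ξ ^ 2) := by fun_prop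
  have hI : 0 ≤ (∫ ξ in (-1 : ℝ)..1, diffDensity φ₁ φ₂ r p ξ) / lam :=
    div_nonneg (intervalIntegral.integral_nonneg (by norm_num)
      fun ξ hξ => diffDensity_nonneg r p hp hξ) hlam.le
  have hB : 0 ≤ lam * k ^ 2 := by positivity
  have t2 : ∀ ξ ∈ Ioo (-1 : ℝ) 1, √(1 - ξ ^ 2) ^ 2 = 1 - ξ ^ 2 := fun ξ hξ =>
    Real.sq_sqrt (one_sub_sq_pos hξ).le
  have t1 : ∀ ξ : ℝ, |√(1 - ξ ^ 2)| ≤ 1 := fun ξ => by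
    rw [abs_of_nonneg (Real.sqrt_nonneg _), Real.sqrt_le_one]; linarith [sq_nonneg ξ]
  have sum_le : ∀ a b c d e : ℝ, 0 ≤ a ^ 2 ∧ 0 ≤ b ^ 2 ∧ 0 ≤ c ^ 2 ∧ 0 ≤ d ^ 2 ∧ 0 ≤ e ^ 2 :=
    fun a b c d e => ⟨sq_nonneg _, sq_nonneg _, sq_nonneg _, sq_nonneg _, sq_nonneg _⟩
  have hHB : 0 ≤ H * (lam * k ^ 2) := by positivity
  have hHI := mul_nonneg hH hI
  refine ⟨?_, ?_, ?_, ?_⟩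
  · have key := abs_integral_sq_sub_le (v₁ := fun ξ => r * φ₁.ar ξ) (v₂ := fun ξ => r * φ₂.ar ξ)
      (a := 1) (by fun_prop) (by fun_prop) hN hlam hH b₁.ar_le b₂.ar_le fun ξ hξ => by
        rw [diffDensity_eq r p (t2 ξ hξ) hsp, one_mul]
        generalize r * φ₁.ar ξ - r * φ₂.ar ξ = a
        nlinarith [sum_le a (√(1 - ξ ^ 2) * (φ₁.ax ξ / √p - φ₂.ax ξ / √p))
          (√(1 - ξ ^ 2) * (√p * φ₁.fr ξ) - √(1 - ξ ^ 2) * (√p * φ₂.fr ξ))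
          (√(1 - ξ ^ 2) * (φ₁.f ξ - φ₂.f ξ) / r) ((φ₁.du ξ - φ₂.du ξ) / r)]
    simp only [mul_pow, intervalIntegral.integral_const_mul] at key
    rw [abs_le] at key ⊢
    constructor <;> linarith
  · have hv : ∀ φ : GaugeProfile, φ.Bounded H k r p → ∀ ξ ∈ Ioo (-1 : ℝ) 1,
        |√(1 - ξ ^ 2) * φ.f ξ * (φ.ax ξ / √p)| ≤ 2 * H * k := by
      intro φ b ξ hξ
      have hf : |φ.f ξ| ≤ 2 := by
        rw [abs_of_nonneg (by linarith [b.f_low ξ hξ])]; exact b.f_le ξ hξ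
      exact (abs_mul_le_mul (abs_mul_le_mul (t1 ξ) hf) (b.ax_le ξ hξ)).trans (le_of_eq (by ring))
    have key := abs_integral_sq_sub_le (v₁ := fun ξ => √(1 - ξ ^ 2) * φ₁.f ξ * (φ₁.ax ξ / √p))
      (v₂ := fun ξ => √(1 - ξ ^ 2) * φ₂.f ξ * (φ₂.ax ξ / √p))
      (a := 8) (by fun_prop) (by fun_prop) hN hlam (by positivity) (hv φ₁ b₁) (hv φ₂ b₂)
      fun ξ hξ => by
        rw [diffDensity_eq r p (t2 ξ hξ) hsp]
        have ry : |r * (φ₂.ax ξ / √p)| ≤ 1 := by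
          refine (abs_mul_le_mul (abs_of_pos hr).le (b₂.ax_le ξ hξ)).trans ?_
          linarith
        have hf : φ₁.f ξ ^ 2 ≤ 2 ^ 2 :=
          pow_le_pow_left₀ (by linarith [b₁.f_low ξ hξ]) (b₁.f_le ξ hξ) 2
        have hy : (r * (φ₂.ax ξ / √p)) ^ 2 ≤ 1 := (sq_le_one_iff_abs_le_one _).2 ry
        have e : √(1 - ξ ^ 2) * φ₁.f ξ * (φ₁.ax ξ / √p) - √(1 - ξ ^ 2) * φ₂.f ξ * (φ₂.ax ξ / √p)
            = φ₁.f ξ * (√(1 - ξ ^ 2) * (φ₁.ax ξ / √p - φ₂.ax ξ / √p))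
              + r * (φ₂.ax ξ / √p) * (√(1 - ξ ^ 2) * (φ₁.f ξ - φ₂.f ξ) / r) := by
          field_simp; ring
        rw [e]
        generalize √(1 - ξ ^ 2) * (φ₁.ax ξ / √p - φ₂.ax ξ / √p) = b
        generalize √(1 - ξ ^ 2) * (φ₁.f ξ - φ₂.f ξ) / r = d
        generalize r * (φ₂.ax ξ / √p) = y at hy ⊢
        have h1 : φ₁.f ξ ^ 2 * b ^ 2 ≤ 2 ^ 2 * b ^ 2 := by gcongr
        have h2 : y ^ 2 * d ^ 2 ≤ 1 * d ^ 2 := by gcongr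
        have h3 := sum_le (r * φ₁.ar ξ - r * φ₂.ar ξ) b
          (√(1 - ξ ^ 2) * (√p * φ₁.fr ξ) - √(1 - ξ ^ 2) * (√p * φ₂.fr ξ)) d
          ((φ₁.du ξ - φ₂.du ξ) / r)
        have h4 := sq_nonneg (φ₁.f ξ * b - y * d)
        have h5 : (φ₁.f ξ * b + y * d) ^ 2 ≤ 2 * (φ₁.f ξ ^ 2 * b ^ 2) + 2 * (y ^ 2 * d ^ 2) := by
          linarith
        linarith [h3.1, h3.2.1, h3.2.2.1, h3.2.2.2.1, h3.2.2.2.2]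
    have e : ∀ φ : GaugeProfile, (1 / 2 * ∫ ξ in (-1 : ℝ)..1, (1 - ξ ^ 2) * φ.f ξ ^ 2 * φ.ax ξ ^ 2) / p
        = 1 / 2 * ∫ ξ in (-1 : ℝ)..1, (√(1 - ξ ^ 2) * φ.f ξ * (φ.ax ξ / √p)) ^ 2 := by
      intro φ
      rw [mul_div_assoc, ← intervalIntegral.integral_div]
      congr 1
      refine integral_congr_Ioo fun ξ hξ => ?_
      rw [mul_pow, mul_pow, t2 ξ hξ, div_pow, hsp]; ring
    rw [e, e]
    rw [abs_le] at key ⊢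
    constructor <;> linarith
  · have hv : ∀ φ : GaugeProfile, φ.Bounded H k r p → ∀ ξ ∈ Ioo (-1 : ℝ) 1,
        |√(1 - ξ ^ 2) * (√p * φ.fr ξ)| ≤ H * k := fun φ b ξ hξ =>
      (abs_mul_le_mul (t1 ξ) (b.fr_le ξ hξ)).trans (le_of_eq (one_mul _))
    have key := abs_integral_sq_sub_le (v₁ := fun ξ => √(1 - ξ ^ 2) * (√p * φ₁.fr ξ))
      (v₂ := fun ξ => √(1 - ξ ^ 2) * (√p * φ₂.fr ξ))
      (a := 1) (by fun_prop) (by fun_prop) hN hlam hH (hv φ₁ b₁) (hv φ₂ b₂) fun ξ hξ => by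
        rw [diffDensity_eq r p (t2 ξ hξ) hsp, one_mul]
        have h3 := sum_le (r * φ₁.ar ξ - r * φ₂.ar ξ)
          (√(1 - ξ ^ 2) * (φ₁.ax ξ / √p - φ₂.ax ξ / √p)) 0
          (√(1 - ξ ^ 2) * (φ₁.f ξ - φ₂.f ξ) / r) ((φ₁.du ξ - φ₂.du ξ) / r)
        linarith [h3.1, h3.2.1, h3.2.2.1, h3.2.2.2.1, h3.2.2.2.2]
    have e : ∀ φ : GaugeProfile, p * (1 / 2 * ∫ ξ in (-1 : ℝ)..1, (1 - ξ ^ 2) * φ.fr ξ ^ 2)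
        = 1 / 2 * ∫ ξ in (-1 : ℝ)..1, (√(1 - ξ ^ 2) * (√p * φ.fr ξ)) ^ 2 := by
      intro φ
      rw [mul_left_comm, ← intervalIntegral.integral_const_mul]
      congr 1
      refine integral_congr_Ioo fun ξ hξ => ?_
      rw [mul_pow, mul_pow, t2 ξ hξ, hsp]; ring
    rw [e, e]
    rw [abs_le] at key ⊢
    constructor <;> linarith
  · have key := abs_integral_sq_sub_le (v₁ := fun ξ => φ₁.du ξ / r) (v₂ := fun ξ => φ₂.du ξ / r)
      (a := 1) (by fun_prop) (by fun_prop) hN hlam hH b₁.du_le b₂.du_le fun ξ hξ => by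
        rw [diffDensity_eq r p (t2 ξ hξ) hsp, one_mul, ← sub_div]
        have h3 := sum_le (r * φ₁.ar ξ - r * φ₂.ar ξ)
          (√(1 - ξ ^ 2) * (φ₁.ax ξ / √p - φ₂.ax ξ / √p))
          (√(1 - ξ ^ 2) * (√p * φ₁.fr ξ) - √(1 - ξ ^ 2) * (√p * φ₂.fr ξ))
          (√(1 - ξ ^ 2) * (φ₁.f ξ - φ₂.f ξ) / r) 0
        linarith [h3.1, h3.2.1, h3.2.2.1, h3.2.2.2.1, h3.2.2.2.2]
    simp only [div_pow, intervalIntegral.integral_div] at key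
    rw [mul_div_assoc, mul_div_assoc]
    rw [abs_le] at key ⊢
    constructor <;> linarith

end GaugeProfile

/-! ### The energy of the difference of two solutions -/

/-- The energy density: fluxes of the difference times the difference of the fields. -/
noncomputable def energyDensity (ℓ : ℝ) (F₁ F₂ : Fields) (r ξ : ℝ) : ℝ :=
  (r ^ 2 * (profile 0 F₁ r).ar ξ / F₁.S r - r ^ 2 * (profile 0 F₂ r).ar ξ / F₂.S r)
      * ((profile 0 F₁ r).α ξ - (profile 0 F₂ r).α ξ)
    + (1 - ξ ^ 2) * ((F₁.μ ℓ r * (F₁.S r * √(F₁.S r)) * (profile 0 F₁ r).fr ξ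
        - F₂.μ ℓ r * (F₂.S r * √(F₂.S r)) * (profile 0 F₂ r).fr ξ)
      * ((profile 0 F₁ r).f ξ - (profile 0 F₂ r).f ξ))

/-- The energy of the difference of two solutions at radius `r`. -/
noncomputable def energy (ℓ : ℝ) (F₁ F₂ : Fields) (r : ℝ) : ℝ :=
  ∫ ξ in (-1 : ℝ)..1, energyDensity ℓ F₁ F₂ r ξ

/-- The rate of change of `energyDensity` given by the field equations. -/
noncomputable def fieldsEnergyRate (ℓ : ℝ) (F₁ F₂ : Fields) (r ξ : ℝ) : ℝ :=
  GaugeProfile.energyRate (profile 0 F₁ r) (profile 0 F₂ r) r (F₁.S r) (F₂.S r) (F₁.μ ℓ r)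
    (F₂.μ ℓ r) ξ

/-- Joint continuity of the gauge fields and their derivatives, and of the metric functions. -/
structure JointlyContinuous (s : Set (ℝ × ℝ)) (φ : ℝ → GaugeProfile) (S μ : ℝ → ℝ) : Prop where
  α : ContinuousOn (fun p : ℝ × ℝ => (φ p.1).α p.2) s
  f : ContinuousOn (fun p : ℝ × ℝ => (φ p.1).f p.2) s
  ar : ContinuousOn (fun p : ℝ × ℝ => (φ p.1).ar p.2) s
  ax : ContinuousOn (fun p : ℝ × ℝ => (φ p.1).ax p.2) s
  fr : ContinuousOn (fun p : ℝ × ℝ => (φ p.1).fr p.2) s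
  dcur : ContinuousOn (fun p : ℝ × ℝ => (φ p.1).dcur p.2) s
  ddu : ContinuousOn (fun p : ℝ × ℝ => (φ p.1).ddu p.2) s
  S_cont : ContinuousOn (fun p : ℝ × ℝ => S p.1) s
  μ_cont : ContinuousOn (fun p : ℝ × ℝ => μ p.1) s
  S_pos : ∀ p ∈ s, 0 < S p.1
  μ_pos : ∀ p ∈ s, 0 < μ p.1

theorem IsSolutionOn.jointlyContinuous {ℓ r₀ : ℝ} {F : Fields} (h : IsSolutionOn ℓ r₀ F)
    (h0 : 0 ≤ r₀) : JointlyContinuous (Ioi r₀ ×ˢ Icc (-1) 1) (profile r₀ F) F.S (F.μ ℓ) := by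
  have ha : SmoothOnStrip r₀ F.α := h.smooth_α
  have hf : SmoothOnStrip r₀ F.f := h.smooth_f
  have hsub : Ioi r₀ ×ˢ Icc (-1 : ℝ) 1 ⊆ Ici r₀ ×ˢ Icc (-1) 1 :=
    Set.prod_mono Ioi_subset_Ici_self Subset.rfl
  have c : ∀ {g : ℝ → ℝ → ℝ}, SmoothOnStrip r₀ g →
      ContinuousOn (fun p : ℝ × ℝ => g p.1 p.2) (Ioi r₀ ×ˢ Icc (-1) 1) :=
    fun hg => hg.continuousOn.mono hsub
  have c1 := c hf
  have c2 := c ha.stripDxi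
  have c3 := c hf.stripDxi
  have c4 := c ha.stripDxi.stripDxi
  have c5 := c hf.stripDxi.stripDxi
  have hmap : MapsTo (fun p : ℝ × ℝ => p.1) (Ioi r₀ ×ˢ Icc (-1) 1) (Ioi r₀) := fun p hp => hp.1
  refine ⟨c ha, c1, c ha.stripDr, c2, c hf.stripDr, ?_, ?_, ?_, ?_,
    fun p hp => h.S_pos p.1 (le_of_lt hp.1), fun p hp => h.μ_pos p.1 hp.1⟩
  · simp only [profile, GaugeProfile.dcur]; fun_prop
  · simp only [profile, GaugeProfile.ddu]; fun_prop
  · exact (h.smooth_S.continuousOn.mono Ioi_subset_Ici_self).comp (by fun_prop) hmap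
  · have : ContinuousOn (F.μ ℓ) (Ioi r₀) := fun r hr =>
      (h.hasDerivAt_μ (h0.trans_lt hr) hr).continuousAt.continuousWithinAt
    exact this.comp (by fun_prop) hmap

theorem continuousOn_energyDensity {ℓ : ℝ} {F₁ F₂ : Fields} (h₁ : IsSolutionOn ℓ 0 F₁)
    (h₂ : IsSolutionOn ℓ 0 F₂) :
    ContinuousOn (fun p : ℝ × ℝ => energyDensity ℓ F₁ F₂ p.1 p.2) (Ioi 0 ×ˢ Icc (-1) 1) := by
  obtain ⟨a1, a2, a3, a4, a5, a6, a7, a8, a9, a10, a11⟩ := h₁.jointlyContinuous le_rfl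
  obtain ⟨b1, b2, b3, b4, b5, b6, b7, b8, b9, b10, b11⟩ := h₂.jointlyContinuous le_rfl
  have hr : ContinuousOn (fun p : ℝ × ℝ => p.1 ^ 2) (Ioi 0 ×ˢ Icc (-1) 1) := by fun_prop
  have hq : ContinuousOn (fun p : ℝ × ℝ => 1 - p.2 ^ 2) (Ioi 0 ×ˢ Icc (-1) 1) := by fun_prop
  exact ((((hr.mul a3).div a8 fun p hp => (a10 p hp).ne').sub
    ((hr.mul b3).div b8 fun p hp => (b10 p hp).ne')).mul (a1.sub b1)).add
    (hq.mul ((((a9.mul (a8.mul a8.sqrt)).mul a5).sub ((b9.mul (b8.mul b8.sqrt)).mul b5)).mul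
      (a2.sub b2)))

theorem continuousOn_fieldsEnergyRate {ℓ : ℝ} {F₁ F₂ : Fields} (h₁ : IsSolutionOn ℓ 0 F₁)
    (h₂ : IsSolutionOn ℓ 0 F₂) :
    ContinuousOn (fun p : ℝ × ℝ => fieldsEnergyRate ℓ F₁ F₂ p.1 p.2) (Ioi 0 ×ˢ Icc (-1) 1) := by
  obtain ⟨a1, a2, a3, a4, a5, a6, a7, a8, a9, a10, a11⟩ := h₁.jointlyContinuous le_rfl
  obtain ⟨b1, b2, b3, b4, b5, b6, b7, b8, b9, b10, b11⟩ := h₂.jointlyContinuous le_rfl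
  have hr : ContinuousOn (fun p : ℝ × ℝ => p.1 ^ 2) (Ioi 0 ×ˢ Icc (-1) 1) := by fun_prop
  have hq : ContinuousOn (fun p : ℝ × ℝ => 1 - p.2 ^ 2) (Ioi 0 ×ˢ Icc (-1) 1) := by fun_prop
  have h2r : ContinuousOn (fun p : ℝ × ℝ => 2 * p.1 ^ 2) (Ioi 0 ×ˢ Icc (-1) 1) := by fun_prop
  have hr0 : ∀ p ∈ Ioi (0 : ℝ) ×ˢ Icc (-1 : ℝ) 1, 2 * p.1 ^ 2 ≠ 0 := fun p hp =>
    ne_of_gt (mul_pos two_pos (pow_pos hp.1 2))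
  have c4 : ContinuousOn (fun _ : ℝ × ℝ => (4 : ℝ)) (Ioi 0 ×ˢ Icc (-1) 1) := continuousOn_const
  have s1 := fun p hp => Real.sqrt_pos.2 (a10 p hp)
  have s2 := fun p hp => Real.sqrt_pos.2 (b10 p hp)
  have A1 := (a6.div (a9.mul a8) fun p hp => (mul_pos (a11 p hp) (a10 p hp)).ne').neg
  have B1 := (b6.div (b9.mul b8) fun p hp => (mul_pos (b11 p hp) (b10 p hp)).ne').neg
  have A2 := (hr.mul a3).div a8 fun p hp => (a10 p hp).ne'
  have B2 := (hr.mul b3).div b8 fun p hp => (b10 p hp).ne'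
  have A3 := (((a2.mul (a4.pow 2)).div ((c4.mul a9).mul a8.sqrt) fun p hp =>
    (mul_pos (mul_pos four_pos (a11 p hp)) (s1 p hp)).ne').add
    (((a8.mul a8.sqrt).div h2r hr0).mul (a2.mul a7))).neg
  have B3 := (((b2.mul (b4.pow 2)).div ((c4.mul b9).mul b8.sqrt) fun p hp =>
    (mul_pos (mul_pos four_pos (b11 p hp)) (s2 p hp)).ne').add
    (((b8.mul b8.sqrt).div h2r hr0).mul (b2.mul b7))).neg
  have A4 := (a9.mul (a8.mul a8.sqrt)).mul a5
  have B4 := (b9.mul (b8.mul b8.sqrt)).mul b5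
  exact (((A1.sub B1).mul (a1.sub b1)).add ((A2.sub B2).mul (a3.sub b3))).add
    (hq.mul (((A3.sub B3).mul (a2.sub b2)).add ((A4.sub B4).mul (a5.sub b5))))

theorem hasDerivAt_energy {ℓ : ℝ} {F₁ F₂ : Fields} (hℓ : 0 < ℓ) (h₁ : IsSolutionOn ℓ 0 F₁)
    (h₂ : IsSolutionOn ℓ 0 F₂) {r : ℝ} (hr : 0 < r) :
    HasDerivAt (energy ℓ F₁ F₂) (∫ ξ in (-1 : ℝ)..1, fieldsEnergyRate ℓ F₁ F₂ r ξ) r := by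
  refine hasDerivAt_integral_strip (continuousOn_energyDensity h₁ h₂)
    (continuousOn_fieldsEnergyRate h₁ h₂) (fun r hr ξ hξ => ?_) hr
  have hξ' := Ioo_subset_Icc_self hξ
  have a : ∀ F : Fields, IsSolutionOn ℓ 0 F →
      HasDerivAt (fun r => (profile 0 F r).α ξ) ((profile 0 F r).ar ξ) r :=
    fun F h => SmoothOnStrip.hasDerivAt_radial h.smooth_α hr hξ'
  have f : ∀ F : Fields, IsSolutionOn ℓ 0 F →
      HasDerivAt (fun r => (profile 0 F r).f ξ) ((profile 0 F r).fr ξ) r :=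
    fun F h => SmoothOnStrip.hasDerivAt_radial h.smooth_f hr hξ'
  refine ((((h₁.hasDerivAt_electric_flux hr hr hξ).sub (h₂.hasDerivAt_electric_flux hr hr hξ)).mul
    ((a F₁ h₁).sub (a F₂ h₂))).add ((((h₁.hasDerivAt_magnetic_flux hℓ hr hr hξ).sub
      (h₂.hasDerivAt_magnetic_flux hℓ hr hr hξ)).mul ((f F₁ h₁).sub (f F₂ h₂))).const_mul
      (1 - ξ ^ 2))).congr_deriv ?_
  simp only [Pi.sub_apply]
  unfold fieldsEnergyRate GaugeProfile.energyRate
  ring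

/-! ### The charges determine the boundary values -/

/-- Equal magnetic charge functions mean equal derivatives of `ω_∞²`, and `ω_∞` vanishes at `ξ = 1`. -/
theorem eqOn_of_qM_eq {w₁ w₂ : ℝ → ℝ} {K : ℝ} (d₁ : DifferentiableOn ℝ w₁ (Ioo (-1) 1))
    (d₂ : DifferentiableOn ℝ w₂ (Ioo (-1) 1)) (n₁ : ∀ ξ ∈ Ioo (-1 : ℝ) 1, 0 ≤ w₁ ξ)
    (n₂ : ∀ ξ ∈ Ioo (-1 : ℝ) 1, 0 ≤ w₂ ξ) (b₁ : ∀ ξ ∈ Ioo (-1 : ℝ) 1, w₁ ξ ≤ K * √(1 - ξ ^ 2))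
    (b₂ : ∀ ξ ∈ Ioo (-1 : ℝ) 1, w₂ ξ ≤ K * √(1 - ξ ^ 2))
    (hq : ∀ ξ ∈ Ioo (-1 : ℝ) 1, qM w₁ ξ = qM w₂ ξ) : EqOn w₁ w₂ (Ioo (-1) 1) := by
  have hd : ∀ ξ ∈ Ioo (-1 : ℝ) 1, HasDerivAt (fun ξ => w₁ ξ ^ 2 - w₂ ξ ^ 2) 0 ξ := by
    intro ξ hξ
    have e := hq ξ hξ
    unfold qM at e
    have h3 : Real.sqrt 3 / 2 ≠ 0 := by positivity
    have e' := mul_left_cancel₀ h3 e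
    have a₁ := ((d₁ ξ hξ).differentiableAt (Ioo_mem_nhds hξ.1 hξ.2)).hasDerivAt
    have a₂ := ((d₂ ξ hξ).differentiableAt (Ioo_mem_nhds hξ.1 hξ.2)).hasDerivAt
    have e₁ : deriv (fun ξ' => w₁ ξ' ^ 2 + ξ' ^ 2) ξ = _ :=
      ((a₁.pow 2).add ((hasDerivAt_id ξ).pow 2)).deriv
    have e₂ : deriv (fun ξ' => w₂ ξ' ^ 2 + ξ' ^ 2) ξ = _ :=
      ((a₂.pow 2).add ((hasDerivAt_id ξ).pow 2)).deriv
    rw [e₁, e₂] at e'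
    exact ((a₁.pow 2).sub (a₂.pow 2)).congr_deriv (by linarith)
  have hsq : ∀ w : ℝ → ℝ, (∀ ξ ∈ Ioo (-1 : ℝ) 1, 0 ≤ w ξ) →
      (∀ ξ ∈ Ioo (-1 : ℝ) 1, w ξ ≤ K * √(1 - ξ ^ 2)) → Tendsto (fun ξ => w ξ ^ 2) (𝓝[<] 1) (𝓝 0) := by
    intro w hn hb
    have h0 : Tendsto (fun ξ : ℝ => K ^ 2 * (1 - ξ ^ 2)) (𝓝[<] 1) (𝓝 (K ^ 2 * (1 - 1 ^ 2))) :=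
      (Continuous.tendsto (by fun_prop) 1).mono_left nhdsWithin_le_nhds
    norm_num at h0
    refine tendsto_of_tendsto_of_tendsto_of_le_of_le' tendsto_const_nhds h0
      (Eventually.of_forall fun ξ => sq_nonneg _) ?_
    filter_upwards [Ioo_mem_nhdsLT (show (-1 : ℝ) < 1 by norm_num)] with ξ hξ
    have := pow_le_pow_left₀ (hn ξ hξ) (hb ξ hξ) 2
    rwa [mul_pow, Real.sq_sqrt (one_sub_sq_pos hξ).le] at this
  intro ξ hξ
  have hconst : ∀ y ∈ Ioo (-1 : ℝ) 1, w₁ y ^ 2 - w₂ y ^ 2 = w₁ ξ ^ 2 - w₂ ξ ^ 2 := fun y hy =>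
    isOpen_Ioo.is_const_of_deriv_eq_zero (convex_Ioo _ _).isPreconnected
      (fun z hz => (hd z hz).differentiableAt.differentiableWithinAt)
      (fun z hz => (hd z hz).deriv) hy hξ
  have hlim := (hsq w₁ n₁ b₁).sub (hsq w₂ n₂ b₂)
  rw [sub_zero] at hlim
  have hlim' : Tendsto (fun y => w₁ y ^ 2 - w₂ y ^ 2) (𝓝[<] 1) (𝓝 (w₁ ξ ^ 2 - w₂ ξ ^ 2)) := by
    refine tendsto_const_nhds.congr' ?_
    filter_upwards [Ioo_mem_nhdsLT (show (-1 : ℝ) < 1 by norm_num)] with y hy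
      using (hconst y hy).symm
  have h0 := tendsto_nhds_unique hlim' hlim
  exact (pow_left_inj₀ (n₁ ξ hξ) (n₂ ξ hξ) two_ne_zero).1 (by linarith)

theorem eqOn_of_qE_eq {A₁ A₂ : ℝ → ℝ} (hq : ∀ ξ ∈ Ioo (-1 : ℝ) 1, qE A₁ ξ = qE A₂ ξ) :
    EqOn A₁ A₂ (Ioo (-1) 1) := by
  intro ξ hξ
  have h3 : Real.sqrt 3 / 2 ≠ 0 := by positivity
  exact mul_left_cancel₀ h3 (hq ξ hξ)

theorem HasAsymptotics.tendsto_ω {F : Fields} {D : AsymptoticData} (h : HasAsymptotics F D) {ξ : ℝ}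
    (hξ : ξ ∈ Icc (-1 : ℝ) 1) : Tendsto (fun r => F.ω r ξ) atTop (𝓝 (D.ωInf ξ)) := by
  have h0 : Tendsto (fun r : ℝ => 1 / r ^ 2) atTop (𝓝 0) :=
    tendsto_const_nhds.div_atTop (tendsto_pow_atTop (by norm_num))
  have h1 : Tendsto (fun r : ℝ => D.W ξ / r) atTop (𝓝 0) := tendsto_const_nhds.div_atTop tendsto_id
  have := (((h.ω_exp ξ hξ).trans_tendsto h0).add h1).add_const (D.ωInf ξ)
  simpa using this

/-! ### The energy vanishes at the centre and at infinity -/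

/-- One member of a pair of solutions in the near-AdS regime, with `ℓ` small. -/
structure RegularNear (C ℓ : ℝ) (F : Fields) (D : AsymptoticData) : Prop where
  reg : IsGloballyRegular ℓ F D
  near : NearAdS C ℓ F
  one_le : 1 ≤ C
  ℓ_pos : 0 < ℓ
  small : C * ℓ ^ 2 ≤ 1 / 2

namespace RegularNear

variable {C ℓ : ℝ} {F F₁ F₂ : Fields} {D D₁ D₂ : AsymptoticData}

theorem metric (h : RegularNear C ℓ F D) : MetricRegular C ℓ F := h.reg.metricRegular h.near.S_low

theorem profile_near (h : RegularNear C ℓ F D) {r : ℝ} (hr : 0 < r) :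
    (profile 0 F r).Near C ℓ r := h.near.profile_near h.reg.sol h.ℓ_pos hr

theorem C_pos (h : RegularNear C ℓ F D) : 0 < C := by linarith [h.one_le]

theorem ωInf_bounds (h : RegularNear C ℓ F D) {ξ : ℝ} (hξ : ξ ∈ Ioo (-1 : ℝ) 1) :
    0 ≤ D.ωInf ξ ∧ D.ωInf ξ ≤ 2 * √(1 - ξ ^ 2) := by
  have hlim := h.reg.asym.tendsto_ω (Ioo_subset_Icc_self hξ)
  have hf : ∀ r, 0 < r → 0 ≤ F.ω r ξ ∧ F.ω r ξ ≤ 2 * √(1 - ξ ^ 2) := by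
    intro r hr
    obtain ⟨h1, h2, -, -⟩ := (h.profile_near hr).pointwise h.C_pos h.ℓ_pos hr h.small hξ
    have h1' : 1 / 2 ≤ F.f r ξ := h1
    have h2' : F.f r ξ ≤ 2 := h2
    have hs := Real.sqrt_nonneg (1 - ξ ^ 2)
    unfold Fields.ω
    constructor
    · positivity
    · rw [mul_comm]; gcongr
  constructor
  · refine ge_of_tendsto hlim ?_
    filter_upwards [eventually_gt_atTop 0] with r hr using (hf r hr).1
  · refine le_of_tendsto hlim ?_
    filter_upwards [eventually_gt_atTop 0] with r hr using (hf r hr).2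

theorem flux_bounds (h : RegularNear C ℓ F D) {r ξ : ℝ} (hr : 0 < r) (hξ : ξ ∈ Ioo (-1 : ℝ) 1) :
    |r ^ 2 * (profile 0 F r).ar ξ / F.S r| ≤ C ^ 2 * (r / (1 + r / ℓ)) ^ 2 ∧
    |F.μ ℓ r * (F.S r * √(F.S r)) * (profile 0 F r).fr ξ| ≤ C * (r / (1 + r / ℓ)) := by
  have hC := h.C_pos
  have hℓ := h.ℓ_pos
  have hx : 0 < 1 + r / ℓ := by positivity
  have hS := h.metric.S_pos hC hr
  have hS1 := h.metric.S_le_one hC hr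
  have hμ := h.metric.μ_pos r hr
  constructor
  · rw [abs_div, abs_mul, abs_of_pos hS, abs_of_pos (by positivity : 0 < r ^ 2), div_eq_mul_inv]
    have hi : (F.S r)⁻¹ ≤ C := inv_le_of_inv_le₀ hC (h.metric.S_low r hr)
    calc _ ≤ r ^ 2 * (C / (1 + r / ℓ) ^ 2) * C := by
          gcongr; exact (h.profile_near hr).ar_le ξ hξ
      _ = _ := by field_simp
  · have hs1 : √(F.S r) ≤ 1 := Real.sqrt_le_one.2 hS1
    rw [abs_mul, abs_of_nonneg (by positivity)]
    calc _ ≤ (1 + r / ℓ) ^ 2 * (1 * 1) * (C * (r / (1 + r / ℓ) ^ 3)) := by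
          gcongr
          · exact (h.metric.μ_le hr).trans (pAds_le_sq hℓ hr)
          · exact (h.profile_near hr).fr_le ξ hξ
      _ = _ := by field_simp

/-- Both products in the energy density are cubic in `r / (1 + r/ℓ)`, so the energy vanishes at the
centre and is dominated by a constant at infinity. -/
theorem abs_energyDensity_le (h₁ : RegularNear C ℓ F₁ D₁) (h₂ : RegularNear C ℓ F₂ D₂) {r ξ : ℝ}
    (hr : 0 < r) (hξ : ξ ∈ Ioo (-1 : ℝ) 1) :
    |energyDensity ℓ F₁ F₂ r ξ| ≤ 8 * C ^ 3 * (r / (1 + r / ℓ)) ^ 3 := by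
  obtain ⟨x1, z1⟩ := h₁.flux_bounds hr hξ
  obtain ⟨x2, z2⟩ := h₂.flux_bounds hr hξ
  have a1 := (h₁.profile_near hr).α_le ξ hξ
  have a2 := (h₂.profile_near hr).α_le ξ hξ
  have f1 := (h₁.profile_near hr).f_le ξ hξ
  have f2 := (h₂.profile_near hr).f_le ξ hξ
  have hℓ := h₁.ℓ_pos
  have hy : 0 ≤ r / (1 + r / ℓ) := by positivity
  set y := r / (1 + r / ℓ)
  have hq : |1 - ξ ^ 2| ≤ 1 := by
    have := one_sub_sq_pos hξ
    rw [abs_of_pos this]; linarith [sq_nonneg ξ]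
  have df : |(profile 0 F₁ r).f ξ - (profile 0 F₂ r).f ξ| ≤ C * y ^ 2 + C * y ^ 2 := by
    have e : (profile 0 F₁ r).f ξ - (profile 0 F₂ r).f ξ
        = ((profile 0 F₁ r).f ξ - 1) - ((profile 0 F₂ r).f ξ - 1) := by ring
    rw [e]; exact (abs_sub _ _).trans (add_le_add f1 f2)
  unfold energyDensity
  refine (abs_add_le _ _).trans ((add_le_add
    (abs_mul_le_mul ((abs_sub _ _).trans (add_le_add x1 x2)) ((abs_sub _ _).trans (add_le_add a1 a2)))
    (abs_mul_le_mul hq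
      (abs_mul_le_mul ((abs_sub _ _).trans (add_le_add z1 z2)) df))).trans ?_)
  have hC := h₁.one_le
  have c1 : C ^ 2 ≤ C ^ 3 := pow_le_pow_right₀ hC (by norm_num)
  have c2 : C ^ 2 * y ^ 3 ≤ C ^ 3 * y ^ 3 := by gcongr
  linarith

theorem abs_energy_le (h₁ : RegularNear C ℓ F₁ D₁) (h₂ : RegularNear C ℓ F₂ D₂) {r : ℝ}
    (hr : 0 < r) : |energy ℓ F₁ F₂ r| ≤ 16 * C ^ 3 * r ^ 3 := by
  have hℓ := h₁.ℓ_pos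
  have hC := h₁.C_pos
  refine (abs_integral_le_of_abs_le fun ξ hξ => h₁.abs_energyDensity_le h₂ hr hξ).trans ?_
  have := pow_le_pow_left₀ (by positivity) (div_one_add_le_self hℓ hr) 3
  have h3 : 0 ≤ C ^ 3 := by positivity
  nlinarith

theorem tendsto_energy_zero (h₁ : RegularNear C ℓ F₁ D₁) (h₂ : RegularNear C ℓ F₂ D₂) :
    Tendsto (energy ℓ F₁ F₂) (𝓝[>] 0) (𝓝 0) := by
  have h0 : Tendsto (fun r : ℝ => 16 * C ^ 3 * r ^ 3) (𝓝[>] 0) (𝓝 (16 * C ^ 3 * 0 ^ 3)) :=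
    (Continuous.tendsto (by fun_prop) 0).mono_left nhdsWithin_le_nhds
  norm_num at h0
  refine squeeze_zero_norm' ?_ h0
  filter_upwards [self_mem_nhdsWithin] with r hr using h₁.abs_energy_le h₂ hr

theorem tendsto_electric_flux (h : RegularNear C ℓ F D) {ξ : ℝ} (hξ : ξ ∈ Ioo (-1 : ℝ) 1) :
    Tendsto (fun r => r ^ 2 * (profile 0 F r).ar ξ / F.S r) atTop (𝓝 (-D.A ξ)) := by
  have hξ' := Ioo_subset_Icc_self hξ
  have h1 := ((h.reg.asym.A_lim ξ hξ').neg.div h.reg.asym.tendsto_S one_ne_zero)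
  rw [div_one] at h1
  refine h1.congr' ?_
  filter_upwards [eventually_gt_atTop 0] with r hr
  rw [Pi.div_apply, neg_neg, SmoothOnStrip.dr_eq h.reg.sol.smooth_α hr hξ']
  rfl

theorem tendsto_energyDensity (h₁ : RegularNear C ℓ F₁ D₁) (h₂ : RegularNear C ℓ F₂ D₂) {ξ : ℝ}
    (hξ : ξ ∈ Ioo (-1 : ℝ) 1) (hω : D₁.ωInf ξ = D₂.ωInf ξ) (hA : D₁.A ξ = D₂.A ξ) :
    Tendsto (fun r => energyDensity ℓ F₁ F₂ r ξ) atTop (𝓝 0) := by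
  have hξ' := Ioo_subset_Icc_self hξ
  have t1 := ((h₁.tendsto_electric_flux hξ).sub (h₂.tendsto_electric_flux hξ)).abs
  have t2 := ((h₁.reg.asym.tendsto_ω hξ').sub (h₂.reg.asym.tendsto_ω hξ')).abs
  rw [hA, sub_self, abs_zero] at t1
  rw [hω, sub_self, abs_zero] at t2
  have t3 := (t1.mul_const (2 * (C * ℓ))).add (t2.const_mul (2 * (C * ℓ)))
  rw [zero_mul, mul_zero, add_zero] at t3
  refine squeeze_zero_norm' ?_ t3
  filter_upwards [eventually_gt_atTop 0] with r hr
  obtain ⟨-, z1⟩ := h₁.flux_bounds hr hξ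
  obtain ⟨-, z2⟩ := h₂.flux_bounds hr hξ
  have a1 := (h₁.profile_near hr).α_le ξ hξ
  have a2 := (h₂.profile_near hr).α_le ξ hξ
  have hℓ := h₁.ℓ_pos
  have hC := h₁.C_pos
  have hCy : C * (r / (1 + r / ℓ)) ≤ C * ℓ := by gcongr; exact div_one_add_le_radius hℓ hr
  have hq := one_sub_sq_pos hξ
  have hs1 : |√(1 - ξ ^ 2)| ≤ 1 := by
    rw [abs_of_nonneg (Real.sqrt_nonneg _), Real.sqrt_le_one]; linarith [sq_nonneg ξ]
  have e : ∀ a b : ℝ, (1 - ξ ^ 2) * (a * b) = (√(1 - ξ ^ 2) * a) * (√(1 - ξ ^ 2) * b) := by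
    intro a b
    have := Real.mul_self_sqrt hq.le
    linear_combination (-(a * b)) * this
  have eω : √(1 - ξ ^ 2) * ((profile 0 F₁ r).f ξ - (profile 0 F₂ r).f ξ)
      = F₁.ω r ξ - F₂.ω r ξ := by
    simp only [profile, Fields.ω]; ring
  unfold energyDensity
  rw [e, eω]
  refine (norm_add_le _ _).trans (add_le_add (abs_mul_le_mul le_rfl ?_) (abs_mul_le_mul ?_ le_rfl))
  · exact (abs_sub _ _).trans (by linarith)
  · refine (abs_mul_le_mul hs1 ((abs_sub _ _).trans (add_le_add z1 z2))).trans (by linarith)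

theorem tendsto_energy_atTop (h₁ : RegularNear C ℓ F₁ D₁) (h₂ : RegularNear C ℓ F₂ D₂)
    (hω : EqOn D₁.ωInf D₂.ωInf (Ioo (-1) 1)) (hA : EqOn D₁.A D₂.A (Ioo (-1) 1)) :
    Tendsto (energy ℓ F₁ F₂) atTop (𝓝 0) := by
  have hℓ := h₁.ℓ_pos
  have hC := h₁.C_pos
  have hne : ∀ᵐ ξ : ℝ ∂MeasureTheory.volume, ξ ≠ 1 := by
    simp [MeasureTheory.ae_iff, MeasureTheory.measure_singleton]
  have key := intervalIntegral.tendsto_integral_filter_of_dominated_convergence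
    (μ := MeasureTheory.volume) (a := -1) (b := 1) (l := atTop) (F := energyDensity ℓ F₁ F₂)
    (f := fun _ => (0 : ℝ)) (fun _ => 8 * C ^ 3 * ℓ ^ 3) ?_ ?_ (by simp) ?_
  · rw [intervalIntegral.integral_zero] at key
    exact key
  · filter_upwards [eventually_gt_atTop 0] with r hr
    refine (intervalIntegrable_of_continuousOn ?_).aestronglyMeasurable_restrict_uIoc
    exact (continuousOn_energyDensity h₁.reg.sol h₂.reg.sol).comp (f := fun ξ : ℝ => (r, ξ))
      (by fun_prop) fun _ hξ => ⟨hr, hξ⟩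
  · filter_upwards [eventually_gt_atTop 0] with r hr
    filter_upwards [hne] with ξ hξ1 hξ
    rw [uIoc_of_le (by norm_num)] at hξ
    refine (h₁.abs_energyDensity_le h₂ hr ⟨hξ.1, lt_of_le_of_ne hξ.2 hξ1⟩).trans ?_
    have := div_one_add_le_radius hℓ hr
    gcongr
  · filter_upwards [hne] with ξ hξ1 hξ
    rw [uIoc_of_le (by norm_num)] at hξ
    have hξ' : ξ ∈ Ioo (-1 : ℝ) 1 := ⟨hξ.1, lt_of_le_of_ne hξ.2 hξ1⟩
    exact h₁.tendsto_energyDensity h₂ hξ' (hω hξ') (hA hξ')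

end RegularNear

/-! ### Uniqueness of globally regular solutions with given charges -/

/-- Constant of the near-vacuum estimates for solutions in the near-AdS regime. -/
def vacuumConst (C : ℝ) : ℝ := 2 * (28 * C) ^ 4

/-- Constant of the energy estimate. -/
def energyConst (L : ℝ) : ℝ := 2400000000 * L ^ 20

/-- Smallness of `ℓ` needed for the contraction argument. -/
def SmallRadius (L ℓ : ℝ) : Prop :=
  24 * L ^ 4 * (energyConst L ^ 2 + energyConst L + 1) * ℓ ^ 2 ≤ 1 / 2

theorem exists_radius_mul_sq_le (c : ℝ) (hc : 0 < c) :
    ∃ ℓ₀ : ℝ, 0 < ℓ₀ ∧ ∀ ℓ, 0 < ℓ → ℓ < ℓ₀ → c * ℓ ^ 2 ≤ 1 / 2 := by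
  refine ⟨1 / (2 * c + 1), by positivity, fun ℓ h0 h1 => ?_⟩
  have h2 : 0 < 2 * c + 1 := by linarith
  rw [lt_div_iff₀ h2] at h1
  have h3 : ℓ ≤ 1 := by nlinarith
  nlinarith

theorem monotoneOn_Ioi_of_hasDerivAt {r₀ : ℝ} {J J' : ℝ → ℝ}
    (hd : ∀ r, r₀ < r → HasDerivAt J (J' r) r) (hn : ∀ r, r₀ < r → 0 ≤ J' r) :
    MonotoneOn J (Ioi r₀) :=
  monotoneOn_of_deriv_nonneg (convex_Ioi r₀)
    (fun r hr => (hd r hr).continuousAt.continuousWithinAt)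
    (fun r hr => (hd r (interior_subset hr)).differentiableAt.differentiableWithinAt)
    fun r hr => by rw [(hd r (interior_subset hr)).deriv]; exact hn r (interior_subset hr)

namespace RegularNear

variable {C ℓ L T : ℝ} {F F₁ F₂ : Fields} {D D₁ D₂ : AsymptoticData}

theorem gaugeBounds (h : RegularNear C ℓ F D) : GaugeBounds (vacuumConst C) ℓ F :=
  (h.near.fieldBounds h.reg.sol h.one_le h.ℓ_pos h.small).gaugeBounds (by linarith [h.one_le]) h.ℓ_pos

theorem le_vacuumConst (h : RegularNear C ℓ F D) : 28 * C ≤ vacuumConst C := by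
  have h1 : 1 ≤ 28 * C := by linarith [h.one_le]
  have h2 : 28 * C ≤ (28 * C) ^ 4 := le_self_pow₀ h1 (by norm_num)
  unfold vacuumConst
  linarith

theorem one_le_vacuumConst (h : RegularNear C ℓ F D) : 1 ≤ vacuumConst C := by
  linarith [h.le_vacuumConst, h.one_le]

theorem nearVacuum (h : RegularNear C ℓ F D)
    (hs : 5 * vacuumConst C * vacuumConst C ^ 2 * ℓ ^ 2 ≤ 1 / 2) :
    NearVacuum (vacuumConst C) ℓ F :=
  ⟨h.metric.mono h.C_pos (by linarith [h.le_vacuumConst, h.one_le]), h.gaugeBounds, hs⟩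

theorem profile_bounded (h : RegularNear C ℓ F D) {r : ℝ} (hr : 0 < r) :
    (profile 0 F r).Bounded (10 * vacuumConst C ^ 3) (kap ℓ r) r (pAds ℓ r) := by
  refine (h.profile_near hr).bounded h.C_pos h.ℓ_pos hr h.small ?_
  have h1 := h.one_le_vacuumConst
  have h2 : vacuumConst C ≤ vacuumConst C ^ 3 := le_self_pow₀ h1 (by norm_num)
  linarith [h.le_vacuumConst]

end RegularNear

theorem SmallRadius.consequences {L ℓ : ℝ} (h : SmallRadius L ℓ) (hL : 1 ≤ L) :
    5 * L * L ^ 2 * ℓ ^ 2 ≤ 1 / 2 ∧ 192000 * L ^ 11 * ℓ ^ 2 ≤ 1 ∧ 10 * L ^ 3 * ℓ ^ 2 ≤ 1 := by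
  have hL0 : 0 ≤ L := by linarith
  have h1 : 1 ≤ L ^ 4 := one_le_pow₀ hL
  have h20 : 1 ≤ L ^ 20 := one_le_pow₀ hL
  have e11 : L ^ 11 ≤ L ^ 20 := pow_le_pow_right₀ hL (by norm_num)
  have e3 : L ^ 3 ≤ L ^ 20 := pow_le_pow_right₀ hL (by norm_num)
  have hA : energyConst L = 2400000000 * L ^ 20 := rfl
  have hA0 : 0 ≤ energyConst L := by rw [hA]; positivity
  have hX : energyConst L ≤ 24 * L ^ 4 * (energyConst L ^ 2 + energyConst L + 1) := by
    have h2 : energyConst L ≤ energyConst L ^ 2 + energyConst L + 1 := by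
      nlinarith [sq_nonneg (energyConst L)]
    have h3 : 0 ≤ energyConst L ^ 2 + energyConst L + 1 := by positivity
    nlinarith
  have hY : energyConst L * ℓ ^ 2 ≤ 1 / 2 := (mul_le_mul_of_nonneg_right hX (sq_nonneg ℓ)).trans h
  have hℓ := sq_nonneg ℓ
  have k : ∀ c : ℝ, c ≤ energyConst L → c * ℓ ^ 2 ≤ 1 / 2 := fun c hc =>
    (mul_le_mul_of_nonneg_right hc hℓ).trans hY
  refine ⟨k _ ?_, (k _ ?_).trans (by norm_num), (k _ ?_).trans (by norm_num)⟩
  · have : 5 * L * L ^ 2 = 5 * L ^ 3 := by ring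
    rw [this, hA]; linarith
  · rw [hA]; linarith
  · rw [hA]; linarith

/-- A pair of solutions in the near-AdS regime with the same charges. -/
structure SameCharges (C ℓ : ℝ) (F₁ F₂ : Fields) (D₁ D₂ : AsymptoticData) : Prop where
  left : RegularNear C ℓ F₁ D₁
  right : RegularNear C ℓ F₂ D₂
  qM_eq : ∀ ξ ∈ Ioo (-1 : ℝ) 1, qM D₁.ωInf ξ = qM D₂.ωInf ξ
  qE_eq : ∀ ξ ∈ Ioo (-1 : ℝ) 1, qE D₁.A ξ = qE D₂.A ξ
  small : SmallRadius (vacuumConst C) ℓ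

namespace SameCharges

variable {C ℓ T : ℝ} {F₁ F₂ : Fields} {D₁ D₂ : AsymptoticData}

theorem nearVacuum (h : SameCharges C ℓ F₁ F₂ D₁ D₂) :
    NearVacuum (vacuumConst C) ℓ F₁ ∧ NearVacuum (vacuumConst C) ℓ F₂ := by
  have hs := (h.small.consequences h.left.one_le_vacuumConst).1
  exact ⟨h.left.nearVacuum hs, h.right.nearVacuum hs⟩

theorem tendsto_energy (h : SameCharges C ℓ F₁ F₂ D₁ D₂) :
    Tendsto (energy ℓ F₁ F₂) atTop (𝓝 0) :=
  h.left.tendsto_energy_atTop h.right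
    (eqOn_of_qM_eq h.left.reg.asym.ωInf_diff h.right.reg.asym.ωInf_diff
      (fun _ hξ => (h.left.ωInf_bounds hξ).1) (fun _ hξ => (h.right.ωInf_bounds hξ).1)
      (fun _ hξ => (h.left.ωInf_bounds hξ).2) (fun _ hξ => (h.right.ωInf_bounds hξ).2) h.qM_eq)
    (eqOn_of_qE_eq h.qE_eq)

/-- The mean square difference of the gauge fields at radius `r`. -/
noncomputable def fieldDistance (ℓ : ℝ) (F₁ F₂ : Fields) (r : ℝ) : ℝ :=
  ∫ ξ in (-1 : ℝ)..1, GaugeProfile.diffDensity (profile 0 F₁ r) (profile 0 F₂ r) r (pAds ℓ r) ξ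

theorem fieldDistance_nonneg (ℓ : ℝ) (F₁ F₂ : Fields) (r : ℝ) : 0 ≤ fieldDistance ℓ F₁ F₂ r :=
  intervalIntegral.integral_nonneg (by norm_num) fun _ hξ =>
    GaugeProfile.diffDensity_nonneg r _ (pAds_pos ℓ r) hξ

/-- `GaugeProfile.integral_energyRate_ge` for two solutions whose metrics differ by at most `T`. -/
theorem energyRate_ge (h : SameCharges C ℓ F₁ F₂ D₁ D₂) {r : ℝ} (hr : 0 < r)
    (hm : |F₁.m r - F₂.m r| ≤ T * r) (hS : |F₁.S r - F₂.S r| ≤ T) :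
    1 / (16 * vacuumConst C ^ 2) * fieldDistance ℓ F₁ F₂ r
      ≤ (∫ ξ in (-1 : ℝ)..1, fieldsEnergyRate ℓ F₁ F₂ r ξ)
        + energyConst (vacuumConst C) * T ^ 2 * kap ℓ r ^ 2 := by
  obtain ⟨v₁, v₂⟩ := h.nearVacuum
  have hL := h.left.one_le_vacuumConst
  have hℓ := h.left.ℓ_pos
  obtain ⟨-, s2, -⟩ := h.small.consequences hL
  have b₁ := h.left.profile_bounded hr
  have b₂ := h.right.profile_bounded hr
  set L := vacuumConst C
  have hL0 : 0 < L := by linarith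
  obtain ⟨d1, d2, d3⟩ := difference_metric_coeffs hL0 hℓ v₁ v₂ hr hm hS
  have key := GaugeProfile.integral_energyRate_ge (h.left.reg.sol.profile_regular hr.le)
    (h.right.reg.sol.profile_regular hr.le) b₁ b₂ hr (kap_nonneg hr)
    (le_trans (by have := mul_kap_le hℓ hr; gcongr) s2) hL (pAds_pos ℓ r)
    (v₁.metric.S_low r hr) (v₂.metric.S_low r hr) (v₁.metric.S_le_one hL0 hr)
    (v₂.metric.S_le_one hL0 hr) (v₁.metric.half_pAds_le_μ v₁.gauge hL0 hL0.le hℓ v₁.small hr)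
    (v₂.metric.half_pAds_le_μ v₂.gauge hL0 hL0.le hℓ v₂.small hr) (v₁.metric.μ_le hr)
    (v₂.metric.μ_le hr) hS d1 d2 d3
  refine key.trans (le_of_eq ?_)
  unfold fieldsEnergyRate energyConst
  ring

/-- The energy, corrected by its possible decrease, controls the difference of the sources. -/
theorem sourceDifference (h : SameCharges C ℓ F₁ F₂ D₁ D₂)
    (hm : ∀ r, 0 < r → |F₁.m r - F₂.m r| ≤ T * r) (hS : ∀ r, 0 < r → |F₁.S r - F₂.S r| ≤ T) :
    SourceDifference (energyConst (vacuumConst C)) ℓ T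
      (fun r => energy ℓ F₁ F₂ r + energyConst (vacuumConst C) * T ^ 2 * kapPrim ℓ r)
      (fun r => (∫ ξ in (-1 : ℝ)..1, fieldsEnergyRate ℓ F₁ F₂ r ξ)
        + energyConst (vacuumConst C) * T ^ 2 * kap ℓ r ^ 2) F₁ F₂ := by
  have hL := h.left.one_le_vacuumConst
  have hℓ := h.left.ℓ_pos
  have hrate := fun r (hr : 0 < r) => h.energyRate_ge hr (hm r hr) (hS r hr)
  have bd₁ := fun r (hr : 0 < r) => h.left.profile_bounded hr
  have bd₂ := fun r (hr : 0 < r) => h.right.profile_bounded hr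
  obtain ⟨-, -, s3⟩ := h.small.consequences hL
  set L := vacuumConst C
  set A := energyConst L with hA
  have hL0 : 0 < L := by linarith
  have hA0 : 0 ≤ A := by rw [hA]; unfold energyConst; positivity
  have hA2 : 0 ≤ A * T ^ 2 := by positivity
  have hd : ∀ r, 0 < r → HasDerivAt (fun r => energy ℓ F₁ F₂ r + A * T ^ 2 * kapPrim ℓ r)
      ((∫ ξ in (-1 : ℝ)..1, fieldsEnergyRate ℓ F₁ F₂ r ξ) + A * T ^ 2 * kap ℓ r ^ 2) r := fun r hr =>
    (hasDerivAt_energy hℓ h.left.reg.sol h.right.reg.sol hr).add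
      ((hasDerivAt_kapPrim hℓ hr).const_mul _)
  have hn : ∀ r, 0 < r → 0 ≤ (∫ ξ in (-1 : ℝ)..1, fieldsEnergyRate ℓ F₁ F₂ r ξ)
      + A * T ^ 2 * kap ℓ r ^ 2 := fun r hr =>
    (mul_nonneg (by positivity) (fieldDistance_nonneg ℓ F₁ F₂ r)).trans (hrate r hr)
  have hmono := monotoneOn_Ioi_of_hasDerivAt hd hn
  -- the four source differences are bounded by the field distance, which the rate controls
  have src : ∀ r, 0 < r → ∀ lam, 0 < lam → ∀ X : ℝ,
      X ≤ 8 * (10 * L ^ 3) * (lam * kap ℓ r ^ 2 + fieldDistance ℓ F₁ F₂ r / lam) →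
      X ≤ A * (lam * kap ℓ r ^ 2 + ((∫ ξ in (-1 : ℝ)..1, fieldsEnergyRate ℓ F₁ F₂ r ξ)
      + A * T ^ 2 * kap ℓ r ^ 2) / lam) := by
    intro r hr lam hlam X hX
    refine hX.trans ?_
    set Y := (∫ ξ in (-1 : ℝ)..1, fieldsEnergyRate ℓ F₁ F₂ r ξ) + A * T ^ 2 * kap ℓ r ^ 2 with hY
    have hY0 : 0 ≤ Y := hn r hr
    have h1 : fieldDistance ℓ F₁ F₂ r ≤ 16 * L ^ 2 * Y := by
      have := hrate r hr
      rw [one_div_mul_eq_div, div_le_iff₀ (by positivity)] at this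
      linarith
    have e5 : L ^ 5 ≤ L ^ 20 := pow_le_pow_right₀ hL (by norm_num)
    have e3 : L ^ 3 ≤ L ^ 20 := pow_le_pow_right₀ hL (by norm_num)
    have h20 : 0 ≤ L ^ 20 := by positivity
    have c1 : 80 * L ^ 3 ≤ A := by rw [hA]; unfold energyConst; linarith
    have c2 : 1280 * L ^ 5 ≤ A := by rw [hA]; unfold energyConst; linarith
    calc _ ≤ 8 * (10 * L ^ 3) * (lam * kap ℓ r ^ 2 + 16 * L ^ 2 * Y / lam) := by gcongr
      _ = 80 * L ^ 3 * (lam * kap ℓ r ^ 2) + 1280 * L ^ 5 * (Y / lam) := by ring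
      _ ≤ A * (lam * kap ℓ r ^ 2) + A * (Y / lam) := by gcongr
      _ = _ := by ring
  have diffs := fun r (hr : 0 < r) lam (hlam : 0 < lam) =>
    GaugeProfile.source_differences (h.left.reg.sol.profile_regular hr.le)
      (h.right.reg.sol.profile_regular hr.le) (bd₁ r hr) (bd₂ r hr) hr (pAds_pos ℓ r)
      (by positivity) (le_trans (by have := mul_kap_le hℓ hr; gcongr) s3) hlam
  refine ⟨hd, hn, fun r hr => ?_, fun r hr => ?_, fun r hr lam hlam => src r hr lam hlam _ ?_,
    fun r hr lam hlam => src r hr lam hlam _ ?_, fun r hr lam hlam => src r hr lam hlam _ ?_,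
    fun r hr lam hlam => src r hr lam hlam _ ?_⟩
  -- the corrected energy increases from its value `0` at the centre
  · have h0 : Tendsto (fun r => energy ℓ F₁ F₂ r) (𝓝[>] 0) (𝓝 0) :=
      h.left.tendsto_energy_zero h.right
    have h1 : ∀ᶠ s in 𝓝[>] (0 : ℝ),
        energy ℓ F₁ F₂ s ≤ energy ℓ F₁ F₂ r + A * T ^ 2 * kapPrim ℓ r := by
      filter_upwards [Ioo_mem_nhdsGT hr] with s hs
      have h2 := hmono hs.1 hr hs.2.le
      have h3 := mul_nonneg hA2 (kapPrim_nonneg hℓ hs.1)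
      simp only at h2
      linarith
    exact le_of_tendsto h0 h1
  -- to a limit that consists of the correction alone, because the charges agree
  · have h0 := h.tendsto_energy.add_const (A * T ^ 2 * ℓ ^ 3)
    rw [zero_add] at h0
    refine ge_of_tendsto h0 ?_
    filter_upwards [eventually_ge_atTop r] with s hs
    have hs0 := hr.trans_le hs
    have h2 := hmono hr hs0 hs
    have h3 := mul_le_mul_of_nonneg_left (kapPrim_le_cube hℓ hs0) hA2
    simp only at h2 ⊢
    linarith
  · rw [h.left.reg.sol.η_eq hr, h.right.reg.sol.η_eq hr]
    exact (diffs r hr lam hlam).1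
  · rw [h.left.reg.sol.ζ_eq hr.le, h.right.reg.sol.ζ_eq hr.le]
    exact (diffs r hr lam hlam).2.1
  · rw [h.left.reg.sol.G_eq hr, h.right.reg.sol.G_eq hr]
    exact (diffs r hr lam hlam).2.2.1
  · rw [h.left.reg.sol.P_eq hr.le, h.right.reg.sol.P_eq hr.le]
    exact (diffs r hr lam hlam).2.2.2

theorem metric_eq (h : SameCharges C ℓ F₁ F₂ D₁ D₂) {r : ℝ} (hr : 0 < r) :
    F₁.m r = F₂.m r ∧ F₁.S r = F₂.S r := by
  obtain ⟨v₁, v₂⟩ := h.nearVacuum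
  have hL := h.left.one_le_vacuumConst
  have hA0 : 0 ≤ energyConst (vacuumConst C) := by
    unfold energyConst
    have : 0 ≤ vacuumConst C := by linarith
    positivity
  exact metric_unique hL hA0 h.left.ℓ_pos v₁ v₂ h.small
    (fun T _ hm hS => ⟨_, _, h.sourceDifference hm hS⟩) hr

/-- With equal metrics the energy is monotone, so it vanishes identically. -/
theorem fieldDistance_eq_zero (h : SameCharges C ℓ F₁ F₂ D₁ D₂) {r : ℝ} (hr : 0 < r) :
    fieldDistance ℓ F₁ F₂ r = 0 := by
  have hJ := h.sourceDifference (T := 0) (fun r hr => by rw [(h.metric_eq hr).1]; simp)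
    (fun r hr => by rw [(h.metric_eq hr).2]; simp)
  have hE : ∀ r, 0 < r → energy ℓ F₁ F₂ r = 0 := by
    intro r hr
    have h1 := hJ.nonneg r hr
    have h2 := hJ.le r hr
    norm_num at h1 h2
    exact le_antisymm h2 h1
  have hd := hasDerivAt_energy h.left.ℓ_pos h.left.reg.sol h.right.reg.sol hr
  have h0 : HasDerivAt (energy ℓ F₁ F₂) 0 r := by
    refine (hasDerivAt_const r (0 : ℝ)).congr_of_eventuallyEq ?_
    filter_upwards [Ioi_mem_nhds hr] with s hs using hE s hs
  have hz := hd.unique h0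
  have key := h.energyRate_ge (T := 0) hr (by rw [(h.metric_eq hr).1]; simp)
    (by rw [(h.metric_eq hr).2]; simp)
  have hL := h.left.one_le_vacuumConst
  rw [hz, one_div_mul_eq_div, div_le_iff₀ (by positivity)] at key
  refine le_antisymm ?_ (fieldDistance_nonneg ℓ F₁ F₂ r)
  simpa using key

/-- Vanishing `fieldDistance` forces `f₁ = f₂` and equal radial derivatives of `α₁` and `α₂`. -/
theorem fields_eq_interior (h : SameCharges C ℓ F₁ F₂ D₁ D₂) {r ξ : ℝ} (hr : 0 < r)
    (hξ : ξ ∈ Ioo (-1 : ℝ) 1) : F₁.α r ξ = F₂.α r ξ ∧ F₁.f r ξ = F₂.f r ξ := by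
  have hξ' := Ioo_subset_Icc_self hξ
  have hq := one_sub_sq_pos hξ
  have zero : ∀ r, 0 < r →
      GaugeProfile.diffDensity (profile 0 F₁ r) (profile 0 F₂ r) r (pAds ℓ r) ξ = 0 := by
    intro r hr
    by_contra hne
    have hpos := lt_of_le_of_ne (GaugeProfile.diffDensity_nonneg (φ₁ := profile 0 F₁ r)
      (φ₂ := profile 0 F₂ r) r _ (pAds_pos ℓ r) hξ') (Ne.symm hne)
    have := intervalIntegral.integral_pos (by norm_num)
      (GaugeProfile.diffDensity_cont r (pAds ℓ r) (h.left.reg.sol.profile_regular hr.le)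
        (h.right.reg.sol.profile_regular hr.le))
      (fun ξ hξ => GaugeProfile.diffDensity_nonneg r _ (pAds_pos ℓ r) (Ioc_subset_Icc_self hξ))
      ⟨ξ, hξ', hpos⟩
    exact this.ne' (h.fieldDistance_eq_zero hr)
  have parts : ∀ r, 0 < r → (profile 0 F₁ r).ar ξ = (profile 0 F₂ r).ar ξ ∧ F₁.f r ξ = F₂.f r ξ := by
    intro r hr
    have hp := pAds_pos ℓ r
    have e := zero r hr
    unfold GaugeProfile.diffDensity at e
    have n1 : 0 ≤ r ^ 2 * ((profile 0 F₁ r).ar ξ - (profile 0 F₂ r).ar ξ) ^ 2 := by positivity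
    have n2 : 0 ≤ (1 - ξ ^ 2) / pAds ℓ r * ((profile 0 F₁ r).ax ξ - (profile 0 F₂ r).ax ξ) ^ 2 := by
      positivity
    have n3 : 0 ≤ (1 - ξ ^ 2) * pAds ℓ r * ((profile 0 F₁ r).fr ξ - (profile 0 F₂ r).fr ξ) ^ 2 := by
      positivity
    have n4 : 0 ≤ (1 - ξ ^ 2) / r ^ 2 * ((profile 0 F₁ r).f ξ - (profile 0 F₂ r).f ξ) ^ 2 := by
      positivity
    have n5 : 0 ≤ ((profile 0 F₁ r).du ξ - (profile 0 F₂ r).du ξ) ^ 2 / r ^ 2 := by positivity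
    have z1 : r ^ 2 * ((profile 0 F₁ r).ar ξ - (profile 0 F₂ r).ar ξ) ^ 2 = 0 := by linarith
    have z4 : (1 - ξ ^ 2) / r ^ 2 * ((profile 0 F₁ r).f ξ - (profile 0 F₂ r).f ξ) ^ 2 = 0 := by
      linarith
    have y1 := (mul_eq_zero.1 z1).resolve_left (by positivity)
    have y4 := (mul_eq_zero.1 z4).resolve_left (by positivity)
    exact ⟨sub_eq_zero.1 (pow_eq_zero_iff two_ne_zero |>.1 y1),
      sub_eq_zero.1 (pow_eq_zero_iff two_ne_zero |>.1 y4)⟩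
  refine ⟨?_, (parts r hr).2⟩
  -- `α₁ - α₂` does not depend on `r`, and it vanishes at the centre
  have hd : ∀ s ∈ Ioi (0 : ℝ), HasDerivAt (fun s => F₁.α s ξ - F₂.α s ξ) 0 s := fun s hs =>
    ((SmoothOnStrip.hasDerivAt_radial h.left.reg.sol.smooth_α hs hξ').sub
      (SmoothOnStrip.hasDerivAt_radial h.right.reg.sol.smooth_α hs hξ')).congr_deriv
      (sub_eq_zero.2 (parts s hs).1)
  have hconst : ∀ s ∈ Ioi (0 : ℝ), F₁.α s ξ - F₂.α s ξ = F₁.α r ξ - F₂.α r ξ := fun s hs =>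
    isOpen_Ioi.is_const_of_deriv_eq_zero (convex_Ioi _).isPreconnected
      (fun z hz => (hd z hz).differentiableAt.differentiableWithinAt)
      (fun z hz => (hd z hz).deriv) hs hr
  have lim : ∀ {F : Fields} {D : AsymptoticData}, IsGloballyRegular ℓ F D →
      Tendsto (fun r => F.α r ξ) (𝓝[>] 0) (𝓝 0) := fun hF =>
    tendsto_zero_of_isBigO_pow one_ne_zero (by simpa using hF.α_zero ξ hξ')
  have hlim := (lim h.left.reg).sub (lim h.right.reg)
  rw [sub_zero] at hlim
  have hlim' : Tendsto (fun s => F₁.α s ξ - F₂.α s ξ) (𝓝[>] 0) (𝓝 (F₁.α r ξ - F₂.α r ξ)) := by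
    refine tendsto_const_nhds.congr' ?_
    filter_upwards [self_mem_nhdsWithin] with s hs using (hconst s hs).symm
  exact sub_eq_zero.1 (tendsto_nhds_unique hlim' hlim)

theorem eq (h : SameCharges C ℓ F₁ F₂ D₁ D₂) {r : ℝ} (hr : 0 ≤ r) :
    F₁.m r = F₂.m r ∧ F₁.S r = F₂.S r ∧
      ∀ ξ ∈ Icc (-1 : ℝ) 1, F₁.α r ξ = F₂.α r ξ ∧ F₁.ω r ξ = F₂.ω r ξ := by
  have ext1 : ∀ {g₁ g₂ : ℝ → ℝ}, ContinuousOn g₁ (Ici 0) → ContinuousOn g₂ (Ici 0) →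
      EqOn g₁ g₂ (Ioi 0) → EqOn g₁ g₂ (Ici 0) := fun c₁ c₂ e =>
    e.of_subset_closure c₁ c₂ Ioi_subset_Ici_self (by rw [closure_Ioi])
  have ext2 : ∀ {g₁ g₂ : ℝ → ℝ → ℝ}, SmoothOnStrip 0 g₁ → SmoothOnStrip 0 g₂ →
      (∀ r, 0 < r → ∀ ξ ∈ Ioo (-1 : ℝ) 1, g₁ r ξ = g₂ r ξ) →
      ∀ ξ ∈ Icc (-1 : ℝ) 1, g₁ r ξ = g₂ r ξ := by
    intro g₁ g₂ c₁ c₂ e ξ hξ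
    have : EqOn (fun p : ℝ × ℝ => g₁ p.1 p.2) (fun p : ℝ × ℝ => g₂ p.1 p.2)
        (Ioi 0 ×ˢ Ioo (-1) 1) := fun p hp => e p.1 hp.1 p.2 hp.2
    refine this.of_subset_closure c₁.continuousOn c₂.continuousOn
      (Set.prod_mono Ioi_subset_Ici_self Ioo_subset_Icc_self) ?_
      (show (r, ξ) ∈ Ici 0 ×ˢ Icc (-1) 1 from ⟨hr, hξ⟩)
    rw [closure_prod_eq, closure_Ioi, closure_Ioo (by norm_num)]
  have s₁ := h.left.reg.sol
  have s₂ := h.right.reg.sol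
  refine ⟨ext1 s₁.smooth_m.continuousOn s₂.smooth_m.continuousOn (fun r hr => (h.metric_eq hr).1) hr,
    ext1 s₁.smooth_S.continuousOn s₂.smooth_S.continuousOn (fun r hr => (h.metric_eq hr).2) hr,
    fun ξ hξ => ⟨ext2 s₁.smooth_α s₂.smooth_α (fun r hr ξ hξ => (h.fields_eq_interior hr hξ).1) ξ hξ,
      ?_⟩⟩
  unfold Fields.ω
  rw [ext2 s₁.smooth_f s₂.smooth_f (fun r hr ξ hξ => (h.fields_eq_interior hr hξ).2) ξ hξ]

end SameCharges

theorem rhoConst_congr {F₁ F₂ : Fields} {k : ℕ}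
    (h : ∀ r, 0 ≤ r → ∀ ξ ∈ Icc (-1 : ℝ) 1, F₁.α r ξ = F₂.α r ξ) : rhoConst F₁ k = rhoConst F₂ k := by
  unfold rhoConst
  congr 1
  refine integral_congr_Ioo fun ξ hξ => ?_
  have e : EqOn (fun r => F₁.α r ξ) (fun r => F₂.α r ξ) (Ici 0) :=
    fun r hr => h r hr ξ (Ioo_subset_Icc_self hξ)
  rw [iteratedDerivWithin_congr e self_mem_Ici]

theorem sigmaConst_congr {F₁ F₂ : Fields} {k : ℕ}
    (h : ∀ r, 0 ≤ r → ∀ ξ ∈ Icc (-1 : ℝ) 1, F₁.ω r ξ = F₂.ω r ξ) :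
    sigmaConst F₁ k = sigmaConst F₂ k := by
  unfold sigmaConst
  congr 1
  refine integral_congr_Ioo fun ξ hξ => ?_
  have e : EqOn (fun r => F₁.ω r ξ) (fun r => F₂.ω r ξ) (Ici 0) :=
    fun r hr => h r hr ξ (Ioo_subset_Icc_self hξ)
  rw [iteratedDerivWithin_congr e self_mem_Ici]

/-- Charges determine globally regular solutions in the near-AdS regime. -/
theorem globallyRegular_unique (C : ℝ) (hC : 0 < C) : ∃ ℓ₀ : ℝ, 0 < ℓ₀ ∧ ∀ ℓ : ℝ, 0 < ℓ → ℓ < ℓ₀ →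
      ∀ (F₁ F₂ : Fields) (D₁ D₂ : AsymptoticData),
        IsGloballyRegular ℓ F₁ D₁ → NearAdS C ℓ F₁ →
        IsGloballyRegular ℓ F₂ D₂ → NearAdS C ℓ F₂ →
        (∀ ξ ∈ Ioo (-1 : ℝ) 1, qM D₁.ωInf ξ = qM D₂.ωInf ξ) →
        (∀ ξ ∈ Ioo (-1 : ℝ) 1, qE D₁.A ξ = qE D₂.A ξ) →
        (∀ r, 0 ≤ r → F₁.m r = F₂.m r ∧ F₁.S r = F₂.S r ∧
          ∀ ξ ∈ Icc (-1 : ℝ) 1, F₁.α r ξ = F₂.α r ξ ∧ F₁.ω r ξ = F₂.ω r ξ) ∧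
        (∀ k : ℕ, 1 ≤ k → rhoConst F₁ k = rhoConst F₂ k) ∧
        (∀ k : ℕ, 2 ≤ k → sigmaConst F₁ k = sigmaConst F₂ k) := by
  have hL : 0 < vacuumConst C := by unfold vacuumConst; positivity
  have hA : 0 < energyConst (vacuumConst C) := by unfold energyConst; positivity
  obtain ⟨ℓ₁, h1, H1⟩ := exists_radius_mul_sq_le C hC
  obtain ⟨ℓ₂, h2, H2⟩ := exists_radius_mul_sq_le (24 * vacuumConst C ^ 4 *
    (energyConst (vacuumConst C) ^ 2 + energyConst (vacuumConst C) + 1)) (by positivity)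
  refine ⟨min ℓ₁ ℓ₂, lt_min h1 h2, ?_⟩
  intro ℓ hℓ hlt F₁ F₂ D₁ D₂ g₁ n₁ g₂ n₂ hM hE
  have hC1 := (g₁.metricRegular n₁.S_low).one_le hC
  have hs := H1 ℓ hℓ (hlt.trans_le (min_le_left _ _))
  have h : SameCharges C ℓ F₁ F₂ D₁ D₂ := ⟨⟨g₁, n₁, hC1, hℓ, hs⟩, ⟨g₂, n₂, hC1, hℓ, hs⟩, hM, hE,
    H2 ℓ hℓ (hlt.trans_le (min_le_right _ _))⟩
  exact ⟨fun r hr => h.eq hr, fun k _ => rhoConst_congr fun r hr ξ hξ => ((h.eq hr).2.2 ξ hξ).1,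
    fun k _ => sigmaConst_congr fun r hr ξ hξ => ((h.eq hr).2.2 ξ hξ).2⟩

/-! ### The mass of globally regular solutions -/

/-- The sources are `O(kap²)`, so `m'` integrates to `O(kapPrim) = O(ℓ³)`. -/
theorem globallyRegular_mass (C : ℝ) (hC : 0 < C) : ∃ K ℓ₀ : ℝ, 0 < K ∧ 0 < ℓ₀ ∧
    ∀ ℓ : ℝ, 0 < ℓ → ℓ < ℓ₀ → ∀ (F : Fields) (D : AsymptoticData), IsGloballyRegular ℓ F D →
      NearAdS C ℓ F → 0 ≤ D.M ∧ D.M ≤ K * ℓ ^ 3 := by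
  have hL : 0 < vacuumConst C := by unfold vacuumConst; positivity
  obtain ⟨ℓ₁, h1, H1⟩ := exists_radius_mul_sq_le C hC
  obtain ⟨ℓ₂, h2, H2⟩ := exists_radius_mul_sq_le (5 * vacuumConst C * C ^ 2) (by positivity)
  refine ⟨5 * vacuumConst C * C ^ 2, min ℓ₁ ℓ₂, by positivity, lt_min h1 h2, ?_⟩
  intro ℓ hℓ hlt F D g n
  have h : RegularNear C ℓ F D := ⟨g, n, (g.metricRegular n.S_low).one_le hC, hℓ,
    H1 ℓ hℓ (hlt.trans_le (min_le_left _ _))⟩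
  exact h.metric.mass_bounds h.gaugeBounds hC hL.le hℓ (H2 ℓ hℓ (hlt.trans_le (min_le_right _ _)))
    g.asym.tendsto_m

/-! ### The mass of black holes -/

namespace IsBlackHole

variable {ℓ r_h C : ℝ} {F : Fields} {D : AsymptoticData}

theorem monotoneOn_m (h : IsBlackHole ℓ r_h F D) : MonotoneOn F.m (Ici r_h) := by
  refine monotoneOn_of_deriv_nonneg (convex_Ici r_h) h.sol.smooth_m.continuousOn
    (fun r hr => ?_) fun r hr => ?_
  all_goals rw [interior_Ici] at hr
  · exact (h.sol.m_differentiableAt hr).differentiableWithinAt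
  · exact deriv_m_nonneg (h.sol.μ_pos r hr) (h.sol.einstein r hr)

theorem m_horizon (h : IsBlackHole ℓ r_h F D) (hr : 0 < r_h) :
    F.m r_h = r_h / 2 + r_h ^ 3 / 2 * (ℓ ^ 2)⁻¹ := by
  have e := h.horizon
  unfold Fields.μ at e
  have e2 : 2 * F.m r_h / r_h = 1 + r_h ^ 2 / ℓ ^ 2 := by linarith
  rw [div_eq_iff hr.ne'] at e2
  have : F.m r_h = (1 + r_h ^ 2 / ℓ ^ 2) * r_h / 2 := by linarith
  rw [this]; ring

theorem m_pos (h : IsBlackHole ℓ r_h F D) (h0 : 0 < r_h) {r : ℝ} (hr : r_h ≤ r) : 0 < F.m r := by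
  refine lt_of_lt_of_le ?_ (h.monotoneOn_m self_mem_Ici hr hr)
  rw [h.m_horizon h0]; positivity

theorem mass_ge (h : IsBlackHole ℓ r_h F D) (h0 : 0 < r_h) :
    r_h ^ 3 / 2 * (ℓ ^ 2)⁻¹ ≤ D.M := by
  refine ge_of_tendsto h.asym.tendsto_m ?_
  filter_upwards [eventually_ge_atTop r_h] with r hr
  have := h.monotoneOn_m self_mem_Ici hr hr
  rw [h.m_horizon h0] at this
  linarith

/-- The electric energy flux `∫ r² α_r α / S dξ` through the sphere of radius `r`. -/
noncomputable def electricFlux (r_h : ℝ) (F : Fields) (r : ℝ) : ℝ :=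
  ∫ ξ in (-1 : ℝ)..1, r ^ 2 * (profile r_h F r).ar ξ / F.S r * F.α r ξ

/-- By the electric Yang-Mills equation the flux grows at the rate of the electric sources of the
Einstein equations. -/
theorem hasDerivAt_electricFlux (h : IsBlackHole ℓ r_h F D) (h0 : 0 < r_h) {r : ℝ} (hr : r_h < r) :
    HasDerivAt (electricFlux r_h F)
      (2 * (F.ζ r / (F.μ ℓ r * F.S r)) + 2 * (r ^ 2 * F.η r / F.S r)) r := by
  obtain ⟨a1, -, a3, a4, -, a6, -, a8, a9, a10, a11⟩ := h.sol.jointlyContinuous h0.le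
  have hR : ContinuousOn (fun p : ℝ × ℝ => p.1 ^ 2) (Ioi r_h ×ˢ Icc (-1) 1) := by fun_prop
  have A1 := (a6.div (a9.mul a8) fun p hp => (mul_pos (a11 p hp) (a10 p hp)).ne').neg
  have A2 := (hR.mul a3).div a8 fun p hp => (a10 p hp).ne'
  have hd := hasDerivAt_integral_strip (r₀ := r_h)
    (H := fun r ξ => r ^ 2 * (profile r_h F r).ar ξ / F.S r * F.α r ξ)
    (H' := fun r ξ => -((profile r_h F r).dcur ξ / (F.μ ℓ r * F.S r)) * F.α r ξ
      + r ^ 2 * (profile r_h F r).ar ξ / F.S r * (profile r_h F r).ar ξ)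
    (A2.mul a1) ((A1.mul a1).add (A2.mul a3)) (fun r hr ξ hξ =>
      (h.sol.hasDerivAt_electric_flux (h0.trans hr) hr hξ).mul
        (SmoothOnStrip.hasDerivAt_radial h.sol.smooth_α hr (Ioo_subset_Icc_self hξ))) hr
  refine hd.congr_deriv ?_
  have hreg := h.sol.profile_regular hr.le
  have parts := integral_deriv_mul_eq_neg hreg.cur_cont hreg.α_cont hreg.dcur_cont hreg.ax_cont
    (fun ξ hξ => hreg.hasDerivAt_cur hξ) hreg.α_deriv (by simp [GaugeProfile.cur])
    (by simp [GaugeProfile.cur])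
  rw [h.sol.ζ_eq hr.le, h.sol.η_eq hr]
  have c1 := hreg.α_cont
  have c2 := hreg.dcur_cont
  have c3 := hreg.ar_cont
  have i1 : IntervalIntegrable (fun ξ => (profile r_h F r).dcur ξ * (profile r_h F r).α ξ)
      MeasureTheory.volume (-1) 1 := intervalIntegrable_of_continuousOn (by fun_prop)
  have i2 : IntervalIntegrable (fun ξ => (profile r_h F r).ar ξ ^ 2)
      MeasureTheory.volume (-1) 1 := intervalIntegrable_of_continuousOn (by fun_prop)
  have e : ∀ ξ, -((profile r_h F r).dcur ξ / (F.μ ℓ r * F.S r)) * F.α r ξ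
      + r ^ 2 * (profile r_h F r).ar ξ / F.S r * (profile r_h F r).ar ξ
      = -(1 / (F.μ ℓ r * F.S r)) * ((profile r_h F r).dcur ξ * (profile r_h F r).α ξ)
        + r ^ 2 / F.S r * (profile r_h F r).ar ξ ^ 2 := fun ξ => by
    have : F.α r ξ = (profile r_h F r).α ξ := rfl
    rw [this]; ring
  simp only [e]
  rw [intervalIntegral.integral_add (i1.const_mul _) (i2.const_mul _),
    intervalIntegral.integral_const_mul, intervalIntegral.integral_const_mul, parts]
  have e2 : ∫ ξ in (-1 : ℝ)..1, (profile r_h F r).cur ξ * (profile r_h F r).ax ξ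
      = ∫ ξ in (-1 : ℝ)..1, (1 - ξ ^ 2) * (profile r_h F r).f ξ ^ 2 * (profile r_h F r).ax ξ ^ 2 :=
    integral_congr_Ioo fun ξ _ => by unfold GaugeProfile.cur; ring
  rw [e2]
  ring

theorem one_le (h : IsBlackHole ℓ r_h F D) (hb : BoundedHair C r_h F) (hC : 0 < C) : 1 ≤ C := by
  have : C⁻¹ ≤ 1 := ge_of_tendsto h.asym.tendsto_S (by
    filter_upwards [eventually_ge_atTop r_h] with r hr using hb.S_low r hr)
  exact (inv_le_one₀ hC).1 this

theorem abs_electricFlux_le (h : IsBlackHole ℓ r_h F D) (hb : BoundedHair C r_h F) (hC : 0 < C)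
    {r : ℝ} (hr : r_h < r) : |electricFlux r_h F r| ≤ 2 * C ^ 3 := by
  have hS := h.sol.S_pos r hr.le
  have hi : (F.S r)⁻¹ ≤ C := inv_le_of_inv_le₀ hC (hb.S_low r hr.le)
  refine abs_integral_le_of_abs_le fun ξ hξ => ?_
  obtain ⟨b1, b2⟩ := hb.α_bd r hr ξ hξ
  rw [SmoothOnStrip.dr_eq h.sol.smooth_α hr (Ioo_subset_Icc_self hξ)] at b2
  have b3 : |r ^ 2 * (profile r_h F r).ar ξ / F.S r| ≤ C * C := by
    rw [div_eq_mul_inv]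
    refine abs_mul_le_mul ?_ (by rw [abs_of_pos (by positivity)]; exact hi)
    rw [abs_mul, abs_of_nonneg (sq_nonneg r)]
    exact b2
  exact (abs_mul_le_mul b3 b1).trans (le_of_eq (by ring))

/-- The magnetic sources are bounded by `1/r²`. The electric ones are not controlled pointwise, since
there is no bound on `α_ξ` and `1/μ` is singular at the horizon; they are kept in the form in which
they make up the derivative of `electricFlux`. -/
theorem deriv_m_le (h : IsBlackHole ℓ r_h F D) (hb : BoundedHair C r_h F) (hC : 0 < C)
    (h0 : 0 < r_h) {r : ℝ} (hr : r_h < r) :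
    deriv F.m r ≤ 3 * C / 16 * (2 * (F.ζ r / (F.μ ℓ r * F.S r)) + 2 * (r ^ 2 * F.η r / F.S r))
      + 3 / 2 * (C ^ 2 * ((r_h ^ 2)⁻¹ + (ℓ ^ 2)⁻¹) + 9 * C ^ 4) * (r ^ 2)⁻¹ := by
  have hr0 : 0 < r := h0.trans hr
  have hC1 := h.one_le hb hC
  have hS := h.sol.S_pos r hr.le
  have hi : (F.S r)⁻¹ ≤ C := inv_le_of_inv_le₀ hC (hb.S_low r hr.le)
  have hμ := h.sol.μ_pos r hr
  have hm := h.m_pos h0 hr.le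
  have aq : ∀ ξ ∈ Ioo (-1 : ℝ) 1, |1 - ξ ^ 2| ≤ 1 := by
    intro ξ hξ
    have := one_sub_sq_pos hξ
    rw [abs_of_pos this]; linarith [sq_nonneg ξ]
  have hG : F.G r ≤ C ^ 2 * (r ^ 2)⁻¹ ^ 2 := by
    rw [h.sol.G_eq hr]
    have key := (le_abs_self _).trans (abs_integral_le_of_abs_le (c := 1 * (C * (r ^ 2)⁻¹) ^ 2)
      fun ξ hξ => by
        refine abs_mul_le_mul (aq ξ hξ) (abs_sq_le (a := (profile r_h F r).fr ξ) ?_)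
        have b := (hb.f_bd r hr ξ hξ).2.2
        rw [SmoothOnStrip.dr_eq h.sol.smooth_f hr (Ioo_subset_Icc_self hξ)] at b
        rw [← div_eq_mul_inv, le_div_iff₀ (by positivity), mul_comm]
        exact b)
    calc _ ≤ 1 / 2 * (2 * (1 * (C * (r ^ 2)⁻¹) ^ 2)) := by gcongr
      _ = _ := by ring
  have hP : F.P r ≤ 9 * C ^ 4 := by
    rw [h.sol.P_eq hr.le]
    have key := (le_abs_self _).trans (abs_integral_le_of_abs_le (c := (6 * C ^ 2) ^ 2)
      fun ξ hξ => by
        refine abs_sq_le (a := (profile r_h F r).du ξ) ?_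
        obtain ⟨b1, b2, -⟩ := hb.f_bd r hr ξ hξ
        rw [SmoothOnStrip.dxi_eq h.sol.smooth_f hr.le hξ] at b2
        have aξ : |ξ| ≤ 1 := abs_le.2 ⟨hξ.1.le, hξ.2.le⟩
        have b3 := abs_le.1 (abs_mul_le_mul (aq ξ hξ) (abs_mul_le_mul b1 b2))
        have b4 : |F.f r ξ ^ 2 - 1| ≤ 2 * C ^ 2 := by
          have h1 := abs_le.1 (abs_sq_le b1)
          have h2 : 1 ≤ C ^ 2 := one_le_pow₀ hC1
          rw [abs_le]; constructor <;> linarith [sq_nonneg (F.f r ξ)]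
        have b5 := abs_le.1 (abs_mul_le_mul aξ b4)
        have e : (profile r_h F r).du ξ = -2 * (ξ * (F.f r ξ ^ 2 - 1))
            + 2 * ((1 - ξ ^ 2) * (F.f r ξ * stripDxi r_h F.f r ξ)) := by
          simp only [GaugeProfile.du, profile]; ring
        rw [e, abs_le]; constructor <;> linarith)
    calc _ ≤ 1 / 8 * (2 * (6 * C ^ 2) ^ 2) := by gcongr
      _ = _ := by ring
  have hμ' : F.μ ℓ r ≤ 1 + r ^ 2 / ℓ ^ 2 := by
    unfold Fields.μ
    have : 0 ≤ 2 * F.m r / r := by positivity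
    linarith
  have hη := F.η_nonneg r
  have hζ := F.ζ_nonneg r
  have t1 : r ^ 2 * F.η r / (4 * F.S r ^ 2) ≤ C / 4 * (r ^ 2 * F.η r / F.S r) := by
    calc _ = (F.S r)⁻¹ / 4 * (r ^ 2 * F.η r / F.S r) := by field_simp
      _ ≤ _ := by gcongr
  have t2 : F.ζ r / (4 * F.μ ℓ r * F.S r ^ 2) ≤ C / 4 * (F.ζ r / (F.μ ℓ r * F.S r)) := by
    calc _ = (F.S r)⁻¹ / 4 * (F.ζ r / (F.μ ℓ r * F.S r)) := by field_simp
      _ ≤ _ := by gcongr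
  have t3 : F.μ ℓ r * F.G r ≤ C ^ 2 * ((r_h ^ 2)⁻¹ + (ℓ ^ 2)⁻¹) * (r ^ 2)⁻¹ := by
    calc _ ≤ (1 + r ^ 2 / ℓ ^ 2) * (C ^ 2 * (r ^ 2)⁻¹ ^ 2) := by
          have := F.G_nonneg r; gcongr
      _ = C ^ 2 * ((r ^ 2)⁻¹ + (ℓ ^ 2)⁻¹) * (r ^ 2)⁻¹ := by field_simp
      _ ≤ _ := by gcongr
  have t4 : F.P r / r ^ 2 ≤ 9 * C ^ 4 * (r ^ 2)⁻¹ := by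
    rw [div_eq_mul_inv]; gcongr
  rw [(h.sol.einstein r hr).1]
  linarith

/-- Integrating `deriv_m_le` from the horizon: the electric sources contribute the growth of the
bounded electric flux, the magnetic ones the integral of `1/r²`. -/
theorem mass_le (h : IsBlackHole ℓ r_h F D) (hb : BoundedHair C r_h F) (hC : 0 < C)
    (h0 : 0 < r_h) : D.M ≤ r_h / 2 + r_h ^ 3 / 2 * (ℓ ^ 2)⁻¹ + 3 / 4 * C ^ 4
      + 3 / 2 * (C ^ 2 * ((r_h ^ 2)⁻¹ + (ℓ ^ 2)⁻¹) + 9 * C ^ 4) * r_h⁻¹ := by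
  set B := 3 / 2 * (C ^ 2 * ((r_h ^ 2)⁻¹ + (ℓ ^ 2)⁻¹) + 9 * C ^ 4) with hB
  have hB0 : 0 ≤ B := by positivity
  -- the flux and `-1/r` together grow at least as fast as `m`
  have hmono := monotoneOn_Ioi_of_hasDerivAt (r₀ := r_h)
    (J := fun r => 3 * C / 16 * electricFlux r_h F r + B * (-r⁻¹) - F.m r)
    (fun r hr => (((h.hasDerivAt_electricFlux h0 hr).const_mul (3 * C / 16)).add
      (((hasDerivAt_inv (h0.trans hr).ne').neg).const_mul B)).sub
      (h.sol.m_differentiableAt hr).hasDerivAt)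
    (fun r hr => by
      have := h.deriv_m_le hb hC h0 hr
      rw [← hB] at this
      rw [neg_neg]
      linarith)
  have key : ∀ r, r_h < r → F.m r ≤ F.m r_h + 3 / 4 * C ^ 4 + B * r_h⁻¹ := by
    intro r hr
    have hcont : Tendsto F.m (𝓝[>] r_h) (𝓝 (F.m r_h)) :=
      (h.sol.smooth_m.continuousOn r_h self_mem_Ici).mono Ioi_subset_Ici_self
    have hlim := ((hcont.add_const (3 / 4 * C ^ 4)).add_const (B * r_h⁻¹))
    refine ge_of_tendsto hlim ?_
    filter_upwards [Ioo_mem_nhdsGT hr] with a ha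
    have h1 := hmono ha.1 hr ha.2.le
    simp only at h1
    have f1 := abs_le.1 (h.abs_electricFlux_le hb hC hr)
    have f2 := abs_le.1 (h.abs_electricFlux_le hb hC ha.1)
    have f3 : 3 * C / 16 * (electricFlux r_h F r - electricFlux r_h F a) ≤ 3 * C / 16 * (4 * C ^ 3) := by
      gcongr; linarith
    have f4 : 0 ≤ B * r⁻¹ := by have := h0.trans hr; positivity
    have f5 : B * a⁻¹ ≤ B * r_h⁻¹ := by have := ha.1; gcongr
    have e : 3 * C / 16 * (4 * C ^ 3) = 3 / 4 * C ^ 4 := by ring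
    linarith
  refine le_of_tendsto h.asym.tendsto_m ?_
  filter_upwards [eventually_gt_atTop r_h] with r hr
  have := key r hr
  rwa [h.m_horizon h0] at this

end IsBlackHole

/-- The mass at the horizon, `m(r_h) = r_h/2 + r_h³/(2ℓ²)`, is a lower bound because `m` increases; the
mass outside adds at most `O(ℓ⁻²)`. -/
theorem blackHole_mass (r_h C : ℝ) (h0 : 0 < r_h) (hC : 0 < C) : ∃ K ℓ₀ : ℝ, 0 < K ∧ 0 < ℓ₀ ∧
    ∀ ℓ : ℝ, 0 < ℓ → ℓ < ℓ₀ → ∀ (F : Fields) (D : AsymptoticData), IsBlackHole ℓ r_h F D →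
      BoundedHair C r_h F → r_h ^ 3 / 2 * (ℓ ^ 2)⁻¹ ≤ D.M ∧ D.M ≤ K * (ℓ ^ 2)⁻¹ := by
  refine ⟨r_h / 2 + r_h ^ 3 / 2 + 3 / 4 * C ^ 4
    + 3 / 2 * (C ^ 2 * ((r_h ^ 2)⁻¹ + 1) + 9 * C ^ 4) * r_h⁻¹, 1, by positivity, one_pos, ?_⟩
  intro ℓ hℓ hlt F D h hb
  refine ⟨h.mass_ge h0, (h.mass_le hb hC h0).trans ?_⟩
  -- since `ℓ < 1`, bounded terms are absorbed into multiples of `ℓ⁻²`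
  have hv : 1 ≤ (ℓ ^ 2)⁻¹ := by
    rw [one_le_inv₀ (by positivity)]; exact pow_le_one₀ hℓ.le hlt.le
  generalize (ℓ ^ 2)⁻¹ = v at hv
  have e1 : r_h / 2 ≤ r_h / 2 * v := le_mul_of_one_le_right (by positivity) hv
  have e2 : 3 / 4 * C ^ 4 ≤ 3 / 4 * C ^ 4 * v := le_mul_of_one_le_right (by positivity) hv
  have e3 : (C ^ 2 * (r_h ^ 2)⁻¹ + 9 * C ^ 4) * r_h⁻¹ ≤ (C ^ 2 * (r_h ^ 2)⁻¹ + 9 * C ^ 4) * r_h⁻¹ * v :=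
    le_mul_of_one_le_right (by positivity) hv
  linarith

/-- For small `ℓ` the mass separates globally regular solutions, `M = O(ℓ³)`, from black holes,
`M ≥ r_h³/(2ℓ²)`. -/
theorem mass_lt_mass (r_h C : ℝ) (h0 : 0 < r_h) (hC : 0 < C) : ∃ ℓ₀ : ℝ, 0 < ℓ₀ ∧
    ∀ ℓ : ℝ, 0 < ℓ → ℓ < ℓ₀ → ∀ (F₁ F₂ : Fields) (D₁ D₂ : AsymptoticData),
        IsGloballyRegular ℓ F₁ D₁ → NearAdS C ℓ F₁ →
        IsBlackHole ℓ r_h F₂ D₂ → BoundedHair C r_h F₂ → D₁.M < D₂.M := by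
  obtain ⟨K, ℓ₁, hK, h1, H1⟩ := globallyRegular_mass C hC
  -- for `ℓ < 1` the claim `K ℓ³ < r_h³ / (2 ℓ²)` follows from `K ℓ < r_h³ / 2`
  refine ⟨min ℓ₁ (min 1 (r_h ^ 3 / (2 * K))), lt_min h1 (lt_min one_pos (by positivity)), ?_⟩
  intro ℓ hℓ hlt F₁ F₂ D₁ D₂ g n b _
  have l1 : ℓ < ℓ₁ := hlt.trans_le (min_le_left _ _)
  have l2 : ℓ < 1 := hlt.trans_le ((min_le_right _ _).trans (min_le_left _ _))
  have l3 : ℓ < r_h ^ 3 / (2 * K) := hlt.trans_le ((min_le_right _ _).trans (min_le_right _ _))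
  refine (H1 ℓ hℓ l1 F₁ D₁ g n).2.trans_lt (lt_of_lt_of_le ?_ (b.mass_ge h0))
  rw [lt_div_iff₀ (by positivity)] at l3
  rw [← div_eq_mul_inv, lt_div_iff₀ (by positivity)]
  have l4 : ℓ ^ 5 ≤ ℓ := pow_le_of_le_one hℓ.le l2.le (by norm_num)
  calc K * ℓ ^ 3 * ℓ ^ 2 = K * ℓ ^ 5 := by ring
    _ ≤ K * ℓ := by gcongr
    _ < r_h ^ 3 / 2 := by linarith

/-! ### Solutions with the explicit gauge fields -/

/-- The coefficients of the two mode series are small with `ℓ`, in the norm that controls the series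
and its derivatives. -/
structure SmallCoeffs (D ℓ : ℝ) (ρ σ : ℕ → ℝ) : Prop where
  ℓ_pos : 0 < ℓ
  one_le : 1 ≤ D
  small : D * ℓ ^ 2 ≤ 1 / 2
  el_summable : Summable (fun n => |elCoeff ℓ ρ n| * seriesWeight n)
  mag_summable : Summable (fun n => |magCoeff ℓ σ n| * seriesWeight n)
  el_le : ∑' n, |elCoeff ℓ ρ n| * seriesWeight n ≤ D * ℓ
  mag_le : ∑' n, |magCoeff ℓ σ n| * seriesWeight n ≤ D * ℓ ^ 2

/-- The constant of `SmallCoeffs` for free constants bounded by `B θ^k`. -/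
noncomputable def coeffConst (B θ : ℝ) : ℝ :=
  B * (θ + θ ^ 2) * (∑' n, (1 / 4 : ℝ) ^ n * seriesWeight n) + 1

theorem tsum_coeff_mul_seriesWeight_le {ℓ B θ : ℝ} (hℓ : 0 < ℓ) (hB : 0 < B) (hθ : 0 < θ)
    (hlt : θ * ℓ ≤ 1 / 4) {a : ℕ → ℝ} (ha : ∀ k, |a k| ≤ B * θ ^ k) (j : ℕ) :
    ∑' n, |a (n + j) * ℓ ^ (n + j)| * seriesWeight n
      ≤ B * (θ * ℓ) ^ j * ∑' n, (1 / 4 : ℝ) ^ n * seriesWeight n := by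
  rw [← tsum_mul_left]
  refine (summable_coeff_mul_seriesWeight hℓ hθ.le (by linarith) ha j).tsum_le_tsum (fun n => ?_)
    ((summable_geometric_mul_seriesWeight (by norm_num) (by norm_num)).mul_left _)
  refine (abs_coeff_mul_seriesWeight_le hℓ ha j n).trans ?_
  have := seriesWeight_pos n
  gcongr

theorem one_le_coeffConst {B θ : ℝ} (hB : 0 < B) (hθ : 0 < θ) : 1 ≤ coeffConst B θ := by
  unfold coeffConst
  have : 0 ≤ ∑' n, (1 / 4 : ℝ) ^ n * seriesWeight n :=
    tsum_nonneg fun n => by have := seriesWeight_pos n; positivity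
  have : 0 ≤ B * (θ + θ ^ 2) * ∑' n, (1 / 4 : ℝ) ^ n * seriesWeight n := by positivity
  linarith

theorem smallCoeffs {ℓ B θ : ℝ} (hℓ : 0 < ℓ) (hB : 0 < B) (hθ : 0 < θ) (hlt : θ * ℓ ≤ 1 / 4)
    (hsmall : coeffConst B θ * ℓ ^ 2 ≤ 1 / 2) {ρ σ : ℕ → ℝ} (hρ : ∀ k, |ρ k| ≤ B * θ ^ k)
    (hσ : ∀ k, |σ k| ≤ B * θ ^ k) : SmallCoeffs (coeffConst B θ) ℓ ρ σ := by
  have hW : 0 ≤ ∑' n, (1 / 4 : ℝ) ^ n * seriesWeight n :=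
    tsum_nonneg fun n => by have := seriesWeight_pos n; positivity
  refine ⟨hℓ, one_le_coeffConst hB hθ, hsmall,
    summable_elCoeff_mul_seriesWeight hℓ hθ.le (by linarith) hρ,
    summable_magCoeff_mul_seriesWeight hℓ hθ.le (by linarith) hσ,
    (tsum_coeff_mul_seriesWeight_le hℓ hB hθ hlt hρ 1).trans ?_,
    (tsum_coeff_mul_seriesWeight_le hℓ hB hθ hlt hσ 2).trans ?_⟩
  all_goals
    unfold coeffConst
    set W := ∑' n, (1 / 4 : ℝ) ^ n * seriesWeight n
  · have : 0 ≤ B * θ ^ 2 * W * ℓ := by positivity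
    linarith
  · have : 0 ≤ B * θ * W * ℓ ^ 2 := by positivity
    have : 0 ≤ ℓ ^ 2 := by positivity
    linarith

/-- For small `ℓ` the hypotheses of `smallCoeffs` hold, together with any condition `c ℓ² ≤ 1/2`. -/
theorem exists_radius_smallCoeffs {B θ c : ℝ} (hB : 0 < B) (hθ : 0 < θ) (hc : 0 < c) :
    ∃ ℓ₀ : ℝ, 0 < ℓ₀ ∧ ∀ ℓ, 0 < ℓ → ℓ < ℓ₀ → c * ℓ ^ 2 ≤ 1 / 2 ∧ ∀ ρ σ : ℕ → ℝ,
      (∀ k, |ρ k| ≤ B * θ ^ k) → (∀ k, |σ k| ≤ B * θ ^ k) → SmallCoeffs (coeffConst B θ) ℓ ρ σ := by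
  have hD := one_le_coeffConst hB hθ
  obtain ⟨ℓ₁, h1, H1⟩ := exists_radius_mul_sq_le c hc
  obtain ⟨ℓ₂, h2, H2⟩ := exists_radius_mul_sq_le (coeffConst B θ) (by linarith)
  refine ⟨min (min ℓ₁ ℓ₂) (1 / (4 * θ)), lt_min (lt_min h1 h2) (by positivity), ?_⟩
  intro ℓ hℓ hlt
  have l1 := hlt.trans_le ((min_le_left _ _).trans (min_le_left _ _))
  have l2 := hlt.trans_le ((min_le_left _ _).trans (min_le_right _ _))
  have l3 := hlt.trans_le (min_le_right _ _)
  rw [lt_div_iff₀ (by positivity)] at l3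
  exact ⟨H1 ℓ hℓ l1, fun ρ σ hρ hσ => smallCoeffs hℓ hB hθ (by linarith) (H2 ℓ hℓ l2) hρ hσ⟩

/-- The radial derivative of the reduced magnetic series. -/
theorem hasDerivAt_fSeries_radial {ℓ : ℝ} {σ : ℕ → ℝ} (hℓ : 0 < ℓ)
    (hA : Summable (fun n => |magCoeff ℓ σ n| * seriesWeight n)) {r ξ : ℝ} (hr : 0 < r)
    (hξ : ξ ∈ Icc (-1 : ℝ) 1) :
    HasDerivAt (fun r => fSeries ℓ σ r ξ) (1 / ℓ * ∑' n, magCoeff ℓ σ n * magModeDeriv n (r / ℓ)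
      * (Polynomial.derivative (legendrePoly (n + 1))).eval ξ) r := by
  refine HasDerivAt.const_add 1 ?_
  exact hasDerivAt_modeSeries_radial hA hasDerivAt_magMode
    (fun n x hx => (abs_magMode_le n x hx).trans (mul_le_of_le_one_right (modeBound_pos n).le
      (pow_le_one₀ (by positivity) (div_one_add_le_one hx))))
    (fun n x hx => (abs_magModeDeriv_le n x hx).trans
      (mul_le_of_le_one_right (modeBound_pos n).le (div_one_add_cube_le_one hx)))
    (fun n => abs_legendre_deriv_le n ξ hξ) hℓ hr

theorem hasDerivAt_alphaSeries_angular {ℓ : ℝ} {ρ : ℕ → ℝ} (hℓ : 0 < ℓ)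
    (hA : Summable (fun n => |elCoeff ℓ ρ n| * seriesWeight n)) {r ξ : ℝ} (hr : 0 < r)
    (hξ : ξ ∈ Ioo (-1 : ℝ) 1) :
    HasDerivAt (fun ξ => alphaSeries ℓ ρ r ξ) (∑' n, elCoeff ℓ ρ n * elMode n (r / ℓ)
      * (Polynomial.derivative (legendrePoly (n + 1))).eval ξ) ξ := by
  simp_rw [alphaSeries_eq hℓ]
  exact hasDerivAt_modeSeries_angular hA (fun n ξ => (legendrePoly (n + 1)).hasDerivAt ξ)
    (fun n => abs_elMode_le n _ (by positivity)) abs_legendre_le abs_legendre_deriv_le hξ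

/-- The angular derivative of the reduced magnetic series. -/
theorem hasDerivAt_fSeries_angular {ℓ : ℝ} {σ : ℕ → ℝ} (hℓ : 0 < ℓ)
    (hA : Summable (fun n => |magCoeff ℓ σ n| * seriesWeight n)) {r ξ : ℝ} (hr : 0 < r)
    (hξ : ξ ∈ Ioo (-1 : ℝ) 1) :
    HasDerivAt (fun ξ => fSeries ℓ σ r ξ) (∑' n, magCoeff ℓ σ n * magMode n (r / ℓ)
      * (Polynomial.derivative (Polynomial.derivative (legendrePoly (n + 1)))).eval ξ) ξ := by
  refine HasDerivAt.const_add 1 ?_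
  exact hasDerivAt_modeSeries_angular hA
    (fun n ξ => (Polynomial.derivative (legendrePoly (n + 1))).hasDerivAt ξ)
    (fun n => abs_magMode_le n _ (by positivity)) abs_legendre_deriv_le
    abs_legendre_deriv_deriv_le hξ

theorem hasDerivAt_fInfSeries {ℓ : ℝ} {σ : ℕ → ℝ}
    (hA : Summable (fun n => |magCoeff ℓ σ n| * seriesWeight n)) {ξ : ℝ}
    (hξ : ξ ∈ Ioo (-1 : ℝ) 1) :
    HasDerivAt (fInfSeries ℓ σ) (∑' n, magCoeff ℓ σ n * coeffW (n + 2)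
      * (Polynomial.derivative (Polynomial.derivative (legendrePoly (n + 1)))).eval ξ) ξ := by
  refine HasDerivAt.const_add 1 ?_
  exact hasDerivAt_modeSeries_angular (h := 1) hA
    (fun n ξ => (Polynomial.derivative (legendrePoly (n + 1))).hasDerivAt ξ)
    (by simpa using abs_coeffW_le) abs_legendre_deriv_le abs_legendre_deriv_deriv_le hξ

namespace SmallCoeffs

variable {D ℓ : ℝ} {ρ σ : ℕ → ℝ}

theorem abs_fSeries_sub_one_le (h : SmallCoeffs D ℓ ρ σ) {r ξ : ℝ} (hr : 0 < r)
    (hξ : ξ ∈ Icc (-1 : ℝ) 1) : |fSeries ℓ σ r ξ - 1| ≤ D * (r / (1 + r / ℓ)) ^ 2 := by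
  have hℓ := h.ℓ_pos
  have hx : 0 < 1 + r / ℓ := by positivity
  have b := abs_modeSeries_le h.mag_summable (R := fun n => magMode n (r / ℓ))
    (Θ := fun n => (Polynomial.derivative (legendrePoly (n + 1))).eval ξ)
    (fun n => abs_magMode_le n (r / ℓ) (by positivity)) (fun n => abs_legendre_deriv_le n ξ hξ)
  unfold fSeries
  rw [add_sub_cancel_left]
  calc _ ≤ D * ℓ ^ 2 * (r / ℓ / (1 + r / ℓ)) ^ 2 := b.trans (by gcongr; exact h.mag_le)
    _ = _ := by field_simp

theorem abs_fSeries_angular_le (h : SmallCoeffs D ℓ ρ σ) {r ξ : ℝ} (hr : 0 < r)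
    (hξ : ξ ∈ Icc (-1 : ℝ) 1) : |∑' n, magCoeff ℓ σ n * magMode n (r / ℓ)
      * (Polynomial.derivative (Polynomial.derivative (legendrePoly (n + 1)))).eval ξ|
        ≤ D * (r / (1 + r / ℓ)) ^ 2 := by
  have hℓ := h.ℓ_pos
  have hx : 0 < 1 + r / ℓ := by positivity
  have b := abs_modeSeries_le h.mag_summable (R := fun n => magMode n (r / ℓ))
    (Θ := fun n => (Polynomial.derivative (Polynomial.derivative (legendrePoly (n + 1)))).eval ξ)
    (fun n => abs_magMode_le n (r / ℓ) (by positivity))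
    (fun n => abs_legendre_deriv_deriv_le n ξ hξ)
  calc _ ≤ D * ℓ ^ 2 * (r / ℓ / (1 + r / ℓ)) ^ 2 := b.trans (by gcongr; exact h.mag_le)
    _ = _ := by field_simp

theorem abs_fSeries_radial_le (h : SmallCoeffs D ℓ ρ σ) {r ξ : ℝ} (hr : 0 < r)
    (hξ : ξ ∈ Icc (-1 : ℝ) 1) : |1 / ℓ * ∑' n, magCoeff ℓ σ n * magModeDeriv n (r / ℓ)
      * (Polynomial.derivative (legendrePoly (n + 1))).eval ξ| ≤ D * (r / (1 + r / ℓ) ^ 3) := by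
  have hℓ := h.ℓ_pos
  have hx : 0 < 1 + r / ℓ := by positivity
  have b := abs_modeSeries_le h.mag_summable (R := fun n => magModeDeriv n (r / ℓ))
    (Θ := fun n => (Polynomial.derivative (legendrePoly (n + 1))).eval ξ)
    (fun n => abs_magModeDeriv_le n (r / ℓ) (by positivity)) (fun n => abs_legendre_deriv_le n ξ hξ)
  rw [abs_mul, abs_of_pos (by positivity : 0 < 1 / ℓ)]
  calc _ ≤ 1 / ℓ * (D * ℓ ^ 2 * (r / ℓ / (1 + r / ℓ) ^ 3)) := by
        gcongr; exact b.trans (by gcongr; exact h.mag_le)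
    _ = _ := by field_simp

theorem abs_alphaSeries_radial_le (h : SmallCoeffs D ℓ ρ σ) {r ξ : ℝ} (hr : 0 < r)
    (hξ : ξ ∈ Icc (-1 : ℝ) 1) : |1 / ℓ * ∑' n, elCoeff ℓ ρ n * elModeDeriv n (r / ℓ)
      * (legendrePoly (n + 1)).eval ξ| ≤ D / (1 + r / ℓ) ^ 2 := by
  have hℓ := h.ℓ_pos
  have hx : 0 < 1 + r / ℓ := by positivity
  have b := abs_modeSeries_le h.el_summable (R := fun n => elModeDeriv n (r / ℓ))
    (Θ := fun n => (legendrePoly (n + 1)).eval ξ)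
    (fun n => abs_elModeDeriv_le n (r / ℓ) (by positivity)) (fun n => abs_legendre_le n ξ hξ)
  rw [abs_mul, abs_of_pos (by positivity : 0 < 1 / ℓ)]
  calc _ ≤ 1 / ℓ * (D * ℓ * (1 / (1 + r / ℓ) ^ 2)) := by
        gcongr; exact b.trans (by gcongr; exact h.el_le)
    _ = _ := by field_simp

theorem abs_alphaSeries_angular_le (h : SmallCoeffs D ℓ ρ σ) {r ξ : ℝ} (hr : 0 < r)
    (hξ : ξ ∈ Icc (-1 : ℝ) 1) : |∑' n, elCoeff ℓ ρ n * elMode n (r / ℓ)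
      * (Polynomial.derivative (legendrePoly (n + 1))).eval ξ| ≤ D * (r / (1 + r / ℓ)) := by
  have hℓ := h.ℓ_pos
  have hx : 0 < 1 + r / ℓ := by positivity
  have b := abs_modeSeries_le h.el_summable (R := fun n => elMode n (r / ℓ))
    (Θ := fun n => (Polynomial.derivative (legendrePoly (n + 1))).eval ξ)
    (fun n => abs_elMode_le n (r / ℓ) (by positivity)) (fun n => abs_legendre_deriv_le n ξ hξ)
  calc _ ≤ D * ℓ * (r / ℓ / (1 + r / ℓ)) := b.trans (by gcongr; exact h.el_le)
    _ = _ := by field_simp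

theorem abs_fInfSeries_sub_one_le (h : SmallCoeffs D ℓ ρ σ) {ξ : ℝ} (hξ : ξ ∈ Icc (-1 : ℝ) 1) :
    |fInfSeries ℓ σ ξ - 1| ≤ 1 / 2 :=
  (abs_fInfSeries_le h.mag_summable hξ).trans (h.mag_le.trans h.small)

theorem wSeries_nonneg (h : SmallCoeffs D ℓ ρ σ) {ξ : ℝ} (hξ : ξ ∈ Ioo (-1 : ℝ) 1) :
    0 ≤ wSeries ℓ σ ξ := by
  have := abs_le.1 (h.abs_fInfSeries_sub_one_le (Ioo_subset_Icc_self hξ))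
  rw [wSeries_eq]
  exact mul_nonneg (Real.sqrt_nonneg _) (by linarith)

theorem wSeries_le (h : SmallCoeffs D ℓ ρ σ) {ξ : ℝ} (hξ : ξ ∈ Ioo (-1 : ℝ) 1) :
    wSeries ℓ σ ξ ≤ 2 * √(1 - ξ ^ 2) := by
  have := abs_le.1 (h.abs_fInfSeries_sub_one_le (Ioo_subset_Icc_self hξ))
  rw [wSeries_eq, mul_comm]
  gcongr
  linarith

theorem wSeries_differentiableOn (h : SmallCoeffs D ℓ ρ σ) :
    DifferentiableOn ℝ (wSeries ℓ σ) (Ioo (-1) 1) := by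
  intro ξ hξ
  rw [show wSeries ℓ σ = fun ξ => √(1 - ξ ^ 2) * fInfSeries ℓ σ ξ from funext (wSeries_eq ℓ σ)]
  have hs : DifferentiableAt ℝ (fun ξ : ℝ => √(1 - ξ ^ 2)) ξ :=
    DifferentiableAt.sqrt (by fun_prop) (one_sub_sq_pos hξ).ne'
  exact (hs.mul (hasDerivAt_fInfSeries h.mag_summable hξ).differentiableAt).differentiableWithinAt

/-- The charge functions determine the free constants. -/
theorem constants_eq {ρ' σ' : ℕ → ℝ} (h : SmallCoeffs D ℓ ρ σ) (h' : SmallCoeffs D ℓ ρ' σ')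
    (hM : ∀ ξ ∈ Ioo (-1 : ℝ) 1, qM (wSeries ℓ σ) ξ = qM (wSeries ℓ σ') ξ)
    (hE : ∀ ξ ∈ Ioo (-1 : ℝ) 1, qE (aSeries ℓ ρ) ξ = qE (aSeries ℓ ρ') ξ) :
    (∀ k : ℕ, 1 ≤ k → ρ k = ρ' k) ∧ (∀ k : ℕ, 2 ≤ k → σ k = σ' k) := by
  have ew := eqOn_of_qM_eq h.wSeries_differentiableOn h'.wSeries_differentiableOn
    (fun ξ hξ => h.wSeries_nonneg hξ) (fun ξ hξ => h'.wSeries_nonneg hξ)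
    (fun ξ hξ => h.wSeries_le hξ) (fun ξ hξ => h'.wSeries_le hξ) hM
  have ea := eqOn_of_qE_eq hE
  refine ⟨fun k hk => ?_, fun k hk => ?_⟩
  · rw [rho_eq_integral h.ℓ_pos h.el_summable k hk, rho_eq_integral h.ℓ_pos h'.el_summable k hk,
      integral_congr_Ioo fun ξ hξ => by rw [ea hξ]]
  · rw [sigma_eq_integral h.ℓ_pos h.mag_summable k hk,
      sigma_eq_integral h.ℓ_pos h'.mag_summable k hk,
      integral_congr_Ioo fun ξ hξ => by rw [ew hξ]]

end SmallCoeffs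

namespace IsExpansionSolution

variable {C D ℓ M : ℝ} {ρ σ : ℕ → ℝ} {F : Fields}

theorem metricRegular (h : IsExpansionSolution C ℓ ρ σ F M) : MetricRegular C ℓ F :=
  ⟨h.m_diff, h.S_diff, fun r hr => h.S_low r hr.le, h.μ_pos, h.einstein, h.m_zero, h.S_lim⟩

/-- The series bounds of `SmallCoeffs`, transferred to the fields: these agree with the series only for
`r ≥ 0`, `ξ ∈ [-1, 1]`, which determines the derivatives at interior points. -/
theorem fieldBounds (h : IsExpansionSolution C ℓ ρ σ F M) (hs : SmallCoeffs D ℓ ρ σ) :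
    FieldBounds (28 * D) ℓ F := by
  have hℓ := hs.ℓ_pos
  have hD : 0 < D := by linarith [hs.one_le]
  have hω : ∀ r, 0 < r → ∀ ξ ∈ Icc (-1 : ℝ) 1, F.ω r ξ = √(1 - ξ ^ 2) * fSeries ℓ σ r ξ :=
    fun r hr ξ hξ => (h.ω_eq r hr.le ξ hξ).trans (omegaSeries_eq hℓ σ r ξ)
  have hX : ∀ r, 0 < r → D * (r / (1 + r / ℓ)) ^ 2 ≤ 1 / 2 := fun r hr => by
    refine le_trans ?_ hs.small
    have := div_one_add_le_radius hℓ hr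
    gcongr
  refine ⟨fun r hr ξ hξ => ?_, fun r hr ξ hξ => ?_, fun r hr ξ hξ => ?_, fun r hr ξ hξ => ?_,
    fun r hr ξ hξ => ?_⟩
  all_goals
    have hξ' := Ioo_subset_Icc_self hξ
    have hx : 0 < 1 + r / ℓ := by positivity
    have hq : |√(1 - ξ ^ 2)| ≤ 1 := by
      rw [abs_of_nonneg (Real.sqrt_nonneg _), Real.sqrt_le_one]; linarith [sq_nonneg ξ]
    have hf1 := hs.abs_fSeries_sub_one_le hr hξ'
  · have e : (fun r => F.α r ξ) =ᶠ[𝓝 r] fun r => alphaSeries ℓ ρ r ξ := by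
      filter_upwards [lt_mem_nhds hr] with s hs' using h.α_eq s hs'.le ξ hξ'
    rw [dr, e.deriv_eq, (hasDerivAt_alphaSeries_radial hℓ hs.el_summable hr hξ').deriv]
    exact (hs.abs_alphaSeries_radial_le hr hξ').trans (by gcongr; linarith)
  · have e : (fun ξ => F.α r ξ) =ᶠ[𝓝 ξ] fun ξ => alphaSeries ℓ ρ r ξ := by
      filter_upwards [isOpen_Ioo.mem_nhds hξ] with s hs' using
        h.α_eq r hr.le s (Ioo_subset_Icc_self hs')
    rw [dxi, e.deriv_eq, (hasDerivAt_alphaSeries_angular hℓ hs.el_summable hr hξ).deriv]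
    exact (hs.abs_alphaSeries_angular_le hr hξ').trans (by gcongr; linarith)
  · have e : (fun r => F.ω r ξ) =ᶠ[𝓝 r] fun r => √(1 - ξ ^ 2) * fSeries ℓ σ r ξ := by
      filter_upwards [lt_mem_nhds hr] with s hs' using hω s hs' ξ hξ'
    rw [dr, e.deriv_eq,
      ((hasDerivAt_fSeries_radial hℓ hs.mag_summable hr hξ').const_mul _).deriv]
    refine (abs_mul_le_mul hq (hs.abs_fSeries_radial_le hr hξ')).trans ?_
    rw [one_mul]; gcongr; linarith
  · have hf : |fSeries ℓ σ r ξ| ≤ 2 := by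
      have := abs_le.1 hf1
      rw [abs_le]; constructor <;> linarith [hX r hr]
    rw [hω r hr ξ hξ']
    exact (abs_mul_le_mul hq hf).trans (by linarith [hs.one_le])
  · have hf : |fSeries ℓ σ r ξ| ≤ 2 := by
      have := abs_le.1 hf1
      rw [abs_le]; constructor <;> linarith [hX r hr]
    have e : (fun ξ => F.ω r ξ ^ 2 + ξ ^ 2)
        =ᶠ[𝓝 ξ] fun ξ => (1 - ξ ^ 2) * fSeries ℓ σ r ξ ^ 2 + ξ ^ 2 := by
      filter_upwards [isOpen_Ioo.mem_nhds hξ] with s hs'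
      rw [hω r hr s (Ioo_subset_Icc_self hs'), mul_pow, Real.sq_sqrt (one_sub_sq_pos hs').le]
    have hfd := hasDerivAt_fSeries_angular hℓ hs.mag_summable hr hξ
    have hfx := hs.abs_fSeries_angular_le hr hξ'
    set fx := ∑' n, magCoeff ℓ σ n * magMode n (r / ℓ)
      * (Polynomial.derivative (Polynomial.derivative (legendrePoly (n + 1)))).eval ξ
    have hd := ((((hasDerivAt_id ξ).pow 2).const_sub 1).mul (hfd.pow 2)).add ((hasDerivAt_id ξ).pow 2)
    have hd' : HasDerivAt (fun ξ => (1 - ξ ^ 2) * fSeries ℓ σ r ξ ^ 2 + ξ ^ 2)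
        (2 * ((1 - ξ ^ 2) * (fSeries ℓ σ r ξ * fx))
          - 2 * (ξ * ((fSeries ℓ σ r ξ + 1) * (fSeries ℓ σ r ξ - 1)))) ξ := by
      refine hd.congr_deriv ?_
      simp only [id, Pi.pow_apply]
      push_cast
      ring
    rw [dxi, e.deriv_eq, hd'.deriv]
    have aξ : |ξ| ≤ 1 := abs_le.2 ⟨hξ.1.le, hξ.2.le⟩
    have aq : |1 - ξ ^ 2| ≤ 1 := by
      rw [abs_of_pos (one_sub_sq_pos hξ)]; linarith [sq_nonneg ξ]
    have hf3 : |fSeries ℓ σ r ξ + 1| ≤ 3 := (abs_add_le _ _).trans (by rw [abs_one]; linarith)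
    have b1 := abs_le.1 (abs_mul_le_mul aq (abs_mul_le_mul hf hfx))
    have b2 := abs_le.1 (abs_mul_le_mul aξ (abs_mul_le_mul hf3 hf1))
    have : 0 ≤ D * (r / (1 + r / ℓ)) ^ 2 := by positivity
    rw [abs_le]; constructor <;> linarith

theorem gaugeBounds (h : IsExpansionSolution C ℓ ρ σ F M) (hs : SmallCoeffs D ℓ ρ σ) :
    GaugeBounds (vacuumConst D) ℓ F :=
  (h.fieldBounds hs).gaugeBounds (by linarith [hs.one_le]) hs.ℓ_pos

end IsExpansionSolution

/-- The same argument as for `globallyRegular_mass`, with field bounds from the series. -/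
theorem expansion_mass (B θ C : ℝ) (hB : 0 < B) (hθ : 0 < θ) (hC : 0 < C) :
    ∃ K ℓ₀ : ℝ, 0 < K ∧ 0 < ℓ₀ ∧ ∀ ℓ : ℝ, 0 < ℓ → ℓ < ℓ₀ → ∀ ρ σ : ℕ → ℝ,
      (∀ k, |ρ k| ≤ B * θ ^ k ∧ |σ k| ≤ B * θ ^ k) →
      ∀ (F : Fields) (M : ℝ), IsExpansionSolution C ℓ ρ σ F M → 0 ≤ M ∧ M ≤ K * ℓ ^ 3 := by
  have hD := one_le_coeffConst hB hθ
  have hL : 0 < vacuumConst (coeffConst B θ) := by unfold vacuumConst; positivity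
  obtain ⟨ℓ₀, h0, H⟩ := exists_radius_smallCoeffs (c := 5 * vacuumConst (coeffConst B θ) * C ^ 2)
    hB hθ (by positivity)
  refine ⟨5 * vacuumConst (coeffConst B θ) * C ^ 2, ℓ₀, by positivity, h0,
    fun ℓ hℓ hlt ρ σ hc F M h => ?_⟩
  obtain ⟨hsmall, hs⟩ := H ℓ hℓ hlt
  exact h.metricRegular.mass_bounds
    (h.gaugeBounds (hs ρ σ (fun k => (hc k).1) fun k => (hc k).2)) hC hL.le hℓ hsmall h.m_lim

theorem alphaSeries_congr {ℓ : ℝ} {ρ ρ' : ℕ → ℝ} (h : ∀ k, 1 ≤ k → ρ k = ρ' k) (r ξ : ℝ) :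
    alphaSeries ℓ ρ r ξ = alphaSeries ℓ ρ' r ξ := by
  unfold alphaSeries alphaTerm
  simp_rw [h _ (Nat.le_add_left 1 _)]

theorem omegaSeries_congr {ℓ : ℝ} {σ σ' : ℕ → ℝ} (h : ∀ k, 2 ≤ k → σ k = σ' k) (r ξ : ℝ) :
    omegaSeries ℓ σ r ξ = omegaSeries ℓ σ' r ξ := by
  unfold omegaSeries omegaTerm
  simp_rw [h _ (Nat.le_add_left 2 _)]

/-- Equal gauge fields on `r ≥ 0` have equal sources: the partial derivatives at interior points
see only the interior. -/
theorem sources_eq {F F' : Fields}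
    (h : ∀ r, 0 ≤ r → ∀ ξ ∈ Icc (-1 : ℝ) 1, F.α r ξ = F'.α r ξ ∧ F.ω r ξ = F'.ω r ξ) {r : ℝ}
    (hr : 0 < r) : F.η r = F'.η r ∧ F.ζ r = F'.ζ r ∧ F.G r = F'.G r ∧ F.P r = F'.P r := by
  have er : ∀ {g g' : ℝ → ℝ → ℝ}, (∀ r, 0 ≤ r → ∀ ξ ∈ Icc (-1 : ℝ) 1, g r ξ = g' r ξ) →
      ∀ ξ ∈ Ioo (-1 : ℝ) 1, dr g r ξ = dr g' r ξ := fun e ξ hξ => Filter.EventuallyEq.deriv_eq (by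
    filter_upwards [lt_mem_nhds hr] with s hs using e s hs.le ξ (Ioo_subset_Icc_self hξ))
  have ex : ∀ {g g' : ℝ → ℝ → ℝ}, (∀ r, 0 ≤ r → ∀ ξ ∈ Icc (-1 : ℝ) 1, g r ξ = g' r ξ) →
      ∀ ξ ∈ Ioo (-1 : ℝ) 1, dxi g r ξ = dxi g' r ξ := fun e ξ hξ => Filter.EventuallyEq.deriv_eq (by
    filter_upwards [isOpen_Ioo.mem_nhds hξ] with s hs using e r hr.le s (Ioo_subset_Icc_self hs))
  have hα := fun r hr ξ hξ => (h r hr ξ hξ).1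
  have hω := fun r hr ξ hξ => (h r hr ξ hξ).2
  refine ⟨?_, ?_, ?_, ?_⟩
  · exact congrArg (1 / 2 * ·) (integral_congr_Ioo fun ξ hξ => by rw [er hα ξ hξ])
  · exact congrArg (1 / 2 * ·) (integral_congr_Ioo fun ξ hξ => by
      rw [ex hα ξ hξ, hω r hr.le ξ (Ioo_subset_Icc_self hξ)])
  · exact congrArg (1 / 2 * ·) (integral_congr_Ioo fun ξ hξ => by rw [er hω ξ hξ])
  · exact congrArg (1 / 8 * ·) (integral_congr_Ioo fun ξ hξ => by
      rw [ex (g := fun r' ξ' => F.ω r' ξ' ^ 2 + ξ' ^ 2) (g' := fun r' ξ' => F'.ω r' ξ' ^ 2 + ξ' ^ 2)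
        (fun r hr ξ hξ => by rw [hω r hr ξ hξ]) ξ hξ])

/-- Charges determine expansion solutions. With equal constants the gauge fields coincide, and the
metric is the fixed point of a contraction with equal sources. -/
theorem expansion_unique (B θ C : ℝ) (hB : 0 < B) (hθ : 0 < θ) (hC : 0 < C) :
    ∃ ℓ₀ : ℝ, 0 < ℓ₀ ∧ ∀ ℓ : ℝ, 0 < ℓ → ℓ < ℓ₀ → ∀ ρ σ ρ' σ' : ℕ → ℝ,
      (∀ k, |ρ k| ≤ B * θ ^ k ∧ |σ k| ≤ B * θ ^ k ∧ |ρ' k| ≤ B * θ ^ k ∧ |σ' k| ≤ B * θ ^ k) →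
      (∀ ξ ∈ Ioo (-1 : ℝ) 1, qM (wSeries ℓ σ) ξ = qM (wSeries ℓ σ') ξ) →
      (∀ ξ ∈ Ioo (-1 : ℝ) 1, qE (aSeries ℓ ρ) ξ = qE (aSeries ℓ ρ') ξ) →
      (∀ k : ℕ, 1 ≤ k → ρ k = ρ' k) ∧ (∀ k : ℕ, 2 ≤ k → σ k = σ' k) ∧
      ∀ (F F' : Fields) (M M' : ℝ),
        IsExpansionSolution C ℓ ρ σ F M → IsExpansionSolution C ℓ ρ' σ' F' M' →
        ∀ r, 0 ≤ r → F.m r = F'.m r ∧ F.S r = F'.S r ∧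
          ∀ ξ ∈ Icc (-1 : ℝ) 1, F.α r ξ = F'.α r ξ ∧ F.ω r ξ = F'.ω r ξ := by
  have hD := one_le_coeffConst hB hθ
  set L := vacuumConst (coeffConst B θ) + C with hLdef
  have hV : 1 ≤ vacuumConst (coeffConst B θ) := by
    unfold vacuumConst
    have : (1 : ℝ) ≤ (28 * coeffConst B θ) ^ 4 := one_le_pow₀ (by linarith)
    linarith
  have hL : 1 ≤ L := by linarith
  obtain ⟨ℓ₀, h0, H⟩ := exists_radius_smallCoeffs (c := 24 * L ^ 4) hB hθ (by positivity)
  refine ⟨ℓ₀, h0, fun ℓ hℓ hlt ρ σ ρ' σ' hc hM hE => ?_⟩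
  obtain ⟨hsmall, hs⟩ := H ℓ hℓ hlt
  have s₁ := hs ρ σ (fun k => (hc k).1) fun k => (hc k).2.1
  have s₂ := hs ρ' σ' (fun k => (hc k).2.2.1) fun k => (hc k).2.2.2
  obtain ⟨eρ, eσ⟩ := s₁.constants_eq s₂ hM hE
  refine ⟨eρ, eσ, fun F F' M M' g g' => ?_⟩
  have fields : ∀ r, 0 ≤ r → ∀ ξ ∈ Icc (-1 : ℝ) 1, F.α r ξ = F'.α r ξ ∧ F.ω r ξ = F'.ω r ξ :=
    fun r hr ξ hξ => ⟨by rw [g.α_eq r hr ξ hξ, g'.α_eq r hr ξ hξ, alphaSeries_congr eρ],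
      by rw [g.ω_eq r hr ξ hξ, g'.ω_eq r hr ξ hξ, omegaSeries_congr eσ]⟩
  have vac : ∀ {ρ σ : ℕ → ℝ} {F : Fields} {M : ℝ}, IsExpansionSolution C ℓ ρ σ F M →
      SmallCoeffs (coeffConst B θ) ℓ ρ σ → NearVacuum L ℓ F := fun g s =>
    ⟨g.metricRegular.mono hC (by linarith), (g.gaugeBounds s).mono (by linarith), by
      have h3 : L ^ 3 ≤ L ^ 4 := pow_le_pow_right₀ hL (by norm_num)
      have h4 : 0 ≤ L ^ 4 := by positivity
      have e : 5 * L * L ^ 2 = 5 * L ^ 3 := by ring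
      refine le_trans ?_ hsmall
      rw [e]
      gcongr
      linarith⟩
  -- equal fields have equal sources, so that the control function is zero
  have hJ : ∀ T : ℝ, SourceDifference 0 ℓ T (fun _ => 0) (fun _ => 0) F F' := fun T => by
    have e := fun r hr => sources_eq fields (r := r) hr
    refine ⟨fun r _ => hasDerivAt_const r 0, fun _ _ => le_rfl, fun _ _ => le_rfl, fun _ _ => by simp,
      fun r hr _ _ => ?_, fun r hr _ _ => ?_, fun r hr _ _ => ?_, fun r hr _ _ => ?_⟩
    · rw [(e r hr).1]; simp
    · rw [(e r hr).2.1]; simp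
    · rw [(e r hr).2.2.1]; simp
    · rw [(e r hr).2.2.2]; simp
  have metric : ∀ r, 0 < r → F.m r = F'.m r ∧ F.S r = F'.S r := fun r hr =>
    metric_unique hL le_rfl hℓ (vac g s₁) (vac g' s₂) (by simpa using hsmall)
      (fun T _ _ _ => ⟨_, _, hJ T⟩) hr
  have ext : ∀ {g₁ g₂ : ℝ → ℝ}, ContinuousOn g₁ (Ici 0) → ContinuousOn g₂ (Ici 0) →
      EqOn g₁ g₂ (Ioi 0) → EqOn g₁ g₂ (Ici 0) := fun c₁ c₂ e =>
    e.of_subset_closure c₁ c₂ Ioi_subset_Ici_self (by rw [closure_Ioi])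
  exact fun r hr => ⟨ext g.m_cont g'.m_cont (fun r hr => (metric r hr).1) hr,
    ext g.S_cont g'.S_cont (fun r hr => (metric r hr).2) hr, fields r hr⟩

end SuInfEYM

theorem mainTheorem2 :
    -- uniqueness: the charge functions determine the whole solution and all free constants
    (∀ C : ℝ, 0 < C → ∃ ℓ₀ : ℝ, 0 < ℓ₀ ∧ ∀ ℓ : ℝ, 0 < ℓ → ℓ < ℓ₀ →
      ∀ (F₁ F₂ : Fields) (D₁ D₂ : AsymptoticData),
        IsGloballyRegular ℓ F₁ D₁ → NearAdS C ℓ F₁ →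
        IsGloballyRegular ℓ F₂ D₂ → NearAdS C ℓ F₂ →
        (∀ ξ ∈ Ioo (-1 : ℝ) 1, qM D₁.ωInf ξ = qM D₂.ωInf ξ) →
        (∀ ξ ∈ Ioo (-1 : ℝ) 1, qE D₁.A ξ = qE D₂.A ξ) →
        (∀ r, 0 ≤ r → F₁.m r = F₂.m r ∧ F₁.S r = F₂.S r ∧
          ∀ ξ ∈ Icc (-1 : ℝ) 1, F₁.α r ξ = F₂.α r ξ ∧ F₁.ω r ξ = F₂.ω r ξ) ∧
        (∀ k : ℕ, 1 ≤ k → rhoConst F₁ k = rhoConst F₂ k) ∧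
        (∀ k : ℕ, 2 ≤ k → sigmaConst F₁ k = sigmaConst F₂ k)) ∧
    -- explicit gauge fields: convergence, boundary functions, inversion of the Legendre series
    (∀ ℓ : ℝ, 0 < ℓ → ∀ ρ σ : ℕ → ℝ, Admissible ℓ ρ → Admissible ℓ σ →
      (∀ ξ ∈ Icc (-1 : ℝ) 1,
        (∀ r, 0 ≤ r → Summable (fun k : ℕ => alphaTerm ℓ ρ (k + 1) r ξ) ∧
          Summable (fun k : ℕ => omegaTerm ℓ σ (k + 2) r ξ)) ∧
        Summable (fun k : ℕ => aTerm ℓ ρ (k + 1) ξ) ∧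
        Summable (fun k : ℕ => wTerm ℓ σ (k + 2) ξ) ∧
        (∀ r, 0 < r → DifferentiableAt ℝ (fun r' => alphaSeries ℓ ρ r' ξ) r) ∧
        Tendsto (fun r => -(r ^ 2 * dr (alphaSeries ℓ ρ) r ξ)) atTop (𝓝 (aSeries ℓ ρ ξ)) ∧
        Tendsto (fun r => omegaSeries ℓ σ r ξ) atTop (𝓝 (wSeries ℓ σ ξ))) ∧
      (∀ k : ℕ, 1 ≤ k → ρ k = (2 * (k : ℝ) + 1) / (2 * coeffA k * ℓ ^ (k + 1)) *
        ∫ ξ in (-1 : ℝ)..1, aSeries ℓ ρ ξ * legendre0 k ξ) ∧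
      (∀ k : ℕ, 2 ≤ k → σ k = (2 * (k : ℝ) - 1) /
          (2 * (k : ℝ) * ((k : ℝ) - 1) * coeffW k * ℓ ^ k) *
          (∫ ξ in (-1 : ℝ)..1, wSeries ℓ σ ξ * legendre1 (k - 1) ξ)
        - (if k = 2 then 1 / (3 * ℓ ^ 2) else 0))) ∧
    -- solutions with the explicit gauge fields: the charge functions determine the constants and
    -- the solution
    (∀ B θ C : ℝ, 0 < B → 0 < θ → 0 < C → ∃ ℓ₀ : ℝ, 0 < ℓ₀ ∧ ∀ ℓ : ℝ, 0 < ℓ → ℓ < ℓ₀ →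
      ∀ ρ σ ρ' σ' : ℕ → ℝ,
        (∀ k, |ρ k| ≤ B * θ ^ k ∧ |σ k| ≤ B * θ ^ k ∧
          |ρ' k| ≤ B * θ ^ k ∧ |σ' k| ≤ B * θ ^ k) →
        (∀ ξ ∈ Ioo (-1 : ℝ) 1, qM (wSeries ℓ σ) ξ = qM (wSeries ℓ σ') ξ) →
        (∀ ξ ∈ Ioo (-1 : ℝ) 1, qE (aSeries ℓ ρ) ξ = qE (aSeries ℓ ρ') ξ) →
        (∀ k : ℕ, 1 ≤ k → ρ k = ρ' k) ∧ (∀ k : ℕ, 2 ≤ k → σ k = σ' k) ∧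
        ∀ (F F' : Fields) (M M' : ℝ),
          IsExpansionSolution C ℓ ρ σ F M → IsExpansionSolution C ℓ ρ' σ' F' M' →
          ∀ r, 0 ≤ r → F.m r = F'.m r ∧ F.S r = F'.S r ∧
            ∀ ξ ∈ Icc (-1 : ℝ) 1, F.α r ξ = F'.α r ξ ∧ F.ω r ξ = F'.ω r ξ) ∧
    -- ADM mass of globally regular solutions
    (∀ C : ℝ, 0 < C → ∃ K ℓ₀ : ℝ, 0 < K ∧ 0 < ℓ₀ ∧ ∀ ℓ : ℝ, 0 < ℓ → ℓ < ℓ₀ →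
      ∀ (F : Fields) (D : AsymptoticData), IsGloballyRegular ℓ F D → NearAdS C ℓ F →
        0 ≤ D.M ∧ D.M ≤ K * ℓ ^ 3) ∧
    (∀ B θ C : ℝ, 0 < B → 0 < θ → 0 < C → ∃ K ℓ₀ : ℝ, 0 < K ∧ 0 < ℓ₀ ∧
      ∀ ℓ : ℝ, 0 < ℓ → ℓ < ℓ₀ → ∀ ρ σ : ℕ → ℝ,
        (∀ k, |ρ k| ≤ B * θ ^ k ∧ |σ k| ≤ B * θ ^ k) →
        ∀ (F : Fields) (M : ℝ), IsExpansionSolution C ℓ ρ σ F M →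
          0 ≤ M ∧ M ≤ K * ℓ ^ 3) ∧
    -- ADM mass of black holes
    (∀ r_h C : ℝ, 0 < r_h → 0 < C → ∃ K ℓ₀ : ℝ, 0 < K ∧ 0 < ℓ₀ ∧ ∀ ℓ : ℝ, 0 < ℓ → ℓ < ℓ₀ →
      ∀ (F : Fields) (D : AsymptoticData), IsBlackHole ℓ r_h F D → BoundedHair C r_h F →
        r_h ^ 3 / 2 * (ℓ ^ 2)⁻¹ ≤ D.M ∧ D.M ≤ K * (ℓ ^ 2)⁻¹) ∧
    -- the ADM mass tells black holes from globally regular solutions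
    (∀ r_h C : ℝ, 0 < r_h → 0 < C → ∃ ℓ₀ : ℝ, 0 < ℓ₀ ∧ ∀ ℓ : ℝ, 0 < ℓ → ℓ < ℓ₀ →
      ∀ (F₁ F₂ : Fields) (D₁ D₂ : AsymptoticData),
        IsGloballyRegular ℓ F₁ D₁ → NearAdS C ℓ F₁ →
        IsBlackHole ℓ r_h F₂ D₂ → BoundedHair C r_h F₂ →
        D₁.M < D₂.M) :=
  ⟨globallyRegular_unique, fun _ hℓ _ _ hρ hσ => explicit_gauge_fields hℓ hρ hσ, expansion_unique,
    globallyRegular_mass, expansion_mass, blackHole_mass, mass_lt_mass⟩
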